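/- **Setting.** Let $A_\pm>0$, $V\in\mathbb R\setminus\{0\}$, $\delta\in\mathbb R$, let $\sigma_3=\mathrm{diag}(1,-1)$, $\sigma_1=\begin{pmatrix}0&1\\1&0\end{pmatrix}$, and put $$q_\pm(x,t)=A_\pm e^{-2if_\pm(x,t)\pm i\delta},\quad f_\pm(x,t)=\tfrac12\big[\pm Vx+(V^2-2A_\pm^2)t\big],\quad p_\pm=\mp V/2+iA_\pm .$$ Let $\Sigma_\pm=[\overline{p_\pm},p_\pm]$ (oriented upward), $\Sigma_{\pm1}^o$ and $\Sigma_{\pm2}^o$ the open upper and lower halves $\mp V/2+i(0,A_\pm)$, $\mp V/2+i(-A_\pm,0)$, and $\Sigma=\mathbb R\cup\Sigma_+\cup\Sigma_-$ ($\mathbb R$ oriented from left to right). Put $\lambda_\pm(k)=(k-p_\pm)^{1/2}(k-\overline{p_\pm})^{1/2}$ with arguments in $[-\pi/2,3\pi/2)$, so that $\lambda_\pm$ has the cut $\Sigma_\pm$, is continuous from the right on it, and $\lambda_\pm(k)\sim k$ at infinity; and $$E_\pm=\mathrm I+\frac{iA_\pm}{\lambda_\pm+(k\pm V/2)}e^{\pm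 i\delta\sigma_3}\sigma_1,\quad d_\pm=\sqrt{\det E_\pm}\ \text{(principal)},\quad \theta_\pm=\lambda_\pm\,(x-2(k\mp V/2)t),\quad \theta_o=k(x-2kt).$$ Let $q$ be a classical solution of $iq_t+q_{xx}+2|q|^2q=0$ on $\mathbb R\times\mathbb R$ with Lax pair $v_x=Xv$, $v_t=Tv$, where $$X=ik\sigma_3+Q,\quad T=-2ik^2\sigma_3+i\sigma_3(Q_x-Q^2)-2kQ,\quad Q=\begin{pmatrix}0&q\\-\bar q&0\end{pmatrix}.$$ The columns $\phi_{\pm1},\phi_{\pm2}$ of the Jost solutions $\phi_\pm$ are the simultaneous solutions of the Lax pair for which the columns $\mu_{\pm1},\mu_{\pm2}$ of $\mu_\pm=d_\pm e^{if_\pm\sigma_3}\phi_\pm e^{-i\theta_\pm\sigma_3}$ tend to those of $E_\pm(k)$ as $x\to\pm\infty$ for every $t$ (at a branch point, where $d_\pm=0$, this defines $d_\pm\phi_\pm$ and $\mu_\pm$). They are used for $\mathrm{Im}\,\lambda_\pm\ge0$ (columns $\phi_{+1}$, $\phi_{-2}$), respectively $\mathrm{Im}\,\lambda_\pm\le0$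 (columns $\phi_{+2}$, $\phi_{-1}$). With $\mathrm{Wr}[u,v]=\det(u,v)$, evaluated at $(x,t)=(0,0)$, put $$s_{11}=\mathrm{Wr}[\phi_{-1},\phi_{+2}],\quad s_{12}=\mathrm{Wr}[\phi_{-2},\phi_{+2}],\quad s_{22}=\mathrm{Wr}[\phi_{+1},\phi_{-2}],\quad r_{21}=\mathrm{Wr}[\phi_{-1},\phi_{+1}],$$ $\rho=s_{12}/s_{22}$ on $\mathbb R\cup\Sigma_{+1}^o$ and $r=1/(s_{22}r_{21})$ on $\mathbb R\cup\Sigma_{-1}^o$. Let $K$ be the set of zeros of $s_{22}$ in $\mathbb C^+\setminus\Sigma$. Finally let $M=\Phi\,e^{-i\theta_o\sigma_3}$, with $\Phi=(\phi_{+1},\phi_{-2}/s_{22})$ in $\mathbb C^+\setminus\Sigma$ and $\Phi=(\phi_{-1}/s_{11},\phi_{+2})$ in $\mathbb C^-\setminus\Sigma$. **Theorem.** Suppose that for all $t\in\mathbb R$: $(1+|x|)(q-q_\pm)(\cdot,t)\in L^1(\mathbb R^\pm)$ and $(q-q_\pm)_x(\cdot,t)\in L^1(\mathbb R^\pm)$,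 the norm of the latter being bounded on bounded time intervals; that at $k=p_+$ and at $k=p_-$ the vectors $e^{-if_+\sigma_3}\mu_{+1}(x,t,k)$ and $e^{-if_-\sigma_3}\mu_{-2}(x,t,k)$ are linearly independent for some (equivalently, every) $(x,t)$, i.e. that $\mu_{+1}(0,0,k)$ and $\mu_{-2}(0,0,k)$ are; and that $K$ is finite and consists of simple zeros of $s_{22}$. Then there are constants $c_k$ ($k\in K$), independent of $(x,t)$, such that for all $(x,t)\in\mathbb R^2$: (i) $M(x,t,\cdot)$ is analytic in $\mathbb C\setminus(\Sigma\cup K\cup\overline K)$. (ii) $M$ has non-tangential limits $M^\pm$ from the left/right with $M^+=M^-\,e^{i\theta_o\sigma_3}J_o\,e^{-i\theta_o\sigma_3}$ at every point $k\ne\pm V/2$ of $\mathbb R\cup\Sigma_{\pm1}^o\cup\Sigma_{\pm2}^o$ that is not a spectral singularity, where $$J_o=\begin{pmatrix}1&\rho\\ \bar\rho&1+\rho\bar\rho\end{pmatrix}\ (k\in\mathbb R),\quad \begin{pmatrix}i\rho e^{-i\delta}&0\\-ie^{-i\delta}&-ie^{i\delta}/\rho\end{pmatrix}\ (k\in\Sigma_{+1}^o),\quad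 \begin{pmatrix}ie^{-i\delta}/\overline{\rho(\bar k)}&-ie^{i\delta}\\0&-i\overline{\rho(\bar k)}e^{i\delta}\end{pmatrix}\ (k\in\Sigma_{+2}^o),$$ $$J_o=\begin{pmatrix}1&-r\\0&1\end{pmatrix}\ (k\in\Sigma_{-1}^o),\qquad \begin{pmatrix}1&0\\ \overline{r(\bar k)}&1\end{pmatrix}\ (k\in\Sigma_{-2}^o).$$ Spectral singularities are the points at which $J_o$ is undefined: $k\in\mathbb R$ with $s_{22}(k)=0$, $k\in\Sigma_{+1}^o$ with $s_{22}(k)s_{12}(k)=0$, $k\in\Sigma_{-1}^o$ with $s_{22}(k)r_{21}(k)=0$, and the complex conjugates of these points. (iii) $M=\mathrm I+O(1/k)$ as $k\to\infty$ in $\mathbb C\setminus\Sigma$. (iv) $M$ has a simple pole at each $k_n\in K$ and at $\overline{k_n}$; the first column $M_1$ has a limit at $k_n$, the second column $M_2$ has a limit at $\overline{k_n}$, and $$\operatorname*{Res}_{k=k_n}M=\big(0,\ c_{k_n}e^{2i\theta_o(x,t,k_n)}M_1(x,t,k_n)\big),\qquad \operatorname*{Res}_{k=\overline{k_n}}M=\big(-\overline{c_{k_n}}e^{-2i\theta_o(x,t,\overline{k_n})}M_2(x,t,\overline{k_n}),\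 0\big).$$ (v) The following limits, taken in $\mathbb C\setminus\Sigma$, exist: $\lim_{k\to p_+}M\,(k-p_+)^{\sigma_3/4}$, $\lim_{k\to\overline{p_+}}M\,(k-\overline{p_+})^{-\sigma_3/4}$, $\lim_{k\to p_-}M$, $\lim_{k\to\overline{p_-}}M$, where the branch of $(k-p_+)^{1/4}$ is cut along the downward and that of $(k-\overline{p_+})^{1/4}$ along the upward vertical half-line (i.e. both along $\Sigma_+$ near the point). -/

import Mathlib

open scoped ComplexConjugate Matrix Topology

noncomputable section

namespace StepNLS

/-! ### Matrices -/

abbrev Mat2 := Matrix (Fin 2) (Fin 2) ℂ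

def sigma3 : Mat2 := !![1, 0; 0, -1]

def sigma1 : Mat2 := !![0, 1; 1, 0]

/-- The matrix `e^{i z σ₃}`. -/
def expSigma3 (z : ℂ) : Mat2 :=
  !![Complex.exp (Complex.I * z), 0; 0, Complex.exp (-(Complex.I * z))]

/-- The diagonal matrix `a^{σ₃} = diag(a, a⁻¹)`. -/
def powSigma3 (a : ℂ) : Mat2 := !![a, 0; 0, a⁻¹]

/-- The diagonal entries `1, -1` of `σ₃`, indexed by the column. -/
def colSign : Fin 2 → ℂ := ![1, -1]

/-- The Wronskian `Wr[u, v] = det (u, v)`. -/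
def wronskian (u v : Fin 2 → ℂ) : ℂ := u 0 * v 1 - u 1 * v 0

/-! ### Branches of the roots -/

/-- The argument of `z` in `[-π/2, 3π/2)`. -/
def cutArg (z : ℂ) : ℝ :=
  if Complex.arg z < -(Real.pi / 2) then Complex.arg z + 2 * Real.pi else Complex.arg z

/-- The square root `√r e^{iφ/2}` of `z = r e^{iφ}`, `-π/2 ≤ φ < 3π/2`: its cut is the downward
vertical half-line, and it is continuous from the right there. -/
def sqrtDown (z : ℂ) : ℂ :=
  (Real.sqrt ‖z‖ : ℂ) * Complex.exp (Complex.I * ((cutArg z / 2 : ℝ) : ℂ))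

/-- The principal square root. -/
def principalSqrt (z : ℂ) : ℂ := z ^ (1 / 2 : ℂ)

/-- `λ(k; A) = (k - iA)^{1/2} (k + iA)^{1/2}`, with cut `i[-A, A]`. -/
def lam (A : ℝ) (k : ℂ) : ℂ :=
  sqrtDown (k - Complex.I * (A : ℂ)) * sqrtDown (k + Complex.I * (A : ℂ))

/-- The fourth root `z^{1/4}` with cut the downward vertical half-line. -/
def root4Down (z : ℂ) : ℂ := principalSqrt (sqrtDown z)

/-- The fourth root `z^{1/4}` with cut the upward vertical half-line (the Schwarz reflection of
`root4Down`). -/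
def root4Up (z : ℂ) : ℂ := conj (root4Down (conj z))

/-! ### Plane waves and their eigenfunctions -/

/-- The plane wave `A e^{-2 i f(x,t) + iδ}`, `f = (V x + (V² - 2A²) t) / 2`. -/
structure PlaneWave where
  A : ℝ
  V : ℝ
  δ : ℝ

namespace PlaneWave

variable (w : PlaneWave)

def f (x t : ℝ) : ℝ := (1 / 2) * (w.V * x + (w.V ^ 2 - 2 * w.A ^ 2) * t)

def q (x t : ℝ) : ℂ :=
  (w.A : ℂ) * Complex.exp (-(2 * Complex.I * (w.f x t : ℂ)) + Complex.I * (w.δ : ℂ))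

/-- The asymptotic eigenvalue `λ(k + V/2; A)`. -/
def eigenval (k : ℂ) : ℂ := lam w.A (k + (w.V : ℂ) / 2)

/-- `E(k) = I + (iA / (λ + (k + V/2))) e^{iδσ₃} σ₁`. -/
def E (k : ℂ) : Mat2 :=
  1 + (Complex.I * (w.A : ℂ) / (w.eigenval k + (k + (w.V : ℂ) / 2))) •
    (expSigma3 (w.δ : ℂ) * sigma1)

/-- `θ(x,t,k) = λ (x - 2 (k - V/2) t)`. -/
def θ (x t : ℝ) (k : ℂ) : ℂ :=
  w.eigenval k * ((x : ℂ) - 2 * (k - (w.V : ℂ) / 2) * (t : ℂ))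

/-- `d(k) = √(det E(k))`. -/
def d (k : ℂ) : ℂ := principalSqrt (w.E k).det

/-- The branch point `-V/2 + iA` of the eigenvalue; the other one is its conjugate. -/
def branchPoint : ℂ := -((w.V : ℂ) / 2) + Complex.I * (w.A : ℂ)

/-- The branch cut, from the conjugate of the branch point up to the branch point. -/
def cut : Set ℂ := {k | k.re = -(w.V / 2) ∧ -w.A ≤ k.im ∧ k.im ≤ w.A}

/-- The open upper half of the cut (base point and branch point removed). -/
def cutUpper : Set ℂ := {k | k.re = -(w.V / 2) ∧ 0 < k.im ∧ k.im < w.A}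

/-- The open lower half of the cut. -/
def cutLower : Set ℂ := {k | k.re = -(w.V / 2) ∧ -w.A < k.im ∧ k.im < 0}

end PlaneWave

/-- The parameters `A₊, A₋, V, δ` of the boundary conditions
`q ~ A_± e^{-iV|x| ± iδ}`, `x → ±∞`, at `t = 0`. -/
structure Background where
  Ap : ℝ
  Am : ℝ
  V : ℝ
  δ : ℝ

namespace Background

variable (b : Background)

/-- The plane wave `q₊`. -/
def plus : PlaneWave := ⟨b.Ap, b.V, b.δ⟩

/-- The plane wave `q₋`. -/
def minus : PlaneWave := ⟨b.Am, -b.V, -b.δ⟩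

/-- `Σ = ℝ ∪ Σ₊ ∪ Σ₋`. -/
def contour : Set ℂ := {k | k.im = 0} ∪ b.plus.cut ∪ b.minus.cut

/-- The contour without the branch points and without the two points `±V/2` at which the cuts
cross the real line (no one-sided limit from above or below makes sense there). -/
def regularContour : Set ℂ :=
  {k | k.im = 0 ∧ k.re ≠ b.V / 2 ∧ k.re ≠ -(b.V / 2)} ∪
    (b.plus.cutUpper ∪ b.plus.cutLower) ∪ (b.minus.cutUpper ∪ b.minus.cutLower)

end Background

/-! ### The NLS equation and its Lax pair -/

/-- `∂q/∂x`. -/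
def qx (q : ℝ → ℝ → ℂ) (x t : ℝ) : ℂ := deriv (fun y => q y t) x

/-- `∂²q/∂x²`. -/
def qxx (q : ℝ → ℝ → ℂ) (x t : ℝ) : ℂ := deriv (fun y => qx q y t) x

/-- `∂q/∂t`. -/
def qt (q : ℝ → ℝ → ℂ) (x t : ℝ) : ℂ := deriv (fun s => q x s) t

/-- Classical solutions of `i q_t + q_xx + 2 |q|² q = 0` on `ℝ × ℝ`. -/
structure IsNLSSolution (q : ℝ → ℝ → ℂ) : Prop where
  diff_x : ∀ x t, DifferentiableAt ℝ (fun y => q y t) x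
  diff_xx : ∀ x t, DifferentiableAt ℝ (fun y => qx q y t) x
  diff_t : ∀ x t, DifferentiableAt ℝ (fun s => q x s) t
  cont : Continuous fun p : ℝ × ℝ => q p.1 p.2
  cont_x : Continuous fun p : ℝ × ℝ => qx q p.1 p.2
  cont_xx : Continuous fun p : ℝ × ℝ => qxx q p.1 p.2
  cont_t : Continuous fun p : ℝ × ℝ => qt q p.1 p.2
  eqn : ∀ x t, Complex.I * qt q x t + qxx q x t + 2 * (‖q x t‖ : ℂ) ^ 2 * q x t = 0

def potential (z : ℂ) : Mat2 := !![0, z; -conj z, 0]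

/-- `X = ikσ₃ + Q`. -/
def laxX (q : ℝ → ℝ → ℂ) (x t : ℝ) (k : ℂ) : Mat2 :=
  (Complex.I * k) • sigma3 + potential (q x t)

/-- `T = -2ik²σ₃ + iσ₃ (Q_x - Q²) - 2kQ`. -/
def laxT (q : ℝ → ℝ → ℂ) (x t : ℝ) (k : ℂ) : Mat2 :=
  (-2 * Complex.I * k ^ 2) • sigma3
    + Complex.I • (sigma3 * (potential (qx q x t) - potential (q x t) ^ 2))
    - (2 * k) • potential (q x t)

/-! ### Jost solutions -/

/-- The `j`-th column of `e^{ifσ₃} v e^{-iθσ₃}`, as a function of the `j`-th column `u` of `v`. -/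
def modify (w : PlaneWave) (j : Fin 2) (k : ℂ) (x t : ℝ) (u : Fin 2 → ℂ) : Fin 2 → ℂ :=
  Complex.exp (-(Complex.I * colSign j * w.θ x t k)) • (expSigma3 (w.f x t : ℂ) *ᵥ u)

/-- `v` is the `j`-th column of `d φ`: a simultaneous solution of both halves of the Lax pair with
`e^{ifσ₃} v e^{-iθσ₃} → E(k)` (in the `j`-th column) as `x → ±∞`, for every `t`.  The end is
`l = atTop` or `l = atBot`.  Unlike `φ` itself, this is meaningful at the branch points as well. -/
structure IsJost (q : ℝ → ℝ → ℂ) (w : PlaneWave) (l : Filter ℝ) (j : Fin 2) (k : ℂ)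
    (v : ℝ → ℝ → Fin 2 → ℂ) : Prop where
  lax_x : ∀ x t, HasDerivAt (fun y => v y t) (laxX q x t k *ᵥ v x t) x
  lax_t : ∀ x t, HasDerivAt (fun s => v x s) (laxT q x t k *ᵥ v x t) t
  asymp : ∀ t, Filter.Tendsto (fun x => modify w j k x t (v x t)) l (𝓝 fun i => w.E k i j)

open Classical in
/-- The column `d φ_j` (zero where no such solution exists; unique where `e^{iθ}`, respectively
`e^{-iθ}`, does not grow at the relevant end, which are the only `k` that are used). -/
def jostD (q : ℝ → ℝ → ℂ) (w : PlaneWave) (l : Filter ℝ) (j : Fin 2) (x t : ℝ) (k : ℂ) :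
    Fin 2 → ℂ :=
  if h : ∃ v, IsJost q w l j k v then h.choose x t else 0

/-- The column `μ_j` of the modified eigenfunction `μ = d e^{ifσ₃} φ e^{-iθσ₃}`. -/
def mu (q : ℝ → ℝ → ℂ) (w : PlaneWave) (l : Filter ℝ) (j : Fin 2) (x t : ℝ) (k : ℂ) :
    Fin 2 → ℂ :=
  modify w j k x t (jostD q w l j x t k)

/-- The column `φ_j` of the Jost solution. -/
def jost (q : ℝ → ℝ → ℂ) (w : PlaneWave) (l : Filter ℝ) (j : Fin 2) (x t : ℝ) (k : ℂ) :
    Fin 2 → ℂ :=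
  (w.d k)⁻¹ • jostD q w l j x t k

section Scattering

variable (q : ℝ → ℝ → ℂ) (b : Background)

/-- `φ₊₁`. -/
def phiP1 (x t : ℝ) (k : ℂ) : Fin 2 → ℂ := jost q b.plus Filter.atTop 0 x t k

/-- `φ₊₂`. -/
def phiP2 (x t : ℝ) (k : ℂ) : Fin 2 → ℂ := jost q b.plus Filter.atTop 1 x t k

/-- `φ₋₁`. -/
def phiM1 (x t : ℝ) (k : ℂ) : Fin 2 → ℂ := jost q b.minus Filter.atBot 0 x t k

/-- `φ₋₂`. -/
def phiM2 (x t : ℝ) (k : ℂ) : Fin 2 → ℂ := jost q b.minus Filter.atBot 1 x t k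

/-- `μ₊₁`. -/
def muP1 (x t : ℝ) (k : ℂ) : Fin 2 → ℂ := mu q b.plus Filter.atTop 0 x t k

/-- `μ₋₂`. -/
def muM2 (x t : ℝ) (k : ℂ) : Fin 2 → ℂ := mu q b.minus Filter.atBot 1 x t k

/-! The scattering coefficients.  All functions involved solve the same traceless linear systems,
so that the Wronskians may be evaluated at `(x, t) = (0, 0)`. -/

def s11 (k : ℂ) : ℂ := wronskian (phiM1 q b 0 0 k) (phiP2 q b 0 0 k)

def s12 (k : ℂ) : ℂ := wronskian (phiM2 q b 0 0 k) (phiP2 q b 0 0 k)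

def s21 (k : ℂ) : ℂ := wronskian (phiP1 q b 0 0 k) (phiM1 q b 0 0 k)

def s22 (k : ℂ) : ℂ := wronskian (phiP1 q b 0 0 k) (phiM2 q b 0 0 k)

def r21 (k : ℂ) : ℂ := wronskian (phiM1 q b 0 0 k) (phiP1 q b 0 0 k)

/-- The reflection coefficient `ρ = s₁₂ / s₂₂`, used on `ℝ` and the upper half of `Σ₊`. -/
def rho (k : ℂ) : ℂ := s12 q b k / s22 q b k

/-- The reflection coefficient `r = 1 / (s₂₂ r₂₁)`, used on the upper half of `Σ₋`. -/
def refl (k : ℂ) : ℂ := 1 / (s22 q b k * r21 q b k)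

/-- The discrete eigenvalues in the upper half-plane. -/
def eigenvalues : Set ℂ := {k | 0 < k.im ∧ k ∉ b.contour ∧ s22 q b k = 0}

/-- The points of `ℝ` and of the upper halves of the cuts at which a denominator in the jump
matrix vanishes (`s₂₂` in `ρ`; also `s₁₂` in `1/ρ`; `s₂₂` and `r₂₁` in `r`). -/
def upperSingularities : Set ℂ :=
  {k | (k.im = 0 ∧ s22 q b k = 0) ∨
    (k ∈ b.plus.cutUpper ∧ (s22 q b k = 0 ∨ s12 q b k = 0)) ∨
    (k ∈ b.minus.cutUpper ∧ (s22 q b k = 0 ∨ r21 q b k = 0))}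

/-- The spectral singularities: the points of the contour at which the jump matrix is
undefined. -/
def spectralSingularities : Set ℂ :=
  {k | k ∈ upperSingularities q b ∨ conj k ∈ upperSingularities q b}

/-- The controlling phase `θ_o(x,t,k) = k (x - 2kt)`. -/
def thetaO (x t : ℝ) (k : ℂ) : ℂ := k * ((x : ℂ) - 2 * k * (t : ℂ))

/-- The matrix with columns `u, v`. -/
def columns (u v : Fin 2 → ℂ) : Mat2 := !![u 0, v 0; u 1, v 1]

open Classical in
/-- `Φ = (φ₊₁, φ₋₂/s₂₂)` in the upper, `Φ = (φ₋₁/s₁₁, φ₊₂)` in the lower half-plane. -/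
def Phi (x t : ℝ) (k : ℂ) : Mat2 :=
  if 0 < k.im then columns (phiP1 q b x t k) ((s22 q b k)⁻¹ • phiM2 q b x t k)
  else columns ((s11 q b k)⁻¹ • phiM1 q b x t k) (phiP2 q b x t k)

/-- `M = Φ e^{-iθ_oσ₃}`. -/
def M (x t : ℝ) (k : ℂ) : Mat2 := Phi q b x t k * expSigma3 (-thetaO x t k)

end Scattering

/-! ### The Riemann-Hilbert problem -/

open Classical in
/-- The jump matrix `J_o(k)` for given `ρ` and `r`. -/
def jumpO (b : Background) (ρ r : ℂ → ℂ) (k : ℂ) : Mat2 :=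
  let e : ℂ := Complex.exp (Complex.I * (b.δ : ℂ))
  let e' : ℂ := Complex.exp (-(Complex.I * (b.δ : ℂ)))
  if k.im = 0 then !![1, ρ k; conj (ρ k), 1 + ρ k * conj (ρ k)]
  else if k ∈ b.plus.cutUpper then
    !![Complex.I * ρ k * e', 0; -Complex.I * e', -Complex.I * e / ρ k]
  else if k ∈ b.plus.cutLower then
    !![Complex.I * e' / conj (ρ (conj k)), -Complex.I * e; 0, -Complex.I * conj (ρ (conj k)) * e]
  else if k ∈ b.minus.cutUpper then !![1, -r k; 0, 1]
  else if k ∈ b.minus.cutLower then !![1, 0; conj (r (conj k)), 1]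
  else 1

/-- `J = e^{iθ_oσ₃} J_o e^{-iθ_oσ₃}`. -/
def jump (b : Background) (ρ r : ℂ → ℂ) (x t : ℝ) (k : ℂ) : Mat2 :=
  expSigma3 (thetaO x t k) * jumpO b ρ r k * expSigma3 (-thetaO x t k)

/-- The unit normal pointing to the left of the contour: `ℝ` is oriented from left to right, the
cuts upward. -/
def leftNormal (k : ℂ) : ℂ := if k.im = 0 then Complex.I else -1

/-- The sector with vertex `k₀`, axis `n` and opening given by `C`. -/
def sector (n k₀ : ℂ) (C : ℝ) : Set ℂ :=
  {k | 0 < ((k - k₀) * conj n).re ∧ ‖k - k₀‖ ≤ C * ((k - k₀) * conj n).re}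

/-- `L` is the non-tangential limit of `F` at `k₀` from the side to which `n` points. -/
def HasNontangentialLimit (F : ℂ → Mat2) (n k₀ : ℂ) (L : Mat2) : Prop :=
  ∀ C : ℝ, Filter.Tendsto F (𝓝[sector n k₀ C] k₀) (𝓝 L)

/-- `F`, analytic in a punctured neighbourhood of `k₀`, has a simple pole with residue `R`. -/
def HasSimplePole (F : ℂ → Mat2) (k₀ : ℂ) (R : Mat2) : Prop :=
  (∀ i j, ∀ᶠ k in 𝓝[≠] k₀, AnalyticAt ℂ (fun z => F z i j) k) ∧
    R ≠ 0 ∧ Filter.Tendsto (fun k => (k - k₀) • F k) (𝓝[≠] k₀) (𝓝 R)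

/-- The Riemann-Hilbert problem, at fixed `(x, t)`, with reflection coefficients `ρ` and `r`,
discrete spectrum `K ∪ K̄`, norming constants `c`, and with the jump condition imposed on
`Σ` minus the branch points, the two crossing points `±V/2` and the set `Z` of spectral
singularities. -/
structure IsRHPSolution (b : Background) (ρ r : ℂ → ℂ) (Z K : Set ℂ) (c : ℂ → ℂ) (x t : ℝ)
    (F : ℂ → Mat2) : Prop where
  finite_K : K.Finite
  subset_K : ∀ k ∈ K, 0 < k.im ∧ k ∉ b.contour
  analytic : ∀ i j, AnalyticOnNhd ℂ (fun k => F k i j)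
    {k | k ∉ b.contour ∧ k ∉ K ∧ conj k ∉ K}
  jump_cond : ∀ k ∈ b.regularContour, k ∉ Z → ∃ Fp Fm : Mat2,
    HasNontangentialLimit F (leftNormal k) k Fp ∧
    HasNontangentialLimit F (-leftNormal k) k Fm ∧
    Fp = Fm * jump b ρ r x t k
  normalization : ∀ i j, (fun k => F k i j - (1 : Mat2) i j)
    =O[Bornology.cobounded ℂ ⊓ Filter.principal b.contourᶜ] fun k : ℂ => 1 / k
  residue_upper : ∀ k₀ ∈ K, ∃ F₁ : Fin 2 → ℂ,
    Filter.Tendsto (fun k i => F k i 0) (𝓝[≠] k₀) (𝓝 F₁) ∧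
    HasSimplePole F k₀
      (columns 0 ((c k₀ * Complex.exp (2 * Complex.I * thetaO x t k₀)) • F₁))
  residue_lower : ∀ k₀ ∈ K, ∃ F₂ : Fin 2 → ℂ,
    Filter.Tendsto (fun k i => F k i 1) (𝓝[≠] conj k₀) (𝓝 F₂) ∧
    HasSimplePole F (conj k₀)
      (columns ((-conj (c k₀) * Complex.exp (-(2 * Complex.I * thetaO x t (conj k₀)))) • F₂) 0)
  growth_p : ∃ B : Mat2, Filter.Tendsto
    (fun k => F k * powSigma3 (root4Down (k - b.plus.branchPoint)))
    (𝓝[b.contourᶜ] b.plus.branchPoint) (𝓝 B)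
  growth_p_conj : ∃ B : Mat2, Filter.Tendsto
    (fun k => F k * powSigma3 ((root4Up (k - conj b.plus.branchPoint))⁻¹))
    (𝓝[b.contourᶜ] conj b.plus.branchPoint) (𝓝 B)
  growth_m : ∃ B : Mat2, Filter.Tendsto F (𝓝[b.contourᶜ] b.minus.branchPoint) (𝓝 B)
  growth_m_conj : ∃ B : Mat2, Filter.Tendsto F (𝓝[b.contourᶜ] conj b.minus.branchPoint) (𝓝 B)

/-! ### Function spaces -/

/-- `f ∈ L^{1,1}(s)`, i.e. `(1 + |x|) f ∈ L¹(s)`. -/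
def MemL11 (f : ℝ → ℂ) (s : Set ℝ) : Prop :=
  MeasureTheory.IntegrableOn (fun x => ((1 + |x| : ℝ) : ℂ) * f x) s

/-- On the half-line `s`, `q - w ∈ L^{1,1}` and `(q - w)_x ∈ L¹` for all times, the norm of
`(q - w)_x` in `L¹(s)` being bounded on bounded time intervals. -/
structure IsAsymptoticTo (q : ℝ → ℝ → ℂ) (w : PlaneWave) (s : Set ℝ) : Prop where
  memL11 : ∀ t, MemL11 (fun x => q x t - w.q x t) s
  integrable_x : ∀ t,
    MeasureTheory.IntegrableOn (fun x => deriv (fun y => q y t - w.q y t) x) s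
  locally_bounded : ∀ τ : ℝ, ∃ C : ℝ, ∀ t, |t| ≤ τ →
    ∫ x in s, ‖deriv (fun y => q y t - w.q y t) x‖ ≤ C

/-- Linear independence of `μ₊₁` and `μ₋₂` at `k`, after removal of the plane-wave factors
`e^{if_±σ₃}` from them (which differ from each other, but are both trivial at `x = t = 0`).  If it
holds for one `(x, t)` then it holds for all. -/
def GenericAt (q : ℝ → ℝ → ℂ) (b : Background) (k : ℂ) : Prop :=
  ∃ x t : ℝ, LinearIndependent ℂ
    ![expSigma3 (-(b.plus.f x t : ℂ)) *ᵥ muP1 q b x t k,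
      expSigma3 (-(b.minus.f x t : ℂ)) *ᵥ muM2 q b x t k]

end StepNLS

end

open scoped ComplexConjugate Matrix Topology

noncomputable section

namespace StepNLS

/-! The matrix `M` is built from Jost solutions, and each item of the Riemann-Hilbert problem is a
property of these or an algebraic identity between Wronskians.

Existence. After the gauge transformation `gauge` the plane wave becomes constant, and the spatial
equation reads `u' = (N + W) u` with `N = bgMat` constant and `W` the perturbation. The columns of
`E` are annihilated by `N`, so a Jost column is the solution of a Volterra equation with constant
leading term, summed as a Neumann series (`IsVolterraKernel.series`). Since `N² = -2iℓN`, the group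
`exp (sN)` is `1 + gN` with an explicit scalar `g`, bounded for `s ≤ 0` both by `|s|` and by `1/|ℓ|`
(`exists_expGroup_apply`). The first bound holds up to the branch points `ℓ = 0` and is paid for by
the weight `1 + |x|`; the second one serves for large `k`. Throughout, `ℓ` is any root of `(k +
V/2)² + A²` with `Im ℓ ≥ 0`, not only the chosen branch `λ`: continuity on this curve
(`continuousOn_jostFun`) gives the limits from both sides of a cut at once.

Time dependence. A solution normalized at `t = 0` is extended to a simultaneous solution of the Lax
pair, because the NLS equation is the zero-curvature condition (`exists_lax_solution`). That the
normalization persists is proved by two Grönwall estimates, in `t` and in `x`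
(`tendsto_gauge_of_zero`). Uniqueness (`half_line_unique`) identifies the result with the series at
every time.

Symmetries. The solution `conj q(-x,-t)` exchanges the two ends, so only `+∞` needs analysis
(`IsJost.reflect`); complex conjugation exchanges the half-planes, so only the upper one does
(`M_conj`).

Jumps. On the left of its cut the first column at `+∞` continues to a multiple of the second one
(`jostFun_neg_eigenval`), and the change of `d` reduces the factor to the constant `-i e^{-iδ}`
(`tendsto_jost_left`). Linear dependence of three plane vectors, with Wronskians as coefficients,
then gives the jump matrices.

Remaining items. Residues come from proportionality of `φ₊₁` and `φ₋₂` at zeros of `s₂₂`. The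
behaviour at infinity comes from `exists_bound_jostSeries`, where an integration by parts gains the
factor `1/k`. At the branch points the products `dφ` stay finite, their Wronskian is nonzero by
genericity, and `d₊` vanishes like a fourth root (`exists_root4Down_eq`). -/

open MeasureTheory Set Filter

/-! ### Grönwall estimates. -/

section Gronwall

variable {E : Type*} [NormedAddCommGroup E] [NormedSpace ℝ E]

/-- Grönwall's inequality with variable coefficients. -/
theorem norm_le_gronwall {u u' : ℝ → E} {α β : ℝ → ℝ} {a b : ℝ} (hab : a ≤ b)
    (hα : Continuous α) (hβ : Continuous β) (hα0 : ∀ x, 0 ≤ α x) (hβ0 : ∀ x, 0 ≤ β x)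
    (hu : ∀ x ∈ Icc a b, HasDerivAt u (u' x) x)
    (hbd : ∀ x ∈ Icc a b, ‖u' x‖ ≤ α x * ‖u x‖ + β x) :
    ‖u b‖ ≤ (‖u a‖ + ∫ x in a..b, β x) * Real.exp (∫ x in a..b, α x) := by
  -- The comparison principle needs a strict differential inequality. Adding `ε` to `β` provides it,
  -- since the exponential factor is at least `1`; afterwards `ε → 0`.
  have key : ∀ ε : ℝ, 0 < ε →
      ‖u b‖ ≤ (‖u a‖ + ∫ x in a..b, (β x + ε)) * Real.exp (∫ x in a..b, α x) := by
    intro ε hε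
    have hA : ∀ x, HasDerivAt (fun x => ∫ y in a..x, α y) (α x) x := fun x =>
      hα.integral_hasStrictDerivAt a x |>.hasDerivAt
    have hB : ∀ x, HasDerivAt (fun x => ∫ y in a..x, (β y + ε)) (β x + ε) x := fun x =>
      (hβ.add continuous_const).integral_hasStrictDerivAt a x |>.hasDerivAt
    have hD : ∀ x, HasDerivAt
        (fun x => (‖u a‖ + ∫ y in a..x, (β y + ε)) * Real.exp (∫ y in a..x, α y))
        ((β x + ε) * Real.exp (∫ y in a..x, α y) +
          (‖u a‖ + ∫ y in a..x, (β y + ε)) * (Real.exp (∫ y in a..x, α y) * α x)) x := fun x =>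
      ((hB x).const_add _).mul (hA x).exp
    refine image_norm_le_of_norm_deriv_right_lt_deriv_boundary' (f := u) (f' := u') (a := a)
      (b := b) (B := fun x => (‖u a‖ + ∫ y in a..x, (β y + ε)) * Real.exp (∫ y in a..x, α y))
      (fun x hx => (hu x hx).continuousAt.continuousWithinAt)
      (fun x hx => (hu x ⟨hx.1, hx.2.le⟩).hasDerivWithinAt) (by simp)
      (fun x _ => (hD x).continuousAt.continuousWithinAt)
      (fun x _ => (hD x).hasDerivWithinAt) ?_ ⟨hab, le_rfl⟩
    intro x hx h
    refine (hbd x ⟨hx.1, hx.2.le⟩).trans_lt ?_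
    have h1 : 1 ≤ Real.exp (∫ y in a..x, α y) :=
      Real.one_le_exp (intervalIntegral.integral_nonneg hx.1 fun y _ => hα0 y)
    rw [h]
    have := hβ0 x
    nlinarith
  have hlim : Tendsto (fun ε : ℝ => (‖u a‖ + ((∫ x in a..b, β x) + (b - a) * ε))
      * Real.exp (∫ x in a..b, α x)) (𝓝[>] 0)
      (𝓝 ((‖u a‖ + ((∫ x in a..b, β x) + (b - a) * 0)) * Real.exp (∫ x in a..b, α x))) := by
    refine Tendsto.mono_left ?_ nhdsWithin_le_nhds
    exact Continuous.tendsto (by fun_prop) 0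
  rw [mul_zero, add_zero] at hlim
  refine ge_of_tendsto hlim ?_
  filter_upwards [self_mem_nhdsWithin] with ε hε
  have := key ε hε
  rwa [intervalIntegral.integral_add (hβ.intervalIntegrable _ _)
    (continuous_const.intervalIntegrable _ _), intervalIntegral.integral_const, smul_eq_mul] at this

/-- Grönwall's inequality on either side of the initial point. -/
theorem norm_le_gronwall_abs {u u' : ℝ → E} {α β : ℝ → ℝ} (a b : ℝ)
    (hα : Continuous α) (hβ : Continuous β) (hα0 : ∀ x, 0 ≤ α x) (hβ0 : ∀ x, 0 ≤ β x)
    (hu : ∀ x, HasDerivAt u (u' x) x)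
    (hbd : ∀ x ∈ uIcc a b, ‖u' x‖ ≤ α x * ‖u x‖ + β x) :
    ‖u b‖ ≤ (‖u a‖ + |∫ x in a..b, β x|) * Real.exp |∫ x in a..b, α x| := by
  rcases le_total a b with hab | hab
  · rw [abs_of_nonneg (intervalIntegral.integral_nonneg hab fun y _ => hα0 y),
      abs_of_nonneg (intervalIntegral.integral_nonneg hab fun y _ => hβ0 y)]
    exact norm_le_gronwall hab hα hβ hα0 hβ0 (fun x _ => hu x)
      fun x hx => hbd x (by rwa [uIcc_of_le hab])
  -- For `b ≤ a` the estimate is applied to the reflected function.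
  · have h := norm_le_gronwall (u := fun x => u (-x)) (u' := fun x => -u' (-x))
      (α := fun x => α (-x)) (β := fun x => β (-x)) (neg_le_neg hab) (by fun_prop) (by fun_prop)
      (fun x => hα0 _) (fun x => hβ0 _)
      (fun x _ => by simpa [Function.comp_def] using (hu (-x)).scomp x (hasDerivAt_neg x))
      (fun x hx => by
        rw [norm_neg]
        refine hbd _ ?_
        rw [uIcc_of_ge hab]
        constructor <;> linarith [hx.1, hx.2])
    rw [intervalIntegral.integral_comp_neg (fun x => α x),
      intervalIntegral.integral_comp_neg (fun x => β x), neg_neg, neg_neg] at h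
    rw [intervalIntegral.integral_symm b a, intervalIntegral.integral_symm b a, abs_neg, abs_neg,
      abs_of_nonneg (intervalIntegral.integral_nonneg hab fun y _ => hα0 y),
      abs_of_nonneg (intervalIntegral.integral_nonneg hab fun y _ => hβ0 y)]
    simpa using h

end Gronwall

/-! ### Linear differential equations and Neumann series. -/

section LinearODE

variable {F : Type*} [NormedAddCommGroup F] [NormedSpace ℂ F]

theorem eq_zero_of_linear_ode {A : ℝ → F →L[ℂ] F} (hA : Continuous A) {u : ℝ → F}
    (hu : ∀ x, HasDerivAt u (A x (u x)) x) {a : ℝ} (ha : u a = 0) (x : ℝ) : u x = 0 := by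
  have := norm_le_gronwall_abs (α := fun x => ‖A x‖) (β := fun _ => 0) a x hA.norm
    continuous_const (fun _ => norm_nonneg _) (fun _ => le_rfl) hu
    (fun y _ => by simpa using (A y).le_opNorm (u y))
  simpa [ha] using this

theorem eq_of_linear_ode {A : ℝ → F →L[ℂ] F} (hA : Continuous A) {u v : ℝ → F}
    (hu : ∀ x, HasDerivAt u (A x (u x)) x) (hv : ∀ x, HasDerivAt v (A x (v x)) x)
    {a : ℝ} (ha : u a = v a) (x : ℝ) : u x = v x := by
  have := eq_zero_of_linear_ode hA (u := fun x => u x - v x)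
    (fun x => by simpa using (hu x).fun_sub (hv x)) (a := a) (by simp [ha]) x
  exact sub_eq_zero.1 this

/-- Convergence of the Neumann series of an operator that halves a weighted supremum norm. -/
theorem neumann_series {F : Type*} [NormedAddCommGroup F] [CompleteSpace F] {D : Set ℝ} {Λ : ℝ → ℝ}
    {B : ℝ}
    (hΛ1 : ∀ x ∈ D, 0 ≤ Λ x) (hΛB : ∀ x ∈ D, Λ x ≤ B) {T : (ℝ → F) → ℝ → F}
    (hTc : ∀ u c, ContinuousOn u D → (∀ x ∈ D, ‖u x‖ ≤ c * Λ x) → ContinuousOn (T u) D)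
    (hTb : ∀ u c, ContinuousOn u D → (∀ x ∈ D, ‖u x‖ ≤ c * Λ x) →
      ∀ x ∈ D, ‖T u x‖ ≤ c / 2 * Λ x)
    (hTe : ∀ u v, EqOn u v D → EqOn (T u) (T v) D)
    (hTs : ∀ u v c, ContinuousOn u D → ContinuousOn v D → (∀ x ∈ D, ‖u x‖ ≤ c * Λ x) →
      (∀ x ∈ D, ‖v x‖ ≤ c * Λ x) → ∀ x ∈ D, T (u + v) x = T u x + T v x)
    {η : ℝ → F} {c : ℝ} (hη : ContinuousOn η D) (hηb : ∀ x ∈ D, ‖η x‖ ≤ c * Λ x) :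
    (∀ n, ContinuousOn (T^[n] η) D) ∧
    (∀ n, ∀ x ∈ D, ‖T^[n] η x‖ ≤ c * Λ x * (1 / 2) ^ n) ∧
    ContinuousOn (fun x => ∑' n, T^[n] η x) D ∧
    (∀ x ∈ D, ‖∑' n, T^[n] η x‖ ≤ 2 * c * Λ x) ∧
    (∀ x ∈ D, ∑' n, T^[n] η x = η x + T (fun y => ∑' n, T^[n] η y) x) := by
  have h1 : ∀ n, ContinuousOn (T^[n] η) D ∧ ∀ x ∈ D, ‖T^[n] η x‖ ≤ (c * (1 / 2) ^ n) * Λ x := by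
    intro n
    induction n with
    | zero => simpa using ⟨hη, hηb⟩
    | succ n ih =>
      rw [Function.iterate_succ_apply']
      refine ⟨hTc _ _ ih.1 ih.2, fun x hx => ?_⟩
      have := hTb _ _ ih.1 ih.2 x hx
      rw [pow_succ]
      calc _ ≤ _ := this
        _ = _ := by ring
  have hb : ∀ n, ∀ x ∈ D, ‖T^[n] η x‖ ≤ c * Λ x * (1 / 2) ^ n := fun n x hx => by
    have := (h1 n).2 x hx; linarith
  have hc0 : ∀ x ∈ D, 0 ≤ c * Λ x := fun x hx => (norm_nonneg _).trans (hηb x hx)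
  have hsumg : Summable fun n : ℕ => ((1 : ℝ) / 2) ^ n :=
    summable_geometric_of_lt_one (by norm_num) (by norm_num)
  have hs : ∀ x ∈ D, Summable fun n => T^[n] η x := fun x hx =>
    Summable.of_norm_bounded (hsumg.mul_left _) fun n => hb n x hx
  have hcont : ∀ N : ℕ, ContinuousOn (fun x => ∑' n, T^[n + N] η x) D := by
    intro N
    refine continuousOn_tsum (u := fun n => |c| * B * (1 / 2) ^ n) (fun n => (h1 _).1)
      (hsumg.mul_left _) fun n x hx => (hb _ x hx).trans ?_
    have h2 : c * Λ x ≤ |c| * B :=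
      (mul_le_mul_of_nonneg_right (le_abs_self c) (hΛ1 x hx)).trans
        (mul_le_mul_of_nonneg_left (hΛB x hx) (abs_nonneg c))
    have h3 : ((1 : ℝ) / 2) ^ (n + N) ≤ (1 / 2) ^ n :=
      pow_le_pow_of_le_one (by norm_num) (by norm_num) (Nat.le_add_right _ _)
    exact mul_le_mul h2 h3 (by positivity) ((hc0 x hx).trans h2)
  have htail : ∀ N : ℕ, ∀ x ∈ D, ‖∑' n, T^[n + N] η x‖ ≤ (2 * c * (1 / 2) ^ N) * Λ x := by
    intro N x hx
    have := tsum_of_norm_bounded (f := fun n => T^[n + N] η x)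
      ((hasSum_geometric_two).mul_left (c * Λ x * (1 / 2) ^ N)) (fun n => by
        have := hb (n + N) x hx
        rw [pow_add] at this
        linarith)
    linarith
  refine ⟨fun n => (h1 n).1, hb, by simpa using hcont 0,
    fun x hx => by simpa using htail 0 x hx, fun x hx => ?_⟩
  -- the partial sums
  have hsplit : ∀ N : ℕ, ∀ y ∈ D, ∑' n, T^[n] η y
      = ∑ n ∈ Finset.range N, T^[n] η y + ∑' n, T^[n + N] η y := fun N y hy =>
    ((hs y hy).sum_add_tsum_nat_add N).symm
  -- `T` is additive on two admissible summands at a time, so it is applied to the series by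
  -- splitting off one term after the other. Locality in `D` (`hTe`) is needed because the splitting
  -- is known only there.
  have hTN : ∀ N : ℕ, T (fun y => ∑' n, T^[n] η y) x
      = ∑ n ∈ Finset.range N, T^[n + 1] η x + T (fun y => ∑' n, T^[n + N] η y) x := by
    intro N
    induction N with
    | zero => simp
    | succ N ih =>
      rw [ih, Finset.sum_range_succ, add_assoc]
      congr 1
      have e : EqOn (fun y => ∑' n, T^[n + N] η y)
          (T^[N] η + fun y => ∑' n, T^[n + (N + 1)] η y) D := fun y hy => by
        have := ((summable_nat_add_iff N).2 (hs y hy)).tsum_eq_zero_add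
        simpa [add_assoc, add_comm 1 N] using this
      rw [hTe _ _ e hx, hTs _ _ (2 * |c|) (h1 N).1 (hcont (N + 1)) ?_ ?_ x hx,
        Function.iterate_succ_apply']
      · intro y hy
        refine (hb N y hy).trans ?_
        have h3 : ((1 : ℝ) / 2) ^ N ≤ 1 := pow_le_one₀ (by norm_num) (by norm_num)
        have h4 := mul_le_mul_of_nonneg_right (le_abs_self c) (hΛ1 y hy)
        have h5 := mul_le_mul_of_nonneg_left h3 (hc0 y hy)
        have h6 := hc0 y hy
        nlinarith
      · intro y hy
        refine (htail (N + 1) y hy).trans ?_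
        have h3 : ((1 : ℝ) / 2) ^ (N + 1) ≤ 1 := pow_le_one₀ (by norm_num) (by norm_num)
        have h4 := mul_le_mul_of_nonneg_right (le_abs_self c) (hΛ1 y hy)
        have h5 := mul_le_mul_of_nonneg_left h3 (hc0 y hy)
        nlinarith
  -- After cancelling the first terms, the defect in the fixed-point equation is a difference of two
  -- tails, each of order `2⁻ᴺ`. As `N` is arbitrary, it vanishes.
  have hle : ∀ N : ℕ, ‖∑' n, T^[n] η x - (η x + T (fun y => ∑' n, T^[n] η y) x)‖
      ≤ 4 * (c * Λ x) * (1 / 2) ^ N := by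
    intro N
    have e1 : ∑' n, T^[n] η x - (η x + T (fun y => ∑' n, T^[n] η y) x)
        = ∑' n, T^[n + (N + 1)] η x - T (fun y => ∑' n, T^[n + N] η y) x := by
      rw [hsplit (N + 1) x hx, hTN N, Finset.sum_range_succ']
      simp only [Function.iterate_zero, id_eq]
      abel
    rw [e1]
    refine (norm_sub_le _ _).trans ?_
    have h7 := htail (N + 1) x hx
    have h8 := hTb _ _ (hcont N) (htail N) x hx
    rw [pow_succ] at h7
    have h9 : 0 ≤ (c * Λ x) * (1 / 2) ^ N := mul_nonneg (hc0 x hx) (by positivity)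
    linarith
  have hlim : Tendsto (fun N : ℕ => 4 * (c * Λ x) * ((1 : ℝ) / 2) ^ N) atTop (𝓝 0) := by
    simpa using (tendsto_pow_atTop_nhds_zero_of_lt_one (by norm_num : (0 : ℝ) ≤ 1 / 2)
      (by norm_num)).const_mul (4 * (c * Λ x))
  have := le_of_tendsto_of_tendsto' tendsto_const_nhds hlim hle
  exact sub_eq_zero.1 (norm_le_zero_iff.1 this)

/-- Global existence for linear differential equations. -/
theorem exists_linear_ode [CompleteSpace F] {A : ℝ → F →L[ℂ] F} (hA : Continuous A) (η : F) :
    ∃ u : ℝ → F, u 0 = η ∧ ∀ x, HasDerivAt u (A x (u x)) x := by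
  set T : (ℝ → F) → ℝ → F := fun u x => ∫ y in (0 : ℝ)..x, A y (u y) with hT
  set a : ℝ → ℝ := fun x => ∫ y in (0 : ℝ)..x, ‖A y‖ with ha
  have had : ∀ x, HasDerivAt a (‖A x‖) x := fun x =>
    hA.norm.integral_hasStrictDerivAt 0 x |>.hasDerivAt
  -- In the norm weighted by `e^{2|a|}` the integral operator has norm at most `1/2`, because `‖A‖
  -- e^{2a}` is the derivative of `e^{2a}/2`. This avoids factorial estimates.
  set Λ : ℝ → ℝ := fun x => Real.exp (2 * |a x|) with hΛ
  have hac : Continuous a := continuous_iff_continuousAt.2 fun x => (had x).continuousAt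
  have hsub : ∀ {R x : ℝ}, x ∈ Ioo (-R) R → uIcc 0 x ⊆ Ioo (-R) R := fun {R x} hx => by
    have hR : 0 < R := by linarith [hx.1, hx.2]
    exact (ordConnected_Ioo).uIcc_subset ⟨by linarith, hR⟩ hx
  have hcA : ∀ {R : ℝ} {u : ℝ → F}, ContinuousOn u (Ioo (-R) R) →
      ContinuousOn (fun y => A y (u y)) (Ioo (-R) R) := fun hu => hA.continuousOn.clm_apply hu
  have hint : ∀ {R : ℝ} {u : ℝ → F}, ContinuousOn u (Ioo (-R) R) → ∀ x ∈ Ioo (-R) R,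
      IntervalIntegrable (fun y => A y (u y)) volume 0 x := fun hu x hx =>
    ((hcA hu).mono (hsub hx)).intervalIntegrable
  have hder : ∀ {R : ℝ} {u : ℝ → F}, ContinuousOn u (Ioo (-R) R) → ∀ x ∈ Ioo (-R) R,
      HasDerivAt (T u) (A x (u x)) x := by
    intro R u hu x hx
    have hcx : ContinuousAt (fun y => A y (u y)) x := (hcA hu).continuousAt (isOpen_Ioo.mem_nhds hx)
    refine intervalIntegral.integral_hasDerivAt_right (hint hu x hx) ?_ hcx
    exact ContinuousOn.stronglyMeasurableAtFilter isOpen_Ioo (hcA hu) x hx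
  have hΛint : ∀ x, |∫ y in (0 : ℝ)..x, ‖A y‖ * Λ y| ≤ Λ x / 2 := by
    intro x
    rcases le_total 0 x with hx | hx
    · have hpos : ∀ y ∈ uIcc 0 x, 0 ≤ a y := fun y hy =>
        intervalIntegral.integral_nonneg (by rw [uIcc_of_le hx] at hy; exact hy.1)
          fun _ _ => norm_nonneg _
      have e : ∫ y in (0 : ℝ)..x, ‖A y‖ * Λ y = Real.exp (2 * a x) / 2 - Real.exp (2 * a 0) / 2 :=
          by
        rw [← intervalIntegral.integral_eq_sub_of_hasDerivAt (f := fun x => Real.exp (2 * a x) / 2)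
          (f' := fun y => ‖A y‖ * Real.exp (2 * a y))]
        · refine intervalIntegral.integral_congr fun y hy => ?_
          simp only [hΛ, abs_of_nonneg (hpos y hy)]
        · intro y _
          exact (((had y).const_mul 2).exp.div_const 2).congr_deriv (by ring)
        · exact (hA.norm.mul (by fun_prop)).intervalIntegrable _ _
      rw [abs_of_nonneg (intervalIntegral.integral_nonneg hx fun y _ => by positivity), e]
      simp only [hΛ, abs_of_nonneg (hpos x right_mem_uIcc)]
      have := Real.exp_pos (2 * a 0)
      linarith
    · have hneg : ∀ y ∈ uIcc 0 x, a y ≤ 0 := fun y hy => by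
        rw [uIcc_of_ge hx] at hy
        simp only [ha]
        rw [intervalIntegral.integral_symm, neg_nonpos]
        exact intervalIntegral.integral_nonneg hy.2 fun _ _ => norm_nonneg _
      have e : ∫ y in (0 : ℝ)..x, ‖A y‖ * Λ y
          = -Real.exp (-2 * a x) / 2 - -Real.exp (-2 * a 0) / 2 := by
        rw [← intervalIntegral.integral_eq_sub_of_hasDerivAt
          (f := fun x => -Real.exp (-2 * a x) / 2)
          (f' := fun y => ‖A y‖ * Real.exp (-2 * a y))]
        · refine intervalIntegral.integral_congr fun y hy => ?_
          simp only [hΛ, abs_of_nonpos (hneg y hy)]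
          ring_nf
        · intro y _
          exact (((had y).const_mul (-2)).exp.neg.div_const 2).congr_deriv (by ring)
        · exact (hA.norm.mul (by fun_prop)).intervalIntegrable _ _
      have hn : ∫ y in (0 : ℝ)..x, ‖A y‖ * Λ y ≤ 0 := by
        rw [intervalIntegral.integral_symm, neg_nonpos]
        exact intervalIntegral.integral_nonneg hx fun y _ => by positivity
      rw [abs_of_nonpos hn, e]
      simp only [hΛ, abs_of_nonpos (hneg x right_mem_uIcc)]
      have := Real.exp_pos (-2 * a 0)
      have e2 : 2 * -a x = -2 * a x := by ring
      rw [e2]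
      linarith
  -- The weight has to be bounded, which it is on bounded intervals only. The series does not depend
  -- on `R`, so the solutions obtained agree.
  have main : ∀ R : ℝ, 0 < R → ∀ x ∈ Ioo (-R) R,
      ContinuousOn (fun x => ∑' n, T^[n] (fun _ => η) x) (Ioo (-R) R) ∧
      ∑' n, T^[n] (fun _ => η) x = η + T (fun y => ∑' n, T^[n] (fun _ => η) y) x := by
    intro R hR x hx
    have hΛ1 : ∀ x, 1 ≤ Λ x := fun x => Real.one_le_exp (by positivity)
    obtain ⟨B, hB⟩ := (isCompact_Icc (a := -R) (b := R)).bddAbove_image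
      (f := Λ) (by fun_prop)
    have := neumann_series (D := Ioo (-R) R) (Λ := Λ) (B := B) (T := T) (η := fun _ => η)
      (c := ‖η‖) (fun x _ => zero_le_one.trans (hΛ1 x))
      (fun x hx => hB ⟨x, ⟨hx.1.le, hx.2.le⟩, rfl⟩)
      (fun u c hu _ x hx => (hder hu x hx).continuousAt.continuousWithinAt)
      (fun u c hu hb x hx => by
        have h0 : 0 ≤ c := nonneg_of_mul_nonneg_left ((norm_nonneg _).trans (hb x hx))
          (zero_lt_one.trans_le (hΛ1 x))
        calc ‖T u x‖ ≤ |∫ y in (0 : ℝ)..x, c * (‖A y‖ * Λ y)| := by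
              refine intervalIntegral.norm_integral_le_abs_of_norm_le ?_ ?_
              · refine (ae_restrict_mem measurableSet_uIoc).mono fun y hy => ?_
                refine ((A y).le_opNorm _).trans ?_
                have := hb y (hsub hx (uIoc_subset_uIcc hy))
                have := mul_le_mul_of_nonneg_left this (norm_nonneg (A y))
                linarith
              · exact Continuous.intervalIntegrable (by fun_prop) _ _
          _ = c * |∫ y in (0 : ℝ)..x, ‖A y‖ * Λ y| := by
              rw [intervalIntegral.integral_const_mul, abs_mul, abs_of_nonneg h0]
          _ ≤ c * (Λ x / 2) := mul_le_mul_of_nonneg_left (hΛint x) h0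
          _ = c / 2 * Λ x := by ring)
      (fun u v huv x hx => intervalIntegral.integral_congr fun y hy => by
        simp only [huv (hsub hx hy)])
      (fun u v c hu hv _ _ x hx => by
        simp only [hT, Pi.add_apply, map_add]
        exact intervalIntegral.integral_add (hint hu x hx) (hint hv x hx))
      continuousOn_const (fun x _ => le_mul_of_one_le_right (norm_nonneg _) (hΛ1 x))
    exact ⟨this.2.2.1, this.2.2.2.2 x hx⟩
  refine ⟨fun x => ∑' n, T^[n] (fun _ => η) x, ?_, fun x => ?_⟩
  · have := (main 1 one_pos 0 (by norm_num)).2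
    simpa [hT] using this
  · have hx : x ∈ Ioo (-(|x| + 1)) (|x| + 1) :=
      ⟨by linarith [neg_abs_le x], by linarith [le_abs_self x]⟩
    have hR : 0 < |x| + 1 := by positivity
    have h1 := hder (main _ hR x hx).1 x hx
    refine (h1.const_add η).congr_of_eventuallyEq ?_
    filter_upwards [isOpen_Ioo.mem_nhds hx] with y hy
    exact (main _ hR y hy).2

end LinearODE

/-! ### Holomorphic dependence of integrals on a parameter. -/

section ParametricIntegral

variable {F : Type*} [NormedAddCommGroup F] [NormedSpace ℂ F]
  {α : Type*} [MeasurableSpace α] {μ : Measure α}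

/-- An integral of holomorphic functions with an integrable bound is holomorphic. -/
theorem differentiableOn_integral_of_bound {U : Set ℂ} (hU : IsOpen U) {f : ℂ → α → F}
    {g : α → ℝ} (hg : Integrable g μ) (hm : ∀ k ∈ U, AEStronglyMeasurable (f k) μ)
    (hd : ∀ᵐ y ∂μ, DifferentiableOn ℂ (fun k => f k y) U)
    (hb : ∀ᵐ y ∂μ, ∀ k ∈ U, ‖f k y‖ ≤ g y) :
    DifferentiableOn ℂ (fun k => ∫ y, f k y ∂μ) U := by
  intro k₀ hk₀
  obtain ⟨r, hr, hball⟩ := Metric.isOpen_iff.1 hU k₀ hk₀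
  have hsub : ∀ k ∈ Metric.ball k₀ (r / 2), Metric.closedBall k (r / 4) ⊆ U := fun k hk z hz => by
    apply hball
    have h1 := Metric.mem_ball.1 hk
    have h2 := Metric.mem_closedBall.1 hz
    exact Metric.mem_ball.2 ((dist_triangle z k k₀).trans_lt (by linarith))
  have hkU : ∀ k ∈ Metric.ball k₀ (r / 2), k ∈ U := fun k hk =>
    hsub k hk (Metric.mem_closedBall_self (by linarith))
  have hdk : ∀ᵐ y ∂μ, ∀ k ∈ Metric.ball k₀ (r / 2),
      HasDerivAt (fun k => f k y) (deriv (fun k => f k y) k) k := by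
    filter_upwards [hd] with y hy k hk
    exact (hy.differentiableAt (hU.mem_nhds (hkU k hk))).hasDerivAt
  -- The complex derivative is a pointwise limit of a sequence of measurable difference quotients.
  have hm' : AEStronglyMeasurable (fun y => deriv (fun k => f k y) k₀) μ := by
    set h : ℕ → ℂ := fun n => ((r / 2 / (n + 1 : ℝ) : ℝ) : ℂ) / 2 with hh
    have hpos : ∀ n : ℕ, 0 < r / 2 / (n + 1 : ℝ) := fun n => by positivity
    have hle : ∀ n : ℕ, r / 2 / (n + 1 : ℝ) ≤ r / 2 := fun n =>
      div_le_self (by positivity) (by linarith [(Nat.cast_nonneg n : (0 : ℝ) ≤ n)])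
    have hnorm : ∀ n : ℕ, ‖h n‖ = r / 2 / (n + 1 : ℝ) / 2 := fun n => by
      rw [hh, norm_div, Complex.norm_of_nonneg (hpos n).le, Complex.norm_ofNat]
    have hmem : ∀ n, k₀ + h n ∈ Metric.ball k₀ (r / 2) := fun n => by
      rw [Metric.mem_ball, dist_eq_norm, add_sub_cancel_left, hnorm]
      linarith [hpos n, hle n]
    have hne : ∀ n, h n ≠ 0 := fun n => by
      rw [← norm_ne_zero_iff, hnorm]
      exact (by linarith [hpos n] : (0 : ℝ) < r / 2 / (n + 1 : ℝ) / 2).ne'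
    have hlim : Tendsto h atTop (𝓝 0) := by
      rw [tendsto_zero_iff_norm_tendsto_zero]
      simp only [hnorm]
      have := (tendsto_one_div_add_atTop_nhds_zero_nat (𝕜 := ℝ)).const_mul (r / 2 / 2)
      rw [mul_zero] at this
      exact this.congr fun n => by ring
    refine aestronglyMeasurable_of_tendsto_ae atTop
      (f := fun n y => (h n)⁻¹ • (f (k₀ + h n) y - f k₀ y)) (fun n => ?_) ?_
    · exact ((hm _ (hkU _ (hmem n))).sub (hm _ hk₀)).const_smul _
    · filter_upwards [hdk] with y hy
      have h1 := (hy k₀ (Metric.mem_ball_self (by linarith))).tendsto_slope_zero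
      exact h1.comp (tendsto_nhdsWithin_iff.2 ⟨hlim, Eventually.of_forall hne⟩)
  -- Cauchy's estimate on circles of radius `r/4` turns the bound on `f` into an integrable bound on
  -- its derivative.
  have hbd : ∀ᵐ y ∂μ, ∀ k ∈ Metric.ball k₀ (r / 2),
      ‖deriv (fun k => f k y) k‖ ≤ (r / 4)⁻¹ * g y := by
    filter_upwards [hd, hb] with y hy1 hy2 k hk
    have := Complex.norm_deriv_le_of_forall_mem_sphere_norm_le (f := fun k => f k y) (c := k)
      (R := r / 4) (C := g y) (by linarith)
      ((hy1.mono (hsub k hk)).diffContOnCl_ball subset_rfl)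
      (fun z hz => hy2 z (hsub k hk (Metric.sphere_subset_closedBall hz)))
    rwa [div_eq_inv_mul] at this
  have hint : Integrable (f k₀) μ := hg.mono' (hm k₀ hk₀) (by
    filter_upwards [hb] with y hy using hy k₀ hk₀)
  have := (hasDerivAt_integral_of_dominated_loc_of_deriv_le (μ := μ) (F := f)
    (F' := fun k y => deriv (fun k => f k y) k) (bound := fun y => (r / 4)⁻¹ * g y)
    (Metric.ball_mem_nhds k₀ (by linarith : 0 < r / 2))
    (by filter_upwards [hU.mem_nhds hk₀] with k hk using hm k hk) hint hm' hbd
    (hg.const_mul _) hdk).2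
  exact this.differentiableAt.differentiableWithinAt

end ParametricIntegral

/-! ### Volterra equations normalized at `+∞`. -/

section Volterra

variable {F : Type*} [NormedAddCommGroup F] [NormedSpace ℂ F]

/-- A one-parameter group `G` with generator `N`, a perturbation `W` and an integrable bound `m` for
the kernel `G(x - y) W(y)` on `a ≤ x ≤ y`. -/
structure IsVolterraKernel (G : ℝ → F →L[ℂ] F) (N : F →L[ℂ] F) (W : ℝ → F →L[ℂ] F) (m : ℝ → ℝ)
    (a : ℝ) : Prop where
  zero : G 0 = 1
  add : ∀ s t, G (s + t) = G s * G t
  deriv : ∀ s, HasDerivAt G (N * G s) s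
  cont : Continuous W
  cont_bound : Continuous m
  bound_nonneg : ∀ y, 0 ≤ m y
  integrable : IntegrableOn m (Ioi a)
  bound : ∀ x y, a < x → x ≤ y → ‖G (x - y)‖ * ‖W y‖ ≤ m y

/-- The Volterra operator `u ↦ -∫_x^∞ G(x - y) W(y) u(y) dy`. -/
def volterraOp (G : ℝ → F →L[ℂ] F) (W : ℝ → F →L[ℂ] F) (u : ℝ → F) (x : ℝ) : F :=
  -∫ y in Ioi x, G (x - y) (W y (u y))

/-- The solution of `u = η + volterraOp G W u`, as a Neumann series. -/
def volterra (G : ℝ → F →L[ℂ] F) (W : ℝ → F →L[ℂ] F) (η : F) (x : ℝ) : F :=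
  ∑' n, (volterraOp G W)^[n] (fun _ => η) x

namespace IsVolterraKernel

variable {G : ℝ → F →L[ℂ] F} {N : F →L[ℂ] F} {W : ℝ → F →L[ℂ] F} {m : ℝ → ℝ} {a : ℝ}

theorem continuous_group (h : IsVolterraKernel G N W m a) : Continuous G :=
  continuous_iff_continuousAt.2 fun s => (h.deriv s).continuousAt

theorem norm_apply_le (h : IsVolterraKernel G N W m a) {x y : ℝ} (hx : a < x) (hxy : x ≤ y)
    (v : F) : ‖G (x - y) (W y v)‖ ≤ m y * ‖v‖ := by
  refine ((G (x - y)).le_opNorm _).trans ?_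
  refine (mul_le_mul_of_nonneg_left ((W y).le_opNorm v) (norm_nonneg _)).trans ?_
  rw [← mul_assoc]
  exact mul_le_mul_of_nonneg_right (h.bound x y hx hxy) (norm_nonneg _)

theorem integrableOn_apply (h : IsVolterraKernel G N W m a) {u : ℝ → F} {C : ℝ}
    (hu : ContinuousOn u (Ioi a)) (hb : ∀ y ∈ Ioi a, ‖u y‖ ≤ C) {x : ℝ} (hx : a < x) :
    IntegrableOn (fun y => G (x - y) (W y (u y))) (Ioi x) := by
  have hG := h.continuous_group
  have hW := h.cont
  have hc : ContinuousOn (fun y => G (x - y) (W y (u y))) (Ioi x) :=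
    (by fun_prop : Continuous fun y => G (x - y)).continuousOn.clm_apply
      (hW.continuousOn.clm_apply (hu.mono (Ioi_subset_Ioi hx.le)))
  have hm := (h.integrable.mono_set (Ioi_subset_Ioi hx.le)).mul_const C
  refine Integrable.mono' hm (hc.aestronglyMeasurable measurableSet_Ioi) ?_
  refine (ae_restrict_mem measurableSet_Ioi).mono fun y hy => ?_
  exact (h.norm_apply_le hx (le_of_lt hy) _).trans
    (mul_le_mul_of_nonneg_left (hb y (hx.trans hy)) (h.bound_nonneg y))

/-- By the group law `G (x - y) = G x * G (-y)`, so `x` enters only through the factor `G x` and the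
endpoint of the integral, and the product rule applies. The bound `m` is available only to the right
of `a`, hence the auxiliary base point `b` with `a < b < x`. -/
theorem hasDerivAt_volterraOp [CompleteSpace F] (h : IsVolterraKernel G N W m a) {u : ℝ → F} {C : ℝ}
    (hu : ContinuousOn u (Ioi a)) (hb : ∀ y ∈ Ioi a, ‖u y‖ ≤ C) {x : ℝ} (hx : a < x) :
    HasDerivAt (volterraOp G W u) (N (volterraOp G W u x) + W x (u x)) x := by
  obtain ⟨b, hab, hbx⟩ := exists_between hx
  have hG := h.continuous_group
  have hW := h.cont
  have hGG : ∀ s, G (-s) * G s = 1 := fun s => by rw [← h.add, neg_add_cancel, h.zero]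
  have hGG' : ∀ s, G s * G (-s) = 1 := fun s => by rw [← h.add, add_neg_cancel, h.zero]
  set f : ℝ → F := fun y => G (-y) (W y (u y)) with hf
  have hfb : IntegrableOn f (Ioi b) := by
    refine ((G (-b)).integrable_comp (h.integrableOn_apply hu hb hab)).congr ?_
    refine Eventually.of_forall fun y => ?_
    have : G (-b) * G (b - y) = G (-y) := by rw [← h.add]; congr 1; ring
    simp only [hf, ← this]
    rfl
  have hfc : ContinuousOn f (Ioi a) :=
    (by fun_prop : Continuous fun y => G (-y)).continuousOn.clm_apply
      (hW.continuousOn.clm_apply hu)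
  have hrep : ∀ z ∈ Ioi b, volterraOp G W u z
      = -(G z (∫ y in Ioi b, f y) - G z (∫ y in b..z, f y)) := by
    intro z hz
    have hfz : IntegrableOn f (Ioi z) := hfb.mono_set (Ioi_subset_Ioi (le_of_lt hz))
    rw [← intervalIntegral.integral_interval_add_Ioi hfb hfz, map_add, add_sub_cancel_left,
      ← ContinuousLinearMap.integral_comp_comm _ hfz]
    simp only [volterraOp]
    congr 1
    refine integral_congr_ae (Eventually.of_forall fun y => ?_)
    have : G z * G (-y) = G (z - y) := by rw [← h.add]; congr 1
    simp only [hf, ← this]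
    rfl
  have hfI : HasDerivAt (fun z => ∫ y in b..z, f y) (f x) x := by
    refine intervalIntegral.integral_hasDerivAt_right ?_
      (ContinuousOn.stronglyMeasurableAtFilter isOpen_Ioi hfc x hx)
      (hfc.continuousAt (isOpen_Ioi.mem_nhds hx))
    refine (hfc.mono ?_).intervalIntegrable
    rw [uIcc_of_le hbx.le]
    exact fun y hy => hab.trans_le hy.1
  have hGR : HasDerivAt (fun z => (G z).restrictScalars ℝ) ((N * G x).restrictScalars ℝ) x :=
    (ContinuousLinearMap.restrictScalarsL ℂ F F ℝ ℝ).hasFDerivAt.comp_hasDerivAt x (h.deriv x)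
  have h1 := ((hGR.clm_apply (hasDerivAt_const x (∫ y in Ioi b, f y))).fun_sub
    (hGR.clm_apply hfI)).fun_neg
  have h2 := h1.congr_of_eventuallyEq (f₁ := volterraOp G W u) (by
    filter_upwards [isOpen_Ioi.mem_nhds hbx] with z hz using hrep z hz)
  refine h2.congr_deriv ?_
  rw [hrep x hbx]
  have h3 : G x (f x) = W x (u x) := by
    have := congrArg (fun A : F →L[ℂ] F => A (W x (u x))) (hGG' x)
    simpa [hf] using this
  have hm : ∀ v, (N * G x) v = N (G x v) := fun _ => rfl
  simp only [map_zero, add_zero, map_neg, map_sub, ContinuousLinearMap.coe_restrictScalars', hm, h3]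
  abel

/-- The tail integral of the bound. -/
theorem hasDerivAt_tail (h : IsVolterraKernel G N W m a) (x : ℝ) :
    HasDerivAt (fun x => (∫ y in Ioi a, m y) - ∫ y in a..x, m y) (-m x) x :=
  (h.cont_bound.integral_hasStrictDerivAt a x).hasDerivAt.const_sub _

theorem tail_eq (h : IsVolterraKernel G N W m a) {x : ℝ} (hx : a < x) :
    (∫ y in Ioi a, m y) - ∫ y in a..x, m y = ∫ y in Ioi x, m y := by
  rw [← intervalIntegral.integral_interval_add_Ioi h.integrable
    (h.integrable.mono_set (Ioi_subset_Ioi hx.le)), add_sub_cancel_left]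

/-- If `M` is the tail integral of `m`, then `m e^{2M}` is the derivative of `-e^{2M}/2`. This is
why the Volterra operator halves the norm with weight `e^{2M}`. In the proof `M` is written with an
interval integral, which makes it differentiable everywhere. -/
theorem integral_weight (h : IsVolterraKernel G N W m a) {x : ℝ} (hx : a < x) :
    IntegrableOn (fun y => m y * Real.exp (2 * ∫ z in Ioi y, m z)) (Ioi x) ∧
    ∫ y in Ioi x, m y * Real.exp (2 * ∫ z in Ioi y, m z) ≤ Real.exp (2 * ∫ z in Ioi x, m z) / 2 :=
        by
  set M : ℝ → ℝ := fun x => (∫ y in Ioi a, m y) - ∫ y in a..x, m y with hM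
  have hMd := h.hasDerivAt_tail
  have hMc : Continuous M := continuous_iff_continuousAt.2 fun s => (hMd s).continuousAt
  have hm := h.cont_bound
  have hcongr : ∀ y ∈ Ioi x, m y * Real.exp (2 * ∫ z in Ioi y, m z) = m y * Real.exp (2 * M y) :=
    fun y hy => by rw [hM]; simp only; rw [h.tail_eq (hx.trans hy)]
  have hle : ∀ y ∈ Ioi x, M y ≤ ∫ y in Ioi a, m y := fun y hy => by
    have : 0 ≤ ∫ z in a..y, m z :=
      intervalIntegral.integral_nonneg (hx.trans hy).le fun z _ => h.bound_nonneg z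
    simp only [hM]; linarith
  have hi : IntegrableOn (fun y => m y * Real.exp (2 * M y)) (Ioi x) := by
    refine Integrable.mono' ((h.integrable.mono_set (Ioi_subset_Ioi hx.le)).mul_const
      (Real.exp (2 * ∫ y in Ioi a, m y))) (by fun_prop) ?_
    refine (ae_restrict_mem measurableSet_Ioi).mono fun y hy => ?_
    rw [Real.norm_eq_abs, abs_of_nonneg (mul_nonneg (h.bound_nonneg y) (Real.exp_pos _).le)]
    refine mul_le_mul_of_nonneg_left (Real.exp_le_exp.2 ?_) (h.bound_nonneg y)
    linarith [hle y hy]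
  refine ⟨hi.congr_fun (fun y hy => (hcongr y hy).symm) measurableSet_Ioi, ?_⟩
  rw [setIntegral_congr_fun measurableSet_Ioi hcongr]
  have hlim : Tendsto M atTop (𝓝 0) := by
    have := (intervalIntegral_tendsto_integral_Ioi a h.integrable tendsto_id).const_sub
      (∫ y in Ioi a, m y)
    simpa using this
  have h1 := integral_Ioi_of_hasDerivAt_of_tendsto' (a := x) (f := fun y => -Real.exp (2 * M y) / 2)
    (f' := fun y => m y * Real.exp (2 * M y)) (m := -Real.exp (2 * 0) / 2)
    (fun y _ => ((((hMd y).const_mul 2).exp.neg).div_const 2).congr_deriv (by ring)) hi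
    (((Real.continuous_exp.tendsto _).comp (hlim.const_mul 2)).neg.div_const 2)
  rw [h1, ← h.tail_eq hx]
  simp only [mul_zero, Real.exp_zero, hM]
  linarith

theorem tail_nonneg (h : IsVolterraKernel G N W m a) (x : ℝ) : 0 ≤ ∫ y in Ioi x, m y :=
  setIntegral_nonneg measurableSet_Ioi fun y _ => h.bound_nonneg y

theorem tail_le (h : IsVolterraKernel G N W m a) {x : ℝ} (hx : a < x) :
    ∫ y in Ioi x, m y ≤ ∫ y in Ioi a, m y :=
  setIntegral_mono_set h.integrable (Eventually.of_forall h.bound_nonneg)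
    (Ioi_subset_Ioi hx.le).eventuallyLE

/-- Convergence of the Volterra series and the integral equation. -/
theorem series [CompleteSpace F] (h : IsVolterraKernel G N W m a) (η : F) :
    (∀ n, ContinuousOn ((volterraOp G W)^[n] fun _ => η) (Ioi a)) ∧
    (∀ n, ∀ x ∈ Ioi a, ‖(volterraOp G W)^[n] (fun _ => η) x‖
      ≤ ‖η‖ * Real.exp (2 * ∫ z in Ioi a, m z) * (1 / 2) ^ n) ∧
    ContinuousOn (volterra G W η) (Ioi a) ∧
    (∀ x ∈ Ioi a, ‖volterra G W η x‖ ≤ 2 * ‖η‖ * Real.exp (2 * ∫ z in Ioi a, m z)) ∧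
    (∀ x ∈ Ioi a, volterra G W η x = η + volterraOp G W (volterra G W η) x) := by
  have hΛ1 : ∀ x, 1 ≤ Real.exp (2 * ∫ z in Ioi x, m z) := fun x =>
    Real.one_le_exp (by linarith [h.tail_nonneg x])
  have hΛB : ∀ x ∈ Ioi a, Real.exp (2 * ∫ z in Ioi x, m z) ≤ Real.exp (2 * ∫ z in Ioi a, m z) :=
    fun x hx => Real.exp_le_exp.2 (by linarith [h.tail_le hx])
  have hbd : ∀ (u : ℝ → F) (c : ℝ),
      (∀ x ∈ Ioi a, ‖u x‖ ≤ c * Real.exp (2 * ∫ z in Ioi x, m z)) → 0 ≤ c ∧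
      ∀ y ∈ Ioi a, ‖u y‖ ≤ c * Real.exp (2 * ∫ z in Ioi a, m z) := by
    intro u c hu
    have h0 : 0 ≤ c := nonneg_of_mul_nonneg_left
      ((norm_nonneg _).trans (hu (a + 1) (by simp))) (Real.exp_pos _)
    exact ⟨h0, fun y hy => (hu y hy).trans (mul_le_mul_of_nonneg_left (hΛB y hy) h0)⟩
  have := neumann_series (D := Ioi a) (Λ := fun x => Real.exp (2 * ∫ z in Ioi x, m z))
    (B := Real.exp (2 * ∫ z in Ioi a, m z)) (T := volterraOp G W) (η := fun _ => η) (c := ‖η‖)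
    (fun x _ => (Real.exp_pos _).le) hΛB
    (fun u c hu hb x hx =>
      (h.hasDerivAt_volterraOp hu (hbd u c hb).2 hx).continuousAt.continuousWithinAt)
    (fun u c hu hb x hx => by
      rw [volterraOp, norm_neg]
      calc ‖∫ y in Ioi x, G (x - y) (W y (u y))‖
          ≤ ∫ y in Ioi x, c * (m y * Real.exp (2 * ∫ z in Ioi y, m z)) := by
            refine norm_integral_le_of_norm_le ((h.integral_weight hx).1.const_mul c) ?_
            refine (ae_restrict_mem measurableSet_Ioi).mono fun y hy => ?_
            refine (h.norm_apply_le hx (le_of_lt hy) _).trans ?_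
            have := mul_le_mul_of_nonneg_left (hb y (Ioi_subset_Ioi (le_of_lt hx) hy))
                (h.bound_nonneg y)
            linarith
        _ = c * ∫ y in Ioi x, m y * Real.exp (2 * ∫ z in Ioi y, m z) := integral_const_mul _ _
        _ ≤ c * (Real.exp (2 * ∫ z in Ioi x, m z) / 2) :=
            mul_le_mul_of_nonneg_left (h.integral_weight hx).2 (hbd u c hb).1
        _ = _ := by ring)
    (fun u v huv x hx => by
      simp only [volterraOp]
      congr 1
      refine setIntegral_congr_fun measurableSet_Ioi fun y hy => ?_
      simp only [huv (Ioi_subset_Ioi (le_of_lt hx) hy)])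
    (fun u v c hu hv hub hvb x hx => by
      simp only [volterraOp, Pi.add_apply, map_add]
      rw [integral_add (h.integrableOn_apply hu (hbd u c hub).2 hx)
        (h.integrableOn_apply hv (hbd v c hvb).2 hx), neg_add])
    continuousOn_const (fun x _ => le_mul_of_one_le_right (norm_nonneg _) (hΛ1 x))
  obtain ⟨h1, h2, h3, h4, h5⟩ := this
  refine ⟨h1, fun n x hx => (h2 n x hx).trans ?_, h3, fun x hx => (h4 x hx).trans ?_, h5⟩
  · exact mul_le_mul_of_nonneg_right
      (mul_le_mul_of_nonneg_left (hΛB x hx) (norm_nonneg _)) (by positivity)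
  · exact mul_le_mul_of_nonneg_left (hΛB x hx) (by positivity)

/-- The leading term `η` is a constant solution of the unperturbed equation because `N η = 0`; the
Volterra operator adds the response to `W`. -/
theorem hasDerivAt_volterra [CompleteSpace F] (h : IsVolterraKernel G N W m a) {η : F}
    (hη : N η = 0) {x : ℝ} (hx : a < x) :
    HasDerivAt (volterra G W η) (N (volterra G W η x) + W x (volterra G W η x)) x := by
  obtain ⟨-, -, h3, h4, h5⟩ := h.series η
  have h1 := (h.hasDerivAt_volterraOp h3 h4 hx).const_add η
  have h2 := h1.congr_of_eventuallyEq (f₁ := volterra G W η) (by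
    filter_upwards [isOpen_Ioi.mem_nhds hx] with z hz using h5 z hz)
  refine h2.congr_deriv ?_
  conv_rhs => rw [h5 x hx]
  rw [map_add, hη, zero_add, ← h5 x hx]

theorem tendsto_volterra [CompleteSpace F] (h : IsVolterraKernel G N W m a) (η : F) :
    Tendsto (volterra G W η) atTop (𝓝 η) := by
  obtain ⟨-, -, h3, h4, h5⟩ := h.series η
  rw [tendsto_iff_norm_sub_tendsto_zero]
  have hlim : Tendsto (fun x => (∫ y in Ioi x, m y) *
      (2 * ‖η‖ * Real.exp (2 * ∫ z in Ioi a, m z))) atTop (𝓝 0) := by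
    have h6 : Tendsto (fun x => ∫ y in Ioi x, m y) atTop (𝓝 0) := by
      have := (intervalIntegral_tendsto_integral_Ioi a h.integrable tendsto_id).const_sub
        (∫ y in Ioi a, m y)
      rw [sub_self] at this
      refine this.congr' ?_
      filter_upwards [Ioi_mem_atTop a] with x hx using h.tail_eq hx
    simpa using h6.mul_const (2 * ‖η‖ * Real.exp (2 * ∫ z in Ioi a, m z))
  refine squeeze_zero' (Eventually.of_forall fun _ => norm_nonneg _) ?_ hlim
  filter_upwards [Ioi_mem_atTop a] with x hx
  rw [h5 x hx, add_sub_cancel_left, volterraOp, norm_neg, ← integral_mul_const]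
  refine norm_integral_le_of_norm_le
    ((h.integrable.mono_set (Ioi_subset_Ioi (le_of_lt hx))).mul_const _) ?_
  refine (ae_restrict_mem measurableSet_Ioi).mono fun y hy => ?_
  exact (h.norm_apply_le hx (le_of_lt hy) _).trans
    (mul_le_mul_of_nonneg_left (h4 y (Ioi_subset_Ioi (le_of_lt hx) hy)) (h.bound_nonneg y))

end IsVolterraKernel

/-- Needed on the branch cuts, where the leading terms of two Jost series are proportional.
Convergence plays no role: integrals and infinite sums commute with scalars in any case. -/
theorem volterra_smul (G : ℝ → F →L[ℂ] F) (W : ℝ → F →L[ℂ] F) (c : ℂ) (η : F) (x : ℝ) :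
    volterra G W (c • η) x = c • volterra G W η x := by
  have h : ∀ n, ∀ x, (volterraOp G W)^[n] (fun _ => c • η) x
      = c • (volterraOp G W)^[n] (fun _ => η) x := by
    intro n
    induction n with
    | zero => intro x; rfl
    | succ n ih =>
      intro x
      rw [Function.iterate_succ_apply', Function.iterate_succ_apply', volterraOp, volterraOp]
      simp only [ih, map_smul]
      rw [integral_smul, smul_neg]
  simp only [volterra, h]
  exact tsum_const_smul'' c

section Parameter

variable [CompleteSpace F] {W : ℝ → F →L[ℂ] F} {m : ℝ → ℝ} {a : ℝ}

/-- A common bound `m` makes the geometric estimate of the terms uniform in the parameter, and each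
term is continuous by dominated convergence. `S` is an arbitrary set, so that it may contain
boundary points of the spectral curve. -/
theorem continuousOn_volterra {P : Type*} [TopologicalSpace P] [FirstCountableTopology P]
    {S : Set P} {G : P → ℝ → F →L[ℂ] F} {N : P → F →L[ℂ] F} {η : P → F} {C : ℝ}
    (h : ∀ p ∈ S, IsVolterraKernel (G p) (N p) W m a)
    (hG : ∀ s, ContinuousOn (fun p => G p s) S) (hη : ContinuousOn η S)
    (hC : ∀ p ∈ S, ‖η p‖ ≤ C) {x : ℝ} (hx : a < x) :
    ContinuousOn (fun p => volterra (G p) W (η p) x) S := by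
  set B : ℝ := Real.exp (2 * ∫ z in Ioi a, m z) with hB
  have hB0 : 0 < B := Real.exp_pos _
  have hb : ∀ n, ∀ p ∈ S, ∀ x ∈ Ioi a, ‖(volterraOp (G p) W)^[n] (fun _ => η p) x‖
      ≤ C * B * (1 / 2) ^ n := fun n p hp x hx =>
    (((h p hp).series (η p)).2.1 n x hx).trans (mul_le_mul_of_nonneg_right
      (mul_le_mul_of_nonneg_right (hC p hp) hB0.le) (by positivity))
  have hn : ∀ n, ∀ x ∈ Ioi a, ContinuousOn
      (fun p => (volterraOp (G p) W)^[n] (fun _ => η p) x) S := by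
    intro n
    induction n with
    | zero => exact fun x _ => hη
    | succ n ih =>
      intro x hx
      simp only [Function.iterate_succ_apply', volterraOp]
      refine ContinuousOn.neg ?_
      rcases S.eq_empty_or_nonempty with rfl | ⟨p₀, hp₀⟩
      · exact continuousOn_empty _
      refine continuousOn_of_dominated (bound := fun y => m y * (C * B * (1 / 2) ^ n)) ?_ ?_ ?_ ?_
      · intro p hp
        have hs := (h p hp).series (η p)
        exact ((h p hp).integrableOn_apply (hs.1 n) (fun y hy => hb n p hp y hy)
          hx).aestronglyMeasurable
      · intro p hp
        refine (ae_restrict_mem measurableSet_Ioi).mono fun y hy => ?_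
        exact ((h p hp).norm_apply_le hx (le_of_lt hy) _).trans
          (mul_le_mul_of_nonneg_left (hb n p hp y (Ioi_subset_Ioi (le_of_lt hx) hy)) ((h p
              hp).bound_nonneg y))
      · exact ((h p₀ hp₀).integrable.mono_set (Ioi_subset_Ioi (le_of_lt hx))).mul_const _
      · refine (ae_restrict_mem measurableSet_Ioi).mono fun y hy => ?_
        exact (hG (x - y)).clm_apply (continuousOn_const.clm_apply (ih y (Ioi_subset_Ioi (le_of_lt
            hx) hy)))
  exact continuousOn_tsum (fun n => hn n x hx)
    ((summable_geometric_of_lt_one (by norm_num) (by norm_num)).mul_left (C * B))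
    fun n p hp => hb n p hp x hx

theorem differentiableOn_volterra {U : Set ℂ} (hU : IsOpen U)
    {G : ℂ → ℝ → F →L[ℂ] F} {N : ℂ → F →L[ℂ] F} {η : ℂ → F} {C : ℝ}
    (h : ∀ p ∈ U, IsVolterraKernel (G p) (N p) W m a)
    (hG : ∀ s, DifferentiableOn ℂ (fun p => G p s) U) (hη : DifferentiableOn ℂ η U)
    (hC : ∀ p ∈ U, ‖η p‖ ≤ C) {x : ℝ} (hx : a < x) :
    DifferentiableOn ℂ (fun p => volterra (G p) W (η p) x) U := by
  set B : ℝ := Real.exp (2 * ∫ z in Ioi a, m z) with hB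
  have hB0 : 0 < B := Real.exp_pos _
  have hb : ∀ n, ∀ p ∈ U, ∀ x ∈ Ioi a, ‖(volterraOp (G p) W)^[n] (fun _ => η p) x‖
      ≤ C * B * (1 / 2) ^ n := fun n p hp x hx =>
    (((h p hp).series (η p)).2.1 n x hx).trans (mul_le_mul_of_nonneg_right
      (mul_le_mul_of_nonneg_right (hC p hp) hB0.le) (by positivity))
  have hn : ∀ n, ∀ x ∈ Ioi a, DifferentiableOn ℂ
      (fun p => (volterraOp (G p) W)^[n] (fun _ => η p) x) U := by
    intro n
    induction n with
    | zero => exact fun x _ => hη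
    | succ n ih =>
      intro x hx
      simp only [Function.iterate_succ_apply', volterraOp]
      refine DifferentiableOn.fun_neg ?_
      rcases U.eq_empty_or_nonempty with rfl | ⟨p₀, hp₀⟩
      · exact differentiableOn_empty
      refine differentiableOn_integral_of_bound hU (g := fun y => m y * (C * B * (1 / 2) ^ n))
        ?_ ?_ ?_ ?_
      · exact ((h p₀ hp₀).integrable.mono_set (Ioi_subset_Ioi (le_of_lt hx))).mul_const _
      · intro p hp
        have hs := (h p hp).series (η p)
        exact ((h p hp).integrableOn_apply (hs.1 n) (fun y hy => hb n p hp y hy)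
          hx).aestronglyMeasurable
      · refine (ae_restrict_mem measurableSet_Ioi).mono fun y hy => ?_
        exact (hG (x - y)).clm_apply
          ((differentiableOn_const (W y)).clm_apply (ih y (Ioi_subset_Ioi (le_of_lt hx) hy)))
      · refine (ae_restrict_mem measurableSet_Ioi).mono fun y hy p hp => ?_
        exact ((h p hp).norm_apply_le hx (le_of_lt hy) _).trans
          (mul_le_mul_of_nonneg_left (hb n p hp y (Ioi_subset_Ioi (le_of_lt hx) hy)) ((h p
              hp).bound_nonneg y))
  exact Complex.differentiableOn_tsum_of_summable_norm
    ((summable_geometric_of_lt_one (by norm_num) (by norm_num)).mul_left (C * B))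
    (fun n => hn n x hx) hU fun n p hp => hb n p hp x hx

end Parameter

end Volterra

/-! ### Branches of the roots -/

theorem cutArg_mem (z : ℂ) : -(Real.pi / 2) ≤ cutArg z ∧ cutArg z < 3 * Real.pi / 2 := by
  have h1 := Complex.neg_pi_lt_arg z
  have h2 := Complex.arg_le_pi z
  have := Real.pi_pos
  unfold cutArg
  split_ifs with h <;> constructor <;> linarith

theorem sqrtDown_sq (z : ℂ) : sqrtDown z ^ 2 = z := by
  have h : Complex.exp (Complex.I * (cutArg z : ℂ)) = Complex.exp (Complex.arg z * Complex.I) := by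
    unfold cutArg
    split_ifs with h
    · push_cast
      rw [mul_comm, add_mul, Complex.exp_add, Complex.exp_two_pi_mul_I, mul_one]
    · rw [mul_comm]
  rw [sqrtDown, mul_pow, ← Complex.ofReal_pow, Real.sq_sqrt (norm_nonneg z), ← Complex.exp_nat_mul]
  have e : ((2 : ℕ) : ℂ) * (Complex.I * ((cutArg z / 2 : ℝ) : ℂ)) = Complex.I * (cutArg z : ℂ) := by
    push_cast; ring
  rw [e, h, Complex.norm_mul_exp_arg_mul_I]

theorem sqrtDown_re_im (z : ℂ) : (sqrtDown z).re = Real.sqrt ‖z‖ * Real.cos (cutArg z / 2) ∧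
    (sqrtDown z).im = Real.sqrt ‖z‖ * Real.sin (cutArg z / 2) := by
  have e : sqrtDown z = (Real.sqrt ‖z‖ : ℂ) * (Real.cos (cutArg z / 2) + Real.sin (cutArg z / 2) *
      Complex.I) := by
    rw [sqrtDown, mul_comm Complex.I, Complex.exp_mul_I, Complex.ofReal_cos, Complex.ofReal_sin]
  rw [e]
  simp [-Complex.ofReal_cos, -Complex.ofReal_sin]

/-- Half of the argument lies in `[-π/4, 3π/4)`, so the root lies in the half-plane `re + im ≥ 0`,
of whose boundary line only the half with `re ≥ 0` occurs. The choice of branch is used in this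
algebraic form from here on. -/
theorem sqrtDown_halfplane (z : ℂ) : 0 ≤ (sqrtDown z).re + (sqrtDown z).im ∧
    ((sqrtDown z).re + (sqrtDown z).im = 0 → 0 ≤ (sqrtDown z).re) := by
  obtain ⟨h1, h2⟩ := cutArg_mem z
  obtain ⟨e1, e2⟩ := sqrtDown_re_im z
  rw [e1, e2, ← mul_add]
  set a := cutArg z / 2 with ha
  have hpi := Real.pi_pos
  have hk : Real.cos a + Real.sin a = Real.sqrt 2 * Real.cos (a - Real.pi / 4) := by
    rw [Real.cos_sub, Real.cos_pi_div_four, Real.sin_pi_div_four]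
    have : Real.sqrt 2 * Real.sqrt 2 = 2 := Real.mul_self_sqrt (by norm_num)
    linear_combination (-(Real.cos a + Real.sin a) / 2) * this
  have hc : 0 ≤ Real.cos (a - Real.pi / 4) :=
    Real.cos_nonneg_of_neg_pi_div_two_le_of_le (by linarith) (by linarith)
  rw [hk]
  refine ⟨by positivity, fun h => ?_⟩
  rcases mul_eq_zero.1 h with h | h
  · rw [h, zero_mul]
  · have h3 : Real.cos (a - Real.pi / 4) = 0 := by
      rcases mul_eq_zero.1 h with h | h
      · norm_num at h
      · exact h
    have h4 : a = -(Real.pi / 4) := by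
      by_contra hne
      have : 0 < Real.cos (a - Real.pi / 4) := by
        refine Real.cos_pos_of_mem_Ioo ⟨?_, by linarith⟩
        rcases lt_or_gt_of_ne hne with h5 | h5 <;> linarith
      exact this.ne' h3
    rw [h4, Real.cos_neg]
    have := Real.cos_pos_of_mem_Ioo (x := Real.pi / 4) ⟨by linarith, by linarith⟩
    positivity

theorem lam_sq (A : ℝ) (κ : ℂ) : lam A κ ^ 2 = κ ^ 2 + (A : ℂ) ^ 2 := by
  rw [lam, mul_pow, sqrtDown_sq, sqrtDown_sq]
  linear_combination (-(A : ℂ) ^ 2) * Complex.I_sq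

/-- The cut of `lam A`. -/
def lamCut (A : ℝ) : Set ℂ := {κ | κ.re = 0 ∧ -A ≤ κ.im ∧ κ.im ≤ A}

theorem re_im_of_sq {s z : ℂ} (h : s ^ 2 = z) :
    (s.re - s.im) * (s.re + s.im) = z.re ∧ 2 * (s.re * s.im) = z.im := by
  rw [← h, sq]
  simp only [Complex.mul_re, Complex.mul_im]
  constructor <;> ring

/-- Off the cut, `lam A κ` is the root of `κ² + A²` on the side of `κ`. -/
theorem lam_mul_conj_re {A : ℝ} (hA : 0 < A) {κ : ℂ} (hκ : κ ∉ lamCut A) :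
    0 < (lam A κ * conj κ).re := by
  set s := sqrtDown (κ - Complex.I * (A : ℂ)) with hs
  set r := sqrtDown (κ + Complex.I * (A : ℂ)) with hr
  have hs2 := sqrtDown_sq (κ - Complex.I * (A : ℂ))
  have hr2 := sqrtDown_sq (κ + Complex.I * (A : ℂ))
  obtain ⟨hs3, hs4⟩ := sqrtDown_halfplane (κ - Complex.I * (A : ℂ))
  obtain ⟨hr3, hr4⟩ := sqrtDown_halfplane (κ + Complex.I * (A : ℂ))
  rw [← hs] at hs2 hs3 hs4
  rw [← hr] at hr2 hr3 hr4
  obtain ⟨s1, s2⟩ := re_im_of_sq hs2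
  obtain ⟨r1, r2⟩ := re_im_of_sq hr2
  simp only [Complex.sub_re, Complex.add_re, Complex.sub_im, Complex.add_im, Complex.mul_re,
    Complex.mul_im, Complex.I_re, Complex.I_im, Complex.ofReal_re, Complex.ofReal_im] at s1 s2 r1 r2
  -- With `s² = κ - iA` and `r² = κ + iA` one has `λ = sr` and `κ = (s² + r²)/2`, hence `Re (λ κ̄) =
  -- (|s|² + |r|²) Re (s r̄) / 2`. So it suffices that `Re (s r̄) > 0`, which is read off from the
  -- signs of `re ± im` of the two roots.
  have key : 0 < s.re * r.re + s.im * r.im := by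
    rcases lt_trichotomy κ.re 0 with h | h | h
    · have h1 : s.re - s.im < 0 := by nlinarith
      have h2 : r.re - r.im < 0 := by nlinarith
      have h3 : 0 < s.re + s.im := by
        rcases hs3.lt_or_eq with h | h
        · exact h
        · rw [← h] at s1; linarith
      have h4 : 0 < r.re + r.im := by
        rcases hr3.lt_or_eq with h | h
        · exact h
        · rw [← h] at r1; linarith
      nlinarith [mul_pos_of_neg_of_neg h1 h2, mul_pos h3 h4]
    · have hcase : A < κ.im ∨ κ.im < -A := by
        by_contra hn
        push Not at hn
        exact hκ ⟨h, hn.2, hn.1⟩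
      rw [h] at s1 r1
      rcases hcase with hc | hc
      · have a1 : 0 < s.re * s.im := by linarith
        have a2 : 0 < r.re * r.im := by linarith
        have a3 : 0 < s.re := by nlinarith
        have a4 : 0 < s.im := by nlinarith
        have a5 : 0 < r.re := by nlinarith
        have a6 : 0 < r.im := by nlinarith
        positivity
      · have a1 : s.re * s.im < 0 := by linarith
        have a2 : r.re * r.im < 0 := by linarith
        have b1 : s.re + s.im = 0 := by
          by_contra hne
          have : s.re - s.im = 0 := by
            rcases mul_eq_zero.1 (show (s.re - s.im) * (s.re + s.im) = 0 by linarith) with h | h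
            · exact h
            · exact absurd h hne
          nlinarith [sq_nonneg s.re]
        have b2 : r.re + r.im = 0 := by
          by_contra hne
          have : r.re - r.im = 0 := by
            rcases mul_eq_zero.1 (show (r.re - r.im) * (r.re + r.im) = 0 by linarith) with h | h
            · exact h
            · exact absurd h hne
          nlinarith [sq_nonneg r.re]
        have c1 := hs4 b1
        have c2 := hr4 b2
        have d1 : s.im = -s.re := by linarith
        have d2 : r.im = -r.re := by linarith
        rw [d1] at a1 ⊢
        rw [d2] at a2 ⊢
        have e1 : 0 < s.re := by nlinarith
        have e2 : 0 < r.re := by nlinarith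
        nlinarith [mul_pos e1 e2]
    · have h1 : 0 < s.re - s.im := by nlinarith
      have h2 : 0 < r.re - r.im := by nlinarith
      have h3 : 0 < s.re + s.im := by
        rcases hs3.lt_or_eq with h | h
        · exact h
        · rw [← h] at s1; linarith
      have h4 : 0 < r.re + r.im := by
        rcases hr3.lt_or_eq with h | h
        · exact h
        · rw [← h] at r1; linarith
      nlinarith [mul_pos h1 h2, mul_pos h3 h4]
  have e : (lam A κ * conj κ).re
      = (s.re ^ 2 + s.im ^ 2 + r.re ^ 2 + r.im ^ 2) * (s.re * r.re + s.im * r.im) / 2 := by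
    have hk1 : κ.re = ((s.re - s.im) * (s.re + s.im) + (r.re - r.im) * (r.re + r.im)) / 2 := by
      linarith
    have hk2 : κ.im = s.re * s.im + r.re * r.im := by linarith
    rw [lam, ← hs, ← hr]
    simp only [Complex.mul_re, Complex.mul_im, Complex.conj_re, Complex.conj_im, hk1, hk2]
    ring
  rw [e]
  have : 0 < s.re ^ 2 + s.im ^ 2 + r.re ^ 2 + r.im ^ 2 := by
    by_contra hn
    have z1 : s.re = 0 := by
        nlinarith [sq_nonneg s.re, sq_nonneg s.im, sq_nonneg r.re, sq_nonneg r.im]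
    have z2 : s.im = 0 := by
        nlinarith [sq_nonneg s.re, sq_nonneg s.im, sq_nonneg r.re, sq_nonneg r.im]
    rw [z1, z2] at key
    simp at key
  positivity

theorem lam_re_mul_im (A : ℝ) (κ : ℂ) : (lam A κ).re * (lam A κ).im = κ.re * κ.im := by
  have := congrArg Complex.im (lam_sq A κ)
  rw [← Complex.ofReal_pow, Complex.add_im, Complex.ofReal_im, sq, sq, Complex.mul_im,
    Complex.mul_im] at this
  linarith

/-- The products `Re · Im` of `λ` and of `κ` coincide, so `Re λ Re κ` and `Im λ Im κ` have a product
which is a square. As their sum is positive, neither can be negative. -/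
theorem lam_im_pos {A : ℝ} (hA : 0 < A) {κ : ℂ} (hκ : κ ∉ lamCut A) (him : 0 < κ.im) :
    0 < (lam A κ).im := by
  have h1 := lam_mul_conj_re hA hκ
  have h2 := lam_re_mul_im A κ
  simp only [Complex.mul_re, Complex.conj_re, Complex.conj_im] at h1
  by_contra hn
  push Not at hn
  rcases hn.lt_or_eq with h | h
  · have h3 : (lam A κ).re * κ.re ≤ 0 := by
      have : ((lam A κ).re * κ.re) * ((lam A κ).im * κ.im) = (κ.re * κ.im) ^ 2 := by
        rw [sq]; nth_rewrite 1 [← h2]; ring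
      have h4 : (lam A κ).im * κ.im < 0 := mul_neg_of_neg_of_pos h him
      by_contra h5
      push Not at h5
      nlinarith [sq_nonneg (κ.re * κ.im), mul_pos_of_neg_of_neg h4 (neg_neg_of_pos h5)]
    nlinarith
  · rw [h, mul_zero] at h2
    have : κ.re = 0 := by
      rcases mul_eq_zero.1 h2.symm with h | h
      · exact h
      · exact absurd h him.ne'
    rw [this, h] at h1
    simp at h1

theorem lam_re_pos {A : ℝ} (hA : 0 < A) {κ : ℂ} (hre : 0 < κ.re) : 0 < (lam A κ).re := by
  have h1 := lam_mul_conj_re hA (κ := κ) (fun h => hre.ne' h.1)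
  have h2 := lam_re_mul_im A κ
  simp only [Complex.mul_re, Complex.conj_re, Complex.conj_im] at h1
  by_contra hn
  push Not at hn
  rcases hn.lt_or_eq with h | h
  · have h3 : (lam A κ).im * κ.im ≤ 0 := by
      have : ((lam A κ).re * κ.re) * ((lam A κ).im * κ.im) = (κ.re * κ.im) ^ 2 := by
        rw [sq]; nth_rewrite 1 [← h2]; ring
      have h4 : (lam A κ).re * κ.re < 0 := mul_neg_of_neg_of_pos h hre
      by_contra h5
      push Not at h5
      nlinarith [sq_nonneg (κ.re * κ.im), mul_neg_of_neg_of_pos h4 h5]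
    nlinarith
  · rw [h, zero_mul] at h2
    have : κ.im = 0 := by
      rcases mul_eq_zero.1 h2.symm with h | h
      · exact absurd h hre.ne'
      · exact h
    rw [this, h] at h1
    simp at h1

/-- On the cut, `lam A` is its limit from the right. -/
theorem lam_of_mem_cut {A : ℝ} {κ : ℂ} (h0 : κ.re = 0) (h1 : -A < κ.im) (h2 : κ.im < A) :
    0 < (lam A κ).re ∧ (lam A κ).im = 0 := by
  set s := sqrtDown (κ - Complex.I * (A : ℂ)) with hs
  set r := sqrtDown (κ + Complex.I * (A : ℂ)) with hr
  have hs2 := sqrtDown_sq (κ - Complex.I * (A : ℂ))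
  have hr2 := sqrtDown_sq (κ + Complex.I * (A : ℂ))
  obtain ⟨hs3, hs4⟩ := sqrtDown_halfplane (κ - Complex.I * (A : ℂ))
  obtain ⟨hr3, hr4⟩ := sqrtDown_halfplane (κ + Complex.I * (A : ℂ))
  rw [← hs] at hs2 hs3 hs4
  rw [← hr] at hr2 hr3 hr4
  obtain ⟨s1, s2⟩ := re_im_of_sq hs2
  obtain ⟨r1, r2⟩ := re_im_of_sq hr2
  simp only [Complex.sub_re, Complex.add_re, Complex.sub_im, Complex.add_im, Complex.mul_re,
    Complex.mul_im, Complex.I_re, Complex.I_im, Complex.ofReal_re, Complex.ofReal_im, h0]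
    at s1 s2 r1 r2
  have a1 : s.re * s.im < 0 := by linarith
  have a2 : 0 < r.re * r.im := by linarith
  have b1 : s.re + s.im = 0 := by
    by_contra hne
    have : s.re - s.im = 0 := by
      rcases mul_eq_zero.1 (show (s.re - s.im) * (s.re + s.im) = 0 by linarith) with h | h
      · exact h
      · exact absurd h hne
    nlinarith [sq_nonneg s.re]
  have c1 := hs4 b1
  have d1 : s.im = -s.re := by linarith
  have a5 : 0 < r.re := by nlinarith
  have b2 : r.re = r.im := by
    rcases mul_eq_zero.1 (show (r.re - r.im) * (r.re + r.im) = 0 by linarith) with h | h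
    · linarith
    · nlinarith
  have e1 : 0 < s.re := by rw [d1] at a1; nlinarith
  rw [lam, ← hs, ← hr]
  simp only [Complex.mul_re, Complex.mul_im, d1, ← b2]
  constructor
  · nlinarith [mul_pos e1 a5]
  · ring

theorem lam_branch {A : ℝ} {κ : ℂ} (h : κ ^ 2 = -(A : ℂ) ^ 2) : lam A κ = 0 := by
  have := lam_sq A κ
  rw [h, neg_add_cancel] at this
  exact pow_eq_zero_iff two_ne_zero |>.1 this

theorem lam_mul_conj_re_nonneg {A : ℝ} (hA : 0 < A) (κ : ℂ) : 0 ≤ (lam A κ * conj κ).re := by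
  by_cases hκ : κ ∈ lamCut A
  · obtain ⟨h0, h1, h2⟩ := hκ
    rcases h1.lt_or_eq with h1 | h1
    · rcases h2.lt_or_eq with h2 | h2
      · have := (lam_of_mem_cut h0 h1 h2).2
        simp [h0, this]
      · rw [lam_branch, zero_mul, Complex.zero_re]
        have : κ = A * Complex.I := Complex.ext (by simp [h0]) (by simp [h2])
        rw [this, mul_pow, Complex.I_sq]; ring
    · rw [lam_branch, zero_mul, Complex.zero_re]
      have : κ = -(A * Complex.I) := Complex.ext (by simp [h0]) (by simp [← h1])
      rw [this, neg_sq, mul_pow, Complex.I_sq]; ring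
  · exact (lam_mul_conj_re hA hκ).le

theorem eq_of_sq_eq_of_re_mul_pos {u v κ : ℂ} (h : u ^ 2 = v ^ 2) (hu : 0 < (u * conj κ).re)
    (hv : 0 < (v * conj κ).re) : u = v := by
  rcases sq_eq_sq_iff_eq_or_eq_neg.1 h with h | h
  · exact h
  · rw [h, neg_mul, Complex.neg_re] at hu
    linarith

theorem conj_mem_lamCut {A : ℝ} {κ : ℂ} : conj κ ∈ lamCut A ↔ κ ∈ lamCut A := by
  simp only [lamCut, mem_ofPred_eq, Complex.conj_re, Complex.conj_im]
  constructor <;> rintro ⟨h1, h2, h3⟩ <;> exact ⟨h1, by linarith, by linarith⟩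

/-- Both sides have the same square. The sign is fixed by `Re (λ κ̄) > 0` off the cut and by `λ > 0`
on the open cut; at the branch points both sides vanish. -/
theorem lam_conj {A : ℝ} (hA : 0 < A) (κ : ℂ) : lam A (conj κ) = conj (lam A κ) := by
  have hsq : lam A (conj κ) ^ 2 = conj (lam A κ) ^ 2 := by
    rw [← map_pow, lam_sq, lam_sq]; simp
  by_cases hκ : κ ∈ lamCut A
  · obtain ⟨h0, h1, h2⟩ := hκ
    rcases eq_or_ne (lam A κ) 0 with h | h
    · rw [h, map_zero, zero_pow two_ne_zero] at hsq
      rw [h, map_zero]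
      exact pow_eq_zero_iff two_ne_zero |>.1 hsq
    · have h1' : -A ≠ κ.im := fun e => h (lam_branch (by
        have : κ = -(A * Complex.I) := Complex.ext (by simp [h0]) (by simp [← e])
        rw [this, neg_sq, mul_pow, Complex.I_sq]; ring))
      have h2' : κ.im ≠ A := fun e => h (lam_branch (by
        have : κ = A * Complex.I := Complex.ext (by simp [h0]) (by simp [e])
        rw [this, mul_pow, Complex.I_sq]; ring))
      have p1 := lam_of_mem_cut h0 (lt_of_le_of_ne h1 h1') (lt_of_le_of_ne h2 h2')
      have p2 := lam_of_mem_cut (A := A) (κ := conj κ) (by simpa using h0)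
        (by simpa using (lt_of_le_of_ne h2 h2')) (by
          have := lt_of_le_of_ne h1 h1'
          simp only [Complex.conj_im]; linarith)
      refine eq_of_sq_eq_of_re_mul_pos (κ := 1) hsq ?_ ?_
      · simpa using p2.1
      · simpa using p1.1
  · refine eq_of_sq_eq_of_re_mul_pos (κ := conj κ) hsq
      (lam_mul_conj_re hA fun h => hκ (conj_mem_lamCut.1 h)) ?_
    have := lam_mul_conj_re hA hκ
    rwa [← map_mul, Complex.conj_re]

theorem lam_im_nonneg {A : ℝ} (hA : 0 < A) {κ : ℂ} (him : 0 ≤ κ.im) : 0 ≤ (lam A κ).im := by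
  by_cases hκ : κ ∈ lamCut A
  · obtain ⟨h0, h1, h2⟩ := hκ
    rcases h2.lt_or_eq with h2 | h2
    · exact (lam_of_mem_cut h0 (by linarith) h2).2.ge
    · rw [lam_branch, Complex.zero_im]
      have : κ = A * Complex.I := Complex.ext (by simp [h0]) (by simp [h2])
      rw [this, mul_pow, Complex.I_sq]; ring
  · rcases him.lt_or_eq with h | h
    · exact (lam_im_pos hA hκ h).le
    · have e : conj κ = κ := Complex.conj_eq_iff_im.2 h.symm
      have := lam_conj hA κ
      rw [e] at this
      exact (Complex.conj_eq_iff_im.1 this.symm).ge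

theorem principalSqrt_eq {z w : ℂ} (h : w ^ 2 = z) (hw : 0 < w.re) : principalSqrt z = w := by
  rw [principalSqrt, ← h, one_div]
  exact Complex.sq_cpow_two_inv hw

theorem principalSqrt_sq (z : ℂ) : principalSqrt z ^ 2 = z := by
  rw [principalSqrt, one_div]
  exact Complex.cpow_nat_inv_pow z two_ne_zero

theorem continuousAt_principalSqrt {z : ℂ} (h : z ∈ Complex.slitPlane) :
    ContinuousAt principalSqrt z :=
  continuousAt_id.cpow continuousAt_const h

theorem principalSqrt_re_pos {z : ℂ} (h : z ∈ Complex.slitPlane) : 0 < (principalSqrt z).re := by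
  have hz := Complex.slitPlane_ne_zero h
  have h1 := Complex.neg_pi_lt_arg z
  have h2 := lt_of_le_of_ne (Complex.arg_le_pi z) (Complex.slitPlane_arg_ne_pi h)
  rw [principalSqrt, Complex.cpow_def_of_ne_zero hz, Complex.exp_re]
  refine mul_pos (Real.exp_pos _) (Real.cos_pos_of_mem_Ioo ?_)
  have : (Complex.log z * (1 / 2 : ℂ)).im = Complex.arg z / 2 := by
    rw [show (1 / 2 : ℂ) = ((1 / 2 : ℝ) : ℂ) by norm_num, Complex.mul_im, Complex.ofReal_re,
      Complex.ofReal_im, Complex.log_im]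
    ring
  rw [this]
  constructor <;> linarith

theorem sq_mem_slitPlane {w : ℂ} (hw : 0 < w.re) : w ^ 2 ∈ Complex.slitPlane := by
  rw [Complex.mem_slitPlane_iff, sq, Complex.mul_re, Complex.mul_im]
  by_cases h : w.im = 0
  · left; rw [h]; nlinarith
  · right
    have : w.re * w.im ≠ 0 := mul_ne_zero hw.ne' h
    intro h2
    exact this (by linarith)

theorem isClosed_lamCut (A : ℝ) : IsClosed (lamCut A) :=
  (isClosed_eq Complex.continuous_re continuous_const).inter
    ((isClosed_le continuous_const Complex.continuous_im).inter
      (isClosed_le Complex.continuous_im continuous_const))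

/-- Off the cut `λ/κ` has positive real part, so it is the principal root of `1 + A²/κ²`. -/
theorem differentiableAt_lam {A : ℝ} (hA : 0 < A) {κ : ℂ} (hκ : κ ∉ lamCut A) :
    DifferentiableAt ℂ (lam A) κ := by
  have hne : ∀ κ : ℂ, κ ∉ lamCut A → κ ≠ 0 := fun κ h h0 => h (by
    rw [h0]; exact ⟨rfl, by simpa using hA.le, hA.le⟩)
  have hopen := (isClosed_lamCut A).isOpen_compl
  have hw : ∀ κ ∉ lamCut A, 0 < (lam A κ / κ).re ∧ (lam A κ / κ) ^ 2 = 1 + (A : ℂ) ^ 2 / κ ^ 2 := by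
    intro κ h
    constructor
    · have h1 := lam_mul_conj_re hA h
      have h2 : lam A κ / κ = (lam A κ * conj κ) * ((Complex.normSq κ)⁻¹ : ℝ) := by
        rw [div_eq_mul_inv, Complex.inv_def]; ring
      rw [h2, Complex.re_mul_ofReal]
      have := Complex.normSq_pos.2 (hne κ h)
      positivity
    · rw [div_pow, lam_sq]
      have := hne κ h
      field_simp
  have hform : ∀ κ ∉ lamCut A, lam A κ = κ * (1 + (A : ℂ) ^ 2 / κ ^ 2) ^ (1 / 2 : ℂ) := by
    intro κ h
    have := principalSqrt_eq (hw κ h).2 (hw κ h).1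
    rw [principalSqrt] at this
    rw [this, mul_div_cancel₀ _ (hne κ h)]
  have hd : DifferentiableAt ℂ (fun κ : ℂ => κ * (1 + (A : ℂ) ^ 2 / κ ^ 2) ^ (1 / 2 : ℂ)) κ := by
    refine differentiableAt_id.mul (DifferentiableAt.cpow_const ?_ ?_)
    · exact (differentiableAt_const _).add ((differentiableAt_const _).div (by fun_prop)
        (pow_ne_zero _ (hne κ hκ)))
    · rw [← (hw κ hκ).2]; exact sq_mem_slitPlane (hw κ hκ).1
  exact hd.congr_of_eventuallyEq (by
    filter_upwards [hopen.mem_nhds hκ] with z hz using hform z hz)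

/-- The two one-sided limits at the cut. -/
theorem tendsto_lam_right {A : ℝ} (hA : 0 < A) {κ : ℂ} (h0 : κ.re = 0) (h1 : -A < κ.im)
    (h2 : κ.im < A) : Tendsto (lam A) (𝓝[{z | 0 < z.re}] κ) (𝓝 (lam A κ)) ∧
      Tendsto (lam A) (𝓝[{z | z.re < 0}] κ) (𝓝 (-lam A κ)) := by
  have hp := lam_of_mem_cut h0 h1 h2
  -- Near a point of the open cut, `κ² + A²` stays near the positive axis, so its principal root is
  -- continuous. It equals `λ` to the right of the cut and `-λ` to the left.
  have hc : Tendsto (fun z : ℂ => principalSqrt (z ^ 2 + (A : ℂ) ^ 2)) (𝓝 κ) (𝓝 (lam A κ)) := by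
    rw [← principalSqrt_eq (lam_sq A κ) hp.1]
    have : ContinuousAt principalSqrt (κ ^ 2 + (A : ℂ) ^ 2) := by
      refine continuousAt_principalSqrt ?_
      rw [← lam_sq]
      exact sq_mem_slitPlane hp.1
    exact this.tendsto.comp (Continuous.tendsto (by fun_prop) κ)
  constructor
  · refine (hc.mono_left nhdsWithin_le_nhds).congr' ?_
    filter_upwards [self_mem_nhdsWithin] with z hz
    exact principalSqrt_eq (lam_sq A z) (lam_re_pos hA hz)
  · refine (hc.neg.mono_left nhdsWithin_le_nhds).congr' ?_
    filter_upwards [self_mem_nhdsWithin] with z hz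
    have e : lam A (-z) = - lam A z := by
      refine eq_of_sq_eq_of_re_mul_pos (κ := -z) (by rw [neg_sq, lam_sq, lam_sq, neg_sq]) ?_ ?_
      · exact lam_mul_conj_re hA fun h => by
          have h1 : (-z).re = 0 := h.1
          have h2 : z.re < 0 := hz
          rw [Complex.neg_re] at h1
          linarith
      · rw [map_neg, neg_mul_neg]
        exact lam_mul_conj_re hA fun h => by
          have h1 : z.re = 0 := h.1
          have h2 : z.re < 0 := hz
          linarith
    have h3 : principalSqrt (z ^ 2 + (A : ℂ) ^ 2) = lam A (-z) :=
      principalSqrt_eq (by rw [lam_sq, neg_sq]) (lam_re_pos hA (by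
        have h2 : z.re < 0 := hz
        simpa using h2))
    rw [h3, e, neg_neg]

theorem tendsto_lam_branch {A : ℝ} {κ : ℂ} (h : κ ^ 2 = -(A : ℂ) ^ 2) :
    Tendsto (lam A) (𝓝 κ) (𝓝 0) := by
  have h1 : Tendsto (fun z : ℂ => z ^ 2 + (A : ℂ) ^ 2) (𝓝 κ) (𝓝 0) := by
    have : Tendsto (fun z : ℂ => z ^ 2 + (A : ℂ) ^ 2) (𝓝 κ) (𝓝 (κ ^ 2 + (A : ℂ) ^ 2)) :=
      Continuous.tendsto (by fun_prop) κ
    rwa [h, neg_add_cancel] at this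
  rw [tendsto_zero_iff_norm_tendsto_zero] at h1 ⊢
  have h2 := (Real.continuous_sqrt.tendsto 0).comp h1
  rw [Real.sqrt_zero] at h2
  refine h2.congr fun z => ?_
  simp only [Function.comp_apply]
  rw [← lam_sq, norm_pow, Real.sqrt_sq (norm_nonneg _)]

/-- `(ℓ + κ)(ℓ - κ) = A²`. The root `ℓ` is arbitrary, because both sheets occur at the cuts. -/
theorem lam_add_ne_zero {A : ℝ} (hA : 0 < A) {κ ℓ : ℂ} (h : ℓ ^ 2 = κ ^ 2 + (A : ℂ) ^ 2) :
    ℓ + κ ≠ 0 := by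
  intro h0
  have h1 : ℓ = -κ := eq_neg_of_add_eq_zero_left h0
  rw [h1, neg_sq] at h
  have : (A : ℂ) ^ 2 = 0 := by linear_combination -h
  exact hA.ne' (by exact_mod_cast pow_eq_zero_iff two_ne_zero |>.1 this)

/-- No cancellation occurs in `λ + κ`, since `Re (λ κ̄) ≥ 0`. This makes `1/(λ + κ)` of order `1/k`
at infinity. -/
theorem norm_le_norm_lam_add {A : ℝ} (hA : 0 < A) (κ : ℂ) : ‖κ‖ ≤ ‖lam A κ + κ‖ := by
  have h := lam_mul_conj_re_nonneg hA κ
  have h1 : ‖lam A κ + κ‖ ^ 2 = ‖lam A κ‖ ^ 2 + ‖κ‖ ^ 2 + 2 * (lam A κ * conj κ).re := by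
    rw [← Complex.normSq_eq_norm_sq, ← Complex.normSq_eq_norm_sq, ← Complex.normSq_eq_norm_sq,
      Complex.normSq_add]
  refine abs_le_of_sq_le_sq' ?_ (norm_nonneg _) |>.2
  nlinarith [sq_nonneg ‖lam A κ‖]

/-! ### Matrices acting on `ℂ²` as continuous operators. -/

abbrev Vec := Fin 2 → ℂ

/-- Matrices as continuous linear maps. -/
def mulCLM : Mat2 →ₗ[ℂ] (Vec →L[ℂ] Vec) :=
  (LinearMap.toContinuousLinearMap : (Vec →ₗ[ℂ] Vec) ≃ₗ[ℂ] (Vec →L[ℂ] Vec)).toLinearMap ∘ₗ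
    (Matrix.toLin' : Mat2 ≃ₗ[ℂ] (Vec →ₗ[ℂ] Vec)).toLinearMap

@[simp] theorem mulCLM_apply (A : Mat2) (v : Vec) : mulCLM A v = A *ᵥ v := rfl

theorem mulCLM_mul (A B : Mat2) : mulCLM (A * B) = mulCLM A * mulCLM B := by
  ext1 v
  change (A * B) *ᵥ v = A *ᵥ (B *ᵥ v)
  rw [Matrix.mulVec_mulVec]

theorem continuous_mulCLM : Continuous mulCLM := LinearMap.continuous_of_finiteDimensional _

theorem mulVec_two (a b c d : ℂ) (v : Vec) :
    !![a, b; c, d] *ᵥ v = ![a * v 0 + b * v 1, c * v 0 + d * v 1] := by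
  ext i
  fin_cases i <;> simp [Matrix.mulVec, dotProduct, Fin.sum_univ_two]

/-- The expansion in elementary matrices allows derivatives of operator-valued functions to be taken
entry by entry. -/
theorem mulCLM_eq (A : Mat2) : mulCLM A = A 0 0 • mulCLM !![1, 0; 0, 0] +
    A 0 1 • mulCLM !![0, 1; 0, 0] + A 1 0 • mulCLM !![0, 0; 1, 0] +
    A 1 1 • mulCLM !![0, 0; 0, 1] := by
  ext v i
  fin_cases i <;> simp [Matrix.mulVec, dotProduct, Fin.sum_univ_two]

theorem differentiableOn_mulCLM {U : Set ℂ} {A : ℂ → Mat2}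
    (h : ∀ i j, DifferentiableOn ℂ (fun k => A k i j) U) :
    DifferentiableOn ℂ (fun k => mulCLM (A k)) U := by
  have : (fun k => mulCLM (A k)) = fun k => A k 0 0 • mulCLM !![1, 0; 0, 0] +
    A k 0 1 • mulCLM !![0, 1; 0, 0] + A k 1 0 • mulCLM !![0, 0; 1, 0] +
    A k 1 1 • mulCLM !![0, 0; 0, 1] := funext fun k => mulCLM_eq _
  rw [this]
  exact ((((h 0 0).smul_const _).add ((h 0 1).smul_const _)).add ((h 1 0).smul_const _)).add
    ((h 1 1).smul_const _)

theorem norm_vec_le {v : Vec} {C : ℝ} (h0 : ‖v 0‖ ≤ C) (h1 : ‖v 1‖ ≤ C) : ‖v‖ ≤ C := by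
  refine (pi_norm_le_iff_of_nonneg ((norm_nonneg _).trans h0)).2 fun i => ?_
  fin_cases i
  · exact h0
  · exact h1

theorem norm_mulCLM_le (a b c d : ℂ) {C : ℝ} (h0 : ‖a‖ + ‖b‖ ≤ C) (h1 : ‖c‖ + ‖d‖ ≤ C) :
    ‖mulCLM !![a, b; c, d]‖ ≤ C := by
  have hC : 0 ≤ C := (by positivity : 0 ≤ ‖a‖ + ‖b‖).trans h0
  refine ContinuousLinearMap.opNorm_le_bound _ hC fun v => ?_
  rw [mulCLM_apply, mulVec_two]
  have hv0 := norm_le_pi_norm v 0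
  have hv1 := norm_le_pi_norm v 1
  have key : ∀ a b : ℂ, ‖a‖ + ‖b‖ ≤ C → ‖a * v 0 + b * v 1‖ ≤ C * ‖v‖ := by
    intro a b hab
    calc ‖a * v 0 + b * v 1‖ ≤ ‖a‖ * ‖v 0‖ + ‖b‖ * ‖v 1‖ := by
          refine (norm_add_le _ _).trans ?_
          rw [norm_mul, norm_mul]
      _ ≤ ‖a‖ * ‖v‖ + ‖b‖ * ‖v‖ := by gcongr
      _ = (‖a‖ + ‖b‖) * ‖v‖ := by ring
      _ ≤ C * ‖v‖ := by gcongr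
  exact norm_vec_le (by simpa using key a b h0) (by simpa using key c d h1)

theorem norm_mulCLM_potential_le (z : ℂ) : ‖mulCLM (potential z)‖ ≤ ‖z‖ :=
  norm_mulCLM_le _ _ _ _ (by simp) (by simp)

/-! ### One-parameter groups with a generator of rank-one type. -/

section ExpGroup

variable {F : Type*} [NormedAddCommGroup F] [NormedSpace ℂ F]

/-- The one-parameter group generated by `N`. -/
def expGroup (N : F →L[ℂ] F) (s : ℝ) : F →L[ℂ] F := NormedSpace.exp ((s : ℂ) • N)

theorem expGroup_zero (N : F →L[ℂ] F) : expGroup N 0 = 1 := by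
  rw [expGroup, Complex.ofReal_zero, zero_smul, NormedSpace.exp_zero]

variable [CompleteSpace F]

theorem expGroup_add (N : F →L[ℂ] F) (s t : ℝ) :
    expGroup N (s + t) = expGroup N s * expGroup N t := by
  let _ : NormedAlgebra ℚ (F →L[ℂ] F) := NormedAlgebra.restrictScalars ℚ ℂ _
  rw [expGroup, Complex.ofReal_add, add_smul]
  exact NormedSpace.exp_add_of_commute (((Commute.refl _).smul_left (s : ℂ)).smul_right (t : ℂ))

theorem hasDerivAt_expGroup (N : F →L[ℂ] F) (s : ℝ) :
    HasDerivAt (expGroup N) (N * expGroup N s) s := by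
  have := (hasDerivAt_exp_smul_const' (𝕂 := ℂ) N (s : ℂ)).scomp s
    (Complex.ofRealCLM.hasDerivAt (x := s))
  refine this.congr_deriv ?_
  simp only [Complex.ofRealCLM_apply, Complex.ofReal_one, one_smul, expGroup]

theorem continuous_expGroup (s : ℝ) : Continuous fun N : F →L[ℂ] F => expGroup N s := by
  let _ : NormedAlgebra ℚ (F →L[ℂ] F) := NormedAlgebra.restrictScalars ℚ ℂ _
  exact NormedSpace.exp_continuous.comp (continuous_const_smul (s : ℂ))

theorem differentiable_expGroup (s : ℝ) : Differentiable ℂ fun N : F →L[ℂ] F => expGroup N s := by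
  have h1 : Differentiable ℂ (NormedSpace.exp : (F →L[ℂ] F) → (F →L[ℂ] F)) := fun x =>
    (NormedSpace.exp_analytic (𝕂 := ℂ) x).differentiableAt
  exact h1.comp (differentiable_id.const_smul (s : ℂ))

theorem norm_one_sub_exp_le {z : ℂ} (hz : z.re ≤ 0) : ‖1 - Complex.exp z‖ ≤ ‖z‖ := by
  have := Convex.norm_image_sub_le_of_norm_hasDerivWithin_le (f := Complex.exp)
    (f' := Complex.exp) (s := {z : ℂ | z.re ≤ 0}) (C := 1) (x := 0) (y := z)
    (fun x _ => (Complex.hasDerivAt_exp x).hasDerivWithinAt)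
    (fun x hx => by
      rw [Complex.norm_exp]
      exact Real.exp_le_one_iff.2 hx)
    (convex_halfSpace_re_le 0) (by simp) hz
  rw [Complex.exp_zero, sub_zero, one_mul] at this
  rwa [norm_sub_rev]

/-- The backward group of a generator with `N² = -2iℓN`. -/
theorem exists_expGroup_apply {N : F →L[ℂ] F} {ℓ : ℂ} (h : N * N = (-(2 * Complex.I * ℓ)) • N)
    (hℓ : 0 ≤ ℓ.im) {s : ℝ} (hs : s ≤ 0) : ∃ g : ℂ, (∀ v, expGroup N s v = v + g • N v) ∧
      ‖g‖ ≤ |s| ∧ (ℓ ≠ 0 → ‖g‖ ≤ ‖ℓ‖⁻¹) := by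
  set c : ℂ := 2 * Complex.I * ℓ with hc
  have hNN : N * N = (-c) • N := h
  -- As `N² = -cN`, the ansatz `exp (sN) = 1 + g(s) N` leads to `g' = 1 - c g`, `g(0) = 0`, and
  -- uniqueness for linear equations confirms it. The two cases are the solution for `c ≠ 0` and its
  -- limit for `c → 0`.
  set g : ℝ → ℂ := fun s => if c = 0 then (s : ℂ) else (1 - Complex.exp (-(c * s))) / c with hg
  have hgd : ∀ s, HasDerivAt g (1 - c * g s) s := by
    intro s
    by_cases h0 : c = 0
    · simp only [hg, h0, if_true, zero_mul, sub_zero]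
      exact Complex.ofRealCLM.hasDerivAt
    · simp only [hg, h0, if_false]
      have h1 : HasDerivAt (fun s : ℝ => -(c * (s : ℂ))) (-(c * 1)) s :=
        ((Complex.ofRealCLM.hasDerivAt (x := s)).const_mul c).fun_neg
      refine ((h1.cexp.const_sub 1).div_const c).congr_deriv ?_
      field_simp
      ring
  have hrep : ∀ s v, expGroup N s v = v + g s • N v := by
    intro s v
    refine eq_of_linear_ode (A := fun _ => N) continuous_const (u := fun s => expGroup N s v)
      (v := fun s => v + g s • N v) (fun s => ?_) (fun s => ?_) (a := 0) ?_ s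
    · have := (ContinuousLinearMap.apply ℂ F v).restrictScalars ℝ |>.hasFDerivAt.comp_hasDerivAt s
        (hasDerivAt_expGroup N s)
      exact this
    · have := ((hgd s).smul_const (N v)).const_add v
      refine this.congr_deriv ?_
      have e : N (N v) = (-c) • N v := by
        have := congrArg (fun B : F →L[ℂ] F => B v) hNN
        exact this
      rw [map_add, map_smul, e, smul_smul, sub_smul, one_smul, mul_neg, neg_smul, mul_comm c,
        sub_eq_add_neg]
    · simp only [expGroup_zero, hg]
      simp
  have hre : (-(c * s)).re ≤ 0 := by
    have : (-(c * s)).re = 2 * ℓ.im * s := by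
      simp [hc, Complex.mul_re, Complex.mul_im]
    rw [this]
    exact mul_nonpos_of_nonneg_of_nonpos (by linarith) hs
  -- This bound does not degenerate as `ℓ → 0`. It costs a factor `|x - y|` in the Volterra kernel,
  -- which the weight `1 + |x|` absorbs.
  have hg1 : ‖g s‖ ≤ |s| := by
    by_cases h0 : c = 0
    · simp [hg, h0]
    · simp only [hg, h0, if_false]
      rw [norm_div, div_le_iff₀ (norm_pos_iff.2 h0)]
      refine (norm_one_sub_exp_le hre).trans_eq ?_
      rw [norm_neg, norm_mul, Complex.norm_real, Real.norm_eq_abs, mul_comm]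
  refine ⟨g s, hrep s, hg1, fun hne => ?_⟩
  have h0 : c ≠ 0 := mul_ne_zero (mul_ne_zero two_ne_zero Complex.I_ne_zero) hne
  change ‖g s‖ ≤ ‖ℓ‖⁻¹
  simp only [hg, h0, if_false]
  have hcn : ‖c‖ = 2 * ‖ℓ‖ := by simp [hc]
  have h1 : ‖1 - Complex.exp (-(c * s))‖ ≤ 2 := by
    refine (norm_sub_le _ _).trans ?_
    rw [norm_one, Complex.norm_exp]
    linarith [Real.exp_le_one_iff.2 hre]
  rw [norm_div, hcn, div_le_iff₀ (by positivity)]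
  have := norm_pos_iff.2 hne
  field_simp
  exact h1

/-- Bounds for the backward group of a generator with `N² = -2iℓN`. -/
theorem norm_expGroup_le {N : F →L[ℂ] F} {ℓ : ℂ} (h : N * N = (-(2 * Complex.I * ℓ)) • N)
    (hℓ : 0 ≤ ℓ.im) {s : ℝ} (hs : s ≤ 0) :
    ‖expGroup N s‖ ≤ 1 + |s| * ‖N‖ ∧ (ℓ ≠ 0 → ‖expGroup N s‖ ≤ 1 + ‖N‖ / ‖ℓ‖) := by
  obtain ⟨g, hrep, hg1, hg2⟩ := exists_expGroup_apply h hℓ hs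
  have hop : ∀ C, ‖g‖ ≤ C → ‖expGroup N s‖ ≤ 1 + C * ‖N‖ := by
    intro C hC
    have hC0 : 0 ≤ C := (norm_nonneg _).trans hC
    refine ContinuousLinearMap.opNorm_le_bound _ (by positivity) fun v => ?_
    rw [hrep]
    calc ‖v + g • N v‖ ≤ ‖v‖ + ‖g‖ * ‖N v‖ := by
          refine (norm_add_le _ _).trans ?_
          rw [norm_smul]
      _ ≤ ‖v‖ + C * (‖N‖ * ‖v‖) := by
          gcongr
          exact N.le_opNorm v
      _ = _ := by ring
  refine ⟨hop _ hg1, fun hne => ?_⟩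
  have := hop _ (hg2 hne)
  rwa [inv_mul_eq_div] at this

end ExpGroup

/-! ### The constant-coefficient problem -/

/-- The matrix `i(κσ₃ - ℓ) + Q` of the modified eigenfunctions of the plane wave. -/
def bgMat (w : PlaneWave) (κ ℓ : ℂ) : Mat2 :=
  !![Complex.I * (κ - ℓ), w.A * Complex.exp (Complex.I * w.δ);
    -(w.A * Complex.exp (-(Complex.I * w.δ))), -(Complex.I * (κ + ℓ))]

theorem exp_mul_exp_neg (z : ℂ) : Complex.exp z * Complex.exp (-z) = 1 := by
  rw [← Complex.exp_add, add_neg_cancel, Complex.exp_zero]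

/-- Cayley-Hamilton: the matrix has trace `-2iℓ`, and its determinant `κ² + A² - ℓ²` vanishes on the
spectral curve. -/
theorem bgMat_sq (w : PlaneWave) {κ ℓ : ℂ} (h : ℓ ^ 2 = κ ^ 2 + (w.A : ℂ) ^ 2) :
    bgMat w κ ℓ * bgMat w κ ℓ = (-(2 * Complex.I * ℓ)) • bgMat w κ ℓ := by
  have e := exp_mul_exp_neg (Complex.I * w.δ)
  have hI := Complex.I_sq
  ext i j
  fin_cases i <;> fin_cases j <;>
    simp only [bgMat, Matrix.mul_apply, Fin.sum_univ_two, Matrix.smul_apply, smul_eq_mul,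
      Fin.zero_eta, Fin.mk_one, Fin.isValue, Matrix.of_apply, Matrix.cons_val',
          Matrix.cons_val_zero,
      Matrix.cons_val_fin_one, Matrix.cons_val_one]
  · linear_combination (κ ^ 2 - ℓ ^ 2) * hI - (w.A : ℂ) ^ 2 * e + h
  · ring
  · ring
  · linear_combination (κ ^ 2 - ℓ ^ 2) * hI - (w.A : ℂ) ^ 2 * e + h

/-- The one-parameter group generated by `bgMat`. -/
def bgProp (w : PlaneWave) (κ ℓ : ℂ) (s : ℝ) : Vec →L[ℂ] Vec := expGroup (mulCLM (bgMat w κ ℓ)) s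

theorem continuous_bgMat (w : PlaneWave) : Continuous fun p : ℂ × ℂ => mulCLM (bgMat w p.1 p.2) :=
    by
  refine continuous_mulCLM.comp ?_
  refine continuous_matrix fun i j => ?_
  fin_cases i <;> fin_cases j <;> simp [bgMat] <;> fun_prop

theorem continuous_bgProp (w : PlaneWave) (s : ℝ) :
    Continuous fun p : ℂ × ℂ => bgProp w p.1 p.2 s :=
  (continuous_expGroup s).comp (continuous_bgMat w)

theorem differentiableOn_bgProp (w : PlaneWave) (s : ℝ) {U : Set ℂ} {κ ℓ : ℂ → ℂ}
    (hκ : DifferentiableOn ℂ κ U) (hℓ : DifferentiableOn ℂ ℓ U) :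
    DifferentiableOn ℂ (fun k => bgProp w (κ k) (ℓ k) s) U := by
  have hN : DifferentiableOn ℂ (fun k => mulCLM (bgMat w (κ k) (ℓ k))) U := by
    refine differentiableOn_mulCLM fun i j => ?_
    fin_cases i <;> fin_cases j <;> simp only [bgMat, Fin.zero_eta, Fin.mk_one, Fin.isValue,
      Matrix.of_apply, Matrix.cons_val', Matrix.cons_val_zero,
        Matrix.cons_val_fin_one, Matrix.cons_val_one] <;> fun_prop
  exact (differentiable_expGroup (F := Vec) s).comp_differentiableOn hN

theorem norm_bgProp_le (w : PlaneWave) {κ ℓ : ℂ} (h : ℓ ^ 2 = κ ^ 2 + (w.A : ℂ) ^ 2)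
    (hℓ : 0 ≤ ℓ.im) {s : ℝ} (hs : s ≤ 0) :
    ‖bgProp w κ ℓ s‖ ≤ 1 + |s| * ‖mulCLM (bgMat w κ ℓ)‖ ∧
    (ℓ ≠ 0 → ‖bgProp w κ ℓ s‖ ≤ 1 + ‖mulCLM (bgMat w κ ℓ)‖ / ‖ℓ‖) :=
  norm_expGroup_le (by rw [← mulCLM_mul, bgMat_sq w h, map_smul]) hℓ hs

/-- The perturbation of the plane wave in the frame of the modified eigenfunctions. -/
def pert (q : ℝ → ℝ → ℂ) (w : PlaneWave) (x t : ℝ) : ℂ :=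
  q x t * Complex.exp (2 * Complex.I * w.f x t) - w.A * Complex.exp (Complex.I * w.δ)

theorem pert_eq (q : ℝ → ℝ → ℂ) (w : PlaneWave) (x t : ℝ) :
    pert q w x t = (q x t - w.q x t) * Complex.exp (2 * Complex.I * w.f x t) := by
  rw [pert, PlaneWave.q, sub_mul, mul_assoc (w.A : ℂ), ← Complex.exp_add]
  ring_nf

theorem norm_pert (q : ℝ → ℝ → ℂ) (w : PlaneWave) (x t : ℝ) :
    ‖pert q w x t‖ = ‖q x t - w.q x t‖ := by
  rw [pert_eq, norm_mul]
  have : 2 * Complex.I * (w.f x t : ℂ) = ((2 * w.f x t : ℝ) : ℂ) * Complex.I := by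
    push_cast; ring
  rw [this, Complex.norm_exp_ofReal_mul_I, mul_one]

/-- The perturbation as a family of operators. -/
def pertOp (q : ℝ → ℝ → ℂ) (w : PlaneWave) (t y : ℝ) : Vec →L[ℂ] Vec :=
  mulCLM (potential (pert q w y t))

theorem continuous_pert {q : ℝ → ℝ → ℂ} (hq : IsNLSSolution q) (w : PlaneWave) :
    Continuous fun p : ℝ × ℝ => pert q w p.1 p.2 := by
  have h := hq.cont
  have hf : Continuous fun p : ℝ × ℝ => w.f p.1 p.2 := by unfold PlaneWave.f; fun_prop
  unfold pert
  fun_prop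

theorem continuous_potential : Continuous potential := by
  refine continuous_matrix fun i j => ?_
  fin_cases i <;> fin_cases j <;> simp [potential] <;> fun_prop

theorem continuous_pertOp {q : ℝ → ℝ → ℂ} (hq : IsNLSSolution q) (w : PlaneWave) (t : ℝ) :
    Continuous (pertOp q w t) :=
  continuous_mulCLM.comp (continuous_potential.comp
    ((continuous_pert hq w).comp (by fun_prop : Continuous fun y : ℝ => (y, t))))

theorem norm_pertOp_le (q : ℝ → ℝ → ℂ) (w : PlaneWave) (t y : ℝ) :
    ‖pertOp q w t y‖ ≤ ‖q y t - w.q y t‖ := by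
  rw [← norm_pert]
  exact norm_mulCLM_potential_le _

theorem continuous_planeWave (w : PlaneWave) : Continuous fun p : ℝ × ℝ => w.q p.1 p.2 := by
  unfold PlaneWave.q PlaneWave.f
  fun_prop

theorem continuous_sub_planeWave {q : ℝ → ℝ → ℂ} (hq : IsNLSSolution q) (w : PlaneWave) :
    Continuous fun p : ℝ × ℝ => q p.1 p.2 - w.q p.1 p.2 := hq.cont.sub (continuous_planeWave w)

theorem continuous_diff {q : ℝ → ℝ → ℂ} (hq : IsNLSSolution q) (w : PlaneWave) (t : ℝ) :
    Continuous fun y => q y t - w.q y t :=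
  (continuous_sub_planeWave hq w).comp (by fun_prop : Continuous fun y : ℝ => (y, t))

theorem integrableOn_weight {q : ℝ → ℝ → ℂ} {w : PlaneWave} (hq : IsNLSSolution q)
    (has : IsAsymptoticTo q w (Ioi 0)) (t a : ℝ) :
    IntegrableOn (fun y => (1 + |y|) * ‖q y t - w.q y t‖) (Ioi a) := by
  have hc := continuous_diff hq w t
  have h1 : IntegrableOn (fun y => (1 + |y|) * ‖q y t - w.q y t‖) (Ioi 0) := by
    refine (has.memL11 t).norm.congr (Eventually.of_forall fun y => ?_)
    simp only [norm_mul, Complex.norm_real, Real.norm_eq_abs]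
    rw [abs_of_nonneg (by positivity)]
  have h2 : IntegrableOn (fun y => (1 + |y|) * ‖q y t - w.q y t‖) (Icc a 0) :=
    Continuous.integrableOn_Icc (by fun_prop)
  refine (h1.union h2).mono_set fun y hy => ?_
  rcases le_or_gt y 0 with h | h
  · exact Or.inr ⟨le_of_lt hy, h⟩
  · exact Or.inl h

/-- A bound for the Volterra kernel that is uniform for bounded `κ` and `ℓ`. -/
theorem isVolterraKernel_of_bounded {q : ℝ → ℝ → ℂ} {w : PlaneWave} (hq : IsNLSSolution q)
    (has : IsAsymptoticTo q w (Ioi 0)) (t a R : ℝ) : ∃ m : ℝ → ℝ, ∀ κ ℓ : ℂ,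
      ℓ ^ 2 = κ ^ 2 + (w.A : ℂ) ^ 2 → 0 ≤ ℓ.im → ‖mulCLM (bgMat w κ ℓ)‖ ≤ R →
      IsVolterraKernel (bgProp w κ ℓ) (mulCLM (bgMat w κ ℓ)) (pertOp q w t) m a := by
  have hc := continuous_diff hq w t
  -- For `a < x ≤ y` one has `|x - y| ≤ |y| + |a|`, so the propagator is at most `1 + (|y| + |a|) R`
  -- uniformly in `κ` and `ℓ`. The absolute value of `R` keeps the bound nonnegative for every `R`.
  refine ⟨fun y => ((1 + (|y| + |a|) * |R|)) * ‖q y t - w.q y t‖, fun κ ℓ h hℓ hR => ?_⟩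
  refine ⟨expGroup_zero _, expGroup_add _, hasDerivAt_expGroup _, continuous_pertOp hq w t,
    by fun_prop, fun y => by positivity, ?_, fun x y hx hxy => ?_⟩
  · refine Integrable.mono' ((integrableOn_weight hq has t a).const_mul
      (1 + |R| + |a| * |R|)) (by fun_prop) (Eventually.of_forall fun y => ?_)
    rw [Real.norm_eq_abs, abs_of_nonneg (by positivity), ← mul_assoc]
    refine mul_le_mul_of_nonneg_right ?_ (norm_nonneg _)
    have h1 := abs_nonneg y
    have h2 := abs_nonneg R
    have h3 := abs_nonneg a
    nlinarith [mul_nonneg h1 h2, mul_nonneg (mul_nonneg h3 h2) h1]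
  · refine mul_le_mul ?_ (norm_pertOp_le q w t y) (norm_nonneg _) (by positivity)
    refine (norm_bgProp_le w h hℓ (sub_nonpos.2 hxy)).1.trans ?_
    have h1 : |x - y| ≤ |y| + |a| := by
      rw [abs_of_nonpos (sub_nonpos.2 hxy)]
      have := le_abs_self y
      have := neg_abs_le a
      linarith
    have h2 := hR.trans (le_abs_self R)
    have := mul_le_mul h1 h2 (norm_nonneg _) (by positivity)
    linarith

/-! ### Uniqueness on a half-line -/

theorem wronskian_smul_left (c : ℂ) (u v : Vec) : wronskian (c • u) v = c * wronskian u v := by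
  simp only [wronskian, Pi.smul_apply, smul_eq_mul]; ring

theorem wronskian_smul_right (c : ℂ) (u v : Vec) : wronskian u (c • v) = c * wronskian u v := by
  simp only [wronskian, Pi.smul_apply, smul_eq_mul]; ring

theorem hasDerivAt_wronskian {u v u' v' : ℝ → Vec} {x : ℝ} (hu : HasDerivAt u (u' x) x)
    (hv : HasDerivAt v (v' x) x) : HasDerivAt (fun x => wronskian (u x) (v x))
      (wronskian (u' x) (v x) + wronskian (u x) (v' x)) x := by
  have hu0 := hasDerivAt_pi.1 hu
  have hv0 := hasDerivAt_pi.1 hv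
  refine (((hu0 0).mul (hv0 1)).sub ((hu0 1).mul (hv0 0))).congr_deriv ?_
  simp only [wronskian]
  ring

theorem wronskian_mulVec (A : Mat2) (u v : Vec) :
    wronskian (A *ᵥ u) v + wronskian u (A *ᵥ v) = A.trace * wronskian u v := by
  simp only [wronskian, Matrix.mulVec, dotProduct, Fin.sum_univ_two, Matrix.trace_fin_two]
  ring

theorem exists_smul_of_wronskian_eq_zero {u v : Vec} (hu : u ≠ 0) (h : wronskian u v = 0) :
    ∃ c : ℂ, v = c • u := by
  simp only [wronskian] at h
  by_cases h0 : u 0 = 0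
  · have h1 : u 1 ≠ 0 := fun h1 => hu (by ext i; fin_cases i <;> assumption)
    refine ⟨v 1 / u 1, ?_⟩
    ext i
    fin_cases i
    · rw [h0, zero_mul, zero_sub, neg_eq_zero, mul_eq_zero] at h
      have := h.resolve_left h1
      simp [h0, this]
    · simp [div_mul_cancel₀ _ h1]
  · refine ⟨v 0 / u 0, ?_⟩
    ext i
    fin_cases i
    · simp [div_mul_cancel₀ _ h0]
    · simp only [Fin.mk_one, Pi.smul_apply, smul_eq_mul]
      field_simp
      linear_combination h

theorem eq_of_linear_ode_Icc {A : ℝ → Vec →L[ℂ] Vec} (hA : Continuous A) {u v : ℝ → Vec} {a b : ℝ}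
    (hab : a ≤ b) (hu : ∀ x ∈ Icc a b, HasDerivAt u (A x (u x)) x)
    (hv : ∀ x ∈ Icc a b, HasDerivAt v (A x (v x)) x) (ha : u a = v a) : u b = v b := by
  have := norm_le_gronwall (u := fun x => u x - v x) (u' := fun x => A x (u x - v x))
    (α := fun x => ‖A x‖) (β := fun _ => 0) hab hA.norm
    continuous_const (fun _ => norm_nonneg _) (fun _ => le_rfl)
    (fun x hx => by simpa using (hu x hx).fun_sub (hv x hx))
    (fun y _ => by simpa using (A y).le_opNorm (u y - v y))
  rw [ha] at this
  simp only [sub_self, norm_zero, intervalIntegral.integral_zero, add_zero, zero_mul] at this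
  exact sub_eq_zero.1 (norm_le_zero_iff.1 this)

/-- Solutions on a half-line with the same limit coincide if `e^{2iℓx}` is bounded there, where
`-2iℓ` is the trace of the coefficient matrix. -/
theorem half_line_unique {B : ℝ → Mat2} (hB : Continuous B) {ℓ : ℂ} (hℓ : 0 ≤ ℓ.im)
    (htr : ∀ x, (B x).trace = -(2 * Complex.I * ℓ)) {a : ℝ} {u v : ℝ → Vec} {η : Vec} (hη : η ≠ 0)
    (hu : ∀ x, a < x → HasDerivAt u (B x *ᵥ u x) x) (hv : ∀ x, a < x → HasDerivAt v (B x *ᵥ v x) x)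
    (hul : Tendsto u atTop (𝓝 η)) (hvl : Tendsto v atTop (𝓝 η)) {x : ℝ} (hx : a < x) :
    u x = v x := by
  have hBc : Continuous fun x => mulCLM (B x) := continuous_mulCLM.comp hB
  have hne : u x ≠ 0 := by
    intro h0
    have : ∀ y, x ≤ y → u y = 0 := fun y hy =>
      eq_of_linear_ode_Icc (A := fun x => mulCLM (B x)) hBc (v := fun _ => 0) hy
        (fun z hz => hu z (hx.trans_le hz.1)) (fun z _ => by
            simpa using hasDerivAt_const z (0 : Vec))
        h0
    have hl : Tendsto u atTop (𝓝 0) := tendsto_const_nhds.congr' (by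
      filter_upwards [Ici_mem_atTop x] with y hy using (this y hy).symm)
    exact hη (tendsto_nhds_unique hul hl)
  -- By Liouville's formula this product is constant. The Wronskian tends to `0` because both
  -- solutions have the same limit, and the exponential is bounded; hence the Wronskian vanishes and
  -- the solutions are proportional. The common nonzero limit makes the factor `1`.
  have hconst : ∀ y, x ≤ y → Complex.exp (2 * Complex.I * ℓ * y) * wronskian (u y) (v y)
      = Complex.exp (2 * Complex.I * ℓ * x) * wronskian (u x) (v x) := by
    intro y hy
    have hd : ∀ z, a < z → HasDerivAt
        (fun z : ℝ => Complex.exp (2 * Complex.I * ℓ * z) * wronskian (u z) (v z)) 0 z := by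
      intro z hz
      have h1 : HasDerivAt (fun s : ℝ => 2 * Complex.I * ℓ * (s : ℂ)) (2 * Complex.I * ℓ * 1) z :=
        (Complex.ofRealCLM.hasDerivAt (x := z)).const_mul _
      refine (h1.cexp.mul (hasDerivAt_wronskian (u' := fun z => B z *ᵥ u z)
        (v' := fun z => B z *ᵥ v z) (hu z hz) (hv z hz))).congr_deriv ?_
      rw [wronskian_mulVec, htr]
      ring
    refine constant_of_has_deriv_right_zero (a := x) (b := y)
      (f := fun z : ℝ => Complex.exp (2 * Complex.I * ℓ * z) * wronskian (u z) (v z))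
      (fun z hz => (hd z (hx.trans_le hz.1)).continuousAt.continuousWithinAt)
      (fun z hz => (hd z (hx.trans_le hz.1)).hasDerivWithinAt) y ⟨hy, le_rfl⟩
  have hlim : Tendsto (fun y : ℝ => Complex.exp (2 * Complex.I * ℓ * y) * wronskian (u y) (v y))
      atTop (𝓝 0) := by
    have hw : Tendsto (fun y => wronskian (u y) (v y)) atTop (𝓝 0) := by
      have hu0 := tendsto_pi_nhds.1 hul
      have hv0 := tendsto_pi_nhds.1 hvl
      have := ((hu0 0).mul (hv0 1)).sub ((hu0 1).mul (hv0 0))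
      rwa [mul_comm (η 1), sub_self] at this
    rw [tendsto_zero_iff_norm_tendsto_zero] at hw
    refine squeeze_zero_norm' ?_ hw
    filter_upwards [Ici_mem_atTop 0] with y hy
    rw [norm_mul]
    refine mul_le_of_le_one_left (norm_nonneg _) ?_
    rw [Complex.norm_exp, Real.exp_le_one_iff]
    have : (2 * Complex.I * ℓ * (y : ℂ)).re = -(2 * ℓ.im * y) := by
      simp [Complex.mul_re, Complex.mul_im]
    rw [this]
    have hy0 : (0 : ℝ) ≤ y := hy
    have := mul_nonneg hℓ hy0
    linarith
  have hw0 : wronskian (u x) (v x) = 0 := by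
    have h1 := hlim.congr' (f₂ := fun _ =>
      Complex.exp (2 * Complex.I * ℓ * x) * wronskian (u x) (v x)) (by
        filter_upwards [Ici_mem_atTop x] with y hy using hconst y hy)
    have h2 := tendsto_nhds_unique h1 tendsto_const_nhds
    exact (mul_eq_zero.1 h2.symm).resolve_left (Complex.exp_ne_zero _)
  obtain ⟨c, hc⟩ := exists_smul_of_wronskian_eq_zero hne hw0
  have hall : ∀ y, x ≤ y → v y = c • u y := fun y hy =>
    eq_of_linear_ode_Icc (A := fun x => mulCLM (B x)) hBc (v := fun y => c • u y) hy
      (fun z hz => hv z (hx.trans_le hz.1))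
      (fun z hz => by
        have := (hu z (hx.trans_le hz.1)).const_smul c
        rw [← Matrix.mulVec_smul] at this
        exact this) hc
  have hlc : Tendsto v atTop (𝓝 (c • η)) := (hul.const_smul c).congr' (by
    filter_upwards [Ici_mem_atTop x] with y hy using (hall y hy).symm)
  have he : η = c • η := tendsto_nhds_unique hvl hlc
  have hc1 : c = 1 := by
    have h0 : (1 - c) • η = 0 := by rw [sub_smul, one_smul, ← he, sub_self]
    rcases smul_eq_zero.1 h0 with h | h
    · exact (sub_eq_zero.1 h).symm
    · exact absurd h hη
  rw [hc, hc1, one_smul]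

/-! ### Compatibility of linear systems in two variables. -/

section ZeroCurvature

variable {F : Type*} [NormedAddCommGroup F] [NormedSpace ℂ F]

/-- Differentiability in the second variable, uniformly on compact sets of the first one. -/
theorem eventually_norm_sub_le {E : Type*} [NormedAddCommGroup E] [NormedSpace ℝ E]
    {p p' : ℝ → ℝ → E} (hp : ∀ y s, HasDerivAt (p y) (p' y s) s)
    (hc : Continuous fun z : ℝ × ℝ => p' z.1 z.2) {K : Set ℝ} (hK : IsCompact K) (t : ℝ) {ε : ℝ}
    (hε : 0 < ε) : ∀ᶠ h in 𝓝 (0 : ℝ), ∀ y ∈ K, ‖p y (t + h) - p y t - h • p' y t‖ ≤ ε * |h| := by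
  have h1 : ∀ᶠ s in 𝓝 t, ∀ y ∈ K, ‖p' y s - p' y t‖ < ε := by
    refine hK.eventually_forall_of_forall_eventually (P := fun s y => ‖p' y s - p' y t‖ < ε)
      fun y _ => ?_
    have hcont : Continuous fun z : ℝ × ℝ => ‖p' z.2 z.1 - p' z.2 t‖ :=
      ((hc.comp (continuous_snd.prodMk continuous_fst)).sub
        (hc.comp (continuous_snd.prodMk continuous_const))).norm
    have := hcont.tendsto (t, y)
    simp only [sub_self, norm_zero] at this
    exact this.eventually (gt_mem_nhds hε)
  obtain ⟨δ, hδ, hball⟩ := Metric.eventually_nhds_iff_ball.1 h1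
  filter_upwards [Metric.ball_mem_nhds (0 : ℝ) hδ] with h hh y hy
  have hh' : |h| < δ := by simpa using hh
  have hmem : t + h ∈ Metric.ball t δ := by simpa [Real.dist_eq] using hh'
  have := Convex.norm_image_sub_le_of_norm_hasDerivWithin_le (f := fun s => p y s - s • p' y t)
    (f' := fun s => p' y s - p' y t) (s := Metric.ball t δ) (C := ε) (x := t) (y := t + h)
    (fun s _ => by
      have := (hp y s).fun_sub ((hasDerivAt_id s).smul_const (p' y t))
      simpa using this.hasDerivWithinAt)
    (fun s hs => (hball s hs y hy).le) (convex_ball _ _) (Metric.mem_ball_self hδ) hmem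
  rw [add_sub_cancel_left, Real.norm_eq_abs] at this
  refine le_trans (le_of_eq ?_) this
  congr 1
  rw [add_smul]
  abel

theorem eventually_norm_sub_lt {E : Type*} [NormedAddCommGroup E] {p : ℝ → ℝ → E}
    (hc : Continuous fun z : ℝ × ℝ => p z.1 z.2) {K : Set ℝ} (hK : IsCompact K) (t : ℝ) {ε : ℝ}
    (hε : 0 < ε) : ∀ᶠ h in 𝓝 (0 : ℝ), ∀ y ∈ K, ‖p y (t + h) - p y t‖ ≤ ε := by
  refine hK.eventually_forall_of_forall_eventually
    (P := fun h y => ‖p y (t + h) - p y t‖ ≤ ε) fun y _ => ?_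
  have hcont : Continuous fun z : ℝ × ℝ => ‖p z.2 (t + z.1) - p z.2 t‖ :=
    ((hc.comp (continuous_snd.prodMk (continuous_const.add continuous_fst))).sub
      (hc.comp (continuous_snd.prodMk continuous_const))).norm
  have := hcont.tendsto (0, y)
  simp only [add_zero, sub_self, norm_zero] at this
  exact (this.eventually (gt_mem_nhds hε)).mono fun z hz => le_of_lt hz

/-- Compatibility of a linear system in two variables with vanishing curvature. -/
theorem hasDerivAt_of_zero_curvature {X X' T : ℝ → ℝ → F →L[ℂ] F}
    (hX : Continuous fun z : ℝ × ℝ => X z.1 z.2)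
    (hX' : Continuous fun z : ℝ × ℝ => X' z.1 z.2)
    (hXd : ∀ x t, HasDerivAt (X x) (X' x t) t)
    (hT : ∀ x t, HasDerivAt (fun y => T y t) (X' x t + X x t * T x t - T x t * X x t) x)
    {v : ℝ → ℝ → F} (hvx : ∀ x t, HasDerivAt (fun y => v y t) (X x t (v x t)) x)
    (hv0 : ∀ t, HasDerivAt (v 0) (T 0 t (v 0 t)) t) (x t : ℝ) :
    HasDerivAt (v x) (T x t (v x t)) t := by
  -- Vanishing curvature enters here: `T v` satisfies the equation obtained formally by
  -- differentiating `v_x = X v` in `t`.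
  have hw : ∀ y, HasDerivAt (fun y => T y t (v y t))
      (X' y t (v y t) + X y t (T y t (v y t))) y := by
    intro y
    have h1 : HasDerivAt (fun y => (T y t).restrictScalars ℝ)
        ((X' y t + X y t * T y t - T y t * X y t).restrictScalars ℝ) y :=
      (ContinuousLinearMap.restrictScalarsL ℂ F F ℝ ℝ).hasFDerivAt.comp_hasDerivAt y (hT y t)
    refine (h1.clm_apply (hvx y t)).congr_deriv ?_
    change X' y t (v y t) + X y t (T y t (v y t)) - T y t (X y t (v y t)) + T y t (X y t (v y t)) =
        _
    abel
  have hvc : Continuous fun y => v y t :=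
    continuous_iff_continuousAt.2 fun y => (hvx y t).continuousAt
  have hwc : Continuous fun y => T y t (v y t) :=
    continuous_iff_continuousAt.2 fun y => (hw y).continuousAt
  obtain ⟨C, hC⟩ := (isCompact_uIcc (a := (0 : ℝ)) (b := x)).bddAbove_image
    (f := fun y => ‖v y t‖ + ‖T y t (v y t)‖) (hvc.norm.add hwc.norm).continuousOn
  have hC' : ∀ y ∈ uIcc 0 x, ‖v y t‖ + ‖T y t (v y t)‖ ≤ C := fun y hy => hC ⟨y, hy, rfl⟩
  have hC0 : 0 ≤ C := by
    refine le_trans ?_ (hC' 0 left_mem_uIcc)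
    positivity
  obtain ⟨K, hK⟩ := (isCompact_uIcc (a := (0 : ℝ)) (b := x)).bddAbove_image
    (f := fun y => ‖X y t‖)
    ((hX.comp (continuous_id.prodMk continuous_const)).norm.continuousOn)
  have hK' : ∀ y ∈ uIcc 0 x, ‖X y t‖ ≤ K := fun y hy => hK ⟨y, hy, rfl⟩
  have hK0 : 0 ≤ K := (norm_nonneg _).trans (hK' 0 left_mem_uIcc)
  rw [hasDerivAt_iff_isLittleO_nhds_zero, Asymptotics.isLittleO_iff]
  intro c hc
  set M : ℝ := Real.exp ((K + 1) * |x|) with hM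
  have hM0 : 0 < M := Real.exp_pos _
  -- Grönwall's inequality will give the bound `M (1 + C|x|) ε |h|`, which is to be at most `c |h|`;
  -- `ε ≤ 1` keeps `‖X‖` below `K + 1` at the shifted time.
  set ε : ℝ := min 1 (c / (M * (1 + C * |x|))) with hε
  have hε0 : 0 < ε := lt_min one_pos (by positivity)
  have hε1 : ε ≤ 1 := min_le_left _ _
  have hε2 : M * (1 + C * |x|) * ε ≤ c := by
    have h1 : ε ≤ c / (M * (1 + C * |x|)) := min_le_right _ _
    rwa [le_div_iff₀ (by positivity), mul_comm] at h1
  have e0 := (hasDerivAt_iff_isLittleO_nhds_zero.1 (hv0 t)).def hε0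
  filter_upwards [eventually_norm_sub_le hXd hX' isCompact_uIcc t hε0,
    eventually_norm_sub_lt hX isCompact_uIcc t hε0, e0] with h hh1 hh2 hh3
  -- The remainder of the expansion in `t` satisfies a linear equation in `y` with inhomogeneity
  -- `o(h)` and has initial value `o(h)` at `y = 0`. Hence it is `o(h)` at `x`, and
  -- differentiability in `t` follows from that on the single line `x = 0`.
  have hD : ∀ y, HasDerivAt (fun y => v y (t + h) - v y t - h • T y t (v y t))
      (X y (t + h) (v y (t + h)) - X y t (v y t)
        - h • (X' y t (v y t) + X y t (T y t (v y t)))) y := fun y =>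
    ((hvx y (t + h)).fun_sub (hvx y t)).fun_sub ((hw y).const_smul h)
  have hg := norm_le_gronwall_abs (u := fun y => v y (t + h) - v y t - h • T y t (v y t))
    (u' := fun y => X y (t + h) (v y (t + h)) - X y t (v y t)
        - h • (X' y t (v y t) + X y t (T y t (v y t))))
    (α := fun _ => K + 1) (β := fun _ => ε * |h| * C) 0 x continuous_const continuous_const
    (fun _ => by positivity) (fun _ => by positivity) hD (fun y hy => by
      have e : X y (t + h) (v y (t + h)) - X y t (v y t)
          - h • (X' y t (v y t) + X y t (T y t (v y t)))
          = X y (t + h) (v y (t + h) - v y t - h • T y t (v y t))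
            + ((X y (t + h) - X y t - h • X' y t) (v y t)
              + h • ((X y (t + h) - X y t) (T y t (v y t)))) := by
        have e1 : X y (t + h) (h • T y t (v y t)) = h • X y (t + h) (T y t (v y t)) :=
          map_smul ((X y (t + h)).restrictScalars ℝ) h _
        have e2 : (h • X' y t) (v y t) = h • X' y t (v y t) := rfl
        simp only [map_sub, sub_apply, smul_sub, smul_add, e1, e2]
        abel
      rw [e]
      have b1 : ‖X y (t + h)‖ ≤ K + 1 := by
        have h1 := hh2 y hy
        have h2 := hK' y hy
        have h3 : X y (t + h) = X y t + (X y (t + h) - X y t) := by abel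
        rw [h3]
        exact (norm_add_le _ _).trans (by linarith)
      have b2 : ‖(X y (t + h) - X y t - h • X' y t) (v y t)‖ ≤ ε * |h| * ‖v y t‖ :=
        ((X y (t + h) - X y t - h • X' y t).le_opNorm _).trans
          (mul_le_mul_of_nonneg_right (hh1 y hy) (norm_nonneg _))
      have b3 : ‖h • ((X y (t + h) - X y t) (T y t (v y t)))‖ ≤ |h| * (ε * ‖T y t (v y t)‖) := by
        rw [norm_smul, Real.norm_eq_abs]
        exact mul_le_mul_of_nonneg_left (((X y (t + h) - X y t).le_opNorm _).trans
          (mul_le_mul_of_nonneg_right (hh2 y hy) (norm_nonneg _))) (abs_nonneg _)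
      refine (norm_add_le _ _).trans (add_le_add (((X y (t + h)).le_opNorm _).trans
        (mul_le_mul_of_nonneg_right b1 (norm_nonneg _))) ?_)
      refine (norm_add_le _ _).trans ((add_le_add b2 b3).trans ?_)
      have := mul_le_mul_of_nonneg_left (hC' y hy) (by positivity : 0 ≤ ε * |h|)
      linarith)
  have e3 : |x * (ε * |h| * C)| = |x| * (ε * |h| * C) := by
    rw [abs_mul, abs_of_nonneg (by positivity : 0 ≤ ε * |h| * C)]
  have e4 : |x * (K + 1)| = (K + 1) * |x| := by
    rw [abs_mul, abs_of_nonneg (by positivity : 0 ≤ K + 1), mul_comm]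
  rw [intervalIntegral.integral_const, intervalIntegral.integral_const, sub_zero, smul_eq_mul,
    smul_eq_mul, e3, e4, ← hM] at hg
  rw [Real.norm_eq_abs] at hh3 ⊢
  refine hg.trans ?_
  calc (‖v 0 (t + h) - v 0 t - h • T 0 t (v 0 t)‖ + |x| * (ε * |h| * C)) * M
      ≤ (ε * |h| + |x| * (ε * |h| * C)) * M := by gcongr
    _ = M * (1 + C * |x|) * ε * |h| := by ring
    _ ≤ c * |h| := by gcongr

end ZeroCurvature

/-! ### Entries of the Lax pair and existence of its solutions. -/

theorem laxX_eq (q : ℝ → ℝ → ℂ) (x t : ℝ) (k : ℂ) :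
    laxX q x t k = !![Complex.I * k, q x t; -conj (q x t), -(Complex.I * k)] := by
  ext i j
  fin_cases i <;> fin_cases j <;> simp [laxX, sigma3, potential]

theorem laxT_eq (q : ℝ → ℝ → ℂ) (x t : ℝ) (k : ℂ) :
    laxT q x t k = !![-2 * Complex.I * k ^ 2 + Complex.I * (q x t * conj (q x t)),
      Complex.I * qx q x t - 2 * k * q x t;
      Complex.I * conj (qx q x t) + 2 * k * conj (q x t),
      2 * Complex.I * k ^ 2 - Complex.I * (q x t * conj (q x t))] := by
  ext i j
  fin_cases i <;> fin_cases j <;>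
    simp [laxT, sigma3, potential, sq] <;> ring

theorem hasDerivAt_sum_smul {E : Type*} [NormedAddCommGroup E] [NormedSpace ℂ E] {f g h k : ℝ → ℂ}
    {f' g' h' k' : ℂ} {x : ℝ} (hf : HasDerivAt f f' x) (hg : HasDerivAt g g' x)
    (hh : HasDerivAt h h' x) (hk : HasDerivAt k k' x) (a b c d : E) :
    HasDerivAt (fun x => f x • a + g x • b + h x • c + k x • d)
      (f' • a + g' • b + h' • c + k' • d) x :=
  (((hf.smul_const a).fun_add (hg.smul_const b)).fun_add (hh.smul_const c)).fun_add (hk.smul_const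
      d)

theorem hasDerivAt_mulCLM {A : ℝ → Mat2} {A' : Mat2} {x : ℝ}
    (h : ∀ i j, HasDerivAt (fun x => A x i j) (A' i j) x) :
    HasDerivAt (fun x => mulCLM (A x)) (mulCLM A') x := by
  have e : (fun x => mulCLM (A x)) = fun x => A x 0 0 • mulCLM !![1, 0; 0, 0] +
    A x 0 1 • mulCLM !![0, 1; 0, 0] + A x 1 0 • mulCLM !![0, 0; 1, 0] +
    A x 1 1 • mulCLM !![0, 0; 0, 1] := funext fun k => mulCLM_eq _
  rw [e, mulCLM_eq A']
  exact hasDerivAt_sum_smul (h 0 0) (h 0 1) (h 1 0) (h 1 1) _ _ _ _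

theorem hasDerivAt_conj {f : ℝ → ℂ} {f' : ℂ} {x : ℝ} (h : HasDerivAt f f' x) :
    HasDerivAt (fun x => conj (f x)) (conj f') x := h.star

theorem IsNLSSolution.hasDerivAt_x {q : ℝ → ℝ → ℂ} (hq : IsNLSSolution q) (x t : ℝ) :
    HasDerivAt (fun y => q y t) (qx q x t) x := (hq.diff_x x t).hasDerivAt

theorem IsNLSSolution.hasDerivAt_xx {q : ℝ → ℝ → ℂ} (hq : IsNLSSolution q) (x t : ℝ) :
    HasDerivAt (fun y => qx q y t) (qxx q x t) x := (hq.diff_xx x t).hasDerivAt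

theorem IsNLSSolution.hasDerivAt_t {q : ℝ → ℝ → ℂ} (hq : IsNLSSolution q) (x t : ℝ) :
    HasDerivAt (fun s => q x s) (qt q x t) t := (hq.diff_t x t).hasDerivAt

theorem continuous_laxX {q : ℝ → ℝ → ℂ} (hq : IsNLSSolution q) (k : ℂ) :
    Continuous fun p : ℝ × ℝ => mulCLM (laxX q p.1 p.2 k) := by
  refine continuous_mulCLM.comp (continuous_matrix fun i j => ?_)
  have := hq.cont
  fin_cases i <;> fin_cases j <;> simp [laxX_eq] <;> fun_prop

theorem continuous_laxT {q : ℝ → ℝ → ℂ} (hq : IsNLSSolution q) (k : ℂ) :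
    Continuous fun p : ℝ × ℝ => mulCLM (laxT q p.1 p.2 k) := by
  refine continuous_mulCLM.comp (continuous_matrix fun i j => ?_)
  have := hq.cont
  have := hq.cont_x
  fin_cases i <;> fin_cases j <;> simp [laxT_eq] <;> fun_prop

theorem hasDerivAt_laxX_t {q : ℝ → ℝ → ℂ} (hq : IsNLSSolution q) (k : ℂ) (x t : ℝ) (i j : Fin 2) :
    HasDerivAt (fun s => laxX q x s k i j) (potential (qt q x t) i j) t := by
  have h1 := hq.hasDerivAt_t x t
  have h2 := hasDerivAt_conj h1
  fin_cases i <;> fin_cases j <;> simp only [laxX_eq, potential, Fin.zero_eta, Fin.mk_one,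
    Fin.isValue, Matrix.of_apply, Matrix.cons_val', Matrix.cons_val_zero,
    Matrix.cons_val_fin_one, Matrix.cons_val_one]
  · exact hasDerivAt_const _ _
  · exact h1
  · exact h2.fun_neg
  · exact hasDerivAt_const _ _

/-- The zero-curvature equation `T_x = X_t + [X, T]`. Its diagonal entries are identities; the
off-diagonal ones are the NLS equation and its conjugate. -/
theorem hasDerivAt_laxT_x {q : ℝ → ℝ → ℂ} (hq : IsNLSSolution q) (k : ℂ) (x t : ℝ) (i j : Fin 2) :
    HasDerivAt (fun y => laxT q y t k i j)
      ((potential (qt q x t) + laxX q x t k * laxT q x t k - laxT q x t k * laxX q x t k) i j) x :=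
          by
  have h1 := hq.hasDerivAt_x x t
  have h2 := hasDerivAt_conj h1
  have h3 := hq.hasDerivAt_xx x t
  have h5 := (h1.fun_mul h2).const_mul Complex.I
  have h4 := hasDerivAt_conj h3
  have hI := Complex.I_sq
  have hnorm : (‖q x t‖ : ℂ) ^ 2 = q x t * conj (q x t) := (Complex.mul_conj' _).symm
  have he := hq.eqn x t
  have hec := congrArg (starRingEnd ℂ) he
  rw [hnorm] at he
  simp only [map_add, map_mul, Complex.conj_I, map_ofNat, map_zero, hnorm, Complex.conj_conj] at hec
  fin_cases i <;> fin_cases j <;> simp only [laxX_eq, laxT_eq, potential, Fin.zero_eta,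
    Fin.mk_one, Matrix.add_apply, Matrix.sub_apply, Matrix.mul_apply, Fin.sum_univ_two,
    Fin.isValue, Matrix.of_apply, Matrix.cons_val', Matrix.cons_val_zero,
    Matrix.cons_val_fin_one, Matrix.cons_val_one]
  · refine (h5.const_add (-2 * Complex.I * k ^ 2)).congr_deriv ?_
    ring
  · refine ((h3.const_mul Complex.I).fun_sub (h1.const_mul (2 * k))).congr_deriv ?_
    linear_combination Complex.I * he + (-qt q x t - 2 * k * qx q x t) * hI
  · refine ((h4.const_mul Complex.I).fun_add (h2.const_mul (2 * k))).congr_deriv ?_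
    linear_combination Complex.I * hec + (conj (qt q x t) + 2 * k * conj (qx q x t)) * hI
  · refine (h5.const_sub (2 * Complex.I * k ^ 2)).congr_deriv ?_
    ring

/-- Existence of simultaneous solutions of the Lax pair. -/
theorem exists_lax_solution {q : ℝ → ℝ → ℂ} (hq : IsNLSSolution q) (k : ℂ) (v₀ : Vec) :
    ∃ v : ℝ → ℝ → Vec, v 0 0 = v₀ ∧
      (∀ x t, HasDerivAt (fun y => v y t) (laxX q x t k *ᵥ v x t) x) ∧
      (∀ x t, HasDerivAt (fun s => v x s) (laxT q x t k *ᵥ v x t) t) := by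
  have hc1 : Continuous fun t : ℝ => mulCLM (laxT q 0 t k) :=
    Continuous.comp (g := fun p : ℝ × ℝ => mulCLM (laxT q p.1 p.2 k)) (f := fun t => ((0 : ℝ), t))
      (continuous_laxT hq k) (continuous_const.prodMk continuous_id)
  have hc2 : ∀ t, Continuous fun x : ℝ => mulCLM (laxX q x t k) := fun t =>
    Continuous.comp (g := fun p : ℝ × ℝ => mulCLM (laxX q p.1 p.2 k)) (f := fun x => (x, t))
      (continuous_laxX hq k) (continuous_id.prodMk continuous_const)
  -- The temporal equation is solved on the line `x = 0` and the spatial one on every line `t =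
  -- const`; zero curvature yields the temporal equation elsewhere.
  obtain ⟨y, hy0, hy⟩ := exists_linear_ode hc1 v₀
  have hu' := fun t => exists_linear_ode (hc2 t) (y t)
  choose u hu0 hu using hu'
  refine ⟨fun x t => u t x, (hu0 0).trans hy0, fun x t => hu t x, fun x t => ?_⟩
  have hqt := hq.cont_t
  have hy' : ∀ t, HasDerivAt (fun t => u t 0) (mulCLM (laxT q 0 t k) (u t 0)) t := by
    have e : (fun t => u t 0) = y := funext hu0
    intro t
    rw [e, hu0 t]
    exact hy t
  have hX' : ∀ x t, HasDerivAt (fun t => mulCLM (laxX q x t k)) (mulCLM (potential (qt q x t))) t :=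
    fun x t => hasDerivAt_mulCLM (hasDerivAt_laxX_t hq k x t)
  have hT : ∀ x t, HasDerivAt (fun y => mulCLM (laxT q y t k)) (mulCLM (potential (qt q x t))
      + mulCLM (laxX q x t k) * mulCLM (laxT q x t k)
      - mulCLM (laxT q x t k) * mulCLM (laxX q x t k)) x := by
    intro x t
    have h := hasDerivAt_mulCLM (hasDerivAt_laxT_x hq k x t)
    rw [map_sub, map_add, mulCLM_mul, mulCLM_mul] at h
    exact h
  have hc : Continuous fun z : ℝ × ℝ => mulCLM (potential (qt q z.1 z.2)) :=
    continuous_mulCLM.comp (continuous_potential.comp hqt)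
  have key := hasDerivAt_of_zero_curvature (F := Vec) (X := fun x t => mulCLM (laxX q x t k))
    (X' := fun x t => mulCLM (potential (qt q x t))) (T := fun x t => mulCLM (laxT q x t k))
    (continuous_laxX hq k) hc hX' hT (v := fun x t => u t x) (fun x t => hu t x) hy' x t
  exact key

/-! ### Propagation of the decay at infinity to other times. -/

section Transport

variable {F : Type*} [NormedAddCommGroup F] [NormedSpace ℝ F]

theorem abs_intervalIntegral_eq {φ : ℝ → ℝ} (hφ : ∀ s, 0 ≤ φ s) (t : ℝ) :
    |∫ s in (0 : ℝ)..t, φ s| = (if 0 ≤ t then 1 else -1) * ∫ s in (0 : ℝ)..t, φ s := by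
  split_ifs with h
  · rw [one_mul, abs_of_nonneg (intervalIntegral.integral_nonneg h fun s _ => hφ s)]
  · rw [neg_one_mul, abs_of_nonpos]
    rw [intervalIntegral.integral_symm, neg_nonpos]
    exact intervalIntegral.integral_nonneg (not_le.1 h).le fun s _ => hφ s

/-- Decay at infinity of the average over unit intervals of a function of two variables. -/
theorem tendsto_integral_abs_integral {φ : ℝ → ℝ → ℝ} (hφ : Continuous fun z : ℝ × ℝ => φ z.1 z.2)
    (hφ0 : ∀ x s, 0 ≤ φ x s) {t B : ℝ}
    (hB : ∀ X, 1 ≤ X → ∀ s ∈ uIoc 0 t, ∫ x in (X - 1)..X, φ x s ≤ B)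
    (hlim : ∀ s, Tendsto (fun X => ∫ x in (X - 1)..X, φ x s) atTop (𝓝 0)) :
    Tendsto (fun X => ∫ x in (X - 1)..X, |∫ s in (0 : ℝ)..t, φ x s|) atTop (𝓝 0) := by
  have hcs : ∀ X, Continuous fun s => ∫ x in (X - 1)..X, φ x s := fun X =>
    intervalIntegral.continuous_parametric_intervalIntegral_of_continuous'
      (f := fun s x => φ x s) (hφ.comp (continuous_snd.prodMk continuous_fst)) _ _
  -- Dominated convergence applies with the integral over `x` inside; the order of integration is
  -- exchanged at the end. A sign replaces the absolute value, because `φ ≥ 0`.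
  have h1 : Tendsto (fun X => ∫ s in (0 : ℝ)..t, ∫ x in (X - 1)..X, φ x s) atTop
      (𝓝 (∫ s in (0 : ℝ)..t, (0 : ℝ))) := by
    refine intervalIntegral.tendsto_integral_filter_of_dominated_convergence (fun _ => B)
      (Eventually.of_forall fun X => (hcs X).aestronglyMeasurable) ?_
      intervalIntegrable_const (Eventually.of_forall fun s _ => hlim s)
    filter_upwards [Ici_mem_atTop 1] with X hX
    refine Eventually.of_forall fun s hs => ?_
    rw [Real.norm_of_nonneg (intervalIntegral.integral_nonneg (by linarith) fun x _ => hφ0 x s)]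
    exact hB X hX s hs
  rw [intervalIntegral.integral_zero] at h1
  have h2 := h1.const_mul (if 0 ≤ t then (1 : ℝ) else -1)
  rw [mul_zero] at h2
  refine h2.congr fun X => ?_
  simp only [abs_intervalIntegral_eq (hφ0 _)]
  rw [intervalIntegral.integral_const_mul]
  congr 1
  refine intervalIntegral_intervalIntegral_swap ?_
  have hi : IntegrableOn (Function.uncurry fun s x => φ x s)
      (uIcc 0 t ×ˢ uIcc (X - 1) X) (volume : Measure (ℝ × ℝ)) :=
    ContinuousOn.integrableOn_compact (isCompact_uIcc.prod isCompact_uIcc)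
      (hφ.comp (continuous_snd.prodMk continuous_fst)).continuousOn
  exact hi.mono_set (prod_mono uIoc_subset_uIcc uIoc_subset_uIcc)

/-- A function of two variables which decays at time `0` and satisfies perturbed linear systems in
both variables decays at all times. -/
theorem tendsto_zero_of_two_gronwall {D Dx Dt : ℝ → ℝ → F} {a : ℝ → ℝ} {φ : ℝ → ℝ → ℝ}
    {n c c₀ t : ℝ} (hn : 0 ≤ n) (hc : 0 ≤ c) (hc₀ : 0 ≤ c₀) (ha : Continuous a) (ha0 : ∀ x, 0 ≤ a x)
    (hφ : Continuous fun z : ℝ × ℝ => φ z.1 z.2) (hφ0 : ∀ x s, 0 ≤ φ x s)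
    (hx : ∀ x, HasDerivAt (fun y => D y t) (Dx x t) x)
    (hxb : ∀ x, ‖Dx x t‖ ≤ (n + a x) * ‖D x t‖ + c * a x)
    (ht : ∀ x s, HasDerivAt (D x) (Dt x s) s)
    (htb : ∀ x s, ‖Dt x s‖ ≤ (c₀ + φ x s) * ‖D x s‖ + c * φ x s)
    (ha_lim : Tendsto (fun X => ∫ x in (X - 1)..X, a x) atTop (𝓝 0))
    (hφ_lim : Tendsto (fun X => ∫ x in (X - 1)..X, |∫ s in (0 : ℝ)..t, φ x s|) atTop (𝓝 0))
    (h0 : Tendsto (fun x => D x 0) atTop (𝓝 0)) : Tendsto (fun x => D x t) atTop (𝓝 0) := by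
  have hgc : Continuous fun x => |∫ s in (0 : ℝ)..t, φ x s| :=
    (intervalIntegral.continuous_parametric_intervalIntegral_of_continuous' (f := φ) hφ _ _).abs
  -- The time integral of `φ` is small only on average over unit intervals. In each of them there is
  -- a point where it does not exceed the average; `D` is carried from time `0` to time `t` at this
  -- point and then over a distance of at most `1` in space to `X`.
  have hex : ∀ X : ℝ, ∃ x ∈ Icc (X - 1) X, |∫ s in (0 : ℝ)..t, φ x s| ≤
      ∫ x in (X - 1)..X, |∫ s in (0 : ℝ)..t, φ x s| := by
    intro X
    obtain ⟨x₀, hx₀, hmin⟩ := isCompact_Icc.exists_isMinOn (nonempty_Icc.2 (by linarith))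
      (hgc.continuousOn (s := Icc (X - 1) X))
    refine ⟨x₀, hx₀, ?_⟩
    have := intervalIntegral.integral_mono_on (μ := volume) (a := X - 1) (b := X) (by linarith)
      intervalIntegrable_const (hgc.intervalIntegrable _ _) (fun x hx => hmin hx)
    simpa using this
  choose p hp hpg using hex
  have hp_lim : Tendsto p atTop atTop :=
    tendsto_atTop_mono (fun X => (hp X).1) (tendsto_atTop_add_const_right _ (-1) tendsto_id)
  set j : ℝ → ℝ := fun X => ∫ x in (X - 1)..X, |∫ s in (0 : ℝ)..t, φ x s| with hj
  set ω : ℝ → ℝ := fun X => ∫ x in (X - 1)..X, a x with hω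
  have hbound : ∀ X, ‖D X t‖ ≤ ((‖D (p X) 0‖ + c * j X) * Real.exp (c₀ * |t| + j X) + c * ω X) *
      Real.exp (n + ω X) := by
    intro X
    have hφc : Continuous fun s => φ (p X) s := hφ.comp (continuous_const.prodMk continuous_id)
    have g1 := norm_le_gronwall_abs (u := D (p X)) (u' := Dt (p X)) (α := fun s => c₀ + φ (p X) s)
      (β := fun s => c * φ (p X) s) 0 t (by fun_prop) (by fun_prop)
      (fun s => add_nonneg hc₀ (hφ0 _ _)) (fun s => mul_nonneg hc (hφ0 _ _)) (ht (p X))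
      (fun s _ => htb _ _)
    have g2 := norm_le_gronwall (u := fun x => D x t) (u' := fun x => Dx x t)
      (α := fun s => n + a s) (β := fun s => c * a s) (hp X).2 (by fun_prop) (by fun_prop)
      (fun s => add_nonneg hn (ha0 _)) (fun s => mul_nonneg hc (ha0 _)) (fun x _ => hx x)
      (fun x _ => hxb x)
    rw [intervalIntegral.integral_const_mul, intervalIntegral.integral_add intervalIntegrable_const
      (hφc.intervalIntegrable _ _), intervalIntegral.integral_const, abs_mul,
      abs_of_nonneg hc] at g1
    rw [intervalIntegral.integral_const_mul, intervalIntegral.integral_add intervalIntegrable_const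
      (ha.intervalIntegrable _ _), intervalIntegral.integral_const] at g2
    have e1 : |(t - 0) • c₀ + ∫ s in (0 : ℝ)..t, φ (p X) s| ≤ c₀ * |t| + j X := by
      refine (abs_add_le _ _).trans (add_le_add (le_of_eq ?_) (hpg X))
      rw [smul_eq_mul, sub_zero, abs_mul, abs_of_nonneg hc₀, mul_comm]
    have e2 : ∫ x in (p X)..X, a x ≤ ω X :=
      intervalIntegral.integral_mono_interval (hp X).1 (hp X).2 le_rfl
        (Eventually.of_forall ha0) (ha.intervalIntegrable _ _)
    have e3 : (X - p X) • n + ∫ x in (p X)..X, a x ≤ n + ω X := by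
      refine add_le_add ?_ e2
      rw [smul_eq_mul]
      have := (hp X).1
      nlinarith
    have e4 : 0 ≤ ∫ x in (p X)..X, a x := intervalIntegral.integral_nonneg (hp X).2 fun x _ => ha0 x
    have e5 : ‖D (p X) t‖ ≤ (‖D (p X) 0‖ + c * j X) * Real.exp (c₀ * |t| + j X) := by
      refine g1.trans (mul_le_mul ?_ (Real.exp_le_exp.2 e1) (Real.exp_pos _).le ?_)
      · gcongr
        exact hpg X
      · have : 0 ≤ j X := (abs_nonneg _).trans (hpg X)
        positivity
    refine g2.trans (mul_le_mul (add_le_add e5 (mul_le_mul_of_nonneg_left e2 hc))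
      (Real.exp_le_exp.2 e3) (Real.exp_pos _).le ?_)
    have := (norm_nonneg _).trans e5
    have := e4.trans e2
    positivity
  have hlim : Tendsto (fun X => ((‖D (p X) 0‖ + c * j X) * Real.exp (c₀ * |t| + j X) + c * ω X) *
      Real.exp (n + ω X)) atTop (𝓝 (((0 + c * 0) * Real.exp (c₀ * |t| + 0) + c * 0) *
      Real.exp (n + 0))) := by
    have h1 : Tendsto (fun X => ‖D (p X) 0‖) atTop (𝓝 0) := by
      simpa using (h0.comp hp_lim).norm
    exact (((h1.add (hφ_lim.const_mul c)).mul
      ((Real.continuous_exp.tendsto _).comp (hφ_lim.const_add _))).add (ha_lim.const_mul c)).mul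
      ((Real.continuous_exp.tendsto _).comp (ha_lim.const_add _))
  simp only [mul_zero, add_zero, zero_mul] at hlim
  exact squeeze_zero_norm hbound hlim

end Transport

/-! ### The perturbation of the plane wave -/

theorem hasDerivAt_planeWave (w : PlaneWave) (x t : ℝ) :
    HasDerivAt (fun y => w.q y t) (-(Complex.I * w.V) * w.q x t) x := by
  have h1 : HasDerivAt (fun y : ℝ => ((w.f y t : ℝ) : ℂ)) ((1 / 2 * (w.V * 1) : ℝ) : ℂ) x :=
    ((((hasDerivAt_id x).const_mul w.V).add_const _).const_mul (1 / 2)).ofReal_comp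
  have h2 := (((h1.const_mul (2 * Complex.I)).fun_neg.add_const (Complex.I * w.δ)).cexp).const_mul
    (w.A : ℂ)
  refine h2.congr_deriv ?_
  simp only [PlaneWave.q]
  push_cast
  ring

theorem IsNLSSolution.hasDerivAt_sub {q : ℝ → ℝ → ℂ} (hq : IsNLSSolution q) (w : PlaneWave)
    (x t : ℝ) : HasDerivAt (fun y => q y t - w.q y t) (qx q x t + Complex.I * w.V * w.q x t) x :=
  ((hq.hasDerivAt_x x t).fun_sub (hasDerivAt_planeWave w x t)).congr_deriv (by ring)

/-- The `x`-derivative of `q - q_±`. -/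
def pertX (q : ℝ → ℝ → ℂ) (w : PlaneWave) (x t : ℝ) : ℂ := qx q x t + Complex.I * w.V * w.q x t

theorem IsNLSSolution.deriv_sub {q : ℝ → ℝ → ℂ} (hq : IsNLSSolution q) (w : PlaneWave)
    (x t : ℝ) : deriv (fun y => q y t - w.q y t) x = pertX q w x t :=
  (hq.hasDerivAt_sub w x t).deriv

theorem continuous_pertX {q : ℝ → ℝ → ℂ} (hq : IsNLSSolution q) (w : PlaneWave) :
    Continuous fun z : ℝ × ℝ => pertX q w z.1 z.2 :=
  hq.cont_x.add (continuous_const.mul (continuous_planeWave w))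

theorem integrableOn_pertX {q : ℝ → ℝ → ℂ} {w : PlaneWave} (hq : IsNLSSolution q)
    (has : IsAsymptoticTo q w (Ioi 0)) (t a : ℝ) : IntegrableOn (fun y => pertX q w y t) (Ioi a) :=
        by
  have hc : Continuous fun y => pertX q w y t :=
    (continuous_pertX hq w).comp (f := fun y => (y, t)) (by fun_prop)
  have h1 : IntegrableOn (fun y => pertX q w y t) (Ioi 0) := by
    have := has.integrable_x t
    simpa only [hq.deriv_sub] using this
  have h2 : IntegrableOn (fun y => pertX q w y t) (Icc a 0) := hc.integrableOn_Icc
  refine (h1.union h2).mono_set fun y hy => ?_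
  rcases le_or_gt y 0 with h | h
  · exact Or.inr ⟨le_of_lt hy, h⟩
  · exact Or.inl h

theorem integrableOn_sub {q : ℝ → ℝ → ℂ} {w : PlaneWave} (hq : IsNLSSolution q)
    (has : IsAsymptoticTo q w (Ioi 0)) (t a : ℝ) :
    IntegrableOn (fun y => q y t - w.q y t) (Ioi a) := by
  have hc := continuous_diff hq w t
  refine Integrable.mono' (integrableOn_weight hq has t a) hc.aestronglyMeasurable
    (Eventually.of_forall fun y => ?_)
  have := abs_nonneg y
  nlinarith [norm_nonneg (q y t - w.q y t)]

theorem tendsto_sub_zero {q : ℝ → ℝ → ℂ} {w : PlaneWave} (hq : IsNLSSolution q)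
    (has : IsAsymptoticTo q w (Ioi 0)) (t : ℝ) :
    Tendsto (fun y => q y t - w.q y t) atTop (𝓝 0) :=
  tendsto_zero_of_hasDerivAt_of_integrableOn_Ioi (a := 0) (fun x _ => hq.hasDerivAt_sub w x t)
    (integrableOn_pertX hq has t 0) (integrableOn_sub hq has t 0)

/-- The `L¹` norm of the derivative controls the supremum of `q - q_±`. Thus the assumed bound on
bounded time intervals dominates all terms of `timeBound`. -/
theorem norm_sub_le_integral {q : ℝ → ℝ → ℂ} {w : PlaneWave} (hq : IsNLSSolution q)
    (has : IsAsymptoticTo q w (Ioi 0)) (x t : ℝ) :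
    ‖q x t - w.q x t‖ ≤ ∫ y in Ioi x, ‖pertX q w y t‖ := by
  have := integral_Ioi_of_hasDerivAt_of_tendsto' (a := x) (fun y _ => hq.hasDerivAt_sub w y t)
    (integrableOn_pertX hq has t x) (tendsto_sub_zero hq has t)
  rw [zero_sub] at this
  rw [← norm_neg, ← this]
  exact norm_integral_le_integral_norm _

theorem tendsto_tail_zero {f : ℝ → ℝ} {a : ℝ} (hf : IntegrableOn f (Ioi a)) :
    Tendsto (fun X => ∫ y in Ioi X, f y) atTop (𝓝 0) := by
  have h1 := (intervalIntegral_tendsto_integral_Ioi a hf tendsto_id).const_sub (∫ y in Ioi a, f y)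
  rw [sub_self] at h1
  refine h1.congr' ?_
  filter_upwards [Ioi_mem_atTop a] with x hx
  rw [id, ← intervalIntegral.integral_interval_add_Ioi hf
    (hf.mono_set (Ioi_subset_Ioi (le_of_lt hx))), add_sub_cancel_left]

theorem tendsto_integral_unit_zero {f : ℝ → ℝ} {a : ℝ} (hf : IntegrableOn f (Ioi a)) :
    Tendsto (fun X => ∫ y in (X - 1)..X, f y) atTop (𝓝 0) := by
  have h := tendsto_tail_zero hf
  have h1 := (h.comp (tendsto_atTop_add_const_right atTop (-1 : ℝ) tendsto_id)).sub h
  rw [sub_zero] at h1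
  refine h1.congr' ?_
  filter_upwards [Ioi_mem_atTop (a + 1)] with x hx
  have hx' : a + 1 < x := hx
  have h2 := intervalIntegral.integral_interval_add_Ioi (a := x + -1) (b := x)
    (hf.mono_set (Ioi_subset_Ioi (by linarith))) (hf.mono_set (Ioi_subset_Ioi (by linarith)))
  simp only [Function.comp, id]
  rw [← h2, add_sub_cancel_right, sub_eq_add_neg]

/-- The size of the perturbation of the temporal half of the Lax pair. -/
def timeBound (q : ℝ → ℝ → ℂ) (w : PlaneWave) (k : ℂ) (x s : ℝ) : ℝ :=
  |‖q x s‖ ^ 2 - w.A ^ 2| + ‖pertX q w x s‖ + 2 * ‖k‖ * ‖q x s - w.q x s‖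

theorem continuous_timeBound {q : ℝ → ℝ → ℂ} (hq : IsNLSSolution q) (w : PlaneWave) (k : ℂ) :
    Continuous fun z : ℝ × ℝ => timeBound q w k z.1 z.2 := by
  have h1 := hq.cont
  have h2 := continuous_pertX hq w
  have h3 := continuous_planeWave w
  unfold timeBound
  fun_prop

theorem timeBound_nonneg (q : ℝ → ℝ → ℂ) (w : PlaneWave) (k : ℂ) (x s : ℝ) :
    0 ≤ timeBound q w k x s := by
  unfold timeBound
  positivity

theorem norm_planeWave (w : PlaneWave) (x t : ℝ) : ‖w.q x t‖ = |w.A| := by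
  have : -(2 * Complex.I * (w.f x t : ℂ)) + Complex.I * (w.δ : ℂ)
      = ((-2 * w.f x t + w.δ : ℝ) : ℂ) * Complex.I := by
    push_cast; ring
  rw [PlaneWave.q, this, norm_mul, Complex.norm_exp_ofReal_mul_I, mul_one, Complex.norm_real,
    Real.norm_eq_abs]

/-- The `x`-derivative occurring in `T` is integrable but need not tend to zero pointwise, which is
why only averages over unit intervals are claimed. The other terms are bounded by the tail of the
same `L¹` norm. -/
theorem tendsto_integral_timeBound {q : ℝ → ℝ → ℂ} {w : PlaneWave} (hq : IsNLSSolution q)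
    (has : IsAsymptoticTo q w (Ioi 0)) (k : ℂ) (t : ℝ) :
    Tendsto (fun X => ∫ x in (X - 1)..X, |∫ s in (0 : ℝ)..t, timeBound q w k x s|) atTop (𝓝 0) := by
  obtain ⟨C₀, hC₀⟩ := has.locally_bounded |t|
  set C := max C₀ 0 with hCdef
  have hC0 : 0 ≤ C := le_max_right _ _
  set H : ℝ → ℝ → ℝ := fun X s => ∫ y in Ioi X, ‖pertX q w y s‖ with hH
  have hmono : ∀ s X Y, X ≤ Y → H Y s ≤ H X s := fun s X Y hXY =>
    setIntegral_mono_set (integrableOn_pertX hq has s X).norm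
      (Eventually.of_forall fun _ => norm_nonneg _) (Ioi_subset_Ioi hXY).eventuallyLE
  have hHC : ∀ s ∈ uIoc 0 t, ∀ X, 0 ≤ X → H X s ≤ C := by
    intro s hs X hX
    have hst : |s| ≤ |t| := by
      have := abs_sub_left_of_mem_uIcc (uIoc_subset_uIcc hs)
      simpa using this
    refine (hmono s 0 X hX).trans (le_trans ?_ (le_max_left _ _))
    have := hC₀ s hst
    simpa only [hq.deriv_sub] using this
  have hH0 : ∀ X s, 0 ≤ H X s := fun X s => integral_nonneg fun _ => norm_nonneg _
  -- The free bound `B` is used twice: with `C` for a domination uniform in time, and with `1` for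
  -- the limit at fixed time.
  have key : ∀ X s B, H (X - 1) s ≤ B → ∫ x in (X - 1)..X, timeBound q w k x s
      ≤ (B + 2 * |w.A| + 2 * ‖k‖ + 1) * H (X - 1) s := by
    intro X s B hB
    have hpc : Continuous fun x => ‖pertX q w x s‖ :=
      ((continuous_pertX hq w).comp (f := fun y => (y, s)) (by fun_prop)).norm
    have htc : Continuous fun x => timeBound q w k x s :=
      (continuous_timeBound hq w k).comp (f := fun y => (y, s)) (by fun_prop)
    have hle : ∀ x ∈ Icc (X - 1) X, timeBound q w k x s
        ≤ (B + 2 * |w.A| + 2 * ‖k‖) * H (X - 1) s + ‖pertX q w x s‖ := by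
      intro x hx
      have h1 : ‖q x s - w.q x s‖ ≤ H (X - 1) s :=
        (norm_sub_le_integral hq has x s).trans (hmono s _ _ hx.1)
      have h2 : abs (‖q x s‖ - |w.A|) ≤ ‖q x s - w.q x s‖ := by
        rw [← norm_planeWave w x s]
        exact abs_norm_sub_norm_le _ _
      have h3 : |‖q x s‖ ^ 2 - w.A ^ 2| ≤ H (X - 1) s * (B + 2 * |w.A|) := by
        have e : ‖q x s‖ ^ 2 - w.A ^ 2 = (‖q x s‖ - |w.A|) * (‖q x s‖ + |w.A|) := by
          rw [← sq_abs w.A]; ring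
        rw [e, abs_mul]
        refine mul_le_mul (h2.trans h1) ?_ (abs_nonneg _) (hH0 _ _)
        rw [abs_of_nonneg (by positivity)]
        have := abs_le.1 (h2.trans (h1.trans hB))
        linarith
      unfold timeBound
      have := mul_le_mul_of_nonneg_left h1 (by positivity : 0 ≤ 2 * ‖k‖)
      linarith
    have h4 := intervalIntegral.integral_mono_on (μ := volume) (by linarith : X - 1 ≤ X)
      (htc.intervalIntegrable _ _) (Continuous.intervalIntegrable (by fun_prop) _ _) hle
    rw [intervalIntegral.integral_add intervalIntegrable_const (hpc.intervalIntegrable _ _),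
      intervalIntegral.integral_const] at h4
    have h5 : ∫ x in (X - 1)..X, ‖pertX q w x s‖ ≤ H (X - 1) s := by
      rw [intervalIntegral.integral_of_le (by linarith)]
      exact setIntegral_mono_set (integrableOn_pertX hq has s _).norm
        (Eventually.of_forall fun _ => norm_nonneg _) Ioc_subset_Ioi_self.eventuallyLE
    refine h4.trans ?_
    rw [sub_sub_cancel, one_smul]
    linarith
  refine tendsto_integral_abs_integral (B := (C + 2 * |w.A| + 2 * ‖k‖ + 1) * C)
    (continuous_timeBound hq w k) (timeBound_nonneg q w k) (fun X hX s hs => ?_) (fun s => ?_)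
  · have h1 := hHC s hs (X - 1) (by linarith)
    refine (key X s C h1).trans ?_
    gcongr
  · have h1 : Tendsto (fun X => H (X - 1) s) atTop (𝓝 0) :=
      (tendsto_tail_zero (integrableOn_pertX hq has s 0).norm).comp
        (tendsto_atTop_add_const_right atTop (-1 : ℝ) tendsto_id)
    have h2 := h1.const_mul (1 + 2 * |w.A| + 2 * ‖k‖ + 1)
    rw [mul_zero] at h2
    refine squeeze_zero' (Eventually.of_forall fun X =>
      intervalIntegral.integral_nonneg (by linarith) fun x _ => timeBound_nonneg q w k x s) ?_ h2
    filter_upwards [h1.eventually (ge_mem_nhds one_pos)] with X hX using key X s 1 hX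

/-! ### The gauge transformation to the frame of the modified eigenfunctions -/

/-- The matrix `e^{-iℓ(x - 2(k - V/2)t)} e^{ifσ₃}`, applied to a vector. -/
def gauge (w : PlaneWave) (k ℓ : ℂ) (x t : ℝ) (u : Vec) : Vec :=
  Complex.exp (-(Complex.I * ℓ * (x - 2 * (k - w.V / 2) * t))) • (expSigma3 (w.f x t) *ᵥ u)

theorem gauge_eq (w : PlaneWave) (k ℓ : ℂ) (x t : ℝ) (u : Vec) : gauge w k ℓ x t u =
    ![Complex.exp (-(Complex.I * ℓ * (x - 2 * (k - w.V / 2) * t)) + Complex.I * w.f x t) * u 0,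
      Complex.exp (-(Complex.I * ℓ * (x - 2 * (k - w.V / 2) * t)) - Complex.I * w.f x t) * u 1] :=
          by
  rw [gauge, expSigma3, mulVec_two, sub_eq_add_neg _ (Complex.I * _), Complex.exp_add,
    Complex.exp_add]
  ext i
  fin_cases i <;> simp <;> ring

theorem modify_eq_gauge (w : PlaneWave) (j : Fin 2) (k : ℂ) (x t : ℝ) (u : Vec) :
    modify w j k x t u = gauge w k (colSign j * w.eigenval k) x t u := by
  rw [modify, gauge, PlaneWave.θ]
  congr 3
  ring

/-- The inverse of `gauge`. -/
def ungauge (w : PlaneWave) (k ℓ : ℂ) (x t : ℝ) (u : Vec) : Vec :=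
  ![Complex.exp (Complex.I * ℓ * (x - 2 * (k - w.V / 2) * t) - Complex.I * w.f x t) * u 0,
    Complex.exp (Complex.I * ℓ * (x - 2 * (k - w.V / 2) * t) + Complex.I * w.f x t) * u 1]

theorem gauge_ungauge (w : PlaneWave) (k ℓ : ℂ) (x t : ℝ) (u : Vec) :
    gauge w k ℓ x t (ungauge w k ℓ x t u) = u := by
  rw [gauge_eq, ungauge]
  ext i
  fin_cases i <;> simp [← mul_assoc, ← Complex.exp_add]

theorem ungauge_gauge (w : PlaneWave) (k ℓ : ℂ) (x t : ℝ) (u : Vec) :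
    ungauge w k ℓ x t (gauge w k ℓ x t u) = u := by
  rw [gauge_eq, ungauge]
  ext i
  fin_cases i <;> simp [← mul_assoc, ← Complex.exp_add]

theorem hasDerivAt_vec_two {a b : ℝ → ℂ} {a' b' : ℂ} {x : ℝ} (ha : HasDerivAt a a' x)
    (hb : HasDerivAt b b' x) : HasDerivAt (fun x => (![a x, b x] : Vec)) ![a', b'] x := by
  refine hasDerivAt_pi.2 fun i => ?_
  fin_cases i
  · exact ha
  · exact hb

theorem hasDerivAt_phase_x (w : PlaneWave) (k ℓ c : ℂ) (x t : ℝ) :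
    HasDerivAt (fun y : ℝ => Complex.exp (-(Complex.I * ℓ * (y - 2 * (k - w.V / 2) * t))
        + c * (Complex.I * w.f y t)))
      (Complex.exp (-(Complex.I * ℓ * (x - 2 * (k - w.V / 2) * t)) + c * (Complex.I * w.f x t)) *
        (-(Complex.I * ℓ) + c * (Complex.I * w.V / 2))) x := by
  have h0 : HasDerivAt (fun y : ℝ => (y : ℂ)) 1 x := Complex.ofRealCLM.hasDerivAt
  have h1 : HasDerivAt (fun y : ℝ => ((w.f y t : ℝ) : ℂ)) ((1 / 2 * (w.V * 1) : ℝ) : ℂ) x :=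
    ((((hasDerivAt_id x).const_mul w.V).add_const _).const_mul (1 / 2)).ofReal_comp
  refine ((((h0.sub_const _).const_mul (Complex.I * ℓ)).fun_neg.fun_add
    ((h1.const_mul Complex.I).const_mul c)).cexp).congr_deriv ?_
  push_cast
  ring

theorem hasDerivAt_phase_t (w : PlaneWave) (k ℓ c : ℂ) (x t : ℝ) :
    HasDerivAt (fun s : ℝ => Complex.exp (-(Complex.I * ℓ * (x - 2 * (k - w.V / 2) * s))
        + c * (Complex.I * w.f x s)))
      (Complex.exp (-(Complex.I * ℓ * (x - 2 * (k - w.V / 2) * t)) + c * (Complex.I * w.f x t)) *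
        (2 * Complex.I * ℓ * (k - w.V / 2) + c * (Complex.I * (w.V ^ 2 / 2 - w.A ^ 2)))) t := by
  have h0 : HasDerivAt (fun y : ℝ => (y : ℂ)) 1 t := Complex.ofRealCLM.hasDerivAt
  have h1 : HasDerivAt (fun s : ℝ => ((w.f x s : ℝ) : ℂ))
      ((1 / 2 * ((w.V ^ 2 - 2 * w.A ^ 2) * 1) : ℝ) : ℂ) t :=
    ((((hasDerivAt_id t).const_mul (w.V ^ 2 - 2 * w.A ^ 2)).const_add _).const_mul
      (1 / 2)).ofReal_comp
  refine (((((h0.const_mul (2 * (k - w.V / 2))).const_sub _).const_mul (Complex.I *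
      ℓ)).fun_neg.fun_add
    ((h1.const_mul Complex.I).const_mul c)).cexp).congr_deriv ?_
  push_cast
  ring

theorem conj_exp_f (w : PlaneWave) (x t : ℝ) : conj (Complex.exp (2 * Complex.I * w.f x t)) =
    Complex.exp (-(2 * Complex.I * w.f x t)) := by
  rw [← Complex.exp_conj]
  simp only [map_mul, map_ofNat, Complex.conj_I, Complex.conj_ofReal]
  ring_nf

theorem conj_exp_mul_I (y : ℝ) : conj (Complex.exp (Complex.I * y)) = Complex.exp (-(Complex.I *
    y)) := by
  rw [← Complex.exp_conj]
  simp

/-- The coefficient matrix of the spatial equation in the frame of the modified eigenfunctions. -/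
def gaugeX (q : ℝ → ℝ → ℂ) (w : PlaneWave) (k ℓ : ℂ) (x t : ℝ) : Mat2 :=
  bgMat w (k + w.V / 2) ℓ + potential (pert q w x t)

theorem gaugeX_eq (q : ℝ → ℝ → ℂ) (w : PlaneWave) (k ℓ : ℂ) (x t : ℝ) : gaugeX q w k ℓ x t =
    !![Complex.I * (k + w.V / 2 - ℓ), q x t * Complex.exp (2 * Complex.I * w.f x t);
      -(conj (q x t) * Complex.exp (-(2 * Complex.I * w.f x t))),
      -(Complex.I * (k + w.V / 2 + ℓ))] := by
  ext i j
  fin_cases i <;> fin_cases j <;> simp [gaugeX, bgMat, potential, pert, conj_exp_f, conj_exp_mul_I]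
  ring

theorem hasDerivAt_gauge_x {q : ℝ → ℝ → ℂ} (w : PlaneWave) {k : ℂ} (ℓ : ℂ) {v : ℝ → ℝ → Vec}
    {x t : ℝ} (hv : HasDerivAt (fun y => v y t) (laxX q x t k *ᵥ v x t) x) :
    HasDerivAt (fun y => gauge w k ℓ y t (v y t)) (gaugeX q w k ℓ x t *ᵥ gauge w k ℓ x t (v x t)) x
        := by
  rw [laxX_eq, mulVec_two] at hv
  have h0 := hasDerivAt_pi.1 hv 0
  have h1 := hasDerivAt_pi.1 hv 1
  simp only [gauge_eq, sub_eq_add_neg _ (Complex.I * (w.f _ t : ℂ))]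
  have p0 := hasDerivAt_phase_x w k ℓ 1 x t
  have p1 := hasDerivAt_phase_x w k ℓ (-1) x t
  simp only [one_mul, neg_one_mul] at p0 p1
  refine (hasDerivAt_vec_two (p0.fun_mul h0) (p1.fun_mul h1)).congr_deriv ?_
  rw [gaugeX_eq, mulVec_two]
  set P : ℂ := -(Complex.I * ℓ * (x - 2 * (k - w.V / 2) * t))
  have e0 : Complex.exp (P + Complex.I * w.f x t) =
      Complex.exp (2 * Complex.I * w.f x t) * Complex.exp (P + -(Complex.I * w.f x t)) := by
    rw [← Complex.exp_add]; congr 1; ring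
  have e1 : Complex.exp (P + -(Complex.I * w.f x t)) =
      Complex.exp (-(2 * Complex.I * w.f x t)) * Complex.exp (P + Complex.I * w.f x t) := by
    rw [← Complex.exp_add]; congr 1; ring
  ext i
  fin_cases i
  · simp only [Fin.zero_eta, Fin.isValue, Matrix.cons_val_zero, Matrix.cons_val_one]
    linear_combination (q x t * v x t 1) * e0
  · simp only [Fin.mk_one, Fin.isValue, Matrix.cons_val_zero, Matrix.cons_val_one]
    linear_combination (-(conj (q x t) * v x t 0)) * e1

/-- The perturbation of the temporal equation in the frame of the modified eigenfunctions. -/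
def timePert (q : ℝ → ℝ → ℂ) (w : PlaneWave) (k : ℂ) (x t : ℝ) : Mat2 :=
  !![Complex.I * (q x t * conj (q x t) - w.A ^ 2),
      Complex.I * (pertX q w x t * Complex.exp (2 * Complex.I * w.f x t)) - 2 * k * pert q w x t;
    Complex.I * conj (pertX q w x t * Complex.exp (2 * Complex.I * w.f x t))
      + 2 * k * conj (pert q w x t), -(Complex.I * (q x t * conj (q x t) - w.A ^ 2))]

theorem norm_exp_two_I_mul (y : ℝ) : ‖Complex.exp (2 * Complex.I * y)‖ = 1 := by
  have : 2 * Complex.I * (y : ℂ) = ((2 * y : ℝ) : ℂ) * Complex.I := by push_cast; ring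
  rw [this, Complex.norm_exp_ofReal_mul_I]

theorem norm_timePert_le (q : ℝ → ℝ → ℂ) (w : PlaneWave) (k : ℂ) (x t : ℝ) :
    ‖mulCLM (timePert q w k x t)‖ ≤ timeBound q w k x t := by
  have h1 : ‖q x t * conj (q x t) - (w.A : ℂ) ^ 2‖ = |‖q x t‖ ^ 2 - w.A ^ 2| := by
    rw [Complex.mul_conj', ← Real.norm_eq_abs, ← Complex.norm_real]
    push_cast
    rfl
  have h2 : ‖pertX q w x t * Complex.exp (2 * Complex.I * w.f x t)‖ = ‖pertX q w x t‖ := by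
    rw [norm_mul, norm_exp_two_I_mul, mul_one]
  have h3 := norm_pert q w x t
  refine norm_mulCLM_le _ _ _ _ ?_ ?_
  · rw [norm_mul, Complex.norm_I, one_mul, h1, timeBound, add_assoc]
    refine add_le_add le_rfl ((norm_sub_le _ _).trans ?_)
    rw [norm_mul, Complex.norm_I, one_mul, h2, norm_mul, norm_mul, h3, Complex.norm_ofNat]
  · rw [norm_neg, norm_mul _ (_ - _), Complex.norm_I, one_mul, h1, timeBound, add_comm, add_assoc]
    refine add_le_add le_rfl ((norm_add_le _ _).trans ?_)
    rw [norm_mul, Complex.norm_I, one_mul, Complex.norm_conj, h2, norm_mul, norm_mul,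
      Complex.norm_conj, h3, Complex.norm_ofNat]

/-- The coefficient matrix of the temporal equation in the frame of the modified eigenfunctions. -/
def gaugeT (q : ℝ → ℝ → ℂ) (w : PlaneWave) (k ℓ : ℂ) (x t : ℝ) : Mat2 :=
  (-2 * (k - w.V / 2)) • bgMat w (k + w.V / 2) ℓ + timePert q w k x t

/-- The phase of the gauge is chosen such that the unperturbed temporal matrix is `-2(k - V/2)`
times the spatial one. A vector annihilated by `bgMat` is therefore a constant solution of both
background equations. -/
theorem gaugeT_eq (q : ℝ → ℝ → ℂ) (w : PlaneWave) (k ℓ : ℂ) (x t : ℝ) : gaugeT q w k ℓ x t =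
    !![-2 * Complex.I * k ^ 2 + Complex.I * (q x t * conj (q x t)) + 2 * Complex.I * ℓ * (k - w.V /
        2)
        + Complex.I * (w.V ^ 2 / 2 - w.A ^ 2),
      (Complex.I * qx q x t - 2 * k * q x t) * Complex.exp (2 * Complex.I * w.f x t);
      (Complex.I * conj (qx q x t) + 2 * k * conj (q x t)) * Complex.exp (-(2 * Complex.I * w.f x
          t)),
      2 * Complex.I * k ^ 2 - Complex.I * (q x t * conj (q x t)) + 2 * Complex.I * ℓ * (k - w.V / 2)
        - Complex.I * (w.V ^ 2 / 2 - w.A ^ 2)] := by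
  have hI := Complex.I_sq
  have e : w.q x t * Complex.exp (2 * Complex.I * w.f x t) = w.A * Complex.exp (Complex.I * w.δ) :=
      by
    rw [PlaneWave.q, mul_assoc, ← Complex.exp_add]
    ring_nf
  have e' : conj (w.q x t) * Complex.exp (-(2 * Complex.I * w.f x t))
      = w.A * Complex.exp (-(Complex.I * w.δ)) := by
    have := congrArg (starRingEnd ℂ) e
    rw [map_mul, map_mul, conj_exp_f, conj_exp_mul_I, Complex.conj_ofReal] at this
    exact this
  ext i j
  fin_cases i <;> fin_cases j <;> simp only [gaugeT, bgMat, timePert, pert, pertX, Fin.zero_eta,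
    Fin.mk_one, Fin.isValue, Matrix.add_apply, Matrix.smul_apply, smul_eq_mul, Matrix.of_apply,
    Matrix.cons_val', Matrix.cons_val_zero, Matrix.cons_val_fin_one, Matrix.cons_val_one, map_sub,
    map_mul, map_add, conj_exp_f, conj_exp_mul_I, Complex.conj_I, Complex.conj_ofReal]
  · ring
  · linear_combination Complex.I ^ 2 * w.V * e + (w.V * w.A * Complex.exp (Complex.I * w.δ)) * hI
  · linear_combination -Complex.I ^ 2 * w.V * e' - (w.V * w.A * Complex.exp (-(Complex.I * w.δ))) *
        hI
  · ring

theorem hasDerivAt_gauge_t {q : ℝ → ℝ → ℂ} (w : PlaneWave) {k : ℂ} (ℓ : ℂ) {v : ℝ → ℝ → Vec}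
    {x t : ℝ} (hv : HasDerivAt (fun s => v x s) (laxT q x t k *ᵥ v x t) t) :
    HasDerivAt (fun s => gauge w k ℓ x s (v x s)) (gaugeT q w k ℓ x t *ᵥ gauge w k ℓ x t (v x t)) t
        := by
  rw [laxT_eq, mulVec_two] at hv
  have h0 := hasDerivAt_pi.1 hv 0
  have h1 := hasDerivAt_pi.1 hv 1
  simp only [gauge_eq, sub_eq_add_neg _ (Complex.I * (w.f x _ : ℂ))]
  have p0 := hasDerivAt_phase_t w k ℓ 1 x t
  have p1 := hasDerivAt_phase_t w k ℓ (-1) x t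
  simp only [one_mul, neg_one_mul] at p0 p1
  refine (hasDerivAt_vec_two (p0.fun_mul h0) (p1.fun_mul h1)).congr_deriv ?_
  rw [gaugeT_eq, mulVec_two]
  set P : ℂ := -(Complex.I * ℓ * (x - 2 * (k - w.V / 2) * t))
  have e0 : Complex.exp (P + Complex.I * w.f x t) =
      Complex.exp (2 * Complex.I * w.f x t) * Complex.exp (P + -(Complex.I * w.f x t)) := by
    rw [← Complex.exp_add]; congr 1; ring
  have e1 : Complex.exp (P + -(Complex.I * w.f x t)) =
      Complex.exp (-(2 * Complex.I * w.f x t)) * Complex.exp (P + Complex.I * w.f x t) := by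
    rw [← Complex.exp_add]; congr 1; ring
  ext i
  fin_cases i
  · simp only [Fin.zero_eta, Fin.isValue, Matrix.cons_val_zero, Matrix.cons_val_one]
    linear_combination ((Complex.I * qx q x t - 2 * k * q x t) * v x t 1) * e0
  · simp only [Fin.mk_one, Fin.isValue, Matrix.cons_val_zero, Matrix.cons_val_one]
    linear_combination ((Complex.I * conj (qx q x t) + 2 * k * conj (q x t)) * v x t 0) * e1

/-! ### Existence and uniqueness of the Jost solutions at `+∞` -/

theorem trace_gaugeX (q : ℝ → ℝ → ℂ) (w : PlaneWave) (k ℓ : ℂ) (x t : ℝ) :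
    (gaugeX q w k ℓ x t).trace = -(2 * Complex.I * ℓ) := by
  rw [gaugeX_eq, Matrix.trace_fin_two_of]
  ring

theorem continuous_gaugeX {q : ℝ → ℝ → ℂ} (hq : IsNLSSolution q) (w : PlaneWave) (k ℓ : ℂ) (t : ℝ) :
    Continuous fun x => gaugeX q w k ℓ x t :=
  continuous_const.add (continuous_potential.comp
    ((continuous_pert hq w).comp (f := fun y => (y, t)) (by fun_prop)))

theorem norm_mulVec_le (A : Mat2) (v : Vec) : ‖A *ᵥ v‖ ≤ ‖mulCLM A‖ * ‖v‖ := (mulCLM A).le_opNorm v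

/-- Normalization at time `0` implies normalization at every time. Since `η` solves both background
equations, the difference from `η` satisfies linear equations whose inhomogeneity is the
perturbation applied to `η`, the situation of `tendsto_zero_of_two_gronwall`. -/
theorem tendsto_gauge_of_zero {q : ℝ → ℝ → ℂ} {w : PlaneWave} (hq : IsNLSSolution q)
    (has : IsAsymptoticTo q w (Ioi 0)) {k ℓ : ℂ} {η : Vec}
    (hη : bgMat w (k + w.V / 2) ℓ *ᵥ η = 0) {v : ℝ → ℝ → Vec}
    (hx : ∀ x t, HasDerivAt (fun y => v y t) (laxX q x t k *ᵥ v x t) x)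
    (ht : ∀ x t, HasDerivAt (fun s => v x s) (laxT q x t k *ᵥ v x t) t)
    (h0 : Tendsto (fun x => gauge w k ℓ x 0 (v x 0)) atTop (𝓝 η)) (t : ℝ) :
    Tendsto (fun x => gauge w k ℓ x t (v x t)) atTop (𝓝 η) := by
  set N := bgMat w (k + w.V / 2) ℓ with hN
  set D : ℝ → ℝ → Vec := fun x s => gauge w k ℓ x s (v x s) - η with hD
  have hDe : ∀ x s, gauge w k ℓ x s (v x s) = D x s + η := fun x s => by simp [hD]
  have key := tendsto_zero_of_two_gronwall (D := D) (t := t)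
    (Dx := fun x s => gaugeX q w k ℓ x s *ᵥ gauge w k ℓ x s (v x s))
    (Dt := fun x s => gaugeT q w k ℓ x s *ᵥ gauge w k ℓ x s (v x s))
    (a := fun x => ‖q x t - w.q x t‖) (φ := timeBound q w k) (n := ‖mulCLM N‖) (c := ‖η‖)
    (c₀ := 2 * ‖k - w.V / 2‖ * ‖mulCLM N‖) (norm_nonneg _) (norm_nonneg _) (by positivity)
    (continuous_diff hq w t).norm (fun x => norm_nonneg _) (continuous_timeBound hq w k)
    (timeBound_nonneg q w k) (fun x => (hasDerivAt_gauge_x w ℓ (hx x t)).sub_const η) (fun x => ?_)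
    (fun x s => (hasDerivAt_gauge_t w ℓ (ht x s)).sub_const η) (fun x s => ?_)
    (tendsto_integral_unit_zero (integrableOn_sub hq has t 0).norm)
    (tendsto_integral_timeBound hq has k t) (by simpa [hD] using h0.sub_const η)
  · have := key.add_const η
    simpa [hD] using this
  · have e : gaugeX q w k ℓ x t *ᵥ gauge w k ℓ x t (v x t) = N *ᵥ D x t
        + (potential (pert q w x t) *ᵥ D x t + potential (pert q w x t) *ᵥ η) := by
      rw [hDe, gaugeX, ← hN, Matrix.add_mulVec, Matrix.mulVec_add, Matrix.mulVec_add, hη, add_zero]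
    have hp : ‖mulCLM (potential (pert q w x t))‖ ≤ ‖q x t - w.q x t‖ := norm_pertOp_le q w t x
    have b1 := norm_mulVec_le N (D x t)
    have b2 := (norm_mulVec_le (potential (pert q w x t)) (D x t)).trans
      (mul_le_mul_of_nonneg_right hp (norm_nonneg _))
    have b3 := (norm_mulVec_le (potential (pert q w x t)) η).trans
      (mul_le_mul_of_nonneg_right hp (norm_nonneg _))
    change ‖gaugeX q w k ℓ x t *ᵥ gauge w k ℓ x t (v x t)‖ ≤ _
    rw [e]
    refine (norm_add_le _ _).trans ((add_le_add b1 ((norm_add_le _ _).trans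
      (add_le_add b2 b3))).trans (le_of_eq ?_))
    ring
  · have e : gaugeT q w k ℓ x s *ᵥ gauge w k ℓ x s (v x s)
        = (-2 * (k - w.V / 2)) • (N *ᵥ D x s)
        + (timePert q w k x s *ᵥ D x s + timePert q w k x s *ᵥ η) := by
      rw [hDe, gaugeT, ← hN, Matrix.add_mulVec, Matrix.mulVec_add, Matrix.mulVec_add,
        Matrix.smul_mulVec, Matrix.smul_mulVec, hη, smul_zero, add_zero]
    have hp := norm_timePert_le q w k x s
    have b1 : ‖(-2 * (k - w.V / 2)) • (N *ᵥ D x s)‖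
        ≤ 2 * ‖k - w.V / 2‖ * ‖mulCLM N‖ * ‖D x s‖ := by
      rw [norm_smul, norm_mul, norm_neg, Complex.norm_ofNat, mul_assoc _ ‖mulCLM N‖]
      exact mul_le_mul_of_nonneg_left (norm_mulVec_le _ _) (by positivity)
    have b2 := (norm_mulVec_le (timePert q w k x s) (D x s)).trans
      (mul_le_mul_of_nonneg_right hp (norm_nonneg _))
    have b3 := (norm_mulVec_le (timePert q w k x s) η).trans
      (mul_le_mul_of_nonneg_right hp (norm_nonneg _))
    change ‖gaugeT q w k ℓ x s *ᵥ gauge w k ℓ x s (v x s)‖ ≤ _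
    rw [e]
    refine (norm_add_le _ _).trans ((add_le_add b1 ((norm_add_le _ _).trans
      (add_le_add b2 b3))).trans (le_of_eq ?_))
    ring

/-- The solution of the spatial equation at time `t` in the frame of the modified
eigenfunctions, normalized at `+∞`. -/
def jostSeries (q : ℝ → ℝ → ℂ) (w : PlaneWave) (t : ℝ) (k ℓ : ℂ) (η : Vec) (x : ℝ) : Vec :=
  volterra (bgProp w (k + w.V / 2) ℓ) (pertOp q w t) η x

/-- The kernel bound refers to a half-line `x > a`, whereas the series does not depend on `a`; near
each `x` the choice `a = x - 1` serves. -/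
theorem jostSeries_spec {q : ℝ → ℝ → ℂ} {w : PlaneWave} (hq : IsNLSSolution q)
    (has : IsAsymptoticTo q w (Ioi 0)) {k ℓ : ℂ} (h : ℓ ^ 2 = (k + w.V / 2) ^ 2 + (w.A : ℂ) ^ 2)
    (hℓ : 0 ≤ ℓ.im) {η : Vec} (hη : bgMat w (k + w.V / 2) ℓ *ᵥ η = 0) (t : ℝ) :
    (∀ x, HasDerivAt (jostSeries q w t k ℓ η) (gaugeX q w k ℓ x t *ᵥ jostSeries q w t k ℓ η x) x) ∧
    Tendsto (jostSeries q w t k ℓ η) atTop (𝓝 η) := by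
  have hk : ∀ a, ∃ m, IsVolterraKernel (bgProp w (k + w.V / 2) ℓ)
      (mulCLM (bgMat w (k + w.V / 2) ℓ)) (pertOp q w t) m a := fun a => by
    obtain ⟨m, hm⟩ := isVolterraKernel_of_bounded hq has t a ‖mulCLM (bgMat w (k + w.V / 2) ℓ)‖
    exact ⟨m, hm _ _ h hℓ le_rfl⟩
  refine ⟨fun x => ?_, ?_⟩
  · obtain ⟨m, hm⟩ := hk (x - 1)
    refine (hm.hasDerivAt_volterra (η := η) hη (by linarith : x - 1 < x)).congr_deriv ?_
    rw [gaugeX, Matrix.add_mulVec]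
    rfl
  · obtain ⟨m, hm⟩ := hk 0
    exact hm.tendsto_volterra η

/-- The series at time `0` supplies the value at the origin. The Lax solution with this value agrees
with the series along `t = 0`, hence has the right limit there and then at all times. -/
theorem exists_lax_tendsto {q : ℝ → ℝ → ℂ} {w : PlaneWave} (hq : IsNLSSolution q)
    (has : IsAsymptoticTo q w (Ioi 0)) {k ℓ : ℂ} (h : ℓ ^ 2 = (k + w.V / 2) ^ 2 + (w.A : ℂ) ^ 2)
    (hℓ : 0 ≤ ℓ.im) {η : Vec} (hη : bgMat w (k + w.V / 2) ℓ *ᵥ η = 0) : ∃ v : ℝ → ℝ → Vec,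
      (∀ x t, HasDerivAt (fun y => v y t) (laxX q x t k *ᵥ v x t) x) ∧
      (∀ x t, HasDerivAt (fun s => v x s) (laxT q x t k *ᵥ v x t) t) ∧
      ∀ t, Tendsto (fun x => gauge w k ℓ x t (v x t)) atTop (𝓝 η) := by
  obtain ⟨hs1, hs2⟩ := jostSeries_spec hq has h hℓ hη 0
  obtain ⟨v, hv0, hx, ht⟩ := exists_lax_solution hq k (ungauge w k ℓ 0 0 (jostSeries q w 0 k ℓ η 0))
  refine ⟨v, hx, ht, tendsto_gauge_of_zero hq has hη hx ht ?_⟩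
  refine hs2.congr fun x => ?_
  refine (eq_of_linear_ode (A := fun x => mulCLM (gaugeX q w k ℓ x 0))
    (continuous_mulCLM.comp (continuous_gaugeX hq w k ℓ 0))
    (fun x => hs1 x) (fun x => hasDerivAt_gauge_x w ℓ (hx x 0)) (a := 0) ?_ x)
  rw [hv0, gauge_ungauge]

/-- Uniqueness on a half-line. It makes the series at time `t` available for a solution constructed
from time `0`. -/
theorem gauge_eq_jostSeries {q : ℝ → ℝ → ℂ} {w : PlaneWave} (hq : IsNLSSolution q)
    (has : IsAsymptoticTo q w (Ioi 0)) {k ℓ : ℂ} (h : ℓ ^ 2 = (k + w.V / 2) ^ 2 + (w.A : ℂ) ^ 2)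
    (hℓ : 0 ≤ ℓ.im) {η : Vec} (hη0 : η ≠ 0) (hη : bgMat w (k + w.V / 2) ℓ *ᵥ η = 0)
    {v : ℝ → ℝ → Vec} {t : ℝ} (hx : ∀ x, HasDerivAt (fun y => v y t) (laxX q x t k *ᵥ v x t) x)
    (hl : Tendsto (fun x => gauge w k ℓ x t (v x t)) atTop (𝓝 η)) (x : ℝ) :
    gauge w k ℓ x t (v x t) = jostSeries q w t k ℓ η x := by
  obtain ⟨hs1, hs2⟩ := jostSeries_spec hq has h hℓ hη t
  exact half_line_unique (a := x - 1) (u := fun x => gauge w k ℓ x t (v x t))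
    (continuous_gaugeX hq w k ℓ t) hℓ (fun x => trace_gaugeX q w k ℓ x t) hη0
    (fun x _ => hasDerivAt_gauge_x w ℓ (hx x)) (fun x _ => hs1 x) hl hs2 (by linarith)

/-! ### The Jost solutions at `+∞` -/

/-- The first column of `E`, as a function of `z = λ + κ`. -/
def colOne (w : PlaneWave) (z : ℂ) : Vec :=
  ![1, Complex.I * w.A / z * Complex.exp (-(Complex.I * w.δ))]

/-- The second column of `E`, as a function of `z = λ + κ`. -/
def colTwo (w : PlaneWave) (z : ℂ) : Vec :=
  ![Complex.I * w.A / z * Complex.exp (Complex.I * w.δ), 1]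

theorem E_eq (w : PlaneWave) (k : ℂ) : w.E k =
    !![1, Complex.I * w.A / (w.eigenval k + (k + w.V / 2)) * Complex.exp (Complex.I * w.δ);
      Complex.I * w.A / (w.eigenval k + (k + w.V / 2)) * Complex.exp (-(Complex.I * w.δ)), 1] := by
  ext i j
  fin_cases i <;> fin_cases j <;>
    simp [PlaneWave.E, expSigma3, sigma1]

theorem E_col_zero (w : PlaneWave) (k : ℂ) :
    (fun i => w.E k i 0) = colOne w (w.eigenval k + (k + w.V / 2)) := by
  ext i
  fin_cases i <;> simp [E_eq, colOne]

theorem E_col_one (w : PlaneWave) (k : ℂ) :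
    (fun i => w.E k i 1) = colTwo w (w.eigenval k + (k + w.V / 2)) := by
  ext i
  fin_cases i <;> simp [E_eq, colTwo]

theorem bgMat_colOne (w : PlaneWave) {κ ℓ : ℂ} (h : ℓ ^ 2 = κ ^ 2 + (w.A : ℂ) ^ 2) (hz : ℓ + κ ≠ 0)
    :
    bgMat w κ ℓ *ᵥ colOne w (ℓ + κ) = 0 := by
  have e := exp_mul_exp_neg (Complex.I * w.δ)
  rw [bgMat, mulVec_two]
  ext i
  fin_cases i
  · simp only [colOne, Fin.zero_eta, Fin.isValue, Matrix.cons_val_zero, Matrix.cons_val_one,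
      Pi.zero_apply]
    field_simp
    linear_combination (Complex.I * w.A ^ 2) * e - Complex.I * h
  · simp only [colOne, Fin.mk_one, Fin.isValue, Matrix.cons_val_zero, Matrix.cons_val_one,
      Pi.zero_apply]
    field_simp
    linear_combination (-(w.A * (ℓ + κ) * Complex.exp (-(Complex.I * w.δ)))) * Complex.I_sq

/-- The second column of `E` belongs to the exponent `ℓ = -λ`, so that `λ + κ` becomes `-ℓ + κ`. -/
theorem bgMat_colTwo (w : PlaneWave) {κ ℓ : ℂ} (h : ℓ ^ 2 = κ ^ 2 + (w.A : ℂ) ^ 2) (hz : -ℓ + κ ≠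
    0) :
    bgMat w κ ℓ *ᵥ colTwo w (-ℓ + κ) = 0 := by
  have e := exp_mul_exp_neg (Complex.I * w.δ)
  rw [bgMat, mulVec_two]
  ext i
  fin_cases i
  · simp only [colTwo, Fin.zero_eta, Fin.isValue, Matrix.cons_val_zero, Matrix.cons_val_one,
      Pi.zero_apply]
    field_simp
    linear_combination (w.A * (-ℓ + κ) * Complex.exp (Complex.I * w.δ)) * Complex.I_sq
  · simp only [colTwo, Fin.mk_one, Fin.isValue, Matrix.cons_val_zero, Matrix.cons_val_one,
      Pi.zero_apply]
    field_simp
    linear_combination (-Complex.I * w.A ^ 2) * e + Complex.I * h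

theorem colOne_ne_zero (w : PlaneWave) (z : ℂ) : colOne w z ≠ 0 := fun h => by
  simpa [colOne] using congrFun h 0

theorem colTwo_ne_zero (w : PlaneWave) (z : ℂ) : colTwo w z ≠ 0 := fun h => by
  simpa [colTwo] using congrFun h 1

theorem eigenval_sq (w : PlaneWave) (k : ℂ) :
    w.eigenval k ^ 2 = (k + w.V / 2) ^ 2 + (w.A : ℂ) ^ 2 := lam_sq _ _

theorem bgMat_col (w : PlaneWave) (hA : 0 < w.A) (j : Fin 2) (k : ℂ) :
    bgMat w (k + w.V / 2) (colSign j * w.eigenval k) *ᵥ (fun i => w.E k i j) = 0 := by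
  have hz : w.eigenval k + (k + w.V / 2) ≠ 0 := lam_add_ne_zero hA (eigenval_sq w k)
  fin_cases j
  · have := bgMat_colOne w (eigenval_sq w k) hz
    simpa [colSign, E_col_zero] using this
  · have := bgMat_colTwo w (κ := k + w.V / 2) (ℓ := -w.eigenval k)
      (by rw [neg_sq]; exact eigenval_sq w k) (by rwa [neg_neg])
    simpa [colSign, E_col_one] using this

theorem E_col_ne_zero (w : PlaneWave) (j : Fin 2) (k : ℂ) : (fun i => w.E k i j) ≠ 0 := by
  fin_cases j
  · simpa [E_col_zero] using colOne_ne_zero w _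
  · simpa [E_col_one] using colTwo_ne_zero w _

theorem colSign_sq_mul (j : Fin 2) (w : PlaneWave) (k : ℂ) :
    (colSign j * w.eigenval k) ^ 2 = (k + w.V / 2) ^ 2 + (w.A : ℂ) ^ 2 := by
  rw [mul_pow, eigenval_sq]
  fin_cases j <;> simp [colSign]

theorem exists_isJost {q : ℝ → ℝ → ℂ} {w : PlaneWave} (hq : IsNLSSolution q) (hA : 0 < w.A)
    (has : IsAsymptoticTo q w (Ioi 0)) {j : Fin 2} {k : ℂ}
    (hℓ : 0 ≤ (colSign j * w.eigenval k).im) : ∃ v, IsJost q w atTop j k v := by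
  obtain ⟨v, hx, ht, hv⟩ := exists_lax_tendsto hq has (colSign_sq_mul j w k) hℓ (bgMat_col w hA j k)
  refine ⟨v, hx, ht, fun t => ?_⟩
  simpa only [modify_eq_gauge] using hv t

theorem jostD_eq_of_exists {q : ℝ → ℝ → ℂ} {w : PlaneWave} {l : Filter ℝ} {j : Fin 2} {k : ℂ}
    (h : ∃ v, IsJost q w l j k v) : IsJost q w l j k fun x t => jostD q w l j x t k := by
  have : (fun x t => jostD q w l j x t k) = h.choose := by
    ext x t i
    rw [jostD, dif_pos h]
  rw [this]
  exact h.choose_spec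

theorem gauge_isJost {q : ℝ → ℝ → ℂ} {w : PlaneWave} (hq : IsNLSSolution q) (hA : 0 < w.A)
    (has : IsAsymptoticTo q w (Ioi 0)) {j : Fin 2} {k : ℂ}
    (hℓ : 0 ≤ (colSign j * w.eigenval k).im) {v : ℝ → ℝ → Vec} (hv : IsJost q w atTop j k v)
    (x t : ℝ) : gauge w k (colSign j * w.eigenval k) x t (v x t) =
      jostSeries q w t k (colSign j * w.eigenval k) (fun i => w.E k i j) x :=
  gauge_eq_jostSeries hq has (colSign_sq_mul j w k) hℓ (E_col_ne_zero w j k) (bgMat_col w hA j k)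
    (fun x => hv.lax_x x t) (by simpa only [modify_eq_gauge] using hv.asymp t) x

/-- By uniqueness the choice in the definition of `jostD` is immaterial, and the explicit series may
be used instead. -/
theorem jostD_eq {q : ℝ → ℝ → ℂ} {w : PlaneWave} (hq : IsNLSSolution q) (hA : 0 < w.A)
    (has : IsAsymptoticTo q w (Ioi 0)) {j : Fin 2} {k : ℂ}
    (hℓ : 0 ≤ (colSign j * w.eigenval k).im) (x t : ℝ) :
    jostD q w atTop j x t k = ungauge w k (colSign j * w.eigenval k) x t
      (jostSeries q w t k (colSign j * w.eigenval k) (fun i => w.E k i j) x) := by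
  rw [← gauge_isJost hq hA has hℓ (jostD_eq_of_exists (exists_isJost hq hA has hℓ)), ungauge_gauge]

theorem IsJost.unique {q : ℝ → ℝ → ℂ} {w : PlaneWave} (hq : IsNLSSolution q) (hA : 0 < w.A)
    (has : IsAsymptoticTo q w (Ioi 0)) {j : Fin 2} {k : ℂ}
    (hℓ : 0 ≤ (colSign j * w.eigenval k).im) {v : ℝ → ℝ → Vec} (hv : IsJost q w atTop j k v)
    (x t : ℝ) : v x t = jostD q w atTop j x t k := by
  rw [jostD_eq hq hA has hℓ, ← gauge_isJost hq hA has hℓ hv, ungauge_gauge]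

/-! ### Dependence on the spectral parameter -/

/-- The part of the curve `ℓ² = (k + V/2)² + A²` on which the first Jost solution at `+∞` is
defined. -/
def PlaneWave.curve (w : PlaneWave) : Set (ℂ × ℂ) :=
  {p | p.2 ^ 2 = (p.1 + w.V / 2) ^ 2 + (w.A : ℂ) ^ 2 ∧ 0 ≤ p.2.im}

/-- The first column `dφ₁` at `+∞`, as a function on the spectral curve. -/
def jostFun (q : ℝ → ℝ → ℂ) (w : PlaneWave) (x t : ℝ) (p : ℂ × ℂ) : Vec :=
  ungauge w p.1 p.2 x t (jostSeries q w t p.1 p.2 (colOne w (p.2 + (p.1 + w.V / 2))) x)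

theorem continuousAt_colOne (w : PlaneWave) {z : ℂ} (hz : z ≠ 0) : ContinuousAt (colOne w) z := by
  refine continuousAt_pi.2 fun i => ?_
  fin_cases i
  · exact continuousAt_const
  · exact (continuousAt_const.div continuousAt_id hz).mul continuousAt_const

variable {q : ℝ → ℝ → ℂ} {w : PlaneWave}

theorem PlaneWave.curve_ne_zero (hA : 0 < w.A) {p : ℂ × ℂ} (hp : p ∈ w.curve) :
    p.2 + (p.1 + w.V / 2) ≠ 0 := lam_add_ne_zero hA hp.1

theorem continuousOn_colOne (hA : 0 < w.A) :
    ContinuousOn (fun p : ℂ × ℂ => colOne w (p.2 + (p.1 + w.V / 2))) w.curve := by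
  intro p hp
  exact ((continuousAt_colOne w (PlaneWave.curve_ne_zero hA hp)).comp
    (f := fun p : ℂ × ℂ => p.2 + (p.1 + w.V / 2)) (by fun_prop)).continuousWithinAt

theorem continuous_bgMat_curve (w : PlaneWave) :
    Continuous fun p : ℂ × ℂ => mulCLM (bgMat w (p.1 + w.V / 2) p.2) :=
  (continuous_bgMat w).comp (f := fun p : ℂ × ℂ => (p.1 + w.V / 2, p.2)) (by fun_prop)

theorem continuous_bgProp_curve (w : PlaneWave) (s : ℝ) :
    Continuous fun p : ℂ × ℂ => bgProp w (p.1 + w.V / 2) p.2 s :=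
  (continuous_bgProp w s).comp (f := fun p : ℂ × ℂ => (p.1 + w.V / 2, p.2)) (by fun_prop)

/-- Near a given point of the curve the generator and the leading term are bounded, so one kernel
bound serves for a whole neighbourhood. The points `ℓ = 0` are included. -/
theorem continuousOn_jostSeries (hq : IsNLSSolution q) (hA : 0 < w.A)
    (has : IsAsymptoticTo q w (Ioi 0)) (x t : ℝ) : ContinuousOn (fun p : ℂ × ℂ =>
      jostSeries q w t p.1 p.2 (colOne w (p.2 + (p.1 + w.V / 2))) x) w.curve := by
  have hηc := continuousOn_colOne hA
  have hNc := continuous_bgMat_curve w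
  intro p₀ hp₀
  set R := ‖mulCLM (bgMat w (p₀.1 + w.V / 2) p₀.2)‖ + 1 with hR
  set C := ‖colOne w (p₀.2 + (p₀.1 + w.V / 2))‖ + 1 with hC
  obtain ⟨m, hm⟩ := isVolterraKernel_of_bounded hq has t (x - 1) R
  set S : Set (ℂ × ℂ) := {p | p ∈ w.curve ∧ ‖mulCLM (bgMat w (p.1 + w.V / 2) p.2)‖ ≤ R ∧
    ‖colOne w (p.2 + (p.1 + w.V / 2))‖ ≤ C} with hS
  have hmem : S ∈ 𝓝[w.curve] p₀ := by
    have h1 : ∀ᶠ p in 𝓝[w.curve] p₀, ‖mulCLM (bgMat w (p.1 + w.V / 2) p.2)‖ ≤ R :=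
      (hNc.norm.continuousAt.eventually (ge_mem_nhds (lt_add_one _))).filter_mono
        nhdsWithin_le_nhds
    have h2 : ∀ᶠ p in 𝓝[w.curve] p₀, ‖colOne w (p.2 + (p.1 + w.V / 2))‖ ≤ C :=
      (hηc p₀ hp₀).norm.eventually (ge_mem_nhds (lt_add_one _))
    filter_upwards [self_mem_nhdsWithin, h1, h2] with p a b c using ⟨a, b, c⟩
  have hcont := continuousOn_volterra (S := S) (C := C) (x := x) (m := m)
    (G := fun p : ℂ × ℂ => bgProp w (p.1 + w.V / 2) p.2)
    (N := fun p : ℂ × ℂ => mulCLM (bgMat w (p.1 + w.V / 2) p.2)) (W := pertOp q w t)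
    (η := fun p : ℂ × ℂ => colOne w (p.2 + (p.1 + w.V / 2)))
    (fun p hp => hm _ _ hp.1.1 hp.1.2 hp.2.1)
    (fun s => (continuous_bgProp_curve w s).continuousOn) (hηc.mono fun p hp => hp.1) (fun p hp =>
        hp.2.2)
    (by linarith : x - 1 < x)
  have hp₀S : p₀ ∈ S := ⟨hp₀, (lt_add_one _).le, (lt_add_one _).le⟩
  exact (hcont p₀ hp₀S).mono_of_mem_nhdsWithin hmem

theorem continuousOn_jostFun (hq : IsNLSSolution q) (hA : 0 < w.A)
    (has : IsAsymptoticTo q w (Ioi 0)) (x t : ℝ) : ContinuousOn (jostFun q w x t) w.curve := by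
  have hser := continuousOn_jostSeries hq hA has x t
  have h0 := continuousOn_pi.1 hser 0
  have h1 := continuousOn_pi.1 hser 1
  unfold jostFun ungauge
  refine continuousOn_pi.2 fun i => ?_
  fin_cases i
  · refine ContinuousOn.mul (Continuous.continuousOn ?_) h0
    fun_prop
  · refine ContinuousOn.mul (Continuous.continuousOn ?_) h1
    fun_prop

theorem PlaneWave.mem_cut_iff {k : ℂ} : k ∈ w.cut ↔ k + w.V / 2 ∈ lamCut w.A := by
  have h1 : (k + (w.V : ℂ) / 2).re = k.re + w.V / 2 := by simp
  have h2 : (k + (w.V : ℂ) / 2).im = k.im := by simp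
  rw [PlaneWave.cut, lamCut, mem_ofPred_eq, mem_ofPred_eq, h1, h2]
  constructor
  · rintro ⟨a, b⟩
    exact ⟨by linarith, b⟩
  · rintro ⟨a, b⟩
    exact ⟨by linarith, b⟩

theorem isClosed_cut (w : PlaneWave) : IsClosed w.cut := by
  have : w.cut = (fun k : ℂ => k + w.V / 2) ⁻¹' lamCut w.A := by
    ext k
    exact PlaneWave.mem_cut_iff
  rw [this]
  exact (isClosed_lamCut _).preimage (by fun_prop)

theorem add_half_im (k : ℂ) : (k + (w.V : ℂ) / 2).im = k.im := by simp

theorem eigenval_im_nonneg (hA : 0 < w.A) {k : ℂ} (hk : 0 ≤ k.im) : 0 ≤ (w.eigenval k).im :=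
  lam_im_nonneg hA (by rwa [add_half_im])

theorem eigenval_mem_curve {k : ℂ} (hk : 0 ≤ (w.eigenval k).im) :
    (k, w.eigenval k) ∈ w.curve := ⟨eigenval_sq w k, hk⟩

theorem differentiableAt_eigenval (hA : 0 < w.A) {k : ℂ} (hk : k ∉ w.cut) :
    DifferentiableAt ℂ w.eigenval k :=
  (differentiableAt_lam hA (fun h => hk (PlaneWave.mem_cut_iff.2 h))).comp (f := fun k : ℂ => k +
      w.V / 2) k
    (by fun_prop)

theorem jostD_eq_jostFun (hq : IsNLSSolution q) (hA : 0 < w.A)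
    (has : IsAsymptoticTo q w (Ioi 0)) {k : ℂ} (hk : 0 ≤ (w.eigenval k).im) (x t : ℝ) :
    jostD q w atTop 0 x t k = jostFun q w x t (k, w.eigenval k) := by
  rw [jostD_eq hq hA has (by simpa [colSign] using hk), jostFun, E_col_zero]
  simp [colSign]

/-- The first Jost solution is continuous along every approach on which the eigenvalue is. -/
theorem tendsto_jostD (hq : IsNLSSolution q) (hA : 0 < w.A)
    (has : IsAsymptoticTo q w (Ioi 0)) (x t : ℝ) {l : Filter ℂ} {k₀ ℓ₀ : ℂ} (hl : Tendsto id l (𝓝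
        k₀))
    (hlam : Tendsto w.eigenval l (𝓝 ℓ₀)) (hpos : ∀ᶠ k in l, 0 ≤ k.im) (h0 : (k₀, ℓ₀) ∈ w.curve) :
    Tendsto (fun k => jostD q w atTop 0 x t k) l (𝓝 (jostFun q w x t (k₀, ℓ₀))) := by
  -- The approach is lifted to the curve. Its limit `(k₀, ℓ₀)` may lie on the sheet `ℓ₀ = -λ(k₀)`,
  -- as it does when a cut is approached from the left.
  have h1 : Tendsto (fun k => (k, w.eigenval k)) l (𝓝[w.curve] (k₀, ℓ₀)) := by
    refine tendsto_nhdsWithin_iff.2 ⟨hl.prodMk_nhds hlam, ?_⟩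
    filter_upwards [hpos] with k hk using eigenval_mem_curve (eigenval_im_nonneg hA hk)
  refine ((continuousOn_jostFun hq hA has x t (k₀, ℓ₀) h0).tendsto.comp h1).congr' ?_
  filter_upwards [hpos] with k hk
  exact (jostD_eq_jostFun hq hA has (eigenval_im_nonneg hA hk) x t).symm

theorem differentiableOn_vec_two {U : Set ℂ} {a b : ℂ → ℂ} (ha : DifferentiableOn ℂ a U)
    (hb : DifferentiableOn ℂ b U) : DifferentiableOn ℂ (fun k => (![a k, b k] : Vec)) U := by
  refine differentiableOn_pi.2 fun i => ?_
  fin_cases i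
  · exact ha
  · exact hb

theorem differentiableOn_jostD (hq : IsNLSSolution q) (hA : 0 < w.A)
    (has : IsAsymptoticTo q w (Ioi 0)) (x t : ℝ) :
    DifferentiableOn ℂ (fun k => jostD q w atTop 0 x t k) {k | 0 < k.im ∧ k ∉ w.cut} := by
  set U : Set ℂ := {k | 0 < k.im ∧ k ∉ w.cut} with hU
  have hUo : IsOpen U := (isOpen_lt continuous_const Complex.continuous_im).inter
    (isClosed_cut w).isOpen_compl
  have hlam : DifferentiableOn ℂ w.eigenval U := fun k hk =>
    (differentiableAt_eigenval hA hk.2).differentiableWithinAt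
  have hz : ∀ k, w.eigenval k + (k + w.V / 2) ≠ 0 := fun k => lam_add_ne_zero hA (eigenval_sq w k)
  have hη : DifferentiableOn ℂ (fun k => colOne w (w.eigenval k + (k + w.V / 2))) U := by
    unfold colOne
    exact differentiableOn_vec_two (differentiableOn_const _)
      (((differentiableOn_const _).div (hlam.add (by fun_prop)) (fun k _ => hz k)).mul
        (differentiableOn_const _))
  have hNc : ContinuousOn (fun k => mulCLM (bgMat w (k + w.V / 2) (w.eigenval k))) U :=
    (continuous_bgMat w).comp_continuousOn (f := fun k : ℂ => (k + w.V / 2, w.eigenval k))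
      (ContinuousOn.prodMk (by fun_prop) hlam.continuousOn)
  have hser : DifferentiableOn ℂ (fun k => jostSeries q w t k (w.eigenval k)
      (colOne w (w.eigenval k + (k + w.V / 2))) x) U := by
    intro k₀ hk₀
    set R := ‖mulCLM (bgMat w (k₀ + w.V / 2) (w.eigenval k₀))‖ + 1 with hR
    set C := ‖colOne w (w.eigenval k₀ + (k₀ + w.V / 2))‖ + 1 with hC
    obtain ⟨m, hm⟩ := isVolterraKernel_of_bounded hq has t (x - 1) R
    set S : Set ℂ := (U ∩ (fun k => ‖mulCLM (bgMat w (k + w.V / 2) (w.eigenval k))‖) ⁻¹' Iio R) ∩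
      (U ∩ (fun k => ‖colOne w (w.eigenval k + (k + w.V / 2))‖) ⁻¹' Iio C) with hS
    have hSo : IsOpen S := (hNc.norm.isOpen_inter_preimage hUo isOpen_Iio).inter
      (hη.continuousOn.norm.isOpen_inter_preimage hUo isOpen_Iio)
    have hSU : S ⊆ U := fun k hk => hk.1.1
    have hd := differentiableOn_volterra (x := x) (m := m) (C := C) hSo
      (G := fun k => bgProp w (k + w.V / 2) (w.eigenval k))
      (N := fun k => mulCLM (bgMat w (k + w.V / 2) (w.eigenval k))) (W := pertOp q w t)
      (η := fun k => colOne w (w.eigenval k + (k + w.V / 2)))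
      (fun k hk => hm _ _ (eigenval_sq w k) (eigenval_im_nonneg hA (hSU hk).1.le) (le_of_lt hk.1.2))
      (fun s => differentiableOn_bgProp w s (by fun_prop) (hlam.mono hSU)) (hη.mono hSU)
      (fun k hk => le_of_lt hk.2.2) (by linarith : x - 1 < x)
    have hk₀S : k₀ ∈ S := ⟨⟨hk₀, lt_add_one ‖mulCLM (bgMat w (k₀ + w.V / 2) (w.eigenval k₀))‖⟩,
      ⟨hk₀, lt_add_one ‖colOne w (w.eigenval k₀ + (k₀ + w.V / 2))‖⟩⟩
    exact (hd.differentiableAt (hSo.mem_nhds hk₀S)).differentiableWithinAt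
  have hfun : DifferentiableOn ℂ (fun k => jostFun q w x t (k, w.eigenval k)) U := by
    have h0 := differentiableOn_pi.1 hser 0
    have h1 := differentiableOn_pi.1 hser 1
    unfold jostFun ungauge
    refine differentiableOn_vec_two (DifferentiableOn.mul ?_ h0) (DifferentiableOn.mul ?_ h1)
    · exact (by fun_prop : DifferentiableOn ℂ (fun k => Complex.I * w.eigenval k *
        (x - 2 * (k - w.V / 2) * t) - Complex.I * w.f x t) U).cexp
    · exact (by fun_prop : DifferentiableOn ℂ (fun k => Complex.I * w.eigenval k *
        (x - 2 * (k - w.V / 2) * t) + Complex.I * w.f x t) U).cexp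
  exact hfun.congr fun k hk =>
    jostD_eq_jostFun hq hA has (eigenval_im_nonneg hA hk.1.le) x t

/-- On the cut, the continuation from the left of the first column is a multiple of the second
column. -/
theorem jostFun_neg_eigenval (hq : IsNLSSolution q) (hA : 0 < w.A)
    (has : IsAsymptoticTo q w (Ioi 0)) {k : ℂ} (hk : (w.eigenval k).im = 0) (x t : ℝ) :
    jostFun q w x t (k, -w.eigenval k) =
      (-Complex.I * ((w.eigenval k + (k + w.V / 2)) / w.A) * Complex.exp (-(Complex.I * w.δ))) •
        jostD q w atTop 1 x t k := by
  have hz : w.eigenval k + (k + w.V / 2) ≠ 0 := lam_add_ne_zero hA (eigenval_sq w k)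
  have hz' : -w.eigenval k + (k + w.V / 2) ≠ 0 :=
    lam_add_ne_zero hA (by rw [neg_sq]; exact eigenval_sq w k)
  have hAc : (w.A : ℂ) ≠ 0 := by exact_mod_cast hA.ne'
  have hs := eigenval_sq w k
  have e := exp_mul_exp_neg (Complex.I * w.δ)
  -- As `(λ + κ)(-λ + κ) = -A²`, the first column of `E` with `-λ` in place of `λ` is proportional
  -- to the second one with `λ`. Both belong to the same exponent, so their series are proportional
  -- as well.
  have hcol : colOne w (-w.eigenval k + (k + w.V / 2)) =
      (-Complex.I * ((w.eigenval k + (k + w.V / 2)) / w.A) * Complex.exp (-(Complex.I * w.δ))) •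
        colTwo w (w.eigenval k + (k + w.V / 2)) := by
    generalize k + (w.V : ℂ) / 2 = κ at *
    generalize w.eigenval k = ℓ at *
    ext i
    fin_cases i
    · change 1 = -Complex.I * ((ℓ + κ) / w.A) * Complex.exp (-(Complex.I * w.δ)) *
        (Complex.I * w.A / (ℓ + κ) * Complex.exp (Complex.I * w.δ))
      have : -Complex.I * ((ℓ + κ) / w.A) * Complex.exp (-(Complex.I * w.δ)) *
        (Complex.I * w.A / (ℓ + κ) * Complex.exp (Complex.I * w.δ)) = -Complex.I ^ 2 *
        (Complex.exp (Complex.I * w.δ) * Complex.exp (-(Complex.I * w.δ))) := by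
        field_simp
      rw [this, e, Complex.I_sq]
      ring
    · change Complex.I * w.A / (-ℓ + κ) * Complex.exp (-(Complex.I * w.δ)) =
        -Complex.I * ((ℓ + κ) / w.A) * Complex.exp (-(Complex.I * w.δ)) * 1
      have : Complex.I * w.A / (-ℓ + κ) = -Complex.I * ((ℓ + κ) / w.A) := by
        field_simp
        linear_combination -hs
      rw [this, mul_one]
  have h2 : ∀ c : ℂ, ∀ u : Vec, ungauge w k (-w.eigenval k) x t (c • u)
      = c • ungauge w k (-w.eigenval k) x t u := by
    intro c u
    ext i
    fin_cases i <;> simp [ungauge] <;> ring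
  rw [jostFun, hcol, jostSeries, volterra_smul, h2, jostD_eq hq hA has (by simp [colSign, hk]),
    E_col_one]
  simp [colSign, jostSeries]

/-- A zero at one point would propagate along the whole line, against the nonzero limit. -/
theorem IsJost.ne_zero {j : Fin 2} {l : Filter ℝ} [l.NeBot] (hq : IsNLSSolution q)
    {k : ℂ} {v : ℝ → ℝ → Vec} (hv : IsJost q w l j k v) (x t : ℝ) : v x t ≠ 0 := by
  intro h0
  have hall : ∀ y, v y t = 0 := fun y =>
    eq_of_linear_ode (A := fun x => mulCLM (laxX q x t k)) (v := fun _ => 0)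
      (Continuous.comp (g := fun p : ℝ × ℝ => mulCLM (laxX q p.1 p.2 k)) (f := fun x => (x, t))
        (continuous_laxX hq k) (continuous_id.prodMk continuous_const))
      (fun y => hv.lax_x y t) (fun y => by simpa using hasDerivAt_const y (0 : Vec)) (a := x) h0 y
  have h1 := hv.asymp t
  simp only [hall, modify, Matrix.mulVec_zero, smul_zero] at h1
  exact E_col_ne_zero w j k (tendsto_nhds_unique h1 tendsto_const_nhds).symm.symm

/-! ### The normalizing factor `d` -/

section NormalizingFactor

variable {w : PlaneWave}

/-- The quantity `z = λ + (k + V/2)`. -/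
def PlaneWave.z (w : PlaneWave) (k : ℂ) : ℂ := w.eigenval k + (k + w.V / 2)

theorem z_ne_zero (hA : 0 < w.A) (k : ℂ) : w.z k ≠ 0 := lam_add_ne_zero hA (eigenval_sq w k)

theorem one_add_sq_div {A : ℝ} (hA : 0 < A) {κ ℓ : ℂ} (h : ℓ ^ 2 = κ ^ 2 + (A : ℂ) ^ 2) :
    1 - (Complex.I * A / (ℓ + κ)) ^ 2 = 2 * ℓ / (ℓ + κ) := by
  have hz := lam_add_ne_zero hA h
  field_simp
  rw [Complex.I_sq]
  linear_combination -h

theorem det_E (hA : 0 < w.A) (k : ℂ) : (w.E k).det = 2 * w.eigenval k / w.z k := by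
  have e := exp_mul_exp_neg (Complex.I * w.δ)
  rw [E_eq, Matrix.det_fin_two_of, PlaneWave.z, ← one_add_sq_div hA (eigenval_sq w k)]
  linear_combination (-(Complex.I * w.A / (w.eigenval k + (k + w.V / 2))) ^ 2) * e

theorem re_div_pos {a b : ℂ} (h : 0 < (a * conj b).re) : 0 < (a / b).re := by
  have hb : b ≠ 0 := by
    rintro rfl
    simp at h
  have e : a / b = a * conj b * ((Complex.normSq b)⁻¹ : ℝ) := by
    rw [div_eq_mul_inv, Complex.inv_def, mul_assoc, Complex.ofReal_inv]
  rw [e, Complex.re_mul_ofReal]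
  exact mul_pos h (inv_pos.2 (Complex.normSq_pos.2 hb))

/-- `det E = 2λ/z` with `z = λ + κ`, and `Re (λ z̄) = |λ|² + Re (λ κ̄)`. Hence the principal root in
`d` stays away from its cut. -/
theorem det_E_re_pos (hA : 0 < w.A) {k : ℂ} (h : w.eigenval k ≠ 0) : 0 < ((w.E k).det).re := by
  rw [det_E hA]
  refine re_div_pos ?_
  have h1 := lam_mul_conj_re_nonneg hA (k + w.V / 2)
  have h2 : (w.eigenval k * conj (w.eigenval k)).re = Complex.normSq (w.eigenval k) := by
    rw [Complex.mul_conj, Complex.ofReal_re]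
  have h3 := Complex.normSq_pos.2 h
  have e : 2 * w.eigenval k * conj (w.z k) = ((2 : ℝ) : ℂ) * (w.eigenval k * conj (w.eigenval k)
      + w.eigenval k * conj (k + w.V / 2)) := by
    rw [PlaneWave.z, map_add]
    push_cast
    ring
  rw [e, Complex.re_ofReal_mul, Complex.add_re, h2]
  change 0 ≤ (w.eigenval k * conj (k + w.V / 2)).re at h1
  linarith

theorem mem_slitPlane_of_re_pos {z : ℂ} (h : 0 < z.re) : z ∈ Complex.slitPlane := Or.inl h

theorem d_sq (hA : 0 < w.A) (k : ℂ) : w.d k ^ 2 = 2 * w.eigenval k / w.z k := by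
  rw [PlaneWave.d, principalSqrt_sq, det_E hA]

theorem d_ne_zero (hA : 0 < w.A) {k : ℂ} (h : w.eigenval k ≠ 0) : w.d k ≠ 0 := by
  intro h0
  have := d_sq hA k
  rw [h0, zero_pow two_ne_zero, eq_comm, div_eq_zero_iff] at this
  rcases this with h1 | h1
  · exact h (by simpa using h1)
  · exact z_ne_zero hA k h1

theorem tendsto_det_E (hA : 0 < w.A) {l : Filter ℂ} {k₀ ℓ₀ : ℂ} (hl : Tendsto id l (𝓝 k₀))
    (hlam : Tendsto w.eigenval l (𝓝 ℓ₀)) (h : ℓ₀ ^ 2 = (k₀ + w.V / 2) ^ 2 + (w.A : ℂ) ^ 2) :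
    Tendsto (fun k => (w.E k).det) l (𝓝 (2 * ℓ₀ / (ℓ₀ + (k₀ + w.V / 2)))) := by
  simp only [det_E hA]
  exact (hlam.const_mul 2).div (hlam.add (hl.add_const _)) (lam_add_ne_zero hA h)

theorem tendsto_d (hA : 0 < w.A) {l : Filter ℂ} {k₀ : ℂ} (hl : Tendsto id l (𝓝 k₀))
    (hlam : Tendsto w.eigenval l (𝓝 (w.eigenval k₀))) (h : w.eigenval k₀ ≠ 0) :
    Tendsto w.d l (𝓝 (w.d k₀)) := by
  have h1 := tendsto_det_E hA hl hlam (eigenval_sq w k₀)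
  change Tendsto (fun k => (w.E k).det) l (𝓝 (2 * w.eigenval k₀ / w.z k₀)) at h1
  rw [← det_E hA] at h1
  exact (continuousAt_principalSqrt (mem_slitPlane_of_re_pos (det_E_re_pos hA h))).tendsto.comp h1

theorem differentiableAt_d (hA : 0 < w.A) {k : ℂ} (hk : k ∉ w.cut) (h : w.eigenval k ≠ 0) :
    DifferentiableAt ℂ w.d k := by
  have h1 : DifferentiableAt ℂ (fun k => (w.E k).det) k := by
    have hd := differentiableAt_eigenval hA hk
    have e : (fun k => (w.E k).det) = fun k => 2 * w.eigenval k / (w.eigenval k + (k + w.V / 2)) :=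
      funext fun k => det_E hA k
    rw [e]
    exact (hd.const_mul 2).div (hd.add (by fun_prop)) (z_ne_zero hA k)
  exact h1.cpow_const (mem_slitPlane_of_re_pos (det_E_re_pos hA h))

theorem eigenval_ne_zero (hA : 0 < w.A) {k : ℂ} (hk : k ∉ w.cut) : w.eigenval k ≠ 0 := by
  intro h0
  have := lam_mul_conj_re hA (fun h => hk (PlaneWave.mem_cut_iff.2 h))
  change 0 < (w.eigenval k * _).re at this
  rw [h0, zero_mul, Complex.zero_re] at this
  exact lt_irrefl _ this

theorem conj_half (V : ℝ) : conj ((V : ℂ) / 2) = (V : ℂ) / 2 := by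
  rw [map_div₀, Complex.conj_ofReal, map_ofNat]

/-- On the open cut, `z z̄ = A²`. -/
theorem eigenval_of_mem_cut {k : ℂ} (h0 : k.re = -(w.V / 2)) (h1 : -w.A < k.im) (h2 : k.im < w.A) :
    0 < (w.eigenval k).re ∧ (w.eigenval k).im = 0 ∧ 0 < (w.z k).re ∧
      w.z k * conj (w.z k) = (w.A : ℂ) ^ 2 ∧ (-w.eigenval k + (k + w.V / 2)) * w.z k = -(w.A : ℂ) ^
          2 := by
  have hre : (k + (w.V : ℂ) / 2).re = 0 := by simp [h0]
  obtain ⟨a, b⟩ := lam_of_mem_cut (A := w.A) hre (by rwa [add_half_im]) (by rwa [add_half_im])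
  have a' : 0 < (w.eigenval k).re := a
  have b' : (w.eigenval k).im = 0 := b
  have c1 : conj (w.eigenval k) = w.eigenval k := Complex.conj_eq_iff_im.2 b'
  have c2 : conj (k + (w.V : ℂ) / 2) = -(k + (w.V : ℂ) / 2) := by
    apply Complex.ext
    · rw [Complex.conj_re, Complex.neg_re, hre, neg_zero]
    · rw [Complex.conj_im, Complex.neg_im]
  have hs := eigenval_sq w k
  refine ⟨a', b', ?_, ?_, ?_⟩
  · rw [PlaneWave.z, Complex.add_re, hre, add_zero]
    exact a'
  · rw [PlaneWave.z, map_add, c1, c2]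
    linear_combination hs
  · rw [PlaneWave.z]
    linear_combination -hs

/-- On the left `λ` changes sign and `z` becomes `-A²/z`, so `d²` acquires the factor `z²/A²`. For
the sign put `s = √z`: since `z z̄ = A²`, `d` is a positive multiple of `s̄` and `dz/A` a positive
multiple of `s`, both with positive real part. -/
theorem tendsto_d_left (hA : 0 < w.A) {l : Filter ℂ} {k₀ : ℂ} (h0 : k₀.re = -(w.V / 2))
    (h1 : -w.A < k₀.im) (h2 : k₀.im < w.A) (hl : Tendsto id l (𝓝 k₀))
    (hlam : Tendsto w.eigenval l (𝓝 (-w.eigenval k₀))) :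
    Tendsto w.d l (𝓝 (w.d k₀ * (w.z k₀ / w.A))) := by
  obtain ⟨a, b, c, e, e'⟩ := eigenval_of_mem_cut h0 h1 h2
  have hAc : (w.A : ℂ) ≠ 0 := by exact_mod_cast hA.ne'
  have hz := z_ne_zero hA k₀
  set s := principalSqrt (w.z k₀) with hs
  have hs2 : s ^ 2 = w.z k₀ := principalSqrt_sq _
  have hspos : 0 < s.re := principalSqrt_re_pos (mem_slitPlane_of_re_pos c)
  set r : ℝ := Real.sqrt (2 * (w.eigenval k₀).re) with hr
  have hr0 : 0 < r := Real.sqrt_pos.2 (by linarith)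
  have hr2 : (r : ℂ) ^ 2 = 2 * w.eigenval k₀ := by
    have : w.eigenval k₀ = ((w.eigenval k₀).re : ℂ) := Complex.ext (by simp) (by simp [b])
    rw [this, ← Complex.ofReal_pow, hr, Real.sq_sqrt (by linarith)]
    push_cast
    simp
  have hd : w.d k₀ = ((r / w.A : ℝ) : ℂ) * conj s := by
    refine principalSqrt_eq ?_ ?_
    · rw [det_E hA, mul_pow, ← map_pow, hs2, Complex.ofReal_div, div_pow, hr2]
      field_simp
      linear_combination (w.eigenval k₀) * e
    · rw [Complex.re_ofReal_mul, Complex.conj_re]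
      positivity
  have h3 := tendsto_det_E hA hl hlam (by rw [neg_sq]; exact eigenval_sq w k₀)
  have hq : principalSqrt (2 * -w.eigenval k₀ / (-w.eigenval k₀ + (k₀ + w.V / 2)))
      = w.d k₀ * (w.z k₀ / w.A) ∧ 0 < (w.d k₀ * (w.z k₀ / w.A)).re := by
    have hne : -w.eigenval k₀ + (k₀ + w.V / 2) ≠ 0 :=
      lam_add_ne_zero hA (by rw [neg_sq]; exact eigenval_sq w k₀)
    have hpos : 0 < (w.d k₀ * (w.z k₀ / w.A)).re := by
      have : w.d k₀ * (w.z k₀ / w.A) = ((r / w.A ^ 2 * Complex.normSq s : ℝ) : ℂ) * s := by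
        rw [hd, ← hs2, Complex.ofReal_mul, ← Complex.mul_conj]
        push_cast
        field_simp
      rw [this, Complex.re_ofReal_mul]
      have := Complex.normSq_pos.2 (fun h : s = 0 => hspos.ne' (by rw [h, Complex.zero_re]))
      positivity
    refine ⟨principalSqrt_eq ?_ hpos, hpos⟩
    rw [mul_pow, d_sq hA, div_pow]
    generalize -w.eigenval k₀ + (k₀ + (w.V : ℂ) / 2) = y at *
    rw [div_mul_div_comm, div_eq_div_iff (mul_ne_zero hz (pow_ne_zero 2 hAc)) hne]
    linear_combination (2 * w.eigenval k₀ * w.z k₀) * e'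
  have hslit : 2 * -w.eigenval k₀ / (-w.eigenval k₀ + (k₀ + w.V / 2)) ∈ Complex.slitPlane := by
    rw [← principalSqrt_sq (2 * -w.eigenval k₀ / _), hq.1]
    exact sq_mem_slitPlane hq.2
  have := (continuousAt_principalSqrt hslit).tendsto.comp h3
  rw [hq.1] at this
  exact this

theorem eigenval_conj (hA : 0 < w.A) (k : ℂ) : w.eigenval (conj k) = conj (w.eigenval k) := by
  rw [PlaneWave.eigenval, PlaneWave.eigenval, ← lam_conj hA, map_add, conj_half]

theorem z_conj (hA : 0 < w.A) (k : ℂ) : w.z (conj k) = conj (w.z k) := by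
  rw [PlaneWave.z, PlaneWave.z, eigenval_conj hA, map_add, map_add, conj_half]

theorem d_conj (hA : 0 < w.A) (k : ℂ) : w.d (conj k) = conj (w.d k) := by
  by_cases h : w.eigenval k = 0
  · have h' : w.eigenval (conj k) = 0 := by rw [eigenval_conj hA, h, map_zero]
    have h1 : w.d k ^ 2 = 0 := by rw [d_sq hA, h, mul_zero, zero_div]
    have h2 : w.d (conj k) ^ 2 = 0 := by rw [d_sq hA, h', mul_zero, zero_div]
    rw [pow_eq_zero_iff two_ne_zero] at h1 h2
    rw [h1, h2, map_zero]
  · refine principalSqrt_eq ?_ ?_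
    · rw [← map_pow, d_sq hA, det_E hA, eigenval_conj hA, z_conj hA, map_div₀, map_mul, map_ofNat]
    · rw [Complex.conj_re]
      exact principalSqrt_re_pos (mem_slitPlane_of_re_pos (det_E_re_pos hA h))

/-! ### One-sided limits of the eigenvalue -/

theorem tendsto_eigenval_right (hA : 0 < w.A) {k : ℂ} (h0 : k.re = -(w.V / 2))
    (h1 : -w.A < k.im) (h2 : k.im < w.A) :
    Tendsto w.eigenval (𝓝[{k | -(w.V / 2) < k.re}] k) (𝓝 (w.eigenval k)) ∧
    Tendsto w.eigenval (𝓝[{k | k.re < -(w.V / 2)}] k) (𝓝 (-w.eigenval k)) := by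
  have hre : (k + (w.V : ℂ) / 2).re = 0 := by simp [h0]
  obtain ⟨a, b⟩ := tendsto_lam_right hA hre (by rwa [add_half_im]) (by rwa [add_half_im])
  have hc : Tendsto (fun k : ℂ => k + (w.V : ℂ) / 2) (𝓝 k) (𝓝 (k + (w.V : ℂ) / 2)) :=
    Continuous.tendsto (by fun_prop) k
  constructor
  · refine a.comp (tendsto_nhdsWithin_iff.2 ⟨hc.mono_left nhdsWithin_le_nhds, ?_⟩)
    filter_upwards [self_mem_nhdsWithin] with z hz
    have hz' : -(w.V / 2) < z.re := hz
    change 0 < (z + (w.V : ℂ) / 2).re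
    simp
    linarith
  · refine b.comp (tendsto_nhdsWithin_iff.2 ⟨hc.mono_left nhdsWithin_le_nhds, ?_⟩)
    filter_upwards [self_mem_nhdsWithin] with z hz
    have hz' : z.re < -(w.V / 2) := hz
    change (z + (w.V : ℂ) / 2).re < 0
    simp
    linarith

theorem tendsto_eigenval_of_notMem (hA : 0 < w.A) {k : ℂ} (hk : k ∉ w.cut) :
    Tendsto w.eigenval (𝓝 k) (𝓝 (w.eigenval k)) :=
  (differentiableAt_eigenval hA hk).continuousAt

theorem eigenval_branchPoint (w : PlaneWave) : w.eigenval w.branchPoint = 0 := by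
  refine lam_branch ?_
  rw [PlaneWave.branchPoint]
  linear_combination ((w.A : ℂ) ^ 2) * Complex.I_sq

theorem tendsto_eigenval_branchPoint (w : PlaneWave) :
    Tendsto w.eigenval (𝓝 w.branchPoint) (𝓝 0) := by
  refine (tendsto_lam_branch (A := w.A) (κ := w.branchPoint + w.V / 2) ?_).comp
    (Continuous.tendsto (by fun_prop : Continuous fun k : ℂ => k + (w.V : ℂ) / 2) w.branchPoint)
  rw [PlaneWave.branchPoint]
  linear_combination ((w.A : ℂ) ^ 2) * Complex.I_sq

end NormalizingFactor

/-! ### Limits of the normalized Jost solution -/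

section Limits

variable {q : ℝ → ℝ → ℂ} {w : PlaneWave}

theorem tendsto_jost (hq : IsNLSSolution q) (hA : 0 < w.A)
    (has : IsAsymptoticTo q w (Ioi 0)) (x t : ℝ) {l : Filter ℂ} {k₀ : ℂ} (hl : Tendsto id l (𝓝 k₀))
    (hlam : Tendsto w.eigenval l (𝓝 (w.eigenval k₀))) (hpos : ∀ᶠ k in l, 0 ≤ k.im)
    (hk₀ : 0 ≤ k₀.im) (h : w.eigenval k₀ ≠ 0) :
    Tendsto (fun k => jost q w atTop 0 x t k) l (𝓝 (jost q w atTop 0 x t k₀)) := by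
  have h1 := tendsto_jostD hq hA has x t hl hlam hpos (eigenval_mem_curve (eigenval_im_nonneg hA
      hk₀))
  rw [← jostD_eq_jostFun hq hA has (eigenval_im_nonneg hA hk₀)] at h1
  exact ((tendsto_d hA hl hlam h).inv₀ (d_ne_zero hA h)).smul h1

/-- The factor `z/A` from `tendsto_d_left` cancels the one from `jostFun_neg_eigenval`. The
remaining constant is the source of the factors `i e^{±iδ}` in the jump matrices on `Σ₊`. -/
theorem tendsto_jost_left (hq : IsNLSSolution q) (hA : 0 < w.A)
    (has : IsAsymptoticTo q w (Ioi 0)) (x t : ℝ) {k₀ : ℂ} (hk₀ : k₀ ∈ w.cutUpper) {l : Filter ℂ}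
    (hl : Tendsto id l (𝓝 k₀)) (hlam : Tendsto w.eigenval l (𝓝 (-w.eigenval k₀))) :
    Tendsto (fun k => jost q w atTop 0 x t k) l
      (𝓝 ((-Complex.I * Complex.exp (-(Complex.I * w.δ))) • jost q w atTop 1 x t k₀)) := by
  obtain ⟨h0, h1, h2⟩ := hk₀
  obtain ⟨a, b, c, -⟩ := eigenval_of_mem_cut h0 (by linarith) h2
  have hne : w.eigenval k₀ ≠ 0 := fun h => by rw [h, Complex.zero_re] at a; exact lt_irrefl _ a
  have hd := tendsto_d_left hA h0 (by linarith) h2 hl hlam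
  have hAc : (w.A : ℂ) ≠ 0 := by exact_mod_cast hA.ne'
  have hz := z_ne_zero hA k₀
  have hpos : ∀ᶠ k in l, 0 ≤ k.im := by
    have := (Complex.continuous_im.tendsto k₀).comp hl
    filter_upwards [this.eventually (lt_mem_nhds h1)] with k hk using le_of_lt hk
  have hD := tendsto_jostD hq hA has x t hl hlam hpos
    (⟨by rw [neg_sq]; exact eigenval_sq w k₀, by simp [b]⟩ : (k₀, -w.eigenval k₀) ∈ w.curve)
  rw [jostFun_neg_eigenval hq hA has b] at hD
  have hdne := d_ne_zero hA hne
  have := (hd.inv₀ (mul_ne_zero hdne (div_ne_zero hz hAc))).smul hD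
  refine this.trans (le_of_eq ?_)
  rw [jost, smul_smul, smul_smul]
  congr 2
  change (w.d k₀ * (w.z k₀ / w.A))⁻¹ * (-Complex.I * (w.z k₀ / w.A) * _) = _
  field_simp

theorem differentiableOn_jost (hq : IsNLSSolution q) (hA : 0 < w.A)
    (has : IsAsymptoticTo q w (Ioi 0)) (x t : ℝ) :
    DifferentiableOn ℂ (fun k => jost q w atTop 0 x t k) {k | 0 < k.im ∧ k ∉ w.cut} := by
  have hd : DifferentiableOn ℂ w.d {k | 0 < k.im ∧ k ∉ w.cut} := fun k hk =>
    (differentiableAt_d hA hk.2 (eigenval_ne_zero hA hk.2)).differentiableWithinAt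
  exact (hd.inv fun k hk => d_ne_zero hA (eigenval_ne_zero hA hk.2)).smul
    (differentiableOn_jostD hq hA has x t)

end Limits

/-! ### Large values of the spectral parameter -/

/-- A solution of `f' = c f + F` with `Re c ≥ 0` which vanishes at infinity is bounded by the
integral of the inhomogeneity. -/
theorem norm_le_integral_of_damped {f c F : ℝ → ℂ} {G : ℝ → ℝ} {x : ℝ}
    (hf : ∀ y, HasDerivAt f (c y * f y + F y) y) (hc : Continuous c) (hcr : ∀ y, x ≤ y → 0 ≤ (c
        y).re)
    (hF : Continuous F) (hFG : ∀ y, x ≤ y → ‖F y‖ ≤ G y) (hG : IntegrableOn G (Ioi x))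
    (hlim : Tendsto f atTop (𝓝 0)) : ‖f x‖ ≤ ∫ y in Ioi x, G y := by
  -- The integrating factor `e^{-P}` has modulus at most `1` to the right of `x`, because `Re c ≥
  -- 0`.
  set P : ℝ → ℂ := fun y => ∫ s in x..y, c s with hP
  have hPd : ∀ y, HasDerivAt P (c y) y := fun y => (hc.integral_hasStrictDerivAt x y).hasDerivAt
  have hPc : Continuous P := continuous_iff_continuousAt.2 fun y => (hPd y).continuousAt
  have hPre : ∀ y, x ≤ y → 0 ≤ (P y).re := by
    intro y hy
    have : (P y).re = ∫ s in x..y, (c s).re := by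
      have := Complex.reCLM.intervalIntegral_comp_comm (hc.intervalIntegrable (μ := volume) x y)
      exact this.symm
    rw [this]
    exact intervalIntegral.integral_nonneg hy fun s hs => hcr s hs.1
  have hexp : ∀ y, x ≤ y → ‖Complex.exp (-P y)‖ ≤ 1 := by
    intro y hy
    rw [Complex.norm_exp]
    exact Real.exp_le_one_iff.2 (by simpa using hPre y hy)
  have hbound : ∀ y, x ≤ y → ‖f x‖ ≤ ‖f y‖ + ∫ y in Ioi x, G y := by
    intro y hy
    have h1 : ∀ s ∈ uIcc x y, HasDerivAt (fun s => Complex.exp (-P s) * f s)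
        (Complex.exp (-P s) * F s) s := by
      intro s _
      refine (((hPd s).fun_neg.cexp).mul (hf s)).congr_deriv ?_
      ring
    have h2 := intervalIntegral.integral_eq_sub_of_hasDerivAt h1
      (Continuous.intervalIntegrable (by fun_prop) x y)
    have h3 : P x = 0 := intervalIntegral.integral_same
    rw [h3, neg_zero, Complex.exp_zero, one_mul] at h2
    have h4 : ‖∫ s in x..y, Complex.exp (-P s) * F s‖ ≤ ∫ s in x..y, G s := by
      refine intervalIntegral.norm_integral_le_of_norm_le hy (Eventually.of_forall fun s hs => ?_)
        ((intervalIntegrable_iff_integrableOn_Ioc_of_le hy).2 (hG.mono_set Ioc_subset_Ioi_self))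
      rw [norm_mul]
      calc _ ≤ 1 * ‖F s‖ := mul_le_mul_of_nonneg_right (hexp s hs.1.le) (norm_nonneg _)
        _ ≤ G s := by rw [one_mul]; exact hFG s hs.1.le
    have h5 : ∫ s in x..y, G s ≤ ∫ y in Ioi x, G y := by
      rw [intervalIntegral.integral_of_le hy]
      refine setIntegral_mono_set hG ?_ Ioc_subset_Ioi_self.eventuallyLE
      exact (ae_restrict_mem measurableSet_Ioi).mono fun s hs =>
        (norm_nonneg _).trans (hFG s (le_of_lt hs))
    have h6 : f x = Complex.exp (-P y) * f y - ∫ s in x..y, Complex.exp (-P s) * F s := by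
      rw [h2]; ring
    rw [h6]
    refine (norm_sub_le _ _).trans (add_le_add ?_ (h4.trans h5))
    rw [norm_mul]
    calc _ ≤ 1 * ‖f y‖ := mul_le_mul_of_nonneg_right (hexp y hy) (norm_nonneg _)
      _ = ‖f y‖ := one_mul _
  have hl := hlim.norm.add_const (∫ y in Ioi x, G y)
  rw [norm_zero, zero_add] at hl
  refine ge_of_tendsto hl ?_
  filter_upwards [Ici_mem_atTop x] with y hy using hbound y hy

section LargeParameter

variable {q : ℝ → ℝ → ℂ} {w : PlaneWave}

/-- The potential in the frame of the modified eigenfunctions. -/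
def framed (q : ℝ → ℝ → ℂ) (w : PlaneWave) (x t : ℝ) : ℂ :=
  q x t * Complex.exp (2 * Complex.I * w.f x t)

/-- The `x`-derivative of `framed`. -/
def framedX (q : ℝ → ℝ → ℂ) (w : PlaneWave) (x t : ℝ) : ℂ :=
  (qx q x t + Complex.I * w.V * q x t) * Complex.exp (2 * Complex.I * w.f x t)

theorem hasDerivAt_framed (hq : IsNLSSolution q) (w : PlaneWave) (x t : ℝ) :
    HasDerivAt (fun y => framed q w y t) (framedX q w x t) x := by
  have h1 : HasDerivAt (fun y : ℝ => ((w.f y t : ℝ) : ℂ)) ((1 / 2 * (w.V * 1) : ℝ) : ℂ) x :=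
    ((((hasDerivAt_id x).const_mul w.V).add_const _).const_mul (1 / 2)).ofReal_comp
  refine ((hq.hasDerivAt_x x t).fun_mul (h1.const_mul (2 * Complex.I)).cexp).congr_deriv ?_
  rw [framedX]
  push_cast
  ring

theorem continuous_framed (hq : IsNLSSolution q) (w : PlaneWave) (t : ℝ) :
    Continuous fun x => framed q w x t :=
  continuous_iff_continuousAt.2 fun x => (hasDerivAt_framed hq w x t).continuousAt

theorem continuous_framedX (hq : IsNLSSolution q) (w : PlaneWave) (t : ℝ) :
    Continuous fun x => framedX q w x t := by
  have h1 : Continuous fun x => qx q x t := hq.cont_x.comp (f := fun y => (y, t)) (by fun_prop)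
  have h2 : Continuous fun x => q x t := hq.cont.comp (f := fun y => (y, t)) (by fun_prop)
  have hf : Continuous fun x : ℝ => w.f x t := by unfold PlaneWave.f; fun_prop
  unfold framedX
  fun_prop

theorem framed_eq (q : ℝ → ℝ → ℂ) (w : PlaneWave) (x t : ℝ) :
    framed q w x t = w.A * Complex.exp (Complex.I * w.δ) + pert q w x t := by
  rw [framed, pert]
  ring

theorem norm_framed (q : ℝ → ℝ → ℂ) (w : PlaneWave) (x t : ℝ) : ‖framed q w x t‖ = ‖q x t‖ := by
  rw [framed, norm_mul, norm_exp_two_I_mul, mul_one]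

theorem norm_framedX_le (q : ℝ → ℝ → ℂ) (w : PlaneWave) (x t : ℝ) :
    ‖framedX q w x t‖ ≤ ‖pertX q w x t‖ + |w.V| * ‖q x t - w.q x t‖ := by
  rw [framedX, norm_mul, norm_exp_two_I_mul, mul_one]
  have : qx q x t + Complex.I * w.V * q x t
      = pertX q w x t + Complex.I * w.V * (q x t - w.q x t) := by
    rw [pertX]; ring
  rw [this]
  refine (norm_add_le _ _).trans (add_le_add le_rfl (le_of_eq ?_))
  rw [norm_mul, norm_mul, Complex.norm_I, one_mul, Complex.norm_real, Real.norm_eq_abs]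

theorem conj_framed (q : ℝ → ℝ → ℂ) (w : PlaneWave) (x t : ℝ) :
    conj (framed q w x t) = conj (q x t) * Complex.exp (-(2 * Complex.I * w.f x t)) := by
  rw [framed, map_mul, conj_exp_f]

theorem norm_le_of_tail (hq : IsNLSSolution q) (has : IsAsymptoticTo q w (Ioi 0)) {x y t : ℝ}
    (h : x ≤ y) : ‖q y t‖ ≤ |w.A| + ∫ s in Ioi x, ‖pertX q w s t‖ := by
  have h1 := norm_sub_le_integral hq has y t
  have h2 : ∫ s in Ioi y, ‖pertX q w s t‖ ≤ ∫ s in Ioi x, ‖pertX q w s t‖ :=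
    setIntegral_mono_set (integrableOn_pertX hq has t x).norm
      (Eventually.of_forall fun _ => norm_nonneg _) (Ioi_subset_Ioi h).eventuallyLE
  have h3 := norm_planeWave w y t
  calc ‖q y t‖ = ‖w.q y t + (q y t - w.q y t)‖ := by congr 1; ring
    _ ≤ _ := norm_add_le _ _
    _ ≤ _ := by rw [h3]; linarith

/-- The second component, corrected to leading order, is damped towards infinity. -/
theorem norm_second_component_le (hq : IsNLSSolution q) (hA : 0 < w.A)
    (has : IsAsymptoticTo q w (Ioi 0)) {t a B : ℝ} {k ℓ : ℂ}
    (h : ℓ ^ 2 = (k + w.V / 2) ^ 2 + (w.A : ℂ) ^ 2) (hℓ : 0 ≤ ℓ.im) (hk : 0 ≤ k.im)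
    (hz1 : 1 ≤ ‖ℓ + (k + w.V / 2)‖)
    (hzS : |w.A| + ∫ s in Ioi a, ‖pertX q w s t‖ ≤ ‖ℓ + (k + w.V / 2)‖)
    (hB : ∀ y, a < y → ‖jostSeries q w t k ℓ (colOne w (ℓ + (k + w.V / 2))) y 0‖ ≤ B) {x : ℝ}
    (hx : a < x) :
    ‖jostSeries q w t k ℓ (colOne w (ℓ + (k + w.V / 2))) x 1‖ ≤
      (B * (∫ y in Ioi a, (‖pertX q w y t‖ + (|w.V| + (|w.A| + ∫ s in Ioi a, ‖pertX q w s t‖) *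
        (2 * |w.A| + ∫ s in Ioi a, ‖pertX q w s t‖)) * ‖q y t - w.q y t‖)) +
        B * (|w.A| + ∫ s in Ioi a, ‖pertX q w s t‖)) / ‖ℓ + (k + w.V / 2)‖ := by
  set S : ℝ := |w.A| + ∫ s in Ioi a, ‖pertX q w s t‖ with hS
  have hSA : 2 * |w.A| + ∫ s in Ioi a, ‖pertX q w s t‖ = S + |w.A| := by rw [hS]; ring
  rw [hSA]
  have hzne : ℓ + (k + w.V / 2) ≠ 0 := fun h0 => by
    rw [h0, norm_zero] at hz1; linarith
  have hzim : 0 ≤ (ℓ + (k + w.V / 2)).im := by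
    rw [Complex.add_im, add_half_im]; exact add_nonneg hℓ hk
  obtain ⟨hd, hl⟩ := jostSeries_spec hq has h hℓ (bgMat_colOne w h hzne) t
  have hrel : ℓ - (k + w.V / 2) = (w.A : ℂ) ^ 2 / (ℓ + (k + w.V / 2)) := by
    rw [eq_div_iff hzne]; linear_combination h
  set z : ℂ := ℓ + (k + w.V / 2) with hz
  set μ := jostSeries q w t k ℓ (colOne w z) with hμ
  set Q : ℝ → ℂ := fun y => framed q w y t with hQ
  have hz0 : 0 < ‖z‖ := norm_pos_iff.2 hzne
  have hS0 : 0 ≤ S := add_nonneg (abs_nonneg _) (integral_nonneg fun _ => norm_nonneg _)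
  have hB0 : 0 ≤ B := (norm_nonneg _).trans (hB (a + 1) (by linarith))
  have hd' : ∀ y, HasDerivAt μ ![Complex.I * (k + w.V / 2 - ℓ) * μ y 0 + Q y * μ y 1,
      -conj (Q y) * μ y 0 - Complex.I * z * μ y 1] y := by
    intro y
    refine (hd y).congr_deriv ?_
    rw [gaugeX_eq, mulVec_two, hQ]
    ext i
    fin_cases i
    · rfl
    · simp only [Fin.mk_one, Fin.isValue, Matrix.cons_val_one, conj_framed, hz]
      ring_nf
  have hμ0 : ∀ y, HasDerivAt (fun y => μ y 0)
      (Complex.I * (k + w.V / 2 - ℓ) * μ y 0 + Q y * μ y 1) y := fun y => hasDerivAt_pi.1 (hd' y) 0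
  have hμ1 : ∀ y, HasDerivAt (fun y => μ y 1)
      (-conj (Q y) * μ y 0 - Complex.I * z * μ y 1) y := fun y => hasDerivAt_pi.1 (hd' y) 1
  have hμ0c : Continuous fun y => μ y 0 :=
    continuous_iff_continuousAt.2 fun y => (hμ0 y).continuousAt
  have hQc : Continuous Q := continuous_framed hq w t
  have hQ'c : Continuous fun y => framedX q w y t := continuous_framedX hq w t
  have hcc : Continuous fun z : ℂ => conj z := Complex.continuous_conj
  -- The equation `μ₁' = -izμ₁ - Q̄μ₀` suggests `μ₁ ≈ -Q̄μ₀/(iz)`. Removing this leading term leaves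
  -- an inhomogeneity with a factor `1/z`, built from `Q_x` and `|Q|² - A²`, which are integrable.
  set ν : ℝ → ℂ := fun y => μ y 1 + conj (Q y) / (Complex.I * z) * μ y 0 with hν
  set c : ℝ → ℂ := fun y => -(Complex.I * z) - Complex.I * (Q y * conj (Q y)) / z with hc
  set F : ℝ → ℂ := fun y => -(Complex.I / z) * (conj (framedX q w y t)
    + Complex.I / z * conj (Q y) * (Q y * conj (Q y) - (w.A : ℂ) ^ 2)) * μ y 0 with hF
  have hνd : ∀ y, HasDerivAt ν (c y * ν y + F y) y := by
    intro y
    have hQd := hasDerivAt_conj (hasDerivAt_framed hq w y t)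
    refine ((hμ1 y).fun_add ((hQd.div_const (Complex.I * z)).fun_mul (hμ0 y))).congr_deriv ?_
    have hneg : (k + (w.V : ℂ) / 2 - ℓ) = -((w.A : ℂ) ^ 2 / z) := by rw [← hrel]; ring
    rw [hneg]
    change -conj (Q y) * μ y 0 - Complex.I * z * μ y 1
      + (conj (framedX q w y t) / (Complex.I * z) * μ y 0 + conj (Q y) / (Complex.I * z) *
        (Complex.I * -((w.A : ℂ) ^ 2 / z) * μ y 0 + Q y * μ y 1)) = _
    simp only [hc, hF, hν]
    generalize μ y 0 = m0
    generalize μ y 1 = m1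
    generalize framedX q w y t = g
    generalize Q y = Qy
    have hI : (Complex.I)⁻¹ = -Complex.I := Complex.inv_I
    rw [div_eq_mul_inv (conj g), div_eq_mul_inv (conj Qy), mul_inv, hI]
    field_simp
    ring_nf
    simp only [Complex.I_sq]
    ring_nf
  have hSQ : ∀ y, a ≤ y → ‖Q y‖ ≤ S := fun y hy => by
    rw [hQ]; simp only [norm_framed]; exact norm_le_of_tail hq has hy
  -- The real part is `Im z (1 - |Q|²/|z|²)`. The hypothesis `S ≤ ‖z‖` is there to make this
  -- nonnegative.
  have hcre : ∀ y, x ≤ y → 0 ≤ (c y).re := by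
    intro y hy
    have h1 : (c y).re = z.im * (1 - ‖Q y‖ ^ 2 / ‖z‖ ^ 2) := by
      have e1 : Complex.I * (Q y * conj (Q y)) / z
          = ((‖Q y‖ ^ 2 / ‖z‖ ^ 2 : ℝ) : ℂ) * (Complex.I * conj z) := by
        rw [Complex.mul_conj']
        push_cast
        rw [← Complex.mul_conj' z]
        have : conj z ≠ 0 := (map_ne_zero _).2 hzne
        field_simp
      simp only [hc]
      rw [e1, Complex.sub_re, Complex.re_ofReal_mul]
      simp
      ring
    rw [h1]
    refine mul_nonneg hzim (sub_nonneg.2 ?_)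
    rw [div_le_one (by positivity)]
    exact pow_le_pow_left₀ (norm_nonneg _) ((hSQ y (hx.le.trans hy)).trans hzS) 2
  set G : ℝ → ℝ := fun y => ‖pertX q w y t‖ + (|w.V| + S * (S + |w.A|)) * ‖q y t - w.q y t‖ with hG
  have hGi : IntegrableOn G (Ioi a) := (integrableOn_pertX hq has t a).norm.add
    ((integrableOn_sub hq has t a).norm.const_mul _)
  have hG0 : ∀ y, 0 ≤ G y := fun y => by simp only [hG]; positivity
  have hFG : ∀ y, x ≤ y → ‖F y‖ ≤ B / ‖z‖ * G y := by
    intro y hy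
    have b0 := hB y (hx.trans_le hy)
    have b1 := norm_framedX_le q w y t
    have b2 : ‖conj (Q y) * (Q y * conj (Q y) - (w.A : ℂ) ^ 2)‖
        ≤ S * ((S + |w.A|) * ‖q y t - w.q y t‖) := by
      rw [norm_mul, Complex.norm_conj]
      refine mul_le_mul (hSQ y (hx.le.trans hy)) ?_ (norm_nonneg _) hS0
      have e : Q y * conj (Q y) - (w.A : ℂ) ^ 2 = (((‖Q y‖ + |w.A|) * (‖Q y‖ - |w.A|) : ℝ) : ℂ) :=
          by
        rw [Complex.mul_conj']
        have : w.A ^ 2 = |w.A| ^ 2 := (sq_abs _).symm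
        rw [← Complex.ofReal_pow, ← Complex.ofReal_pow, this]
        push_cast; ring
      rw [e, Complex.norm_real, norm_mul, Real.norm_of_nonneg (by positivity)]
      refine mul_le_mul (add_le_add (hSQ y (hx.le.trans hy)) le_rfl) ?_ (norm_nonneg _)
        (by positivity)
      rw [hQ]
      simp only [norm_framed]
      rw [← norm_planeWave w y t]
      exact abs_norm_sub_norm_le _ _
    have b3 : ‖conj (framedX q w y t)
        + Complex.I / z * conj (Q y) * (Q y * conj (Q y) - (w.A : ℂ) ^ 2)‖ ≤ G y := by
      refine (norm_add_le _ _).trans ?_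
      rw [Complex.norm_conj, mul_assoc, norm_mul, norm_div, Complex.norm_I]
      have : 1 / ‖z‖ ≤ 1 := by rw [div_le_one hz0]; exact hz1
      have := (mul_le_of_le_one_left (norm_nonneg (conj (Q y) * (Q y * conj (Q y)
        - (w.A : ℂ) ^ 2))) this).trans b2
      simp only [hG]
      linarith
    simp only [hF]
    rw [norm_mul, norm_mul, norm_neg, norm_div, Complex.norm_I]
    calc 1 / ‖z‖ * _ * ‖μ y 0‖ ≤ 1 / ‖z‖ * G y * B := by gcongr
      _ = B / ‖z‖ * G y := by ring
  have hνl : Tendsto ν atTop (𝓝 0) := by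
    have h0 := tendsto_pi_nhds.1 hl 0
    have h1 := tendsto_pi_nhds.1 hl 1
    have hQl : Tendsto Q atTop (𝓝 (w.A * Complex.exp (Complex.I * w.δ))) := by
      have : Tendsto (fun y => pert q w y t) atTop (𝓝 0) := by
        refine squeeze_zero_norm (fun y => (norm_pert q w y t).le) ?_
        simpa using (tendsto_sub_zero hq has t).norm
      have := this.const_add (w.A * Complex.exp (Complex.I * w.δ))
      rw [add_zero] at this
      exact this.congr fun y => (framed_eq q w y t).symm
    have hQl' := ((hcc.tendsto _).comp hQl)
    have := h1.add ((hQl'.div_const (Complex.I * z)).mul h0)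
    have e : colOne w z 1 + conj (w.A * Complex.exp (Complex.I * w.δ)) / (Complex.I * z)
        * colOne w z 0 = 0 := by
      change Complex.I * w.A / z * Complex.exp (-(Complex.I * w.δ)) + _ * 1 = 0
      rw [map_mul, conj_exp_mul_I, Complex.conj_ofReal]
      field_simp
      rw [Complex.I_sq]
      ring
    rw [e] at this
    exact this
  have hfin := norm_le_integral_of_damped hνd (by simp only [hc]; fun_prop) hcre
    (by simp only [hF]; fun_prop) hFG ((hGi.mono_set (Ioi_subset_Ioi hx.le)).const_mul _) hνl
  rw [integral_const_mul] at hfin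
  have hmono : ∫ y in Ioi x, G y ≤ ∫ y in Ioi a, G y :=
    setIntegral_mono_set hGi (Eventually.of_forall hG0) (Ioi_subset_Ioi hx.le).eventuallyLE
  have e1 : μ x 1 = ν x - conj (Q x) / (Complex.I * z) * μ x 0 := by simp only [hν]; ring
  rw [e1]
  refine (norm_sub_le _ _).trans ?_
  have e2 : ‖conj (Q x) / (Complex.I * z) * μ x 0‖ ≤ S / ‖z‖ * B := by
    rw [norm_mul, norm_div, norm_mul, Complex.norm_I, one_mul, Complex.norm_conj]
    have := hSQ x hx.le
    have := hB x hx
    gcongr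
  calc ‖ν x‖ + _ ≤ B / ‖z‖ * (∫ y in Ioi a, G y) + S / ‖z‖ * B :=
        add_le_add (hfin.trans (by gcongr)) e2
    _ = _ := by ring

end LargeParameter

section LargeParameter

variable {q : ℝ → ℝ → ℂ} {w : PlaneWave}

theorem norm_exp_I_mul (y : ℝ) : ‖Complex.exp (Complex.I * y)‖ = 1 := by
  rw [mul_comm, Complex.norm_exp_ofReal_mul_I]

theorem norm_exp_neg_I_mul (y : ℝ) : ‖Complex.exp (-(Complex.I * y))‖ = 1 := by
  rw [← conj_exp_mul_I, Complex.norm_conj, norm_exp_I_mul]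

theorem norm_colOne_le {z : ℂ} (hz : |w.A| ≤ ‖z‖) : ‖colOne w z‖ ≤ 1 := by
  refine norm_vec_le ?_ ?_
  · change ‖(1 : ℂ)‖ ≤ 1
    rw [norm_one]
  · change ‖Complex.I * w.A / z * Complex.exp (-(Complex.I * w.δ))‖ ≤ 1
    rw [norm_mul, norm_exp_neg_I_mul, mul_one, norm_div, norm_mul, Complex.norm_I, one_mul,
      Complex.norm_real, Real.norm_eq_abs]
    exact div_le_one_of_le₀ hz (norm_nonneg _)

/-- Size of the eigenvalue and of the generator for large `z = ℓ + κ`. -/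
theorem large_parameter_bounds {κ ℓ : ℂ} (h : ℓ ^ 2 = κ ^ 2 + (w.A : ℂ) ^ 2) (h1 : 1 ≤ ‖ℓ + κ‖)
    (h2 : 2 * |w.A| ≤ ‖ℓ + κ‖) : ‖κ - ℓ‖ ≤ ‖ℓ + κ‖ / 4 ∧ ‖ℓ + κ‖ / 4 ≤ ‖ℓ‖ ∧
      ‖mulCLM (bgMat w κ ℓ)‖ ≤ 3 / 2 * ‖ℓ + κ‖ := by
  have h0 : 0 < ‖ℓ + κ‖ := by linarith
  have e : ‖κ - ℓ‖ * ‖ℓ + κ‖ = |w.A| ^ 2 := by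
    rw [← norm_mul]
    have : (κ - ℓ) * (ℓ + κ) = -(w.A : ℂ) ^ 2 := by linear_combination -h
    rw [this, norm_neg, norm_pow, Complex.norm_real, Real.norm_eq_abs]
  have b1 : ‖κ - ℓ‖ ≤ ‖ℓ + κ‖ / 4 := by
    by_contra! hc
    have : ‖ℓ + κ‖ / 4 * ‖ℓ + κ‖ < |w.A| ^ 2 := by
      rw [← e]; exact mul_lt_mul_of_pos_right hc h0
    nlinarith [abs_nonneg w.A]
  refine ⟨b1, ?_, norm_mulCLM_le _ _ _ _ ?_ ?_⟩
  · have : ‖ℓ + κ‖ ≤ 2 * ‖ℓ‖ + ‖κ - ℓ‖ := by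
      calc ‖ℓ + κ‖ = ‖2 * ℓ + (κ - ℓ)‖ := by congr 1; ring
        _ ≤ ‖2 * ℓ‖ + ‖κ - ℓ‖ := norm_add_le _ _
        _ = _ := by rw [norm_mul, Complex.norm_ofNat]
    linarith
  · rw [norm_mul, norm_mul, Complex.norm_I, norm_exp_I_mul, Complex.norm_real, Real.norm_eq_abs]
    linarith
  · rw [norm_neg, norm_neg, norm_mul, norm_mul, Complex.norm_I, norm_exp_neg_I_mul,
      Complex.norm_real, Real.norm_eq_abs, add_comm κ]
    linarith

/-- The series is bounded uniformly in large `k`, and its second component is of order `1/z` by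
`norm_second_component_le`. In the integral for the first component the propagator is `1 + gN` with
`|g| ≤ 4/|z|`: the second component contributes its own factor `1/z`, while the conjugate potential
enters the first row only through `gN`. Hence the whole integral is of order `1/z`. -/
theorem exists_bound_jostSeries (hq : IsNLSSolution q) (hA : 0 < w.A)
    (has : IsAsymptoticTo q w (Ioi 0)) (x t : ℝ) : ∃ R C : ℝ, ∀ k ℓ : ℂ,
      ℓ ^ 2 = (k + w.V / 2) ^ 2 + (w.A : ℂ) ^ 2 → 0 ≤ ℓ.im → 0 ≤ k.im →
      R ≤ ‖ℓ + (k + w.V / 2)‖ →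
      ‖jostSeries q w t k ℓ (colOne w (ℓ + (k + w.V / 2))) x 0 - 1‖ ≤ C / ‖ℓ + (k + w.V / 2)‖ ∧
      ‖jostSeries q w t k ℓ (colOne w (ℓ + (k + w.V / 2))) x 1‖ ≤ C / ‖ℓ + (k + w.V / 2)‖ := by
  set a := x - 1 with ha
  have hax : a < x := by linarith
  set S : ℝ := |w.A| + ∫ s in Ioi a, ‖pertX q w s t‖ with hS
  -- `‖N‖ ≤ 3|z|/2` and `|ℓ| ≥ |z|/4` give `‖N‖/|ℓ| ≤ 6`, so the propagator is bounded by `1 + 6`.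
  set m : ℝ → ℝ := fun y => 7 * ‖q y t - w.q y t‖ with hm
  set B : ℝ := 2 * 1 * Real.exp (2 * ∫ z in Ioi a, m z) with hB
  set I₀ : ℝ := ∫ y in Ioi a, ‖q y t - w.q y t‖ with hI₀
  set C₁ : ℝ := B * (∫ y in Ioi a, (‖pertX q w y t‖ + (|w.V| + S *
    (2 * |w.A| + ∫ s in Ioi a, ‖pertX q w s t‖)) * ‖q y t - w.q y t‖)) + B * S with hC₁
  have hB0 : 0 < B := by positivity
  refine ⟨max (max 1 (2 * |w.A|)) S, max C₁ ((2 * C₁ + 4 * |w.A| * B) * I₀),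
    fun k ℓ h hℓ hk hR => ?_⟩
  have hz1 : 1 ≤ ‖ℓ + (k + w.V / 2)‖ := ((le_max_left _ _).trans (le_max_left _ _)).trans hR
  have hz2 : 2 * |w.A| ≤ ‖ℓ + (k + w.V / 2)‖ := ((le_max_right _ _).trans (le_max_left _ _)).trans
      hR
  have hzS : S ≤ ‖ℓ + (k + w.V / 2)‖ := (le_max_right _ _).trans hR
  obtain ⟨b1, b2, b3⟩ := large_parameter_bounds h hz1 hz2
  set z := ℓ + (k + w.V / 2) with hz
  have hz0 : 0 < ‖z‖ := by linarith
  have hℓ0 : ℓ ≠ 0 := norm_pos_iff.1 (by linarith)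
  have hker : IsVolterraKernel (bgProp w (k + w.V / 2) ℓ) (mulCLM (bgMat w (k + w.V / 2) ℓ))
      (pertOp q w t) m a := by
    refine ⟨expGroup_zero _, expGroup_add _, hasDerivAt_expGroup _, continuous_pertOp hq w t,
      continuous_const.mul (continuous_diff hq w t).norm, fun y => by positivity,
      (integrableOn_sub hq has t a).norm.const_mul 7, fun s y hs hsy => ?_⟩
    refine mul_le_mul ?_ (norm_pertOp_le q w t y) (norm_nonneg _) (by norm_num)
    refine ((norm_bgProp_le w h hℓ (sub_nonpos.2 hsy)).2 hℓ0).trans ?_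
    have : ‖mulCLM (bgMat w (k + w.V / 2) ℓ)‖ / ‖ℓ‖ ≤ 6 := by
      rw [div_le_iff₀ (norm_pos_iff.2 hℓ0)]
      linarith
    linarith
  obtain ⟨-, -, hcont, hbd, heq⟩ := hker.series (colOne w z)
  have hη1 : ‖colOne w z‖ ≤ 1 := norm_colOne_le (by linarith [abs_nonneg w.A])
  have hbd' : ∀ y ∈ Ioi a, ‖jostSeries q w t k ℓ (colOne w z) y‖ ≤ B := fun y hy =>
    (hbd y hy).trans (by rw [hB]; gcongr)
  have hcomp : ∀ y, a < y → ‖jostSeries q w t k ℓ (colOne w z) y 1‖ ≤ C₁ / ‖z‖ := fun y hy =>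
    norm_second_component_le hq hA has h hℓ hk hz1 hzS
      (fun y hy => (norm_le_pi_norm _ 0).trans (hbd' y hy)) hy
  have hC₁0 : 0 ≤ C₁ := by
    have := (norm_nonneg _).trans (hcomp x hax)
    rw [le_div_iff₀ hz0, zero_mul] at this
    exact this
  refine ⟨?_, (hcomp x hax).trans (by gcongr; exact le_max_left _ _)⟩
  set μ := jostSeries q w t k ℓ (colOne w z) with hμ
  have hint := hker.integrableOn_apply hcont hbd' hax
  have hx : μ x = colOne w z - ∫ y in Ioi x, bgProp w (k + w.V / 2) ℓ (x - y) (pertOp q w t y (μ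
      y)) := by
    rw [sub_eq_add_neg]
    exact heq x hax
  have hx0 : μ x 0 - 1 = -∫ y in Ioi x, bgProp w (k + w.V / 2) ℓ (x - y) (pertOp q w t y (μ y)) 0
      := by
    have hp := (ContinuousLinearMap.proj (R := ℂ) (φ := fun _ : Fin 2 => ℂ) 0).integral_comp_comm
        hint
    have h0 : colOne w z 0 = 1 := rfl
    rw [hx, Pi.sub_apply, h0]
    refine Eq.trans ?_ (congrArg Neg.neg hp.symm)
    rw [sub_sub_cancel_left]
    rfl
  have hNN : mulCLM (bgMat w (k + w.V / 2) ℓ) * mulCLM (bgMat w (k + w.V / 2) ℓ)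
      = (-(2 * Complex.I * ℓ)) • mulCLM (bgMat w (k + w.V / 2) ℓ) := by
    rw [← mulCLM_mul, bgMat_sq w h, map_smul]
  have hpt : ∀ y ∈ Ioi x, ‖bgProp w (k + w.V / 2) ℓ (x - y) (pertOp q w t y (μ y)) 0‖ ≤
      (2 * C₁ + 4 * |w.A| * B) / ‖z‖ * ‖q y t - w.q y t‖ := by
    intro y hy
    have hy' : x < y := hy
    obtain ⟨g, hg, -, hg2⟩ := exists_expGroup_apply hNN hℓ (by linarith : x - y ≤ 0)
    have hg3 : ‖g‖ ≤ 4 / ‖z‖ := by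
      refine (hg2 hℓ0).trans ?_
      rw [inv_le_comm₀ (norm_pos_iff.2 hℓ0) (by positivity), inv_div]
      exact b2
    have c1 := hcomp y (hax.trans hy')
    have c0 : ‖μ y 0‖ ≤ B := (norm_le_pi_norm _ 0).trans (hbd' y (hax.trans hy'))
    have e1 : pertOp q w t y (μ y) = ![pert q w y t * μ y 1, -conj (pert q w y t) * μ y 0] := by
      rw [pertOp, mulCLM_apply, potential, mulVec_two]
      simp
    have e2 : bgProp w (k + w.V / 2) ℓ (x - y) (pertOp q w t y (μ y)) 0 =
        pert q w y t * μ y 1 + g * (Complex.I * (k + w.V / 2 - ℓ) * (pert q w y t * μ y 1)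
          + w.A * Complex.exp (Complex.I * w.δ) * (-conj (pert q w y t) * μ y 0)) := by
      rw [bgProp, hg, e1, mulCLM_apply, bgMat, mulVec_two]
      simp
    rw [e2]
    have n1 : ‖pert q w y t * μ y 1‖ ≤ ‖q y t - w.q y t‖ * (C₁ / ‖z‖) := by
      rw [norm_mul, norm_pert]
      gcongr
    have n2 : ‖-conj (pert q w y t) * μ y 0‖ ≤ ‖q y t - w.q y t‖ * B := by
      rw [norm_mul, norm_neg, Complex.norm_conj, norm_pert]
      gcongr
    have n3 : ‖Complex.I * (k + w.V / 2 - ℓ) * (pert q w y t * μ y 1)‖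
        ≤ ‖z‖ / 4 * (‖q y t - w.q y t‖ * (C₁ / ‖z‖)) := by
      rw [norm_mul, norm_mul, Complex.norm_I, one_mul]
      gcongr
    have n4 : ‖(w.A : ℂ) * Complex.exp (Complex.I * w.δ) * (-conj (pert q w y t) * μ y 0)‖
        ≤ |w.A| * (‖q y t - w.q y t‖ * B) := by
      rw [norm_mul, norm_mul, norm_exp_I_mul, mul_one, Complex.norm_real, Real.norm_eq_abs]
      gcongr
    calc _ ≤ ‖q y t - w.q y t‖ * (C₁ / ‖z‖) + 4 / ‖z‖ * (‖z‖ / 4 * (‖q y t - w.q y t‖ * (C₁ / ‖z‖))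
          + |w.A| * (‖q y t - w.q y t‖ * B)) := by
          refine (norm_add_le _ _).trans (add_le_add n1 ?_)
          rw [norm_mul]
          refine mul_le_mul hg3 ((norm_add_le _ _).trans (add_le_add n3 n4)) (norm_nonneg _)
            (by positivity)
      _ = _ := by
          field_simp
          ring
  rw [hx0, norm_neg]
  refine (norm_integral_le_of_norm_le (((integrableOn_sub hq has t x).norm).const_mul _)
    ((ae_restrict_mem measurableSet_Ioi).mono hpt)).trans ?_
  rw [integral_const_mul]
  have hmono : ∫ y in Ioi x, ‖q y t - w.q y t‖ ≤ I₀ :=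
    setIntegral_mono_set (integrableOn_sub hq has t a).norm
      (Eventually.of_forall fun _ => norm_nonneg _) (Ioi_subset_Ioi hax.le).eventuallyLE
  calc _ ≤ (2 * C₁ + 4 * |w.A| * B) / ‖z‖ * I₀ := by gcongr
    _ = (2 * C₁ + 4 * |w.A| * B) * I₀ / ‖z‖ := by ring
    _ ≤ _ := by gcongr; exact le_max_right _ _

end LargeParameter

/-! ### Asymptotics of the Jost functions and of `d` as `k → ∞`. -/

section Normalization

variable {q : ℝ → ℝ → ℂ} {w : PlaneWave}

theorem isBigO_mul_sub_one {α : Type*} {l : Filter α} {f h g : α → ℂ}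
    (hf : (fun k => f k - 1) =O[l] g) (hh : (fun k => h k - 1) =O[l] g) (hg : Tendsto g l (𝓝 0)) :
    (fun k => f k * h k - 1) =O[l] g := by
  have hh1 : Tendsto h l (𝓝 1) := by
    have := (hh.trans_tendsto hg).add_const 1
    simpa using this
  have e : (fun k => f k * h k - 1) = fun k => (f k - 1) * h k + (h k - 1) := by
    ext k; ring
  rw [e]
  have h1 : (fun k => (f k - 1) * h k) =O[l] fun k => g k * 1 := hf.mul (hh1.isBigO_one ℂ)
  simp only [mul_one] at h1
  exact h1.add hh

theorem isBigO_inv_sub_one {α : Type*} {l : Filter α} {f g : α → ℂ}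
    (hf : (fun k => f k - 1) =O[l] g) (hg : Tendsto g l (𝓝 0)) :
    (fun k => (f k)⁻¹ - 1) =O[l] g := by
  have hf1 : Tendsto f l (𝓝 1) := by
    have := (hf.trans_tendsto hg).add_const 1
    simpa using this
  have hinv : Tendsto (fun k => (f k)⁻¹) l (𝓝 1) := by simpa using hf1.inv₀ one_ne_zero
  have h1 : (fun k => -(f k - 1) * (f k)⁻¹) =O[l] fun k => g k * 1 :=
    hf.neg_left.mul (hinv.isBigO_one ℂ)
  simp only [mul_one] at h1
  refine h1.congr' ?_ EventuallyEq.rfl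
  filter_upwards [hf1.eventually_ne one_ne_zero] with k hk
  field_simp
  ring

theorem tendsto_one_div_cobounded : Tendsto (fun k : ℂ => 1 / k) (Bornology.cobounded ℂ) (𝓝 0) := by
  simpa using tendsto_inv₀_cobounded (α := ℂ)

/-- The closed upper half-plane near infinity. -/
def upperInfinity : Filter ℂ := Bornology.cobounded ℂ ⊓ 𝓟 {k | 0 ≤ k.im}

theorem eventually_norm_z (hA : 0 < w.A) : ∀ᶠ k in Bornology.cobounded ℂ, ‖k‖ / 2 ≤ ‖w.z k‖ := by
  have h1 : ∀ᶠ k : ℂ in Bornology.cobounded ℂ, |w.V| ≤ ‖k‖ :=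
    tendsto_norm_cobounded_atTop.eventually (eventually_ge_atTop _)
  filter_upwards [h1] with k hk
  have h2 : ‖k + (w.V : ℂ) / 2‖ ≤ ‖w.z k‖ := norm_le_norm_lam_add hA _
  have h3 : ‖k‖ ≤ ‖k + (w.V : ℂ) / 2‖ + |w.V| / 2 := by
    calc ‖k‖ = ‖(k + (w.V : ℂ) / 2) - (w.V : ℂ) / 2‖ := by congr 1; ring
      _ ≤ _ := norm_sub_le _ _
      _ = _ := by rw [norm_div (w.V : ℂ), Complex.norm_real, Complex.norm_ofNat, Real.norm_eq_abs]
  linarith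

theorem tendsto_norm_z (hA : 0 < w.A) : Tendsto (fun k => ‖w.z k‖) (Bornology.cobounded ℂ) atTop :=
  tendsto_atTop_mono' _ (eventually_norm_z hA)
    (tendsto_norm_cobounded_atTop.atTop_div_const two_pos)

theorem isBigO_inv_z (hA : 0 < w.A) :
    (fun k => 1 / w.z k) =O[Bornology.cobounded ℂ] fun k : ℂ => 1 / k := by
  refine Asymptotics.IsBigO.of_bound 2 ?_
  have h1 : ∀ᶠ k : ℂ in Bornology.cobounded ℂ, 1 ≤ ‖k‖ :=
    tendsto_norm_cobounded_atTop.eventually (eventually_ge_atTop _)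
  filter_upwards [eventually_norm_z hA, h1] with k hk hk1
  rw [norm_div, norm_div, norm_one, mul_one_div, div_le_div_iff₀ (by linarith) (by linarith)]
  linarith

/-- `(d - 1)(d + 1) = A²/z²`, and `|d + 1| ≥ 1` since `Re d > 0`. -/
theorem isBigO_d_sub_one (hA : 0 < w.A) :
    (fun k => w.d k - 1) =O[Bornology.cobounded ℂ] fun k : ℂ => 1 / k := by
  refine Asymptotics.IsBigO.trans ?_ (isBigO_inv_z (w := w) hA)
  refine Asymptotics.IsBigO.of_bound (|w.A| ^ 2) ?_
  filter_upwards [(tendsto_norm_z hA).eventually (eventually_ge_atTop (max 1 (2 * |w.A|)))] with k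
      hk
  have h1 : 1 ≤ ‖w.z k‖ := (le_max_left _ _).trans hk
  have h2 : 2 * |w.A| ≤ ‖w.z k‖ := (le_max_right _ _).trans hk
  obtain ⟨-, b2, -⟩ := large_parameter_bounds (eigenval_sq w k) h1 h2
  change ‖w.z k‖ / 4 ≤ ‖w.eigenval k‖ at b2
  have hne : w.eigenval k ≠ 0 := norm_pos_iff.1 (by linarith)
  have hpos : 0 < (w.d k).re := principalSqrt_re_pos (mem_slitPlane_of_re_pos (det_E_re_pos hA hne))
  have h3 : 1 ≤ ‖w.d k + 1‖ := by
    refine le_trans ?_ (Complex.re_le_norm _)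
    rw [Complex.add_re, Complex.one_re]
    linarith
  have h4 : (w.d k - 1) * (w.d k + 1) = -(Complex.I * w.A / w.z k) ^ 2 := by
    have e1 := d_sq hA k
    have e2 := one_add_sq_div hA (eigenval_sq w k)
    change 1 - (Complex.I * w.A / w.z k) ^ 2 = 2 * w.eigenval k / w.z k at e2
    linear_combination e1 - e2
  have h5 : ‖w.d k - 1‖ * ‖w.d k + 1‖ = (|w.A| / ‖w.z k‖) ^ 2 := by
    rw [← norm_mul, h4, norm_neg, norm_pow, norm_div, norm_mul, Complex.norm_I, one_mul,
      Complex.norm_real, Real.norm_eq_abs]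
  have h6 : ‖w.d k - 1‖ ≤ (|w.A| / ‖w.z k‖) ^ 2 := by
    rw [← h5]
    exact le_mul_of_one_le_right (norm_nonneg _) h3
  refine h6.trans ?_
  rw [norm_div, norm_one, div_pow, mul_one_div]
  refine div_le_div_of_nonneg_left (by positivity) (by linarith) ?_
  nlinarith

/-- The difference between the phases of the Jost solution and of the normalization. -/
theorem phase_eq (hA : 0 < w.A) (x t : ℝ) (k : ℂ) :
    Complex.I * w.eigenval k * (x - 2 * (k - w.V / 2) * t) - Complex.I * w.f x t
      - Complex.I * thetaO x t k =
    (Complex.I * w.A ^ 2 * (x + t * (2 * w.V + w.A ^ 2 * (1 / w.z k)))) * (1 / w.z k) := by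
  have hz := z_ne_zero hA k
  have hs := eigenval_sq w k
  -- After this substitution the terms of the phase without a factor `1/z` cancel against `f` and
  -- `θ_o`.
  have e1 : w.eigenval k = k + w.V / 2 + (w.A : ℂ) ^ 2 * (1 / w.z k) := by
    have : (w.eigenval k - (k + w.V / 2)) * w.z k = (w.A : ℂ) ^ 2 := by
      rw [PlaneWave.z]; linear_combination hs
    field_simp
    linear_combination 2 * this
  have e2 : w.z k * (1 / w.z k) = 1 := by field_simp
  have e3 : w.z k = 2 * (k + w.V / 2) + (w.A : ℂ) ^ 2 * (1 / w.z k) := by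
    nth_rewrite 1 [PlaneWave.z]
    rw [e1]
    ring
  rw [thetaO, PlaneWave.f, e1]
  push_cast
  generalize 1 / w.z k = y at *
  rw [e3] at e2
  linear_combination (-(Complex.I * w.A ^ 2 * t)) * e2

theorem isBigO_exp_phase (hA : 0 < w.A) (x t : ℝ) :
    (fun k => Complex.exp (Complex.I * w.eigenval k * (x - 2 * (k - w.V / 2) * t)
      - Complex.I * w.f x t - Complex.I * thetaO x t k) - 1)
      =O[Bornology.cobounded ℂ] fun k : ℂ => 1 / k := by
  have hz := isBigO_inv_z (w := w) hA
  have hz0 := hz.trans_tendsto tendsto_one_div_cobounded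
  have hphase : (fun k => Complex.I * w.eigenval k * (x - 2 * (k - w.V / 2) * t)
      - Complex.I * w.f x t - Complex.I * thetaO x t k)
      =O[Bornology.cobounded ℂ] fun k : ℂ => 1 / k := by
    simp only [phase_eq hA]
    have h1 : Tendsto (fun k => Complex.I * w.A ^ 2 * (x + t * (2 * w.V + w.A ^ 2 * (1 / w.z k))))
        (Bornology.cobounded ℂ) (𝓝 (Complex.I * w.A ^ 2 * (x + t * (2 * w.V + w.A ^ 2 * 0)))) :=
      ((((hz0.const_mul _).const_add _).const_mul _).const_add _).const_mul _
    have h2 := (h1.isBigO_one ℂ).mul hz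
    simpa only [one_mul] using h2
  have h0 := hphase.trans_tendsto tendsto_one_div_cobounded
  have hexp : (fun z : ℂ => Complex.exp z - 1) =O[𝓝 0] fun z : ℂ => z := by
    have := (Complex.hasDerivAt_exp 0).isBigO_sub
    simpa using this
  exact (hexp.comp_tendsto h0).trans hphase

/-- The factors `1/d`, the phase difference and the series all tend to their limits at the rate
`1/k`. In the second component the phase differs by `e^{2if}`, which does not depend on `k`. -/
theorem isBigO_jost (hq : IsNLSSolution q) (hA : 0 < w.A)
    (has : IsAsymptoticTo q w (Ioi 0)) (x t : ℝ) :
    (fun k => Complex.exp (-(Complex.I * thetaO x t k)) * jost q w atTop 0 x t k 0 - 1)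
      =O[upperInfinity] (fun k : ℂ => 1 / k) ∧
    (fun k => Complex.exp (-(Complex.I * thetaO x t k)) * jost q w atTop 0 x t k 1)
      =O[upperInfinity] fun k : ℂ => 1 / k := by
  have hle : upperInfinity ≤ Bornology.cobounded ℂ := inf_le_left
  have hg := tendsto_one_div_cobounded.mono_left hle
  have hd := isBigO_inv_sub_one ((isBigO_d_sub_one hA).mono hle) hg
  have hp := (isBigO_exp_phase hA x t).mono hle
  have hdp := isBigO_mul_sub_one hd hp hg
  have him : ∀ᶠ k in upperInfinity, 0 ≤ k.im := mem_inf_of_right (mem_principal_self _)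
  obtain ⟨R, C, hRC⟩ := exists_bound_jostSeries hq hA has x t
  have hlarge : ∀ᶠ k in upperInfinity, R ≤ ‖w.z k‖ :=
    ((tendsto_norm_z hA).mono_left hle).eventually (eventually_ge_atTop R)
  have hz := (isBigO_inv_z (w := w) hA).mono hle
  have h0 : (fun k => jostSeries q w t k (w.eigenval k) (colOne w (w.z k)) x 0 - 1)
      =O[upperInfinity] fun k : ℂ => 1 / k := by
    refine (Asymptotics.IsBigO.of_bound C ?_).trans hz
    filter_upwards [him, hlarge] with k hk hR
    rw [norm_div, norm_one, mul_one_div]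
    exact (hRC k _ (eigenval_sq w k) (eigenval_im_nonneg hA hk) hk hR).1
  have h1 : (fun k => jostSeries q w t k (w.eigenval k) (colOne w (w.z k)) x 1)
      =O[upperInfinity] fun k : ℂ => 1 / k := by
    refine (Asymptotics.IsBigO.of_bound C ?_).trans hz
    filter_upwards [him, hlarge] with k hk hR
    rw [norm_div, norm_one, mul_one_div]
    exact (hRC k _ (eigenval_sq w k) (eigenval_im_nonneg hA hk) hk hR).2
  constructor
  · refine (isBigO_mul_sub_one hdp h0 hg).congr' ?_ EventuallyEq.rfl
    filter_upwards [him] with k hk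
    rw [jost, jostD_eq_jostFun hq hA has (eigenval_im_nonneg hA hk), jostFun, ungauge,
        Pi.smul_apply,
      smul_eq_mul, sub_eq_add_neg _ (Complex.I * thetaO x t k), Complex.exp_add]
    simp only [Matrix.cons_val_zero, PlaneWave.z]
    ring
  · have hdp1 : Tendsto (fun k => (w.d k)⁻¹ * Complex.exp (Complex.I * w.eigenval k *
        (x - 2 * (k - w.V / 2) * t) - Complex.I * w.f x t - Complex.I * thetaO x t k))
        upperInfinity (𝓝 1) := by
      have := (hdp.trans_tendsto hg).add_const 1
      simpa using this
    have h2 := ((hdp1.isBigO_one ℂ).mul h1).const_mul_left (Complex.exp (2 * Complex.I * w.f x t))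
    simp only [one_mul] at h2
    refine h2.congr' ?_ EventuallyEq.rfl
    filter_upwards [him] with k hk
    rw [jost, jostD_eq_jostFun hq hA has (eigenval_im_nonneg hA hk), jostFun, ungauge,
        Pi.smul_apply,
      smul_eq_mul]
    simp only [Matrix.cons_val_one, Matrix.cons_val_zero, PlaneWave.z]
    have e : Complex.exp (2 * Complex.I * w.f x t) * Complex.exp (Complex.I * w.eigenval k *
        (x - 2 * (k - w.V / 2) * t) - Complex.I * w.f x t - Complex.I * thetaO x t k) =
        Complex.exp (-(Complex.I * thetaO x t k)) * Complex.exp (Complex.I * w.eigenval k *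
        (x - 2 * (k - w.V / 2) * t) + Complex.I * w.f x t) := by
      rw [← Complex.exp_add, ← Complex.exp_add]
      congr 1
      ring
    linear_combination ((w.d k)⁻¹ * jostSeries q w t k (w.eigenval k)
      (colOne w (w.eigenval k + (k + w.V / 2))) x 1) * e

end Normalization

/-! ### Reflection in space-time -/

section Reflection

/-- The solution `conj q(-x, -t)` of the same equation. -/
def reflectQ (q : ℝ → ℝ → ℂ) (x t : ℝ) : ℂ := conj (q (-x) (-t))

/-- The plane wave corresponding to `reflectQ`. -/
def PlaneWave.reflect (w : PlaneWave) : PlaneWave := ⟨w.A, w.V, -w.δ⟩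

/-- Exchange of the components. -/
def flip (u : Vec) : Vec := ![u 1, u 0]

theorem flip_flip (u : Vec) : flip (flip u) = u := by
  ext i
  fin_cases i <;> rfl

theorem reflectQ_reflectQ (q : ℝ → ℝ → ℂ) : reflectQ (reflectQ q) = q := by
  ext x t
  simp [reflectQ]

theorem PlaneWave.reflect_reflect (w : PlaneWave) : w.reflect.reflect = w := by
  cases w
  simp [PlaneWave.reflect]

theorem PlaneWave.reflect_q (w : PlaneWave) : w.reflect.q = reflectQ w.q := by
  ext x t
  simp only [PlaneWave.q, reflectQ, map_mul, Complex.conj_ofReal, ← Complex.exp_conj, map_add,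
    map_neg, Complex.conj_I, map_ofNat, PlaneWave.reflect, PlaneWave.f]
  push_cast
  ring_nf

variable {q : ℝ → ℝ → ℂ} {w : PlaneWave}

theorem hasDerivAt_reflect {f : ℝ → ℂ} {f' : ℂ} {x : ℝ} (h : HasDerivAt f f' (-x)) :
    HasDerivAt (fun y => conj (f (-y))) (-conj f') x := by
  have h1 := h.scomp x (hasDerivAt_neg x)
  have h2 := hasDerivAt_conj h1
  refine h2.congr_deriv ?_
  simp

theorem reflectQ_hasDerivAt_x (hq : IsNLSSolution q) (x t : ℝ) :
    HasDerivAt (fun y => reflectQ q y t) (-conj (qx q (-x) (-t))) x :=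
  hasDerivAt_reflect (f := fun y => q y (-t)) (hq.hasDerivAt_x (-x) (-t))

theorem qx_reflectQ (hq : IsNLSSolution q) (x t : ℝ) :
    qx (reflectQ q) x t = -conj (qx q (-x) (-t)) := (reflectQ_hasDerivAt_x hq x t).deriv

theorem reflectQ_hasDerivAt_xx (hq : IsNLSSolution q) (x t : ℝ) :
    HasDerivAt (fun y => qx (reflectQ q) y t) (conj (qxx q (-x) (-t))) x := by
  simp only [qx_reflectQ hq]
  have := (hasDerivAt_reflect (f := fun y => qx q y (-t)) (hq.hasDerivAt_xx (-x) (-t))).fun_neg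
  rwa [neg_neg] at this

theorem qxx_reflectQ (hq : IsNLSSolution q) (x t : ℝ) :
    qxx (reflectQ q) x t = conj (qxx q (-x) (-t)) := (reflectQ_hasDerivAt_xx hq x t).deriv

theorem reflectQ_hasDerivAt_t (hq : IsNLSSolution q) (x t : ℝ) :
    HasDerivAt (fun s => reflectQ q x s) (-conj (qt q (-x) (-t))) t :=
  hasDerivAt_reflect (f := fun s => q (-x) s) (hq.hasDerivAt_t (-x) (-t))

theorem qt_reflectQ (hq : IsNLSSolution q) (x t : ℝ) :
    qt (reflectQ q) x t = -conj (qt q (-x) (-t)) := (reflectQ_hasDerivAt_t hq x t).deriv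

theorem isNLSSolution_reflectQ (hq : IsNLSSolution q) : IsNLSSolution (reflectQ q) := by
  have hn : Continuous fun p : ℝ × ℝ => (-p.1, -p.2) := by fun_prop
  have hcc : Continuous fun z : ℂ => conj z := Complex.continuous_conj
  refine ⟨fun x t => (reflectQ_hasDerivAt_x hq x t).differentiableAt,
    fun x t => (reflectQ_hasDerivAt_xx hq x t).differentiableAt,
    fun x t => (reflectQ_hasDerivAt_t hq x t).differentiableAt, hcc.comp (hq.cont.comp hn), ?_, ?_,
    ?_, fun x t => ?_⟩
  · simp only [qx_reflectQ hq]
    exact (hcc.comp (hq.cont_x.comp hn)).neg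
  · simp only [qxx_reflectQ hq]
    exact hcc.comp (hq.cont_xx.comp hn)
  · simp only [qt_reflectQ hq]
    exact (hcc.comp (hq.cont_t.comp hn)).neg
  · have := congrArg (starRingEnd ℂ) (hq.eqn (-x) (-t))
    simp only [map_add, map_mul, map_pow, Complex.conj_I, Complex.conj_ofReal, map_ofNat,
      map_zero] at this
    rw [qt_reflectQ hq, qxx_reflectQ hq, reflectQ, Complex.norm_conj]
    linear_combination this

theorem integrableOn_comp_neg {E : Type*} [NormedAddCommGroup E] {f : ℝ → E}
    (h : IntegrableOn f (Iio 0)) : IntegrableOn (fun x => f (-x)) (Ioi 0) := by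
  have := ((Measure.measurePreserving_neg (volume : Measure ℝ)).integrableOn_comp_preimage
    (MeasurableEquiv.neg ℝ).measurableEmbedding (f := f) (s := Iio 0)).2 h
  have e : (Neg.neg : ℝ → ℝ) ⁻¹' Iio 0 = Ioi 0 := by
    ext x; simp
  rw [e] at this
  exact this

theorem isAsymptoticTo_reflect (hq : IsNLSSolution q) (has : IsAsymptoticTo q w (Iio 0)) :
    IsAsymptoticTo (reflectQ q) w.reflect (Ioi 0) := by
  have hsub : ∀ x t, reflectQ q x t - w.reflect.q x t = conj (q (-x) (-t) - w.q (-x) (-t)) := by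
    intro x t
    rw [PlaneWave.reflect_q, reflectQ, reflectQ, map_sub]
  have hder : ∀ x t, deriv (fun y => reflectQ q y t - w.reflect.q y t) x
      = -conj (deriv (fun y => q y (-t) - w.q y (-t)) (-x)) := by
    intro x t
    simp only [hsub]
    refine HasDerivAt.deriv (hasDerivAt_reflect (f := fun y => q y (-t) - w.q y (-t)) ?_)
    exact (hq.hasDerivAt_sub w (-x) (-t)).differentiableAt.hasDerivAt
  have hconj : ∀ f : ℝ → ℂ, IntegrableOn f (Ioi 0) → IntegrableOn (fun x => conj (f x)) (Ioi 0) :=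
    fun f hf => Complex.conjCLE.toContinuousLinearMap.integrable_comp hf
  refine ⟨fun t => ?_, fun t => ?_, fun τ => ?_⟩
  · have h1 := hconj _ (integrableOn_comp_neg (has.memL11 (-t)))
    unfold MemL11
    refine h1.congr (Eventually.of_forall fun x => ?_)
    simp only [hsub, map_mul, Complex.conj_ofReal, abs_neg]
  · have h1 := (hconj _ (integrableOn_comp_neg (has.integrable_x (-t)))).neg
    simp only [hder]
    exact h1
  · obtain ⟨C, hC⟩ := has.locally_bounded τ
    refine ⟨C, fun t ht => ?_⟩
    simp only [hder, norm_neg, Complex.norm_conj]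
    have h1 := integral_comp_neg_Ioi 0 (fun x => ‖deriv (fun y => q y (-t) - w.q y (-t)) x‖)
    rw [h1, neg_zero, integral_Iic_eq_integral_Iio]
    exact hC (-t) (by rwa [abs_neg])

theorem eigenval_reflect (w : PlaneWave) (k : ℂ) : w.reflect.eigenval k = w.eigenval k := rfl

theorem d_reflect (hA : 0 < w.A) (k : ℂ) : w.reflect.d k = w.d k := by
  have h1 := det_E hA k
  have h2 := det_E (w := w.reflect) hA k
  rw [PlaneWave.d, PlaneWave.d, h1, h2]
  rfl

theorem hasDerivAt_flip {v : ℝ → Vec} {v' : Vec} {x : ℝ} (h : HasDerivAt v v' (-x)) :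
    HasDerivAt (fun y => flip (v (-y))) (-flip v') x := by
  have h0 := ((hasDerivAt_pi.1 h 0).scomp x (hasDerivAt_neg x))
  have h1 := ((hasDerivAt_pi.1 h 1).scomp x (hasDerivAt_neg x))
  refine (hasDerivAt_vec_two h1 h0).congr_deriv ?_
  ext i
  fin_cases i <;> simp [flip]

/-- Reflection exchanges the two ends and the two columns of the Jost solutions. -/
theorem IsJost.reflect (hq : IsNLSSolution q) {l l' : Filter ℝ} (hl : Tendsto (fun x => -x) l' l)
    {j : Fin 2} {k : ℂ} {v : ℝ → ℝ → Vec} (hv : IsJost q w l j k v) :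
    IsJost (reflectQ q) w.reflect l' (1 - j) k fun x t => flip (v (-x) (-t)) := by
  refine ⟨fun x t => ?_, fun x t => ?_, fun t => ?_⟩
  · refine (hasDerivAt_flip (v := fun y => v y (-t)) (hv.lax_x (-x) (-t))).congr_deriv ?_
    rw [laxX_eq, laxX_eq, mulVec_two, mulVec_two]
    ext i
    fin_cases i <;> simp [flip, reflectQ]
  · refine (hasDerivAt_flip (v := fun s => v (-x) s) (hv.lax_t (-x) (-t))).congr_deriv ?_
    rw [laxT_eq, laxT_eq, mulVec_two, mulVec_two, qx_reflectQ hq]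
    ext i
    fin_cases i <;> simp [flip, reflectQ] <;> ring
  · have h1 := (hv.asymp (-t)).comp hl
    have hf : Continuous flip := by
      unfold flip
      refine continuous_pi fun i => ?_
      fin_cases i
      · exact continuous_apply 1
      · exact continuous_apply 0
    have h2 := (hf.tendsto _).comp h1
    have hE : flip (fun i => w.E k i j) = fun i => w.reflect.E k i (1 - j) := by
      ext i
      fin_cases j <;> fin_cases i <;>
        simp [flip, E_eq, PlaneWave.reflect, PlaneWave.eigenval]
    rw [hE] at h2
    refine h2.congr fun x => ?_
    -- `θ` and `f` are both odd in `(x, t)`. The sign of `θ` is compensated by the change of the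
    -- column and that of `f` by the exchange of the components.
    have hθ : w.reflect.θ x t k = -w.θ (-x) (-t) k := by
      have h0 : w.reflect.θ x t k = w.eigenval k * ((x : ℂ) - 2 * (k - (w.V : ℂ) / 2) * (t : ℂ)) :=
        rfl
      rw [h0, PlaneWave.θ]
      push_cast
      ring
    have hfx : w.reflect.f x t = -w.f (-x) (-t) := by
      simp only [PlaneWave.f, PlaneWave.reflect]
      ring
    have hc : colSign (1 - j) = -colSign j := by fin_cases j <;> simp [colSign]
    simp only [Function.comp, modify, hθ, hfx, hc, expSigma3, mulVec_two]
    ext i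
    fin_cases i <;> simp [flip]

theorem isJost_reflect_iff (hq : IsNLSSolution q) {j : Fin 2} {k : ℂ} :
    (∃ v, IsJost q w atBot j k v) ↔ ∃ v, IsJost (reflectQ q) w.reflect atTop (1 - j) k v := by
  constructor
  · rintro ⟨v, hv⟩
    exact ⟨_, hv.reflect hq tendsto_neg_atTop_atBot⟩
  · rintro ⟨v, hv⟩
    have := hv.reflect (isNLSSolution_reflectQ hq) tendsto_neg_atBot_atTop
    rw [reflectQ_reflectQ, PlaneWave.reflect_reflect, sub_sub_cancel] at this
    exact ⟨_, this⟩

theorem exists_isJost_atBot (hq : IsNLSSolution q) (hA : 0 < w.A)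
    (has : IsAsymptoticTo q w (Iio 0)) {j : Fin 2} {k : ℂ}
    (hℓ : 0 ≤ (colSign (1 - j) * w.eigenval k).im) : ∃ v, IsJost q w atBot j k v :=
  (isJost_reflect_iff hq).2 (exists_isJost (w := w.reflect) (isNLSSolution_reflectQ hq) hA
    (isAsymptoticTo_reflect hq has) hℓ)

theorem IsJost.eq_reflect (hq : IsNLSSolution q) (hA : 0 < w.A)
    (has : IsAsymptoticTo q w (Iio 0)) {j : Fin 2} {k : ℂ}
    (hℓ : 0 ≤ (colSign (1 - j) * w.eigenval k).im) {v : ℝ → ℝ → Vec} (hv : IsJost q w atBot j k v)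
    (x t : ℝ) : v x t = flip (jostD (reflectQ q) w.reflect atTop (1 - j) (-x) (-t) k) := by
  have h1 := hv.reflect hq tendsto_neg_atTop_atBot
  have h2 := h1.unique (w := w.reflect) (isNLSSolution_reflectQ hq) hA
    (isAsymptoticTo_reflect hq has) hℓ (-x) (-t)
  rw [← h2, flip_flip, neg_neg, neg_neg]

theorem IsJost.unique_atBot (hq : IsNLSSolution q) (hA : 0 < w.A)
    (has : IsAsymptoticTo q w (Iio 0)) {j : Fin 2} {k : ℂ}
    (hℓ : 0 ≤ (colSign (1 - j) * w.eigenval k).im) {v : ℝ → ℝ → Vec} (hv : IsJost q w atBot j k v)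
    (x t : ℝ) : v x t = jostD q w atBot j x t k := by
  rw [hv.eq_reflect hq hA has hℓ,
    ← (jostD_eq_of_exists (exists_isJost_atBot hq hA has hℓ)).eq_reflect hq hA has hℓ]

theorem jostD_atBot (hq : IsNLSSolution q) (hA : 0 < w.A)
    (has : IsAsymptoticTo q w (Iio 0)) {j : Fin 2} {k : ℂ}
    (hℓ : 0 ≤ (colSign (1 - j) * w.eigenval k).im) (x t : ℝ) : jostD q w atBot j x t k =
      flip (jostD (reflectQ q) w.reflect atTop (1 - j) (-x) (-t) k) :=
  (jostD_eq_of_exists (exists_isJost_atBot hq hA has hℓ)).eq_reflect hq hA has hℓ x t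

theorem flip_smul (c : ℂ) (u : Vec) : flip (c • u) = c • flip u := by
  ext i
  fin_cases i <;> rfl

theorem jost_atBot (hq : IsNLSSolution q) (hA : 0 < w.A)
    (has : IsAsymptoticTo q w (Iio 0)) {j : Fin 2} {k : ℂ}
    (hℓ : 0 ≤ (colSign (1 - j) * w.eigenval k).im) (x t : ℝ) : jost q w atBot j x t k =
      flip (jost (reflectQ q) w.reflect atTop (1 - j) (-x) (-t) k) := by
  rw [jost, jost, jostD_atBot hq hA has hℓ, flip_smul, d_reflect hA]

end Reflection

/-! ### Complex conjugation -/

section Conjugation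

/-- The vector `J ū`, `J = [[0, 1], [-1, 0]]`. -/
def conjJ (u : Vec) : Vec := ![conj (u 1), -conj (u 0)]

theorem conjJ_smul (c : ℂ) (u : Vec) : conjJ (c • u) = conj c • conjJ u := by
  ext i
  fin_cases i <;> simp [conjJ]

theorem conjJ_conjJ (u : Vec) : conjJ (conjJ u) = -u := by
  ext i
  fin_cases i <;> simp [conjJ]

theorem wronskian_conjJ (u v : Vec) : wronskian (conjJ u) (conjJ v) = conj (wronskian u v) := by
  simp [wronskian, conjJ]
  ring

theorem hasDerivAt_conjJ {v : ℝ → Vec} {v' : Vec} {x : ℝ} (h : HasDerivAt v v' x) :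
    HasDerivAt (fun y => conjJ (v y)) (conjJ v') x :=
  hasDerivAt_vec_two (hasDerivAt_conj (hasDerivAt_pi.1 h 1))
    (hasDerivAt_conj (hasDerivAt_pi.1 h 0)).fun_neg

theorem continuous_conjJ : Continuous conjJ := by
  unfold conjJ
  refine continuous_pi fun i => ?_
  fin_cases i
  · exact Complex.continuous_conj.comp (continuous_apply 1)
  · exact (Complex.continuous_conj.comp (continuous_apply 0)).neg

variable {q : ℝ → ℝ → ℂ} {w : PlaneWave}

/-- Both matrices of the Lax pair at `k̄` are the `J`-conjugates of their values at `k`. The sign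
`-colSign j` occurs because `conjJ` maps the first column of `E(k)` to minus the second one of
`E(k̄)`, but the second one to plus the first. -/
theorem IsJost.conj (hA : 0 < w.A) {l : Filter ℝ} {j : Fin 2} {k : ℂ} {v : ℝ → ℝ → Vec}
    (hv : IsJost q w l j k v) :
    IsJost q w l (1 - j) (conj k) fun x t => (-colSign j) • conjJ (v x t) := by
  have hc : ∀ {f : ℝ → Vec} {f' : Vec} {y : ℝ}, HasDerivAt f f' y →
      HasDerivAt (fun y => (-colSign j) • conjJ (f y)) ((-colSign j) • conjJ f') y := fun h =>
    (hasDerivAt_conjJ h).const_smul (-colSign j)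
  have hf2 : Continuous fun u : Vec => (-colSign j) • conjJ u := (continuous_const_smul (-colSign
      j)).comp continuous_conjJ
  refine ⟨fun x t => (hc (hv.lax_x x t)).congr_deriv ?_, fun x t => (hc (hv.lax_t x t)).congr_deriv
      ?_,
    fun t => ?_⟩
  · rw [Matrix.mulVec_smul]
    congr 1
    rw [laxX_eq, laxX_eq, mulVec_two, mulVec_two]
    ext i
    fin_cases i <;> simp [conjJ] <;> ring
  · rw [Matrix.mulVec_smul]
    congr 1
    rw [laxT_eq, laxT_eq, mulVec_two, mulVec_two]
    ext i
    fin_cases i <;> simp [conjJ, map_ofNat] <;> ring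
  · have h2 := (hf2.tendsto _).comp (hv.asymp t)
    have hE : ((-colSign j) • conjJ fun i => w.E k i j) = fun i => w.E (starRingEnd ℂ k) i (1 - j)
        := by
      have hz := z_conj hA k
      rw [PlaneWave.z, PlaneWave.z] at hz
      have e1 : (starRingEnd ℂ) (Complex.exp (-(Complex.I * w.δ))) = Complex.exp (Complex.I * w.δ)
          := by
        rw [← conj_exp_mul_I, Complex.conj_conj]
      ext i
      fin_cases j <;> fin_cases i <;>
        simp [conjJ, E_eq, colSign, hz, e1, conj_exp_mul_I, -map_add] <;> ring
    rw [hE] at h2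
    refine h2.congr fun x => ?_
    have hθ : (starRingEnd ℂ) (w.θ x t k) = w.θ x t (starRingEnd ℂ k) := by
      rw [PlaneWave.θ, PlaneWave.θ, eigenval_conj hA]
      simp only [map_mul, map_sub, Complex.conj_ofReal, map_ofNat, conj_half]
    have hsign : colSign (1 - j) = -colSign j := by fin_cases j <;> simp [colSign]
    have hsr : (starRingEnd ℂ) (colSign j) = colSign j := by fin_cases j <;> simp [colSign]
    have e1 : (starRingEnd ℂ) (Complex.exp (-(Complex.I * w.f x t))) =
        Complex.exp (Complex.I * w.f x t) := by
      rw [← conj_exp_mul_I, Complex.conj_conj]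
    simp only [Function.comp, modify, conjJ_smul, expSigma3, mulVec_two,
      Matrix.mulVec_smul, ← Complex.exp_conj, map_neg, map_mul, Complex.conj_I, hθ, hsign, hsr]
    rw [smul_comm]
    congr 1
    · congr 1
      ring
    · congr 1
      ext i
      fin_cases i <;> simp [conjJ, e1, conj_exp_mul_I]

theorem jost_conj (hA : 0 < w.A) {l : Filter ℝ} {j : Fin 2} {k : ℂ} (hex : ∃ v, IsJost q w l j k v)
    (huniq : ∀ v, IsJost q w l (1 - j) (conj k) v → ∀ x t, v x t = jostD q w l (1 - j) x t (conj k))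
    (x t : ℝ) :
    jost q w l (1 - j) x t (conj k) = (-colSign j) • conjJ (jost q w l j x t k) := by
  have := huniq _ ((jostD_eq_of_exists hex).conj hA) x t
  rw [jost, jost, ← this, conjJ_smul, d_conj hA, map_inv₀, smul_comm]

end Conjugation

/-! ### Simultaneous solutions of the Lax pair -/

/-- `v` solves both halves of the Lax pair. -/
structure IsLaxSolution (q : ℝ → ℝ → ℂ) (k : ℂ) (v : ℝ → ℝ → Vec) : Prop where
  lax_x : ∀ x t, HasDerivAt (fun y => v y t) (laxX q x t k *ᵥ v x t) x
  lax_t : ∀ x t, HasDerivAt (fun s => v x s) (laxT q x t k *ᵥ v x t) t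

section LaxSolutions

variable {q : ℝ → ℝ → ℂ} {k : ℂ} {u v : ℝ → ℝ → Vec}

theorem IsJost.isLaxSolution {w : PlaneWave} {l : Filter ℝ} {j : Fin 2} (h : IsJost q w l j k v) :
    IsLaxSolution q k v := ⟨h.lax_x, h.lax_t⟩

theorem IsLaxSolution.smul (c : ℂ) (h : IsLaxSolution q k v) :
    IsLaxSolution q k fun x t => c • v x t := by
  refine ⟨fun x t => ?_, fun x t => ?_⟩
  · rw [Matrix.mulVec_smul]
    exact HasDerivAt.fun_const_smul c (h.lax_x x t)
  · rw [Matrix.mulVec_smul]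
    exact HasDerivAt.fun_const_smul c (h.lax_t x t)

/-- The Wronskian of two solutions is constant. -/
theorem IsLaxSolution.wronskian_eq (hu : IsLaxSolution q k u) (hv : IsLaxSolution q k v)
    (x t y s : ℝ) : wronskian (u x t) (v x t) = wronskian (u y s) (v y s) := by
  have htx : ∀ x t, (laxX q x t k).trace = 0 := fun x t => by
    rw [laxX_eq, Matrix.trace_fin_two_of]; ring
  have htt : ∀ x t, (laxT q x t k).trace = 0 := fun x t => by
    rw [laxT_eq, Matrix.trace_fin_two_of]; ring
  have h1 : ∀ x t, HasDerivAt (fun y => wronskian (u y t) (v y t)) 0 x := fun x t =>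
    (hasDerivAt_wronskian (u := fun y => u y t) (v := fun y => v y t)
      (u' := fun y => laxX q y t k *ᵥ u y t) (v' := fun y => laxX q y t k *ᵥ v y t)
      (hu.lax_x x t) (hv.lax_x x t)).congr_deriv (by rw [wronskian_mulVec, htx, zero_mul])
  have h2 : ∀ x t, HasDerivAt (fun s => wronskian (u x s) (v x s)) 0 t := fun x t =>
    (hasDerivAt_wronskian (u := fun s => u x s) (v := fun s => v x s)
      (u' := fun s => laxT q x s k *ᵥ u x s) (v' := fun s => laxT q x s k *ᵥ v x s)
      (hu.lax_t x t) (hv.lax_t x t)).congr_deriv (by rw [wronskian_mulVec, htt, zero_mul])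
  have e1 := is_const_of_deriv_eq_zero (fun z => (h1 z t).differentiableAt)
    (fun z => (h1 z t).deriv) x y
  have e2 := is_const_of_deriv_eq_zero (fun z => (h2 y z).differentiableAt)
    (fun z => (h2 y z).deriv) t s
  exact e1.trans e2

/-- A solution is determined by its value at the origin. -/
theorem IsLaxSolution.eq_of_eq_zero (hq : IsNLSSolution q) (hu : IsLaxSolution q k u)
    (hv : IsLaxSolution q k v) (h0 : u 0 0 = v 0 0) (x t : ℝ) : u x t = v x t := by
  have h1 : ∀ t, u 0 t = v 0 t := fun t =>
    eq_of_linear_ode (A := fun s => mulCLM (laxT q 0 s k))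
      (Continuous.comp (g := fun p : ℝ × ℝ => mulCLM (laxT q p.1 p.2 k)) (f := fun s => (0, s))
        (continuous_laxT hq k) (continuous_const.prodMk continuous_id))
      (fun s => hu.lax_t 0 s) (fun s => hv.lax_t 0 s) (a := 0) h0 t
  exact eq_of_linear_ode (A := fun x => mulCLM (laxX q x t k))
      (Continuous.comp (g := fun p : ℝ × ℝ => mulCLM (laxX q p.1 p.2 k)) (f := fun x => (x, t))
        (continuous_laxX hq k) (continuous_id.prodMk continuous_const))
      (fun y => hu.lax_x y t) (fun y => hv.lax_x y t) (a := 0) (h1 t) x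

theorem wronskian_expSigma3 (a : ℂ) (u v : Vec) :
    wronskian (expSigma3 a *ᵥ u) (expSigma3 a *ᵥ v) = wronskian u v := by
  rw [expSigma3, mulVec_two, mulVec_two]
  simp only [wronskian, Matrix.cons_val_zero, Matrix.cons_val_one]
  linear_combination (u 0 * v 1 - u 1 * v 0) * exp_mul_exp_neg (Complex.I * a)

/-- The exponentials of the two columns cancel and the gauge matrix has determinant `1`; so the
Wronskian of two Jost solutions can be computed from their limits. -/
theorem wronskian_modify (w : PlaneWave) (k : ℂ) (x t : ℝ) (u v : Vec) :
    wronskian (modify w 0 k x t u) (modify w 1 k x t v) = wronskian u v := by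
  rw [modify, modify, wronskian_smul_left, wronskian_smul_right, wronskian_expSigma3, ← mul_assoc,
    ← Complex.exp_add]
  simp [colSign]

theorem continuous_wronskian : Continuous fun p : Vec × Vec => wronskian p.1 p.2 := by
  unfold wronskian
  fun_prop

/-- The Wronskian of the two Jost solutions at the same end. -/
theorem wronskian_jostD {w : PlaneWave} {l : Filter ℝ} [l.NeBot]
    (hu : IsJost q w l 0 k u) (hv : IsJost q w l 1 k v) (x t : ℝ) :
    wronskian (u x t) (v x t) = (w.E k).det := by
  have h1 : Tendsto (fun y => wronskian (modify w 0 k y t (u y t)) (modify w 1 k y t (v y t))) l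
      (𝓝 (wronskian (fun i => w.E k i 0) (fun i => w.E k i 1))) :=
    (continuous_wronskian.tendsto _).comp ((hu.asymp t).prodMk_nhds (hv.asymp t))
  simp only [wronskian_modify] at h1
  have h2 : ∀ y, wronskian (u y t) (v y t) = wronskian (u x t) (v x t) := fun y =>
    hu.isLaxSolution.wronskian_eq hv.isLaxSolution y t x t
  simp only [h2] at h1
  rw [tendsto_nhds_unique tendsto_const_nhds h1, wronskian, Matrix.det_fin_two]
  ring

/-- Three plane vectors are linearly dependent. -/
theorem wronskian_cyclic (a b c : Vec) :
    wronskian a c • b = wronskian b c • a + wronskian a b • c := by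
  ext i
  fin_cases i <;> simp [wronskian] <;> ring

theorem wronskian_swap (a b : Vec) : wronskian a b = -wronskian b a := by
  simp only [wronskian]
  ring

end LaxSolutions

/-! ### The Jost solutions at `-∞` -/

section MinusInfinity

variable {q : ℝ → ℝ → ℂ} {w : PlaneWave}

theorem continuous_flip : Continuous flip := by
  unfold flip
  refine continuous_pi fun i => ?_
  fin_cases i
  · exact continuous_apply 1
  · exact continuous_apply 0

theorem jost_atBot_one (hq : IsNLSSolution q) (hA : 0 < w.A) (has : IsAsymptoticTo q w (Iio 0))
    {k : ℂ} (hk : 0 ≤ k.im) (x t : ℝ) : jost q w atBot 1 x t k =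
      flip (jost (reflectQ q) w.reflect atTop 0 (-x) (-t) k) :=
  jost_atBot hq hA has (by simpa [colSign] using eigenval_im_nonneg hA hk) x t

theorem tendsto_jostD_atBot (hq : IsNLSSolution q) (hA : 0 < w.A)
    (has : IsAsymptoticTo q w (Iio 0)) (x t : ℝ) {l : Filter ℂ} {k₀ : ℂ} (hl : Tendsto id l (𝓝 k₀))
    (hlam : Tendsto w.eigenval l (𝓝 (w.eigenval k₀))) (hpos : ∀ᶠ k in l, 0 ≤ k.im)
    (hk₀ : 0 ≤ k₀.im) :
    Tendsto (fun k => jostD q w atBot 1 x t k) l (𝓝 (jostD q w atBot 1 x t k₀)) := by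
  have key : ∀ k : ℂ, 0 ≤ k.im → jostD q w atBot 1 x t k =
      flip (jostD (reflectQ q) w.reflect atTop 0 (-x) (-t) k) := fun k hk =>
    jostD_atBot hq hA has (by simpa [colSign] using eigenval_im_nonneg hA hk) x t
  have h1 := tendsto_jostD (w := w.reflect) (isNLSSolution_reflectQ hq) hA
    (isAsymptoticTo_reflect hq has) (-x) (-t) hl hlam hpos
    (eigenval_mem_curve (eigenval_im_nonneg (w := w.reflect) hA hk₀))
  rw [← eigenval_reflect, ← jostD_eq_jostFun (w := w.reflect) (isNLSSolution_reflectQ hq) hA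
    (isAsymptoticTo_reflect hq has) (eigenval_im_nonneg (w := w.reflect) hA hk₀)] at h1
  rw [key k₀ hk₀]
  refine ((continuous_flip.tendsto _).comp h1).congr' ?_
  filter_upwards [hpos] with k hk using (key k hk).symm

theorem tendsto_jost_atBot (hq : IsNLSSolution q) (hA : 0 < w.A)
    (has : IsAsymptoticTo q w (Iio 0)) (x t : ℝ) {l : Filter ℂ} {k₀ : ℂ} (hl : Tendsto id l (𝓝 k₀))
    (hlam : Tendsto w.eigenval l (𝓝 (w.eigenval k₀))) (hpos : ∀ᶠ k in l, 0 ≤ k.im)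
    (hk₀ : 0 ≤ k₀.im) (h : w.eigenval k₀ ≠ 0) :
    Tendsto (fun k => jost q w atBot 1 x t k) l (𝓝 (jost q w atBot 1 x t k₀)) :=
  ((tendsto_d hA hl hlam h).inv₀ (d_ne_zero hA h)).smul
    (tendsto_jostD_atBot hq hA has x t hl hlam hpos hk₀)

/-- The result at `+∞` for the reflected solution. Reflection changes the sign of `δ`, hence the
opposite exponent. -/
theorem tendsto_jost_atBot_left (hq : IsNLSSolution q) (hA : 0 < w.A)
    (has : IsAsymptoticTo q w (Iio 0)) (x t : ℝ) {k₀ : ℂ} (hk₀ : k₀ ∈ w.cutUpper) {l : Filter ℂ}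
    (hl : Tendsto id l (𝓝 k₀)) (hlam : Tendsto w.eigenval l (𝓝 (-w.eigenval k₀))) :
    Tendsto (fun k => jost q w atBot 1 x t k) l
      (𝓝 ((-Complex.I * Complex.exp (Complex.I * w.δ)) • jost q w atBot 0 x t k₀)) := by
  have h1 := tendsto_jost_left (w := w.reflect) (isNLSSolution_reflectQ hq) hA
    (isAsymptoticTo_reflect hq has) (-x) (-t) hk₀ hl hlam
  have hpos : ∀ᶠ k in l, 0 ≤ k.im := by
    have := (Complex.continuous_im.tendsto k₀).comp hl
    filter_upwards [this.eventually (lt_mem_nhds hk₀.2.1)] with k hk using le_of_lt hk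
  have him : (w.eigenval k₀).im = 0 :=
    (eigenval_of_mem_cut hk₀.1 (by linarith [hk₀.2.1]) hk₀.2.2).2.1
  have h2 := (continuous_flip.tendsto _).comp h1
  have e0 : jost q w atBot 0 x t k₀ = flip (jost (reflectQ q) w.reflect atTop 1 (-x) (-t) k₀) :=
    jost_atBot hq hA has (by simp [colSign, him]) x t
  have e : -(Complex.I * (w.reflect.δ : ℂ)) = Complex.I * w.δ := by
    simp [PlaneWave.reflect]
  rw [flip_smul, ← e0, e] at h2
  refine h2.congr' ?_
  filter_upwards [hpos] with k hk using (jost_atBot_one hq hA has hk x t).symm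

theorem differentiableOn_jost_atBot (hq : IsNLSSolution q) (hA : 0 < w.A)
    (has : IsAsymptoticTo q w (Iio 0)) (x t : ℝ) :
    DifferentiableOn ℂ (fun k => jost q w atBot 1 x t k) {k | 0 < k.im ∧ k ∉ w.cut} := by
  have h1 := differentiableOn_pi.1 (differentiableOn_jost (w := w.reflect)
    (isNLSSolution_reflectQ hq) hA (isAsymptoticTo_reflect hq has) (-x) (-t))
  exact (differentiableOn_vec_two (h1 1) (h1 0)).congr fun k hk =>
    jost_atBot_one hq hA has hk.1.le x t

theorem isBigO_jost_atBot (hq : IsNLSSolution q) (hA : 0 < w.A)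
    (has : IsAsymptoticTo q w (Iio 0)) (x t : ℝ) :
    (fun k => Complex.exp (Complex.I * thetaO x t k) * jost q w atBot 1 x t k 1 - 1)
      =O[upperInfinity] (fun k : ℂ => 1 / k) ∧
    (fun k => Complex.exp (Complex.I * thetaO x t k) * jost q w atBot 1 x t k 0)
      =O[upperInfinity] fun k : ℂ => 1 / k := by
  obtain ⟨h0, h1⟩ := isBigO_jost (w := w.reflect) (isNLSSolution_reflectQ hq) hA
    (isAsymptoticTo_reflect hq has) (-x) (-t)
  have hth : ∀ k, -(Complex.I * thetaO (-x) (-t) k) = Complex.I * thetaO x t k := fun k => by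
    simp only [thetaO]
    push_cast
    ring
  simp only [hth] at h0 h1
  have him : ∀ᶠ k in upperInfinity, 0 ≤ k.im := mem_inf_of_right (mem_principal_self _)
  constructor
  · refine h0.congr' ?_ EventuallyEq.rfl
    filter_upwards [him] with k hk
    rw [jost_atBot_one hq hA has hk]
    rfl
  · refine h1.congr' ?_ EventuallyEq.rfl
    filter_upwards [him] with k hk
    rw [jost_atBot_one hq hA has hk]
    rfl

end MinusInfinity

/-! ### The scattering problem -/

/-- A solution of the NLS equation with step-like oscillatory boundary conditions. -/
structure IsStepSolution (q : ℝ → ℝ → ℂ) (b : Background) : Prop where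
  Ap_pos : 0 < b.Ap
  Am_pos : 0 < b.Am
  V_ne : b.V ≠ 0
  nls : IsNLSSolution q
  plus : IsAsymptoticTo q b.plus (Ioi 0)
  minus : IsAsymptoticTo q b.minus (Iio 0)

section Scattering

variable {q : ℝ → ℝ → ℂ} {b : Background}

namespace IsStepSolution

theorem isJost_plus (h : IsStepSolution q b) {j : Fin 2} {k : ℂ}
    (hk : 0 ≤ (colSign j * b.plus.eigenval k).im) :
    IsJost q b.plus atTop j k fun x t => jostD q b.plus atTop j x t k :=
  jostD_eq_of_exists (exists_isJost h.nls h.Ap_pos h.plus hk)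

theorem isJost_minus (h : IsStepSolution q b) {j : Fin 2} {k : ℂ}
    (hk : 0 ≤ (colSign (1 - j) * b.minus.eigenval k).im) :
    IsJost q b.minus atBot j k fun x t => jostD q b.minus atBot j x t k :=
  jostD_eq_of_exists (exists_isJost_atBot h.nls h.Am_pos h.minus hk)

theorem plus_im_nonneg (h : IsStepSolution q b) {k : ℂ} (hk : 0 ≤ k.im) :
    0 ≤ (colSign 0 * b.plus.eigenval k).im := by
  simpa [colSign] using eigenval_im_nonneg (w := b.plus) h.Ap_pos hk

theorem minus_im_nonneg (h : IsStepSolution q b) {k : ℂ} (hk : 0 ≤ k.im) :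
    0 ≤ (colSign (1 - 1) * b.minus.eigenval k).im := by
  simpa [colSign] using eigenval_im_nonneg (w := b.minus) h.Am_pos hk

theorem isLax_phiP1 (h : IsStepSolution q b) {k : ℂ} (hk : 0 ≤ k.im) :
    IsLaxSolution q k fun x t => phiP1 q b x t k :=
  (h.isJost_plus (j := 0) (h.plus_im_nonneg hk)).isLaxSolution.smul _

theorem isLax_phiM2 (h : IsStepSolution q b) {k : ℂ} (hk : 0 ≤ k.im) :
    IsLaxSolution q k fun x t => phiM2 q b x t k :=
  (h.isJost_minus (j := 1) (h.minus_im_nonneg hk)).isLaxSolution.smul _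

theorem isLax_phiP2 (h : IsStepSolution q b) {k : ℂ} (hk : (b.plus.eigenval k).im = 0) :
    IsLaxSolution q k fun x t => phiP2 q b x t k :=
  (h.isJost_plus (j := 1) (by simp [colSign, hk])).isLaxSolution.smul _

theorem isLax_phiM1 (h : IsStepSolution q b) {k : ℂ} (hk : (b.minus.eigenval k).im = 0) :
    IsLaxSolution q k fun x t => phiM1 q b x t k :=
  (h.isJost_minus (j := 0) (by simp [colSign, hk])).isLaxSolution.smul _

theorem phiP1_ne_zero (h : IsStepSolution q b) {k : ℂ} (hk : 0 ≤ k.im)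
    (hne : b.plus.eigenval k ≠ 0) (x t : ℝ) : phiP1 q b x t k ≠ 0 :=
  smul_ne_zero (inv_ne_zero (d_ne_zero (w := b.plus) h.Ap_pos hne))
    ((h.isJost_plus (j := 0) (h.plus_im_nonneg hk)).ne_zero h.nls x t)

theorem phiM2_ne_zero (h : IsStepSolution q b) {k : ℂ} (hk : 0 ≤ k.im)
    (hne : b.minus.eigenval k ≠ 0) (x t : ℝ) : phiM2 q b x t k ≠ 0 :=
  smul_ne_zero (inv_ne_zero (d_ne_zero (w := b.minus) h.Am_pos hne))
    ((h.isJost_minus (j := 1) (h.minus_im_nonneg hk)).ne_zero h.nls x t)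

/-- The Jost solutions at `+∞` are normalized to have Wronskian one. -/
theorem wronskian_plus (h : IsStepSolution q b) {k : ℂ} (hk : (b.plus.eigenval k).im = 0)
    (hne : b.plus.eigenval k ≠ 0) (x t : ℝ) : wronskian (phiP1 q b x t k) (phiP2 q b x t k) = 1 :=
        by
  have hd := d_ne_zero (w := b.plus) h.Ap_pos hne
  rw [phiP1, phiP2, jost, jost, wronskian_smul_left, wronskian_smul_right,
    wronskian_jostD (h.isJost_plus (j := 0) (by simp [colSign, hk]))
      (h.isJost_plus (j := 1) (by simp [colSign, hk])),
    det_E (w := b.plus) h.Ap_pos, ← d_sq (w := b.plus) h.Ap_pos]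
  field_simp

theorem wronskian_minus (h : IsStepSolution q b) {k : ℂ} (hk : (b.minus.eigenval k).im = 0)
    (hne : b.minus.eigenval k ≠ 0) (x t : ℝ) :
    wronskian (phiM1 q b x t k) (phiM2 q b x t k) = 1 := by
  have hd := d_ne_zero (w := b.minus) h.Am_pos hne
  rw [phiM1, phiM2, jost, jost, wronskian_smul_left, wronskian_smul_right,
    wronskian_jostD (h.isJost_minus (j := 0) (by simp [colSign, hk]))
      (h.isJost_minus (j := 1) (by simp [colSign, hk])),
    det_E (w := b.minus) h.Am_pos, ← d_sq (w := b.minus) h.Am_pos]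
  field_simp

/-! #### The Schwarz symmetry -/

theorem phiP2_conj (h : IsStepSolution q b) {k : ℂ} (hk : 0 ≤ k.im) (x t : ℝ) :
    phiP2 q b x t (conj k) = -conjJ (phiP1 q b x t k) := by
  have hp := eigenval_im_nonneg (w := b.plus) h.Ap_pos hk
  have := jost_conj (w := b.plus) (j := 0) h.Ap_pos
    (exists_isJost h.nls h.Ap_pos h.plus (by simpa [colSign] using hp))
    (fun v hv => hv.unique h.nls h.Ap_pos h.plus (by
      rw [eigenval_conj (w := b.plus) h.Ap_pos]; simpa [colSign] using hp)) x t
  rw [phiP2, phiP1, ← neg_one_smul ℂ (conjJ _)]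
  exact this

theorem phiM1_conj (h : IsStepSolution q b) {k : ℂ} (hk : 0 ≤ k.im) (x t : ℝ) :
    phiM1 q b x t (conj k) = conjJ (phiM2 q b x t k) := by
  have hp := eigenval_im_nonneg (w := b.minus) h.Am_pos hk
  have := jost_conj (w := b.minus) (j := 1) h.Am_pos
    (exists_isJost_atBot h.nls h.Am_pos h.minus (by simpa [colSign] using hp))
    (fun v hv => hv.unique_atBot h.nls h.Am_pos h.minus (by
      rw [eigenval_conj (w := b.minus) h.Am_pos]; simpa [colSign] using hp)) x t
  have e : -colSign 1 = 1 := by simp [colSign]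
  rw [phiM1, phiM2, ← one_smul ℂ (conjJ _), ← e]
  exact this

theorem s11_conj (h : IsStepSolution q b) {k : ℂ} (hk : 0 ≤ k.im) :
    s11 q b (conj k) = conj (s22 q b k) := by
  rw [s11, s22, h.phiP2_conj hk, h.phiM1_conj hk, ← wronskian_conjJ, wronskian_swap (conjJ (phiP1 _
      _ _ _ _)),
    ← neg_one_smul ℂ (conjJ (phiP1 _ _ _ _ _)), wronskian_smul_right]
  ring

/-- On the real line both coefficients are defined, and this is how `ρ̄` enters the jump matrix
there. -/
theorem conj_s12 (h : IsStepSolution q b) {k : ℂ} (hk : k.im = 0) :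
    conj (s12 q b k) = r21 q b k := by
  have hc : conj k = k := Complex.conj_eq_iff_im.2 hk
  have h1 := h.phiP2_conj hk.ge 0 0
  have h2 := h.phiM1_conj hk.ge 0 0
  rw [hc] at h1 h2
  rw [s12, r21, h1, h2, ← wronskian_conjJ, ← neg_one_smul ℂ (conjJ (phiP1 _ _ _ _ _)), conjJ_smul,
    conjJ_conjJ]
  simp

/-! #### Relations between the Jost solutions on the contour -/

theorem s22_eq (h : IsStepSolution q b) {k : ℂ} (hk : 0 ≤ k.im) (x t : ℝ) :
    wronskian (phiP1 q b x t k) (phiM2 q b x t k) = s22 q b k :=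
  (h.isLax_phiP1 hk).wronskian_eq (h.isLax_phiM2 hk) x t 0 0

/-- The linear relation between three plane vectors, whose coefficients are Wronskians and hence
constants. It applies where `λ₊` is real, so that both Jost solutions at `+∞` exist; `phiM1_eq` is
its counterpart where `λ₋` is real. -/
theorem phiP2_eq (h : IsStepSolution q b) {k : ℂ} (hk : 0 ≤ k.im) (hl : (b.plus.eigenval k).im = 0)
    (hne : b.plus.eigenval k ≠ 0) (x t : ℝ) :
    s22 q b k • phiP2 q b x t k = phiM2 q b x t k - s12 q b k • phiP1 q b x t k := by
  have h1 := wronskian_cyclic (phiP1 q b x t k) (phiP2 q b x t k) (phiM2 q b x t k)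
  have h2 : wronskian (phiM2 q b x t k) (phiP2 q b x t k) = s12 q b k :=
    (h.isLax_phiM2 hk).wronskian_eq (h.isLax_phiP2 hl) x t 0 0
  rw [h.s22_eq hk, wronskian_swap (phiP2 _ _ _ _ _), h2, h.wronskian_plus hl hne, one_smul,
      neg_smul] at h1
  rw [h1]
  abel

theorem phiM1_eq (h : IsStepSolution q b) {k : ℂ} (hk : 0 ≤ k.im) (hl : (b.minus.eigenval k).im = 0)
    (hne : b.minus.eigenval k ≠ 0) (x t : ℝ) :
    s22 q b k • phiM1 q b x t k = phiP1 q b x t k - r21 q b k • phiM2 q b x t k := by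
  have h1 := wronskian_cyclic (phiP1 q b x t k) (phiM1 q b x t k) (phiM2 q b x t k)
  have h2 : wronskian (phiM1 q b x t k) (phiP1 q b x t k) = r21 q b k :=
    (h.isLax_phiM1 hl).wronskian_eq (h.isLax_phiP1 hk) x t 0 0
  rw [h.s22_eq hk, wronskian_swap (phiP1 _ _ _ _ _), h2, h.wronskian_minus hl hne, one_smul,
      neg_smul] at h1
  rw [h1]
  abel

end IsStepSolution

/-! ### The matrix `M` -/

/-- The Schwarz reflection `A ↦ J Ā J⁻¹` of matrices. -/
def schwarz (A : Mat2) : Mat2 := !![conj (A 1 1), -conj (A 1 0); -conj (A 0 1), conj (A 0 0)]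

theorem schwarz_mul (A B : Mat2) : schwarz (A * B) = schwarz A * schwarz B := by
  ext i j
  fin_cases i <;> fin_cases j <;> simp [schwarz, Matrix.mul_apply, Fin.sum_univ_two] <;> ring

theorem schwarz_smul (c : ℂ) (A : Mat2) : schwarz (c • A) = conj c • schwarz A := by
  ext i j
  fin_cases i <;> fin_cases j <;> simp [schwarz]

theorem schwarz_schwarz (A : Mat2) : schwarz (schwarz A) = A := by
  ext i j
  fin_cases i <;> fin_cases j <;> simp [schwarz]

theorem continuous_schwarz : Continuous schwarz := by
  have hc := Complex.continuous_conj
  refine continuous_matrix fun i j => ?_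
  fin_cases i <;> fin_cases j
  · exact hc.comp (continuous_id.matrix_elem 1 1)
  · exact (hc.comp (continuous_id.matrix_elem 1 0)).neg
  · exact (hc.comp (continuous_id.matrix_elem 0 1)).neg
  · exact hc.comp (continuous_id.matrix_elem 0 0)

theorem schwarz_expSigma3 (z : ℂ) : schwarz (expSigma3 z) = expSigma3 (conj z) := by
  ext i j
  fin_cases i <;> fin_cases j <;> simp [schwarz, expSigma3, ← Complex.exp_conj]

theorem schwarz_columns (u v : Vec) : schwarz (columns u v) = columns (conjJ v) (-conjJ u) := by
  ext i j
  fin_cases i <;> fin_cases j <;> simp [schwarz, columns, conjJ]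

theorem conj_thetaO (x t : ℝ) (k : ℂ) : thetaO x t (conj k) = conj (thetaO x t k) := by
  simp [thetaO, map_ofNat]

theorem M_of_im_pos (x t : ℝ) {k : ℂ} (hk : 0 < k.im) : M q b x t k =
    columns (phiP1 q b x t k) ((s22 q b k)⁻¹ • phiM2 q b x t k) * expSigma3 (-thetaO x t k) := by
  rw [M, Phi, if_pos hk]

/-- Everything about `M` in the lower half-plane is deduced from the upper one through this
symmetry; `schwarz` is multiplicative, so it respects jump relations. -/
theorem M_conj (h : IsStepSolution q b) (x t : ℝ) {k : ℂ} (hk : 0 < k.im) :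
    M q b x t (conj k) = schwarz (M q b x t k) := by
  have hn : ¬ 0 < (conj k).im := by rw [Complex.conj_im]; linarith
  rw [M_of_im_pos x t hk, schwarz_mul, schwarz_columns, schwarz_expSigma3, M, Phi, if_neg hn,
    h.s11_conj hk.le, h.phiM1_conj hk.le, h.phiP2_conj hk.le, conjJ_smul, map_inv₀, conj_thetaO,
        map_neg]

theorem M_of_im_neg (h : IsStepSolution q b) (x t : ℝ) {k : ℂ} (hk : k.im < 0) :
    M q b x t k = schwarz (M q b x t (conj k)) := by
  rw [← M_conj h x t (by rw [Complex.conj_im]; linarith), Complex.conj_conj]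

theorem continuous_columns : Continuous fun p : Vec × Vec => columns p.1 p.2 := by
  refine continuous_matrix fun i j => ?_
  fin_cases i <;> fin_cases j
  · exact (by fun_prop : Continuous fun p : Vec × Vec => p.1 0)
  · exact (by fun_prop : Continuous fun p : Vec × Vec => p.2 0)
  · exact (by fun_prop : Continuous fun p : Vec × Vec => p.1 1)
  · exact (by fun_prop : Continuous fun p : Vec × Vec => p.2 1)

theorem continuous_expSigma3 : Continuous expSigma3 := by
  refine continuous_matrix fun i j => ?_
  fin_cases i <;> fin_cases j <;> simp [expSigma3] <;> fun_prop

theorem continuous_thetaO (x t : ℝ) : Continuous (thetaO x t) := by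
  unfold thetaO
  fun_prop

/-- Limits of `M` from limits of its columns, for approaches within the upper half-plane. -/
theorem tendsto_M (x t : ℝ) {l : Filter ℂ} {k₀ : ℂ} {a c : Vec} {s : ℂ} (hl : Tendsto id l (𝓝 k₀))
    (hpos : ∀ᶠ k in l, 0 < k.im) (ha : Tendsto (fun k => phiP1 q b x t k) l (𝓝 a))
    (hc : Tendsto (fun k => phiM2 q b x t k) l (𝓝 c)) (hs : Tendsto (s22 q b) l (𝓝 s)) (h0 : s ≠ 0)
        :
    Tendsto (M q b x t) l (𝓝 (columns a (s⁻¹ • c) * expSigma3 (-thetaO x t k₀))) := by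
  have h1 : Tendsto (fun k => columns (phiP1 q b x t k) ((s22 q b k)⁻¹ • phiM2 q b x t k)) l
      (𝓝 (columns a (s⁻¹ • c))) :=
    (continuous_columns.tendsto _).comp (ha.prodMk_nhds ((hs.inv₀ h0).smul hc))
  have h2 : Tendsto (fun k => expSigma3 (-thetaO x t k)) l (𝓝 (expSigma3 (-thetaO x t k₀))) :=
    ((continuous_expSigma3.comp (continuous_thetaO x t).neg).tendsto k₀).comp hl
  refine (Tendsto.mul (M := Mat2) h1 h2).congr' ?_
  filter_upwards [hpos] with k hk using (M_of_im_pos x t hk).symm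

theorem tendsto_s22 {l : Filter ℂ} {a c : Vec} (ha : Tendsto (fun k => phiP1 q b 0 0 k) l (𝓝 a))
    (hc : Tendsto (fun k => phiM2 q b 0 0 k) l (𝓝 c)) : Tendsto (s22 q b) l (𝓝 (wronskian a c)) :=
  (continuous_wronskian.tendsto _).comp (ha.prodMk_nhds hc)

/-- `θ_o` has no jump, so the exponentials cancel and the jump of `M` reduces to that of `Φ`, with
the matrix `J_o`. -/
theorem jump_mul (b : Background) (ρ r : ℂ → ℂ) (x t : ℝ) (k : ℂ) (A : Mat2) :
    A * expSigma3 (-thetaO x t k) * jump b ρ r x t k = A * jumpO b ρ r k * expSigma3 (-thetaO x t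
        k) := by
  have h1 : expSigma3 (-thetaO x t k) * expSigma3 (thetaO x t k) = 1 := by
    have e := exp_mul_exp_neg (Complex.I * thetaO x t k)
    ext i j
    fin_cases i <;> fin_cases j <;> simp [expSigma3, ← Complex.exp_add]
  rw [jump, Matrix.mul_assoc A, ← Matrix.mul_assoc _ _ (expSigma3 (-thetaO x t k)), ←
      Matrix.mul_assoc _ (expSigma3 (thetaO x t k)), h1,
    Matrix.one_mul, Matrix.mul_assoc]

end Scattering

/-! ### Non-tangential limits and the jumps of `M` -/

section Nontangential

/-- The boundary values exist even without restriction to sectors, since the Jost solutions are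
continuous up to the contour. -/
theorem hasNontangentialLimit_of_halfplane {F : ℂ → Mat2} {n k₀ : ℂ} {L : Mat2}
    (h : Tendsto F (𝓝[{k | 0 < ((k - k₀) * conj n).re}] k₀) (𝓝 L)) :
    HasNontangentialLimit F n k₀ L := fun _ =>
  h.mono_left (nhdsWithin_mono _ fun _ hk => hk.1)

theorem tendsto_id_nhdsWithin (s : Set ℂ) (k : ℂ) : Tendsto id (𝓝[s] k) (𝓝 k) :=
  tendsto_id'.2 nhdsWithin_le_nhds

theorem tendsto_conj_sector (n k₀ : ℂ) (C : ℝ) :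
    Tendsto (fun z : ℂ => conj z) (𝓝[sector (conj n) (conj k₀) C] (conj k₀))
      (𝓝[sector n k₀ C] k₀) := by
  refine tendsto_nhdsWithin_iff.2 ⟨?_, ?_⟩
  · have := (Complex.continuous_conj.tendsto (conj k₀)).mono_left
      (nhdsWithin_le_nhds (s := sector (conj n) (conj k₀) C))
    rwa [Complex.conj_conj] at this
  · filter_upwards [self_mem_nhdsWithin] with z hz
    have e1 : ((conj z - k₀) * conj n).re = ((z - conj k₀) * conj (conj n)).re := by
      rw [← Complex.conj_re]
      simp
    have e2 : ‖conj z - k₀‖ = ‖z - conj k₀‖ := by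
      rw [← Complex.norm_conj]
      simp
    obtain ⟨h1, h2⟩ := hz
    rw [← e1] at h1
    rw [← e1, ← e2] at h2
    exact ⟨h1, h2⟩

variable {q : ℝ → ℝ → ℂ} {b : Background}

/-- The Schwarz symmetry of `M` carries over to its boundary values. -/
theorem hasNontangentialLimit_conj (h : IsStepSolution q b) {x t : ℝ} {n k₀ : ℂ} {L : Mat2}
    (hpos : ∀ᶠ k in 𝓝[{k | 0 < ((k - k₀) * conj n).re}] k₀, 0 < k.im)
    (hL : HasNontangentialLimit (M q b x t) n k₀ L) :
    HasNontangentialLimit (M q b x t) (conj n) (conj k₀) (schwarz L) := by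
  intro C
  have hc := tendsto_conj_sector n k₀ C
  refine ((continuous_schwarz.tendsto L).comp ((hL C).comp hc)).congr' ?_
  have hpos' := hc.eventually (nhdsWithin_mono (s := sector n k₀ C) _ (fun _ hk => hk.1) hpos)
  filter_upwards [hpos'] with k hk
  exact (M_of_im_neg h x t (by simpa using hk)).symm

end Nontangential

section Jumps

variable {q : ℝ → ℝ → ℂ} {b : Background}

namespace IsStepSolution

theorem notMem_plus_cut {k : ℂ} (hk : k.re ≠ -(b.V / 2)) : k ∉ b.plus.cut := fun h => hk h.1

theorem notMem_minus_cut {k : ℂ} (hk : k.re ≠ b.V / 2) : k ∉ b.minus.cut := fun h => hk (by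
  rw [h.1]; simp [Background.minus]; ring)

theorem re_of_mem_minus {k : ℂ} (hk : k.re = -(b.minus.V / 2)) : k.re = b.V / 2 := by
  rw [hk]; simp [Background.minus]; ring

/-- `V ≠ 0` places the cuts on different vertical lines. At a point of one of them only one of the
two eigenvalues is discontinuous. -/
theorem notMem_minus_of_plus (h : IsStepSolution q b) {k : ℂ} (hk : k.re = -(b.V / 2)) :
    k ∉ b.minus.cut := notMem_minus_cut fun h' => h.V_ne (by linarith)

theorem notMem_plus_of_minus (h : IsStepSolution q b) {k : ℂ} (hk : k.re = b.V / 2) :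
    k ∉ b.plus.cut := notMem_plus_cut fun h' => h.V_ne (by linarith)

theorem tendsto_phiP1 (h : IsStepSolution q b) (x t : ℝ) {l : Filter ℂ} {k₀ : ℂ}
    (hl : l ≤ 𝓝 k₀) (hpos : ∀ᶠ k in l, 0 ≤ k.im) (h0 : 0 ≤ k₀.im) (hk : k₀ ∉ b.plus.cut) :
    Tendsto (fun k => phiP1 q b x t k) l (𝓝 (phiP1 q b x t k₀)) :=
  tendsto_jost h.nls h.Ap_pos h.plus x t hl
    ((tendsto_eigenval_of_notMem (w := b.plus) h.Ap_pos hk).mono_left hl) hpos h0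
    (eigenval_ne_zero (w := b.plus) h.Ap_pos hk)

theorem tendsto_phiM2 (h : IsStepSolution q b) (x t : ℝ) {l : Filter ℂ} {k₀ : ℂ}
    (hl : l ≤ 𝓝 k₀) (hpos : ∀ᶠ k in l, 0 ≤ k.im) (h0 : 0 ≤ k₀.im) (hk : k₀ ∉ b.minus.cut) :
    Tendsto (fun k => phiM2 q b x t k) l (𝓝 (phiM2 q b x t k₀)) :=
  tendsto_jost_atBot h.nls h.Am_pos h.minus x t hl
    ((tendsto_eigenval_of_notMem (w := b.minus) h.Am_pos hk).mono_left hl) hpos h0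
    (eigenval_ne_zero (w := b.minus) h.Am_pos hk)

/-- The jump across the real line. -/
theorem jump_real (h : IsStepSolution q b) (x t : ℝ) {k : ℂ} (hk : k.im = 0)
    (h1 : k.re ≠ b.V / 2) (h2 : k.re ≠ -(b.V / 2)) (hs : s22 q b k ≠ 0) : ∃ Fp Fm : Mat2,
    HasNontangentialLimit (M q b x t) Complex.I k Fp ∧
    HasNontangentialLimit (M q b x t) (-Complex.I) k Fm ∧
    Fp = Fm * jump b (rho q b) (refl q b) x t k := by
  have hc : conj k = k := Complex.conj_eq_iff_im.2 hk
  have hpos : ∀ᶠ z in 𝓝[{z | 0 < ((z - k) * conj Complex.I).re}] k, 0 < z.im := by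
    filter_upwards [self_mem_nhdsWithin] with z hz
    have hz' : 0 < ((z - k) * conj Complex.I).re := hz
    simpa [hk] using hz'
  have hle : 𝓝[{z | 0 < ((z - k) * conj Complex.I).re}] k ≤ 𝓝 k := nhdsWithin_le_nhds
  have hpos' := hpos.mono fun z hz => hz.le
  have ha := fun x t => h.tendsto_phiP1 x t hle hpos' hk.ge (notMem_plus_cut h2)
  have hb := fun x t => h.tendsto_phiM2 x t hle hpos' hk.ge (notMem_minus_cut h1)
  have hM := hasNontangentialLimit_of_halfplane
    (tendsto_M x t hle hpos (ha x t) (hb x t) (tendsto_s22 (ha 0 0) (hb 0 0)) hs)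
  -- For real `k` the reflection interchanges the two sides, so the boundary value from below is the
  -- Schwarz image of the one from above.
  have hM' := hasNontangentialLimit_conj h hpos hM
  rw [hc, Complex.conj_I, schwarz_mul, schwarz_expSigma3, map_neg, ← conj_thetaO, hc,
    schwarz_columns] at hM'
  refine ⟨_, _, hM, hM', ?_⟩
  rw [jump_mul]
  congr 1
  have hl1 : (b.plus.eigenval k).im = 0 := by
    rw [← Complex.conj_eq_iff_im, ← eigenval_conj (w := b.plus) h.Ap_pos, hc]
  have e1 := h.phiP2_conj hk.ge x t
  have e2 := h.phiM1_conj hk.ge x t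
  rw [hc] at e1 e2
  have hl2 : (b.minus.eigenval k).im = 0 := by
    rw [← Complex.conj_eq_iff_im, ← eigenval_conj (w := b.minus) h.Am_pos, hc]
  have e3 := h.phiP2_eq hk.ge hl1 (eigenval_ne_zero (w := b.plus) h.Ap_pos (notMem_plus_cut h2)) x t
  have hs11 : wronskian (phiM1 q b x t k) (phiP2 q b x t k) = conj (s22 q b k) := by
    rw [← h.s11_conj hk.ge, hc]
    exact (h.isLax_phiM1 hl2).wronskian_eq (h.isLax_phiP2 hl1) x t 0 0
  have hr21 : wronskian (phiM1 q b x t k) (phiP1 q b x t k) = conj (s12 q b k) := by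
    rw [h.conj_s12 hk]
    exact (h.isLax_phiM1 hl2).wronskian_eq (h.isLax_phiP1 hk.ge) x t 0 0
  have e4 := wronskian_cyclic (phiM1 q b x t k) (phiP1 q b x t k) (phiP2 q b x t k)
  rw [hs11, hr21, h.wronskian_plus hl1 (eigenval_ne_zero (w := b.plus) h.Ap_pos (notMem_plus_cut
      h2)),
    one_smul] at e4
  have hsc : conj (s22 q b k) ≠ 0 := (map_ne_zero _).2 hs
  rw [conjJ_smul, ← e1, ← e2, map_inv₀, jumpO, if_pos hk]
  have hrho : rho q b k = s12 q b k / s22 q b k := rfl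
  ext i j
  have e3i := congrFun e3 i
  have e4i := congrFun e4 i
  simp only [Pi.smul_apply, Pi.sub_apply, Pi.add_apply, smul_eq_mul] at e3i e4i
  have hA : phiP1 q b x t k i = (conj (s22 q b k))⁻¹ * phiM1 q b x t k i +
      phiP2 q b x t k i * conj (rho q b k) := by
    rw [hrho, map_div₀]
    field_simp
    linear_combination e4i
  have hB : (s22 q b k)⁻¹ * phiM2 q b x t k i =
      phiP2 q b x t k i + rho q b k * phiP1 q b x t k i := by
    rw [hrho]
    field_simp
    linear_combination -e3i
  -- The two scattering relations `hA` and `hB` are combined by eliminating `φ₊₁`; this produces the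
  -- entry `1 + ρρ̄`.
  have key : (s22 q b k)⁻¹ * phiM2 q b x t k i = (conj (s22 q b k))⁻¹ * phiM1 q b x t k i * rho q b
      k
      + phiP2 q b x t k i * (1 + rho q b k * conj (rho q b k)) := by
    linear_combination hB + rho q b k * hA
  fin_cases i <;> fin_cases j <;> simp [columns, Matrix.mul_apply, Fin.sum_univ_two]
  · exact hA
  · exact key
  · exact hA
  · exact key

theorem eventually_im_pos {k : ℂ} (hk : 0 < k.im) {s : Set ℂ} : ∀ᶠ z in 𝓝[s] k, 0 < z.im :=
  nhdsWithin_le_nhds ((Complex.continuous_im.tendsto k).eventually (lt_mem_nhds hk))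

theorem halfplane_left (k : ℂ) : {z : ℂ | 0 < ((z - k) * conj (-1)).re} = {z | z.re < k.re} := by
  ext z
  simp

theorem halfplane_right (k : ℂ) : {z : ℂ | 0 < ((z - k) * conj 1).re} = {z | k.re < z.re} := by
  ext z
  simp

/-- The jump across the upper half of `Σ₊`. -/
theorem jump_plus (h : IsStepSolution q b) (x t : ℝ) {k : ℂ} (hk : k ∈ b.plus.cutUpper)
    (hs : s22 q b k ≠ 0) (hs' : s12 q b k ≠ 0) : ∃ Fp Fm : Mat2,
    HasNontangentialLimit (M q b x t) (-1) k Fp ∧ HasNontangentialLimit (M q b x t) 1 k Fm ∧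
    Fp = Fm * jump b (rho q b) (refl q b) x t k := by
  obtain ⟨h0, h1, h2⟩ := id hk
  have hlow : -b.plus.A < k.im := by linarith
  obtain ⟨hre, him, -⟩ := eigenval_of_mem_cut h0 hlow h2
  have hne : b.plus.eigenval k ≠ 0 := fun e => by rw [e, Complex.zero_re] at hre; exact hre.false
  obtain ⟨hr, hl⟩ := tendsto_eigenval_right (w := b.plus) h.Ap_pos h0 hlow h2
  rw [← h0] at hr hl
  have hnot := h.notMem_minus_of_plus (k := k) h0
  have hpR := fun x t => tendsto_jost h.nls h.Ap_pos h.plus x t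
    (tendsto_id_nhdsWithin {z : ℂ | k.re < z.re} k) hr
    ((eventually_im_pos h1).mono fun z hz => hz.le) h1.le hne
  have hpL := fun x t => tendsto_jost_left h.nls h.Ap_pos h.plus x t hk
    (tendsto_id_nhdsWithin {z : ℂ | z.re < k.re} k) hl
  have hm := fun (s : Set ℂ) x t => h.tendsto_phiM2 x t (nhdsWithin_le_nhds : 𝓝[s] k ≤ 𝓝 k)
    ((eventually_im_pos h1).mono fun z hz => hz.le) h1.le hnot
  -- From the left `φ₊₁` tends to a multiple of `φ₊₂`, so `s₂₂` tends to a multiple of `s₁₂`.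
  -- Therefore zeros of `s₁₂` are also excluded.
  have hsL : wronskian ((-Complex.I * Complex.exp (-(Complex.I * b.δ))) • phiP2 q b 0 0 k)
      (phiM2 q b 0 0 k) = Complex.I * Complex.exp (-(Complex.I * b.δ)) * s12 q b k := by
    rw [wronskian_smul_left, wronskian_swap, s12]
    ring
  have hsL0 : Complex.I * Complex.exp (-(Complex.I * b.δ)) * s12 q b k ≠ 0 :=
    mul_ne_zero (mul_ne_zero Complex.I_ne_zero (Complex.exp_ne_zero _)) hs'
  have hMR := tendsto_M x t (tendsto_id_nhdsWithin _ k) (eventually_im_pos h1) (hpR x t) (hm _ x t)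
    (tendsto_s22 (hpR 0 0) (hm _ 0 0)) hs
  have hSL := tendsto_s22 (q := q) (b := b) (hpL 0 0) (hm _ 0 0)
  have hMLs : Tendsto (s22 q b) _ (𝓝 _) := hSL.trans (le_of_eq (congrArg 𝓝 hsL))
  have hML := tendsto_M x t (tendsto_id_nhdsWithin _ k) (eventually_im_pos h1) (hpL x t) (hm _ x t)
      hMLs hsL0
  rw [← halfplane_right] at hMR
  rw [← halfplane_left] at hML
  refine ⟨_, _, hasNontangentialLimit_of_halfplane hML, hasNontangentialLimit_of_halfplane hMR, ?_⟩
  rw [jump_mul]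
  congr 1
  have e3 := h.phiP2_eq h1.le him hne x t
  rw [jumpO, if_neg h1.ne', if_pos hk]
  have hrho : rho q b k = s12 q b k / s22 q b k := rfl
  have ee := exp_mul_exp_neg (Complex.I * b.δ)
  have hδ : Complex.exp (-(Complex.I * b.δ)) = (Complex.exp (Complex.I * b.δ))⁻¹ :=
    Complex.exp_neg _
  have hE := Complex.exp_ne_zero (Complex.I * b.δ)
  change columns ((-Complex.I * Complex.exp (-(Complex.I * b.δ))) • phiP2 q b x t k) _ =
    columns (phiP1 q b x t k) ((s22 q b k)⁻¹ • phiM2 q b x t k) * _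
  ext i j
  have e3i := congrFun e3 i
  simp only [Pi.smul_apply, Pi.sub_apply, smul_eq_mul] at e3i
  have hA : -Complex.I * Complex.exp (-(Complex.I * b.δ)) * phiP2 q b x t k i =
      phiP1 q b x t k i * (Complex.I * rho q b k * Complex.exp (-(Complex.I * b.δ))) +
      (s22 q b k)⁻¹ * phiM2 q b x t k i * (-Complex.I * Complex.exp (-(Complex.I * b.δ))) := by
    rw [hrho, hδ]
    field_simp
    linear_combination -e3i
  have hB : (Complex.I * Complex.exp (-(Complex.I * b.δ)) * s12 q b k)⁻¹ * phiM2 q b x t k i =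
      (s22 q b k)⁻¹ * phiM2 q b x t k i * (-Complex.I * Complex.exp (Complex.I * b.δ) / rho q b k)
          := by
    rw [hrho, hδ, mul_inv, mul_inv, Complex.inv_I]
    field_simp
  fin_cases i <;> fin_cases j <;> simp only [columns, Matrix.mul_apply, Fin.sum_univ_two,
    Matrix.of_apply, Matrix.cons_val', Matrix.cons_val_zero, Matrix.cons_val_one,
        Matrix.cons_val_fin_one,
    Pi.smul_apply, smul_eq_mul, Fin.zero_eta, Fin.mk_one, mul_zero, zero_add]
  · exact hA
  · exact hB
  · exact hA
  · exact hB

/-- The jump across the upper half of `Σ₋`. -/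
theorem jump_minus (h : IsStepSolution q b) (x t : ℝ) {k : ℂ} (hk : k ∈ b.minus.cutUpper)
    (hs : s22 q b k ≠ 0) (hs' : r21 q b k ≠ 0) : ∃ Fp Fm : Mat2,
    HasNontangentialLimit (M q b x t) (-1) k Fp ∧ HasNontangentialLimit (M q b x t) 1 k Fm ∧
    Fp = Fm * jump b (rho q b) (refl q b) x t k := by
  obtain ⟨h0, h1, h2⟩ := id hk
  have hlow : -b.minus.A < k.im := by linarith
  obtain ⟨hre, him, -⟩ := eigenval_of_mem_cut h0 hlow h2
  have hne : b.minus.eigenval k ≠ 0 := fun e => by rw [e, Complex.zero_re] at hre; exact hre.false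
  obtain ⟨hr, hl⟩ := tendsto_eigenval_right (w := b.minus) h.Am_pos h0 hlow h2
  rw [← h0] at hr hl
  have hnot := h.notMem_plus_of_minus (k := k) (re_of_mem_minus h0)
  have hmR := fun x t => tendsto_jost_atBot h.nls h.Am_pos h.minus x t
    (tendsto_id_nhdsWithin {z : ℂ | k.re < z.re} k) hr
    ((eventually_im_pos h1).mono fun z hz => hz.le) h1.le hne
  have hmL := fun x t => tendsto_jost_atBot_left h.nls h.Am_pos h.minus x t hk
    (tendsto_id_nhdsWithin {z : ℂ | z.re < k.re} k) hl
  have hp := fun (s : Set ℂ) x t => h.tendsto_phiP1 x t (nhdsWithin_le_nhds : 𝓝[s] k ≤ 𝓝 k)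
    ((eventually_im_pos h1).mono fun z hz => hz.le) h1.le hnot
  have hδ : Complex.exp (Complex.I * b.minus.δ) = (Complex.exp (Complex.I * b.δ))⁻¹ := by
    rw [← Complex.exp_neg]
    simp [Background.minus]
  simp only [hδ] at hmL
  have hE := Complex.exp_ne_zero (Complex.I * b.δ)
  -- Here it is `φ₋₂` that changes, and `s₂₂` tends to a multiple of `r₂₁`. The same constant occurs
  -- in both and drops out of the quotient in the second column.
  have hsL : wronskian (phiP1 q b 0 0 k)
      ((-Complex.I * (Complex.exp (Complex.I * b.δ))⁻¹) • phiM1 q b 0 0 k) =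
      Complex.I * (Complex.exp (Complex.I * b.δ))⁻¹ * r21 q b k := by
    rw [wronskian_smul_right, wronskian_swap, r21]
    ring
  have hsL0 : Complex.I * (Complex.exp (Complex.I * b.δ))⁻¹ * r21 q b k ≠ 0 :=
    mul_ne_zero (mul_ne_zero Complex.I_ne_zero (inv_ne_zero hE)) hs'
  have hMR := tendsto_M x t (tendsto_id_nhdsWithin _ k) (eventually_im_pos h1) (hp _ x t) (hmR x t)
    (tendsto_s22 (hp _ 0 0) (hmR 0 0)) hs
  have hSL := tendsto_s22 (q := q) (b := b) (hp _ 0 0) (hmL 0 0)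
  have hMLs : Tendsto (s22 q b) _ (𝓝 _) := hSL.trans (le_of_eq (congrArg 𝓝 hsL))
  have hML := tendsto_M x t (tendsto_id_nhdsWithin _ k) (eventually_im_pos h1) (hp _ x t) (hmL x t)
      hMLs hsL0
  rw [← halfplane_right] at hMR
  rw [← halfplane_left] at hML
  refine ⟨_, _, hasNontangentialLimit_of_halfplane hML, hasNontangentialLimit_of_halfplane hMR, ?_⟩
  rw [jump_mul]
  congr 1
  have e3 := h.phiM1_eq h1.le him hne x t
  have hn1 : k ∉ b.plus.cutUpper := fun h' => hnot ⟨h'.1, by linarith [h'.2.1, h'.2.2], h'.2.2.le⟩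
  have hn2 : k ∉ b.plus.cutLower := fun h' => h'.2.2.not_gt h1
  rw [jumpO, if_neg h1.ne', if_neg hn1, if_neg hn2, if_pos hk]
  have hrefl : refl q b k = 1 / (s22 q b k * r21 q b k) := rfl
  change columns (phiP1 q b x t k) (_ • (-Complex.I * (Complex.exp (Complex.I * b.δ))⁻¹) • phiM1 q
      b x t k) =
    columns (phiP1 q b x t k) ((s22 q b k)⁻¹ • phiM2 q b x t k) * _
  ext i j
  have e3i := congrFun e3 i
  simp only [Pi.smul_apply, Pi.sub_apply, smul_eq_mul] at e3i
  have hB : (Complex.I * (Complex.exp (Complex.I * b.δ))⁻¹ * r21 q b k)⁻¹ *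
      (-Complex.I * (Complex.exp (Complex.I * b.δ))⁻¹ * phiM1 q b x t k i) =
      phiP1 q b x t k i * -refl q b k + (s22 q b k)⁻¹ * phiM2 q b x t k i := by
    rw [hrefl]
    field_simp
    linear_combination -e3i
  fin_cases i <;> fin_cases j <;> simp only [columns, Matrix.mul_apply, Fin.sum_univ_two,
    Matrix.of_apply, Matrix.cons_val', Matrix.cons_val_zero, Matrix.cons_val_one,
        Matrix.cons_val_fin_one,
    Pi.smul_apply, smul_eq_mul, Fin.zero_eta, Fin.mk_one, mul_zero, mul_one, add_zero]
  · exact hB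
  · exact hB

end IsStepSolution

end Jumps

/-! ### The jump condition on the whole contour -/

section JumpCondition

variable {q : ℝ → ℝ → ℂ} {b : Background}

theorem conj_mem_cutUpper {w : PlaneWave} {k : ℂ} (hk : k ∈ w.cutLower) : conj k ∈ w.cutUpper := by
  obtain ⟨h0, h1, h2⟩ := hk
  exact ⟨by rwa [Complex.conj_re], by rw [Complex.conj_im]; linarith,
    by rw [Complex.conj_im]; linarith⟩

theorem cutUpper_subset_cut {w : PlaneWave} : w.cutUpper ⊆ w.cut := fun _ hk =>
  ⟨hk.1, by linarith [hk.2.1, hk.2.2], hk.2.2.le⟩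

theorem cutLower_subset_cut {w : PlaneWave} : w.cutLower ⊆ w.cut := fun _ hk =>
  ⟨hk.1, hk.2.1.le, by linarith [hk.2.1, hk.2.2]⟩

namespace IsStepSolution

/-- Reflection in the real line preserves the left side of the upward cuts, so the jump matrices
correspond under `schwarz` without inversion. -/
theorem jumpO_conj (h : IsStepSolution q b) (ρ r : ℂ → ℂ) {k : ℂ}
    (hk : k ∈ b.plus.cutLower ∪ b.minus.cutLower) :
    jumpO b ρ r k = schwarz (jumpO b ρ r (conj k)) := by
  have him : k.im < 0 := by
    rcases hk with hk | hk <;> exact hk.2.2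
  have hup : ∀ {w : PlaneWave}, k ∉ w.cutUpper := fun h' => h'.2.1.not_gt him
  have hlow : ∀ {w : PlaneWave}, conj k ∉ w.cutLower := fun h' => by
    have := h'.2.2
    rw [Complex.conj_im] at this
    linarith
  have him' : (conj k).im ≠ 0 := by
    rw [Complex.conj_im]
    exact neg_ne_zero.2 him.ne
  have e1 : conj (Complex.exp (Complex.I * b.δ)) = Complex.exp (-(Complex.I * b.δ)) :=
    conj_exp_mul_I b.δ
  have e2 : conj (Complex.exp (-(Complex.I * b.δ))) = Complex.exp (Complex.I * b.δ) := by
    rw [← e1, Complex.conj_conj]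
  rcases hk with hk | hk
  · rw [jumpO, jumpO, if_neg him.ne, if_neg hup, if_pos hk, if_neg him', if_pos (conj_mem_cutUpper
        hk)]
    ext i j
    fin_cases i <;> fin_cases j <;> simp [schwarz, e1, e2]
  · have hn := h.notMem_plus_of_minus (k := k) (re_of_mem_minus hk.1)
    have hn' := h.notMem_plus_of_minus (k := conj k) (by
        rw [Complex.conj_re]; exact re_of_mem_minus hk.1)
    rw [jumpO, jumpO, if_neg him.ne, if_neg hup, if_neg (fun h' => hn (cutLower_subset_cut h')),
      if_neg hup, if_pos hk, if_neg him', if_neg (fun h' => hn' (cutUpper_subset_cut h')), if_neg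
          hlow,
      if_pos (conj_mem_cutUpper hk)]
    ext i j
    fin_cases i <;> fin_cases j <;> simp [schwarz]

theorem jump_upper (h : IsStepSolution q b) (x t : ℝ) {k : ℂ}
    (hk : k ∈ b.plus.cutUpper ∪ b.minus.cutUpper) (hs : k ∉ upperSingularities q b) :
    ∃ Fp Fm : Mat2,
    HasNontangentialLimit (M q b x t) (-1) k Fp ∧ HasNontangentialLimit (M q b x t) 1 k Fm ∧
    Fp = Fm * jump b (rho q b) (refl q b) x t k := by
  rcases hk with hk | hk
  · exact h.jump_plus x t hk (fun e => hs (Or.inr (Or.inl ⟨hk, Or.inl e⟩)))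
      (fun e => hs (Or.inr (Or.inl ⟨hk, Or.inr e⟩)))
  · exact h.jump_minus x t hk (fun e => hs (Or.inr (Or.inr ⟨hk, Or.inl e⟩)))
      (fun e => hs (Or.inr (Or.inr ⟨hk, Or.inr e⟩)))

theorem jump_lower (h : IsStepSolution q b) (x t : ℝ) {k : ℂ}
    (hk : k ∈ b.plus.cutLower ∪ b.minus.cutLower) (hs : conj k ∉ upperSingularities q b) :
    ∃ Fp Fm : Mat2,
    HasNontangentialLimit (M q b x t) (-1) k Fp ∧ HasNontangentialLimit (M q b x t) 1 k Fm ∧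
    Fp = Fm * jump b (rho q b) (refl q b) x t k := by
  have hk' : conj k ∈ b.plus.cutUpper ∪ b.minus.cutUpper :=
    hk.imp conj_mem_cutUpper conj_mem_cutUpper
  have him : 0 < (conj k).im := by
    rcases hk' with hk' | hk' <;> exact hk'.2.1
  obtain ⟨Fp, Fm, h1, h2, h3⟩ := h.jump_upper x t hk' hs
  have h1' := hasNontangentialLimit_conj h (eventually_im_pos him) h1
  have h2' := hasNontangentialLimit_conj h (eventually_im_pos him) h2
  rw [Complex.conj_conj, map_neg, map_one] at h1'
  rw [Complex.conj_conj, map_one] at h2'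
  refine ⟨_, _, h1', h2', ?_⟩
  rw [h3, schwarz_mul, jump, schwarz_mul, schwarz_mul, schwarz_expSigma3, schwarz_expSigma3,
      map_neg,
    ← conj_thetaO, Complex.conj_conj, ← h.jumpO_conj _ _ hk, jump]

/-- The jump condition. -/
theorem jump_cond (h : IsStepSolution q b) (x t : ℝ) {k : ℂ} (hk : k ∈ b.regularContour)
    (hs : k ∉ spectralSingularities q b) : ∃ Fp Fm : Mat2,
    HasNontangentialLimit (M q b x t) (leftNormal k) k Fp ∧
    HasNontangentialLimit (M q b x t) (-leftNormal k) k Fm ∧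
    Fp = Fm * jump b (rho q b) (refl q b) x t k := by
  have hs1 : k ∉ upperSingularities q b := fun h' => hs (Or.inl h')
  have hs2 : conj k ∉ upperSingularities q b := fun h' => hs (Or.inr h')
  have hup : k ∈ b.plus.cutUpper ∪ b.minus.cutUpper → ∃ Fp Fm : Mat2,
      HasNontangentialLimit (M q b x t) (leftNormal k) k Fp ∧
      HasNontangentialLimit (M q b x t) (-leftNormal k) k Fm ∧
      Fp = Fm * jump b (rho q b) (refl q b) x t k := fun hk => by
    have him : k.im ≠ 0 := by
      rcases hk with hk | hk <;> exact hk.2.1.ne'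
    rw [leftNormal, if_neg him, neg_neg]
    exact h.jump_upper x t hk hs1
  have hlow : k ∈ b.plus.cutLower ∪ b.minus.cutLower → ∃ Fp Fm : Mat2,
      HasNontangentialLimit (M q b x t) (leftNormal k) k Fp ∧
      HasNontangentialLimit (M q b x t) (-leftNormal k) k Fm ∧
      Fp = Fm * jump b (rho q b) (refl q b) x t k := fun hk => by
    have him : k.im ≠ 0 := by
      rcases hk with hk | hk <;> exact hk.2.2.ne
    rw [leftNormal, if_neg him, neg_neg]
    exact h.jump_lower x t hk hs2
  rcases hk with (⟨him, h1, h2⟩ | hk | hk) | hk | hk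
  · rw [leftNormal, if_pos him]
    exact h.jump_real x t him h1 h2 fun e => hs1 (Or.inl ⟨him, e⟩)
  · exact hup (Or.inl hk)
  · exact hlow (Or.inl hk)
  · exact hup (Or.inr hk)
  · exact hlow (Or.inr hk)

end IsStepSolution

end JumpCondition

/-! ### Analyticity -/

section Analyticity

variable {q : ℝ → ℝ → ℂ} {b : Background}

theorem isClosed_contour (b : Background) : IsClosed b.contour :=
  ((isClosed_eq Complex.continuous_im continuous_const).union (isClosed_cut _)).union (isClosed_cut
      _)

theorem conj_mem_contour {k : ℂ} (hk : conj k ∈ b.contour) : k ∈ b.contour := by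
  have hc : ∀ w : PlaneWave, conj k ∈ w.cut → k ∈ w.cut := fun w h => by
    obtain ⟨h0, h1, h2⟩ := h
    rw [Complex.conj_re] at h0
    rw [Complex.conj_im] at h1 h2
    exact ⟨h0, by linarith, by linarith⟩
  rcases hk with (hk | hk) | hk
  · exact Or.inl (Or.inl (by simpa using hk))
  · exact Or.inl (Or.inr (hc _ hk))
  · exact Or.inr (hc _ hk)

/-- The part of the upper half-plane off the contour. -/
def upperDomain (b : Background) : Set ℂ := {k | 0 < k.im ∧ k ∉ b.contour}

theorem isOpen_upperDomain (b : Background) : IsOpen (upperDomain b) :=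
  (isOpen_lt continuous_const Complex.continuous_im).inter (isClosed_contour b).isOpen_compl

theorem differentiableOn_apply {f : ℂ → Vec} {U : Set ℂ} (h : DifferentiableOn ℂ f U) (i : Fin 2) :
    DifferentiableOn ℂ (fun k => f k i) U := differentiableOn_pi.1 h i

namespace IsStepSolution

theorem differentiableOn_phiP1 (h : IsStepSolution q b) (x t : ℝ) :
    DifferentiableOn ℂ (fun k => phiP1 q b x t k) (upperDomain b) :=
  (differentiableOn_jost h.nls h.Ap_pos h.plus x t).mono fun _ hk =>
    ⟨hk.1, fun h' => hk.2 (Or.inl (Or.inr h'))⟩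

theorem differentiableOn_phiM2 (h : IsStepSolution q b) (x t : ℝ) :
    DifferentiableOn ℂ (fun k => phiM2 q b x t k) (upperDomain b) :=
  (differentiableOn_jost_atBot h.nls h.Am_pos h.minus x t).mono fun _ hk =>
    ⟨hk.1, fun h' => hk.2 (Or.inr h')⟩

theorem differentiableOn_s22 (h : IsStepSolution q b) :
    DifferentiableOn ℂ (s22 q b) (upperDomain b) := by
  have h1 := differentiableOn_apply (h.differentiableOn_phiP1 0 0)
  have h2 := differentiableOn_apply (h.differentiableOn_phiM2 0 0)
  exact ((h1 0).mul (h2 1)).sub ((h1 1).mul (h2 0))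

theorem M_apply_zero (x t : ℝ) {k : ℂ} (hk : 0 < k.im) (i : Fin 2) :
    M q b x t k i 0 = Complex.exp (-(Complex.I * thetaO x t k)) * phiP1 q b x t k i := by
  rw [M_of_im_pos x t hk]
  fin_cases i <;> simp [columns, expSigma3, Matrix.mul_apply, Fin.sum_univ_two, mul_comm]

theorem M_apply_one (x t : ℝ) {k : ℂ} (hk : 0 < k.im) (i : Fin 2) :
    M q b x t k i 1 = Complex.exp (Complex.I * thetaO x t k) * ((s22 q b k)⁻¹ * phiM2 q b x t k i)
        := by
  rw [M_of_im_pos x t hk]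
  fin_cases i <;> simp [columns, expSigma3, Matrix.mul_apply, Fin.sum_univ_two, mul_comm]

theorem differentiableOn_M (h : IsStepSolution q b) (x t : ℝ) (i j : Fin 2) :
    DifferentiableOn ℂ (fun k => M q b x t k i j) {k ∈ upperDomain b | s22 q b k ≠ 0} := by
  have h1 := (differentiableOn_apply (h.differentiableOn_phiP1 x t) i).mono
    (fun k hk => hk.1 : {k ∈ upperDomain b | s22 q b k ≠ 0} ⊆ upperDomain b)
  have h2 := (differentiableOn_apply (h.differentiableOn_phiM2 x t) i).mono
    (fun k hk => hk.1 : {k ∈ upperDomain b | s22 q b k ≠ 0} ⊆ upperDomain b)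
  have h3 := (h.differentiableOn_s22.mono
    (fun k hk => hk.1 : {k ∈ upperDomain b | s22 q b k ≠ 0} ⊆ upperDomain b)).inv fun k hk => hk.2
  have hth : Differentiable ℂ (thetaO x t) := by
    unfold thetaO
    fun_prop
  have he : ∀ c : ℂ, DifferentiableOn ℂ (fun k => Complex.exp (c * thetaO x t k))
      {k ∈ upperDomain b | s22 q b k ≠ 0} := fun c => (hth.const_mul c).cexp.differentiableOn
  fin_cases j
  · refine ((he (-Complex.I)).mul h1).congr fun k hk => ?_
    rw [Pi.mul_apply, neg_mul]
    exact M_apply_zero x t hk.1.1 i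
  · refine ((he Complex.I).mul (h3.mul h2)).congr fun k hk => ?_
    exact M_apply_one x t hk.1.1 i

theorem isOpen_regular (h : IsStepSolution q b) : IsOpen {k ∈ upperDomain b | s22 q b k ≠ 0} :=
  h.differentiableOn_s22.continuousOn.isOpen_inter_preimage (isOpen_upperDomain b)
      isOpen_compl_singleton

/-- Analyticity in the upper half-plane carries over to the lower one. -/
theorem analyticAt_M_conj (h : IsStepSolution q b) {x t : ℝ} {k : ℂ} (hk : k.im < 0)
    (hM : ∀ i j, AnalyticAt ℂ (fun z => M q b x t z i j) (conj k)) (i j : Fin 2) :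
    AnalyticAt ℂ (fun z => M q b x t z i j) k := by
  have hconj : ∀ i j, AnalyticAt ℂ (fun z => conj (M q b x t (conj z) i j)) k := fun i j => by
    have hev := Complex.analyticAt_iff_eventually_differentiableAt.1 (hM i j)
    refine Complex.analyticAt_iff_eventually_differentiableAt.2 ?_
    have := (Complex.continuous_conj.tendsto k).eventually hev
    filter_upwards [this] with z hz
    have := hz.conj_conj
    rw [Complex.conj_conj] at this
    exact this
  have hev : ∀ᶠ z in 𝓝 k, z.im < 0 := (Complex.continuous_im.tendsto k).eventually (gt_mem_nhds hk)
  have key : ∀ i j, (fun z => schwarz (M q b x t (conj z)) i j) =ᶠ[𝓝 k] fun z => M q b x t z i j :=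
    fun i j => by
      filter_upwards [hev] with z hz
      rw [M_of_im_neg h x t hz]
  refine AnalyticAt.congr ?_ (key i j)
  fin_cases i <;> fin_cases j
  · exact hconj 1 1
  · exact (hconj 1 0).neg
  · exact (hconj 0 1).neg
  · exact hconj 0 0

theorem analyticAt_M (h : IsStepSolution q b) (x t : ℝ) {k : ℂ} (hk : k ∉ b.contour)
    (h1 : k ∉ eigenvalues q b) (h2 : conj k ∉ eigenvalues q b) (i j : Fin 2) :
    AnalyticAt ℂ (fun z => M q b x t z i j) k := by
  have hup : ∀ {k : ℂ}, 0 < k.im → k ∉ b.contour → k ∉ eigenvalues q b → ∀ i j,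
      AnalyticAt ℂ (fun z => M q b x t z i j) k := fun {k} hk0 hk hk1 i j =>
    (h.differentiableOn_M x t i j).analyticAt
      (h.isOpen_regular.mem_nhds ⟨⟨hk0, hk⟩, fun e => hk1 ⟨hk0, hk, e⟩⟩)
  have him : k.im ≠ 0 := fun e => hk (Or.inl (Or.inl e))
  rcases him.lt_or_gt with him | him
  · exact h.analyticAt_M_conj him (hup (by rw [Complex.conj_im]; linarith)
      (fun h' => hk (conj_mem_contour h')) h2) i j
  · exact hup him hk h1 i j

end IsStepSolution

end Analyticity

/-! ### Residues -/

section Residues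

variable {q : ℝ → ℝ → ℂ} {b : Background}

theorem tendsto_matrix {l : Filter ℂ} {F : ℂ → Mat2} {L : Mat2}
    (h : ∀ i j, Tendsto (fun k => F k i j) l (𝓝 (L i j))) : Tendsto F l (𝓝 L) :=
  tendsto_pi_nhds.2 fun i => tendsto_pi_nhds.2 fun j => h i j

theorem schwarz_residue (c : ℂ) (x t : ℝ) (k : ℂ) (u : Vec) :
    schwarz (columns 0 ((c * Complex.exp (2 * Complex.I * thetaO x t k)) • u)) =
      columns ((-conj c * Complex.exp (-(2 * Complex.I * thetaO x t (conj k)))) • -conjJ u) 0 := by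
  have e : conj (Complex.exp (2 * Complex.I * thetaO x t k)) =
      Complex.exp (-(2 * Complex.I * thetaO x t (conj k))) := by
    rw [conj_thetaO, ← Complex.exp_conj]
    simp [map_ofNat]
  rw [schwarz_columns, conjJ_smul, map_mul, e]
  ext i j
  fin_cases i <;> fin_cases j <;> simp [columns, conjJ]

theorem tendsto_conj_punctured (k₀ : ℂ) :
    Tendsto (fun z : ℂ => conj z) (𝓝[≠] conj k₀) (𝓝[≠] k₀) := by
  refine tendsto_nhdsWithin_iff.2 ⟨?_, ?_⟩
  · have := (Complex.continuous_conj.tendsto (conj k₀)).mono_left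
      (nhdsWithin_le_nhds (s := {conj k₀}ᶜ))
    rwa [Complex.conj_conj] at this
  · filter_upwards [self_mem_nhdsWithin] with z hz hz'
    exact hz (by rw [mem_singleton_iff, ← (hz' : conj z = k₀), Complex.conj_conj])

namespace IsStepSolution

/-- At a zero of `s₂₂` the Jost solutions are proportional, with a factor independent of
`(x, t)`. -/
theorem exists_proportional (h : IsStepSolution q b) {k : ℂ} (hk : k ∈ eigenvalues q b) :
    ∃ β : ℂ, ∀ x t, phiM2 q b x t k = β • phiP1 q b x t k := by
  obtain ⟨h0, h1, h2⟩ := hk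
  have hne := h.phiP1_ne_zero h0.le (eigenval_ne_zero (w := b.plus) h.Ap_pos
    fun h' => h1 (Or.inl (Or.inr h'))) 0 0
  obtain ⟨β, hβ⟩ := exists_smul_of_wronskian_eq_zero hne h2
  exact ⟨β, (h.isLax_phiM2 h0.le).eq_of_eq_zero h.nls ((h.isLax_phiP1 h0.le).smul β) hβ⟩

theorem hasDerivAt_s22 (h : IsStepSolution q b) {k : ℂ} (hk : k ∈ eigenvalues q b) :
    HasDerivAt (s22 q b) (deriv (s22 q b) k) k :=
  (h.differentiableOn_s22.differentiableAt
    ((isOpen_upperDomain b).mem_nhds ⟨hk.1, hk.2.1⟩)).hasDerivAt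

theorem eventually_upper (b : Background) {k : ℂ} (hk : k ∈ upperDomain b) :
    ∀ᶠ z in 𝓝[≠] k, z ∈ upperDomain b :=
  nhdsWithin_le_nhds ((isOpen_upperDomain b).mem_nhds hk)

theorem tendsto_M_column (h : IsStepSolution q b) (x t : ℝ) {k₀ : ℂ} (hk : k₀ ∈ upperDomain b) :
    Tendsto (fun k i => M q b x t k i 0) (𝓝[≠] k₀)
      (𝓝 (Complex.exp (-(Complex.I * thetaO x t k₀)) • phiP1 q b x t k₀)) := by
  have hle : 𝓝[≠] k₀ ≤ 𝓝 k₀ := nhdsWithin_le_nhds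
  have h1 := h.tendsto_phiP1 x t hle ((eventually_upper b hk).mono fun _ hz => hz.1.le) hk.1.le
    fun h' => hk.2 (Or.inl (Or.inr h'))
  have h2 : Tendsto (fun k => Complex.exp (-(Complex.I * thetaO x t k))) (𝓝[≠] k₀)
      (𝓝 (Complex.exp (-(Complex.I * thetaO x t k₀)))) :=
    ((Complex.continuous_exp.comp ((continuous_thetaO x t).const_mul Complex.I).neg).tendsto
      k₀).mono_left hle
  refine (h2.smul h1).congr' ?_
  filter_upwards [eventually_upper b hk] with k hk'
  ext i
  exact (M_apply_zero x t hk'.1 i).symm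

/-- Only `1/s₂₂` is singular, and `(k - k₀)/s₂₂` tends to `1/s₂₂'`. Replacing `φ₋₂` by `β φ₊₁`
expresses the residue through the first column; `e^{2iθ_o}` makes up for the opposite exponentials
of the columns. It is nonzero because `φ₋₂` has no zeros. -/
theorem hasSimplePole_M (h : IsStepSolution q b) (x t : ℝ) {k₀ : ℂ} (hk : k₀ ∈ eigenvalues q b)
    (hd : deriv (s22 q b) k₀ ≠ 0) {β : ℂ} (hβ : phiM2 q b x t k₀ = β • phiP1 q b x t k₀) :
    HasSimplePole (M q b x t) k₀ (columns 0
      ((β / deriv (s22 q b) k₀ * Complex.exp (2 * Complex.I * thetaO x t k₀)) •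
        Complex.exp (-(Complex.I * thetaO x t k₀)) • phiP1 q b x t k₀)) := by
  have hup : k₀ ∈ upperDomain b := ⟨hk.1, hk.2.1⟩
  have hev := eventually_upper b hup
  have hs := h.hasDerivAt_s22 hk
  have hne : ∀ᶠ z in 𝓝[≠] k₀, s22 q b z ≠ 0 := hs.eventually_ne hd
  have hvec : (β / deriv (s22 q b) k₀ * Complex.exp (2 * Complex.I * thetaO x t k₀)) •
      Complex.exp (-(Complex.I * thetaO x t k₀)) • phiP1 q b x t k₀ =
      (Complex.exp (Complex.I * thetaO x t k₀) * (deriv (s22 q b) k₀)⁻¹) • phiM2 q b x t k₀ := by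
    have e : Complex.exp (2 * Complex.I * thetaO x t k₀) * Complex.exp (-(Complex.I * thetaO x t
        k₀)) =
        Complex.exp (Complex.I * thetaO x t k₀) := by
      rw [← Complex.exp_add]
      congr 1
      ring
    rw [hβ, smul_smul, smul_smul, ← e]
    congr 1
    ring
  rw [hvec]
  refine ⟨fun i j => ?_, fun h0 => ?_, ?_⟩
  · filter_upwards [hev, hne] with k h1 h2
    exact (h.differentiableOn_M x t i j).analyticAt (h.isOpen_regular.mem_nhds ⟨h1, h2⟩)
  · have h1 := h.phiM2_ne_zero hup.1.le (eigenval_ne_zero (w := b.minus) h.Am_pos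
      fun h' => hup.2 (Or.inr h')) x t
    refine smul_ne_zero (mul_ne_zero (Complex.exp_ne_zero (Complex.I * thetaO x t k₀)) (inv_ne_zero
        hd)) h1 ?_
    ext i
    have := congrFun (congrFun h0 i) 1
    fin_cases i <;> exact this
  · have hle : 𝓝[≠] k₀ ≤ 𝓝 k₀ := nhdsWithin_le_nhds
    have hsub : Tendsto (fun k => k - k₀) (𝓝[≠] k₀) (𝓝 0) := by
      have : Tendsto (fun k => k - k₀) (𝓝 k₀) (𝓝 (k₀ - k₀)) := (continuous_id.sub
          continuous_const).tendsto _
      rw [sub_self] at this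
      exact this.mono_left hle
    have hslope : Tendsto (fun k => (k - k₀) * (s22 q b k)⁻¹) (𝓝[≠] k₀)
        (𝓝 (deriv (s22 q b) k₀)⁻¹) := by
      refine (hs.tendsto_slope.inv₀ hd).congr fun k => ?_
      rw [slope_def_field, hk.2.2, sub_zero, inv_div, div_eq_mul_inv]
    have hM2 := tendsto_pi_nhds.1 (h.tendsto_phiM2 x t hle (hev.mono fun _ hz => hz.1.le) hup.1.le
      fun h' => hup.2 (Or.inr h'))
    have hexp : Tendsto (fun k => Complex.exp (Complex.I * thetaO x t k)) (𝓝[≠] k₀)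
        (𝓝 (Complex.exp (Complex.I * thetaO x t k₀))) :=
      ((Complex.continuous_exp.comp ((continuous_thetaO x t).const_mul Complex.I)).tendsto
        k₀).mono_left hle
    have hc1 := tendsto_pi_nhds.1 (h.tendsto_M_column x t hup)
    refine tendsto_matrix fun i j => ?_
    fin_cases j
    · have := hsub.mul (hc1 i)
      rw [zero_mul] at this
      refine this.congr' (Eventually.of_forall fun k => rfl) |>.trans (le_of_eq ?_)
      congr 1
      fin_cases i <;> rfl
    · refine ((hexp.mul (hslope.mul (hM2 i))).congr' ?_).trans (le_of_eq ?_)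
      · filter_upwards [hev] with k hk'
        change _ = (k - k₀) * M q b x t k i 1
        rw [M_apply_one x t hk'.1 i]
        ring
      · congr 1
        rw [← mul_assoc]
        fin_cases i <;> rfl

/-- The Schwarz symmetry of the poles. -/
theorem hasSimplePole_conj (h : IsStepSolution q b) {x t : ℝ} {k₀ : ℂ} (hk : 0 < k₀.im) {R : Mat2}
    (hR : HasSimplePole (M q b x t) k₀ R) : HasSimplePole (M q b x t) (conj k₀) (schwarz R) := by
  have hc := tendsto_conj_punctured k₀
  have hpos : ∀ᶠ z in 𝓝[≠] conj k₀, z.im < 0 := by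
    have := hc.eventually (eventually_im_pos hk)
    filter_upwards [this] with z hz
    simpa using hz
  obtain ⟨h1, h2, h3⟩ := hR
  refine ⟨fun i j => ?_, fun h0 => h2 ?_, ?_⟩
  · have hall : ∀ᶠ z in 𝓝[≠] k₀, ∀ i j, AnalyticAt ℂ (fun z => M q b x t z i j) z :=
      eventually_all.2 fun i => eventually_all.2 fun j => h1 i j
    filter_upwards [hc.eventually hall, hpos] with z hz hz' using h.analyticAt_M_conj hz' hz i j
  · rw [← schwarz_schwarz R, h0]
    ext i j
    fin_cases i <;> fin_cases j <;> simp [schwarz]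
  · refine ((continuous_schwarz.tendsto R).comp (h3.comp hc)).congr' ?_
    filter_upwards [hpos] with z hz
    simp only [Function.comp]
    rw [schwarz_smul, map_sub, Complex.conj_conj, ← M_of_im_neg h x t hz]

theorem tendsto_M_column_conj (h : IsStepSolution q b) {x t : ℝ} {k₀ : ℂ} (hk : 0 < k₀.im) {F₁ :
    Vec}
    (hF : Tendsto (fun k i => M q b x t k i 0) (𝓝[≠] k₀) (𝓝 F₁)) :
    Tendsto (fun k i => M q b x t k i 1) (𝓝[≠] conj k₀) (𝓝 (-conjJ F₁)) := by
  have hc := tendsto_conj_punctured k₀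
  refine ((continuous_conjJ.neg.tendsto F₁).comp (hF.comp hc)).congr' ?_
  filter_upwards [hc.eventually (eventually_im_pos hk)] with z hz
  have hz' : z.im < 0 := by simpa using hz
  ext i
  rw [M_of_im_neg h x t hz']
  fin_cases i <;> simp [conjJ, schwarz]

end IsStepSolution

end Residues

/-! ### Normalization -/

section Normalization

variable {q : ℝ → ℝ → ℂ} {b : Background}

namespace IsStepSolution

theorem isBigO_s22 (h : IsStepSolution q b) :
    (fun k => s22 q b k - 1) =O[upperInfinity] fun k : ℂ => 1 / k := by
  have hg : Tendsto (fun k : ℂ => 1 / k) upperInfinity (𝓝 0) :=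
    tendsto_one_div_cobounded.mono_left inf_le_left
  obtain ⟨h1, h2⟩ := isBigO_jost h.nls h.Ap_pos h.plus 0 0
  obtain ⟨h3, h4⟩ := isBigO_jost_atBot h.nls h.Am_pos h.minus 0 0
  have e0 : ∀ k, thetaO 0 0 k = 0 := fun k => by simp [thetaO]
  simp only [e0, mul_zero, neg_zero, Complex.exp_zero, one_mul] at h1 h2 h3 h4
  have h5 := h2.mul (h4.trans (hg.isBigO_one ℂ))
  simp only [mul_one] at h5
  refine ((isBigO_mul_sub_one h1 h3 hg).sub h5).congr_left fun k => ?_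
  simp only [s22, wronskian, phiP1, phiM2]
  ring

theorem isBigO_M_upper (h : IsStepSolution q b) (x t : ℝ) (i j : Fin 2) :
    (fun k => M q b x t k i j - (1 : Mat2) i j) =O[Bornology.cobounded ℂ ⊓ 𝓟 {k | 0 < k.im}]
      fun k : ℂ => 1 / k := by
  have hle : Bornology.cobounded ℂ ⊓ 𝓟 {k : ℂ | 0 < k.im} ≤ upperInfinity :=
    inf_le_inf_left _ (principal_mono.2 fun k (hk : 0 < k.im) => (hk.le : 0 ≤ k.im))
  have hg : Tendsto (fun k : ℂ => 1 / k) upperInfinity (𝓝 0) :=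
    tendsto_one_div_cobounded.mono_left inf_le_left
  have hpos : ∀ᶠ k in Bornology.cobounded ℂ ⊓ 𝓟 {k : ℂ | 0 < k.im}, 0 < k.im :=
    mem_inf_of_right (mem_principal_self _)
  obtain ⟨h1, h2⟩ := isBigO_jost h.nls h.Ap_pos h.plus x t
  obtain ⟨h3, h4⟩ := isBigO_jost_atBot h.nls h.Am_pos h.minus x t
  have hs := isBigO_inv_sub_one h.isBigO_s22 hg
  have hs1 : Tendsto (fun k => (s22 q b k)⁻¹) upperInfinity (𝓝 1) := by
    have := (hs.trans_tendsto hg).add_const 1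
    simpa using this
  have h5 := (hs1.isBigO_one ℂ).mul h4
  simp only [one_mul] at h5
  have h6 := isBigO_mul_sub_one hs h3 hg
  fin_cases i <;> fin_cases j
  · refine (h1.mono hle).congr' ?_ EventuallyEq.rfl
    filter_upwards [hpos] with k hk
    simp [M_apply_zero x t hk, phiP1]
  · refine (h5.mono hle).congr' ?_ EventuallyEq.rfl
    filter_upwards [hpos] with k hk
    simp [M_apply_one x t hk, phiM2]
    ring
  · refine (h2.mono hle).congr' ?_ EventuallyEq.rfl
    filter_upwards [hpos] with k hk
    simp [M_apply_zero x t hk, phiP1]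
  · refine (h6.mono hle).congr' ?_ EventuallyEq.rfl
    filter_upwards [hpos] with k hk
    simp [M_apply_one x t hk, phiM2]
    ring

theorem isBigO_M_lower (h : IsStepSolution q b) (x t : ℝ) (i j : Fin 2) :
    (fun k => M q b x t k i j - (1 : Mat2) i j) =O[Bornology.cobounded ℂ ⊓ 𝓟 {k | k.im < 0}]
      fun k : ℂ => 1 / k := by
  have hc : Tendsto (fun k : ℂ => conj k) (Bornology.cobounded ℂ ⊓ 𝓟 {k | k.im < 0})
      (Bornology.cobounded ℂ ⊓ 𝓟 {k | 0 < k.im}) := by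
    refine tendsto_inf.2 ⟨?_, ?_⟩
    · refine Tendsto.mono_left ?_ inf_le_left
      rw [← tendsto_norm_atTop_iff_cobounded]
      simpa only [Complex.norm_conj] using tendsto_norm_cobounded_atTop
    · refine tendsto_principal.2 (mem_inf_of_right ?_)
      refine mem_principal.2 fun k hk => ?_
      have : k.im < 0 := hk
      change 0 < (conj k).im
      rw [Complex.conj_im]
      linarith
  have hneg : ∀ᶠ k in Bornology.cobounded ℂ ⊓ 𝓟 {k : ℂ | k.im < 0}, k.im < 0 :=
    mem_inf_of_right (mem_principal_self _)
  have key : ∀ i j, (fun k => conj (M q b x t (conj k) i j - (1 : Mat2) i j))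
      =O[Bornology.cobounded ℂ ⊓ 𝓟 {k | k.im < 0}] fun k : ℂ => 1 / k := fun i j => by
    have := ((h.isBigO_M_upper x t i j).comp_tendsto hc).norm_norm
    refine Asymptotics.IsBigO.of_norm_norm (this.congr (fun k => ?_) (fun k => ?_))
    · simp only [Function.comp, Complex.norm_conj]
    · simp only [Function.comp, norm_div, Complex.norm_conj]
  have fin : ∀ {f : ℂ → ℂ}, f =O[Bornology.cobounded ℂ ⊓ 𝓟 {k | k.im < 0}] (fun k : ℂ => 1 / k) →
      (∀ k : ℂ, k.im < 0 → f k = schwarz (M q b x t (conj k)) i j - (1 : Mat2) i j) →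
      (fun k => M q b x t k i j - (1 : Mat2) i j) =O[Bornology.cobounded ℂ ⊓ 𝓟 {k | k.im < 0}]
      fun k : ℂ => 1 / k := fun hf he => by
    refine hf.congr' ?_ EventuallyEq.rfl
    filter_upwards [hneg] with k hk
    rw [he k hk, ← M_of_im_neg h x t hk]
  fin_cases i <;> fin_cases j
  · exact fin (key 1 1) fun k _ => by simp [schwarz]
  · exact fin (key 1 0).neg_left fun k _ => by simp [schwarz]
  · exact fin (key 0 1).neg_left fun k _ => by simp [schwarz]
  · exact fin (key 0 0) fun k _ => by simp [schwarz]

theorem isBigO_M (h : IsStepSolution q b) (x t : ℝ) (i j : Fin 2) :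
    (fun k => M q b x t k i j - (1 : Mat2) i j) =O[Bornology.cobounded ℂ ⊓ 𝓟 b.contourᶜ]
      fun k : ℂ => 1 / k := by
  refine ((h.isBigO_M_upper x t i j).sup (h.isBigO_M_lower x t i j)).mono ?_
  rw [← inf_sup_left, sup_principal]
  refine inf_le_inf_left _ (principal_mono.2 fun k hk => ?_)
  have him : k.im ≠ 0 := fun e => hk (Or.inl (Or.inl e))
  exact him.lt_or_gt.symm

end IsStepSolution

end Normalization

/-! ### The fourth root at the branch point -/

section FourthRoot

theorem sqrtDown_re_pos_of_im_pos {z : ℂ} (hz : 0 < z.im) : 0 < (sqrtDown z).re ∧ 0 < (sqrtDown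
    z).im := by
  obtain ⟨e1, e2⟩ := sqrtDown_re_im z
  have hz0 : 0 < ‖z‖ := norm_pos_iff.2 fun h => by rw [h, Complex.zero_im] at hz; exact hz.false
  have h0 := Complex.arg_nonneg_iff.2 hz.le
  have h1 : Complex.arg z ≠ 0 := fun h => hz.ne' (Complex.arg_eq_zero_iff.1 h).2
  have h2 : Complex.arg z ≤ Real.pi := Complex.arg_le_pi z
  have h3 : Complex.arg z ≠ Real.pi := fun h => hz.ne' (Complex.arg_eq_pi_iff.1 h).2
  have hpi := Real.pi_pos
  have hc : cutArg z = Complex.arg z := if_neg (by linarith)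
  have hs := Real.sqrt_pos.2 hz0
  have hpos : 0 < Complex.arg z := lt_of_le_of_ne h0 h1.symm
  have hlt : Complex.arg z < Real.pi := lt_of_le_of_ne h2 h3
  rw [e1, e2, hc]
  exact ⟨mul_pos hs (Real.cos_pos_of_mem_Ioo ⟨by linarith, by linarith⟩),
    mul_pos hs (Real.sin_pos_of_pos_of_lt_pi (by linarith) (by linarith))⟩

theorem continuousAt_sqrtDown {z : ℂ} (hz : 0 < z.im) : ContinuousAt sqrtDown z := by
  have h1 : principalSqrt =ᶠ[𝓝 z] sqrtDown := by
    filter_upwards [(Complex.continuous_im.tendsto z).eventually (lt_mem_nhds hz)] with y hy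
    exact principalSqrt_eq (sqrtDown_sq y) (sqrtDown_re_pos_of_im_pos hy).1
  exact (continuousAt_principalSqrt (Or.inr hz.ne')).congr h1

/-- The argument of such a `z` is less than `π/4` in modulus. The product of two such numbers stays
in the right half-plane, which makes principal roots multiplicative below. -/
theorem abs_im_lt_re_of_sq {z : ℂ} (h : 0 < z.re) (h2 : 0 < (z ^ 2).re) : |z.im| < z.re := by
  rw [sq, Complex.mul_re] at h2
  exact abs_lt_of_sq_lt_sq (by nlinarith) h.le

theorem re_mul_pos {z y : ℂ} (hz : |z.im| < z.re) (hy : |y.im| < y.re) : 0 < (z * y).re := by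
  rw [Complex.mul_re]
  have h1 : |z.im * y.im| < z.re * y.re := by
    rw [abs_mul]
    exact mul_lt_mul'' hz hy (abs_nonneg _) (abs_nonneg _)
  linarith [le_abs_self (z.im * y.im)]

variable {w : PlaneWave}

/-- The factor `d` vanishes at the branch point like a fourth root. -/
theorem exists_root4Down_eq (hA : 0 < w.A) : ∃ G : ℂ → ℂ, ∃ g : ℂ, g ≠ 0 ∧
    Tendsto G (𝓝[w.cutᶜ] w.branchPoint) (𝓝 g) ∧
    ∀ᶠ k in 𝓝[w.cutᶜ] w.branchPoint, root4Down (k - w.branchPoint) = w.d k * G k := by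
  have him : 0 < (2 * Complex.I * w.A : ℂ).im := by simpa using hA
  set s := sqrtDown (2 * Complex.I * w.A) with hs
  have hs1 : 0 < s.im := (sqrtDown_re_pos_of_im_pos him).2
  have hs0 : s ≠ 0 := fun h => by rw [h, Complex.zero_im] at hs1; exact hs1.false
  -- From `d² = 2λ/z` and the factorization of `λ` one gets `√(k - p) = d² H`, with `H` continuous
  -- and nonzero at `p`. Its limit `iA/(2√(2iA))` has positive real part, because `√(2iA)` has
  -- positive imaginary part.
  set H : ℂ → ℂ := fun k => w.z k / (2 * sqrtDown (k - w.branchPoint + 2 * Complex.I * w.A)) with hH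
  have hre : 0 < (Complex.I * w.A / (2 * s)).re := by
    refine re_div_pos ?_
    simp
    positivity
  have hle : 𝓝[w.cutᶜ] w.branchPoint ≤ 𝓝 w.branchPoint := nhdsWithin_le_nhds
  have hlim : Tendsto H (𝓝[w.cutᶜ] w.branchPoint) (𝓝 (Complex.I * w.A / (2 * s))) := by
    have h1 : Tendsto w.z (𝓝 w.branchPoint) (𝓝 (0 + (w.branchPoint + w.V / 2))) :=
      (tendsto_eigenval_branchPoint w).add
        ((by fun_prop : Continuous fun k : ℂ => k + (w.V : ℂ) / 2).tendsto _)
    have e1 : 0 + (w.branchPoint + (w.V : ℂ) / 2) = Complex.I * w.A := by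
      rw [PlaneWave.branchPoint]; ring
    rw [e1] at h1
    have h2 : Tendsto (fun k => k - w.branchPoint + 2 * Complex.I * w.A) (𝓝 w.branchPoint)
        (𝓝 (2 * Complex.I * w.A)) := by
      have := (by fun_prop : Continuous fun k : ℂ => k - w.branchPoint + 2 * Complex.I * w.A).tendsto
        w.branchPoint
      rwa [sub_self, zero_add] at this
    have h3 := ((continuousAt_sqrtDown him).tendsto.comp h2).const_mul 2
    exact (h1.div h3 (mul_ne_zero two_ne_zero hs0)).mono_left hle
  have hslit := mem_slitPlane_of_re_pos hre
  refine ⟨fun k => principalSqrt (H k), principalSqrt (Complex.I * w.A / (2 * s)), fun h0 => ?_,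
    (continuousAt_principalSqrt hslit).tendsto.comp hlim, ?_⟩
  · have := principalSqrt_re_pos hslit
    rw [h0, Complex.zero_re] at this
    exact this.false
  · have hev : ∀ᶠ k in 𝓝[w.cutᶜ] w.branchPoint, 0 < (H k).re :=
      ((Complex.continuous_re.tendsto _).comp hlim).eventually (lt_mem_nhds hre)
    filter_upwards [hev, self_mem_nhdsWithin] with k hk hcut
    have hne := eigenval_ne_zero hA hcut
    have hd := det_E_re_pos hA hne
    have hd1 : 0 < (w.d k).re := principalSqrt_re_pos (mem_slitPlane_of_re_pos hd)
    have hd2 : |(w.d k).im| < (w.d k).re := abs_im_lt_re_of_sq hd1 (by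
      rw [PlaneWave.d, principalSqrt_sq]; exact hd)
    have hG1 := principalSqrt_re_pos (mem_slitPlane_of_re_pos hk)
    have hG2 := abs_im_lt_re_of_sq hG1 (by rw [principalSqrt_sq]; exact hk)
    -- The branch is right because `d` and the root of `H` both have arguments below `π/4` in
    -- modulus.
    refine principalSqrt_eq ?_ (re_mul_pos hd2 hG2)
    have hlam : w.eigenval k = sqrtDown (k - w.branchPoint) *
        sqrtDown (k - w.branchPoint + 2 * Complex.I * w.A) := by
      rw [PlaneWave.eigenval, lam, PlaneWave.branchPoint]
      congr 2 <;> ring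
    have hz := z_ne_zero hA k
    have hne2 : sqrtDown (k - w.branchPoint + 2 * Complex.I * w.A) ≠ 0 := fun h => hne (by
      rw [hlam, h, mul_zero])
    rw [mul_pow, principalSqrt_sq, d_sq hA, hlam]
    simp only [hH]
    field_simp

end FourthRoot

/-! ### Behaviour at the branch points -/

section BranchPoints

variable {q : ℝ → ℝ → ℂ} {b : Background}

theorem branchPoint_im (w : PlaneWave) : w.branchPoint.im = w.A := by
  rw [PlaneWave.branchPoint, Complex.add_im, Complex.neg_im, Complex.mul_im]
  simp

theorem branchPoint_re (w : PlaneWave) : w.branchPoint.re = -(w.V / 2) := by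
  rw [PlaneWave.branchPoint, Complex.add_re, Complex.neg_re, Complex.mul_re]
  simp

theorem wronskian_ne_zero_of_linearIndependent {u v : Vec} (h : LinearIndependent ℂ ![u, v]) :
    wronskian u v ≠ 0 := by
  intro h0
  have hu : u ≠ 0 := h.ne_zero 0
  obtain ⟨c, hc⟩ := exists_smul_of_wronskian_eq_zero hu h0
  have := LinearIndependent.pair_iff.1 h (-c) 1 (by rw [hc]; simp)
  exact one_ne_zero this.2

theorem expSigma3_neg_mulVec_modify (w : PlaneWave) (j : Fin 2) (k : ℂ) (x t : ℝ) (u : Vec) :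
    expSigma3 (-(w.f x t : ℂ)) *ᵥ modify w j k x t u =
      Complex.exp (-(Complex.I * colSign j * w.θ x t k)) • u := by
  rw [modify, Matrix.mulVec_smul, Matrix.mulVec_mulVec]
  have : expSigma3 (-(w.f x t : ℂ)) * expSigma3 (w.f x t) = 1 := by
    ext i j
    fin_cases i <;> fin_cases j <;> simp [expSigma3, ← Complex.exp_add]
  rw [this, Matrix.one_mulVec]

namespace IsStepSolution

/-- Without the plane-wave factors, `μ₊₁` and `μ₋₂` are nonzero multiples of solutions of the Lax
pair, whose Wronskian is constant; so independence at any `(x, t)` can be moved to the origin. -/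
theorem wronskian_ne_zero_of_genericAt (h : IsStepSolution q b) {k : ℂ} (hk : 0 ≤ k.im)
    (hg : GenericAt q b k) :
    wronskian (jostD q b.plus atTop 0 0 0 k) (jostD q b.minus atBot 1 0 0 k) ≠ 0 := by
  obtain ⟨x, t, hxt⟩ := hg
  have h1 := wronskian_ne_zero_of_linearIndependent hxt
  rw [muP1, muM2, mu, mu, expSigma3_neg_mulVec_modify, expSigma3_neg_mulVec_modify,
    wronskian_smul_left, wronskian_smul_right] at h1
  have h2 := right_ne_zero_of_mul (right_ne_zero_of_mul h1)
  have h3 := (h.isJost_plus (h.plus_im_nonneg hk)).isLaxSolution.wronskian_eq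
    (h.isJost_minus (h.minus_im_nonneg hk)).isLaxSolution x t 0 0
  rwa [h3] at h2

theorem mul_powSigma3_apply (A : Mat2) (a : ℂ) (i : Fin 2) :
    (A * powSigma3 a) i 0 = A i 0 * a ∧ (A * powSigma3 a) i 1 = A i 1 * a⁻¹ := by
  constructor <;> simp [powSigma3, Matrix.mul_apply, Fin.sum_univ_two]

theorem tendsto_exp_thetaO (c : ℂ) (x t : ℝ) {l : Filter ℂ} {k₀ : ℂ} (hl : l ≤ 𝓝 k₀) :
    Tendsto (fun k => Complex.exp (c * thetaO x t k)) l (𝓝 (Complex.exp (c * thetaO x t k₀))) :=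
  ((Complex.continuous_exp.comp ((continuous_thetaO x t).const_mul c)).tendsto k₀).mono_left hl

/-- The behaviour at the branch point `p₊`. -/
theorem growth_plus (h : IsStepSolution q b) (hg : GenericAt q b b.plus.branchPoint) (x t : ℝ) :
    ∃ B : Mat2, Tendsto
      (fun k => M q b x t k * powSigma3 (root4Down (k - b.plus.branchPoint)))
      (𝓝[b.contourᶜ] b.plus.branchPoint) (𝓝 B) := by
  set p := b.plus.branchPoint with hp
  set l := 𝓝[b.contourᶜ] p with hl
  have hA : 0 < b.plus.A := h.Ap_pos
  have him : 0 < p.im := by rw [branchPoint_im]; exact hA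
  have hle : l ≤ 𝓝 p := nhdsWithin_le_nhds
  have hpos : ∀ᶠ k in l, 0 < k.im := eventually_im_pos him
  have hnot : p ∉ b.minus.cut := h.notMem_minus_of_plus (branchPoint_re b.plus)
  obtain ⟨G, g, hg0, hG, hroot⟩ := exists_root4Down_eq hA
  have hlc : l ≤ 𝓝[b.plus.cutᶜ] p :=
    nhdsWithin_mono _ (compl_subset_compl.2 fun k hk => Or.inl (Or.inr hk))
  replace hG := hG.mono_left hlc
  replace hroot := hlc hroot
  have hlam := (tendsto_eigenval_branchPoint b.plus).mono_left hle
  rw [← eigenval_branchPoint b.plus] at hlam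
  have hD : ∀ x t, Tendsto (fun k => jostD q b.plus atTop 0 x t k) l
      (𝓝 (jostD q b.plus atTop 0 x t p)) := fun x t => by
    have him' := eigenval_im_nonneg (w := b.plus) hA him.le
    rw [jostD_eq_jostFun h.nls hA h.plus him']
    exact tendsto_jostD h.nls hA h.plus x t (tendsto_id'.2 hle) hlam (hpos.mono fun k hk => hk.le)
      (eigenval_mem_curve him')
  have hm := fun x t => h.tendsto_phiM2 x t hle (hpos.mono fun k hk => hk.le) him.le hnot
  have hW : Tendsto (fun k => wronskian (jostD q b.plus atTop 0 0 0 k) (phiM2 q b 0 0 k)) l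
      (𝓝 (wronskian (jostD q b.plus atTop 0 0 0 p) (phiM2 q b 0 0 p))) :=
    (continuous_wronskian.tendsto _).comp ((hD 0 0).prodMk_nhds (hm 0 0))
  have hW0 : wronskian (jostD q b.plus atTop 0 0 0 p) (phiM2 q b 0 0 p) ≠ 0 := by
    rw [phiM2, jost, wronskian_smul_right]
    exact mul_ne_zero (inv_ne_zero (d_ne_zero (w := b.minus) h.Am_pos
      (eigenval_ne_zero (w := b.minus) h.Am_pos hnot))) (h.wronskian_ne_zero_of_genericAt him.le hg)
  have hdne : ∀ᶠ k in l, b.plus.d k ≠ 0 := by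
    filter_upwards [hlc self_mem_nhdsWithin] with k hk
    exact d_ne_zero hA (eigenval_ne_zero hA hk)
  -- Near `p₊` the fourth root is `d₊ G`. It cancels the `1/d₊` of `φ₊₁` in the first column. In the
  -- second column `1/s₂₂` equals `d₊` over the Wronskian of `d₊φ₊₁` and `φ₋₂`, and division by `d₊
  -- G` removes `d₊`.
  refine ⟨columns ((Complex.exp (-Complex.I * thetaO x t p) * g) • jostD q b.plus atTop 0 x t p)
    ((Complex.exp (Complex.I * thetaO x t p) *
      (g⁻¹ * (wronskian (jostD q b.plus atTop 0 0 0 p) (phiM2 q b 0 0 p))⁻¹)) • phiM2 q b x t p),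
          ?_⟩
  have h0 := tendsto_pi_nhds.1 (((tendsto_exp_thetaO (-Complex.I) x t hle).mul hG).smul (hD x t))
  have h1 := tendsto_pi_nhds.1 (((tendsto_exp_thetaO Complex.I x t hle).mul
    ((hG.inv₀ hg0).mul (hW.inv₀ hW0))).smul (hm x t))
  refine tendsto_matrix fun i j => ?_
  fin_cases j
  · refine ((h0 i).congr' ?_).trans (le_of_eq (congrArg 𝓝 ?_))
    · filter_upwards [hpos, hroot, hdne] with k hk hr hd
      change _ = (M q b x t k * _) i 0
      rw [(mul_powSigma3_apply _ _ i).1, M_apply_zero x t hk, phiP1, jost, hr, neg_mul]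
      simp only [Pi.smul_apply, smul_eq_mul]
      field_simp
    · fin_cases i <;> rfl
  · refine ((h1 i).congr' ?_).trans (le_of_eq (congrArg 𝓝 ?_))
    · filter_upwards [hpos, hroot, hdne] with k hk hr hd
      change _ = (M q b x t k * _) i 1
      rw [(mul_powSigma3_apply _ _ i).2, M_apply_one x t hk, hr]
      have hs : s22 q b k = (b.plus.d k)⁻¹ *
          wronskian (jostD q b.plus atTop 0 0 0 k) (phiM2 q b 0 0 k) := by
        rw [s22, phiP1, jost, wronskian_smul_left]
      rw [hs]
      simp only [Pi.smul_apply, smul_eq_mul, mul_inv, inv_inv]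
      have hdd : b.plus.d k * (b.plus.d k)⁻¹ = 1 := mul_inv_cancel₀ hd
      linear_combination (-(Complex.exp (Complex.I * thetaO x t k) * (G k)⁻¹ *
        (wronskian (jostD q b.plus atTop 0 0 0 k) (phiM2 q b 0 0 k))⁻¹ * phiM2 q b x t k i)) * hdd
    · fin_cases i <;> rfl

/-- The behaviour at the branch point `p₋`. -/
theorem growth_minus (h : IsStepSolution q b) (hg : GenericAt q b b.minus.branchPoint) (x t : ℝ) :
    ∃ B : Mat2, Tendsto (M q b x t) (𝓝[b.contourᶜ] b.minus.branchPoint) (𝓝 B) := by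
  set p := b.minus.branchPoint with hp
  set l := 𝓝[b.contourᶜ] p with hl
  have hA : 0 < b.minus.A := h.Am_pos
  have him : 0 < p.im := by rw [branchPoint_im]; exact hA
  have hle : l ≤ 𝓝 p := nhdsWithin_le_nhds
  have hpos : ∀ᶠ k in l, 0 < k.im := eventually_im_pos him
  have hnot : p ∉ b.plus.cut := h.notMem_plus_of_minus (re_of_mem_minus (branchPoint_re b.minus))
  have hlam := (tendsto_eigenval_branchPoint b.minus).mono_left hle
  rw [← eigenval_branchPoint b.minus] at hlam
  have hD : ∀ x t, Tendsto (fun k => jostD q b.minus atBot 1 x t k) l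
      (𝓝 (jostD q b.minus atBot 1 x t p)) := fun x t =>
    tendsto_jostD_atBot h.nls hA h.minus x t (tendsto_id'.2 hle) hlam
      (hpos.mono fun k hk => hk.le) him.le
  have hm := fun x t => h.tendsto_phiP1 x t hle (hpos.mono fun k hk => hk.le) him.le hnot
  have hW : Tendsto (fun k => wronskian (phiP1 q b 0 0 k) (jostD q b.minus atBot 1 0 0 k)) l
      (𝓝 (wronskian (phiP1 q b 0 0 p) (jostD q b.minus atBot 1 0 0 p))) :=
    (continuous_wronskian.tendsto _).comp ((hm 0 0).prodMk_nhds (hD 0 0))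
  have hW0 : wronskian (phiP1 q b 0 0 p) (jostD q b.minus atBot 1 0 0 p) ≠ 0 := by
    rw [phiP1, jost, wronskian_smul_left]
    exact mul_ne_zero (inv_ne_zero (d_ne_zero (w := b.plus) h.Ap_pos
      (eigenval_ne_zero (w := b.plus) h.Ap_pos hnot))) (h.wronskian_ne_zero_of_genericAt him.le hg)
  have hdne : ∀ᶠ k in l, b.minus.d k ≠ 0 := by
    filter_upwards [self_mem_nhdsWithin] with k hk
    exact d_ne_zero hA (eigenval_ne_zero hA fun h' => hk (Or.inr h'))
  -- At `p₋` the factor `1/d₋` of `φ₋₂` occurs also in `s₂₂`, so the quotient stays finite and no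
  -- root is needed.
  refine ⟨columns (Complex.exp (-Complex.I * thetaO x t p) • phiP1 q b x t p)
    ((Complex.exp (Complex.I * thetaO x t p) *
      (wronskian (phiP1 q b 0 0 p) (jostD q b.minus atBot 1 0 0 p))⁻¹) •
        jostD q b.minus atBot 1 x t p), ?_⟩
  have h0 := tendsto_pi_nhds.1 ((tendsto_exp_thetaO (-Complex.I) x t hle).smul (hm x t))
  have h1 := tendsto_pi_nhds.1 (((tendsto_exp_thetaO Complex.I x t hle).mul
    (hW.inv₀ hW0)).smul (hD x t))
  refine tendsto_matrix fun i j => ?_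
  fin_cases j
  · refine ((h0 i).congr' ?_).trans (le_of_eq (congrArg 𝓝 ?_))
    · filter_upwards [hpos] with k hk
      change _ = M q b x t k i 0
      rw [M_apply_zero x t hk, neg_mul]
      rfl
    · fin_cases i <;> rfl
  · refine ((h1 i).congr' ?_).trans (le_of_eq (congrArg 𝓝 ?_))
    · filter_upwards [hpos, hdne] with k hk hd
      change _ = M q b x t k i 1
      have hs : s22 q b k = (b.minus.d k)⁻¹ *
          wronskian (phiP1 q b 0 0 k) (jostD q b.minus atBot 1 0 0 k) := by
        rw [s22, phiM2, jost, wronskian_smul_right]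
      rw [M_apply_one x t hk, hs, phiM2, jost]
      simp only [Pi.smul_apply, smul_eq_mul, mul_inv, inv_inv]
      have hdd : b.minus.d k * (b.minus.d k)⁻¹ = 1 := mul_inv_cancel₀ hd
      linear_combination (-(Complex.exp (Complex.I * thetaO x t k) *
        (wronskian (phiP1 q b 0 0 k) (jostD q b.minus atBot 1 0 0 k))⁻¹ *
        jostD q b.minus atBot 1 x t k i)) * hdd
    · fin_cases i <;> rfl

theorem tendsto_conj_contour (b : Background) (p : ℂ) :
    Tendsto (fun z : ℂ => conj z) (𝓝[b.contourᶜ] conj p) (𝓝[b.contourᶜ] p) := by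
  refine tendsto_nhdsWithin_iff.2 ⟨?_, ?_⟩
  · have := (Complex.continuous_conj.tendsto (conj p)).mono_left
      (nhdsWithin_le_nhds (s := b.contourᶜ))
    rwa [Complex.conj_conj] at this
  · filter_upwards [self_mem_nhdsWithin] with z hz h' using hz (conj_mem_contour h')

theorem eventually_im_neg {p : ℂ} (hp : 0 < p.im) {s : Set ℂ} : ∀ᶠ z in 𝓝[s] conj p, z.im < 0 :=
  nhdsWithin_le_nhds ((Complex.continuous_im.tendsto _).eventually
    (gt_mem_nhds (by rw [Complex.conj_im]; linarith)))

theorem growth_plus_conj (h : IsStepSolution q b) (hg : GenericAt q b b.plus.branchPoint) (x t : ℝ)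
    :
    ∃ B : Mat2, Tendsto
      (fun k => M q b x t k * powSigma3 ((root4Up (k - conj b.plus.branchPoint))⁻¹))
      (𝓝[b.contourᶜ] conj b.plus.branchPoint) (𝓝 B) := by
  obtain ⟨B, hB⟩ := h.growth_plus hg x t
  refine ⟨schwarz B, ((continuous_schwarz.tendsto B).comp (hB.comp (tendsto_conj_contour b
      _))).congr' ?_⟩
  have him : 0 < b.plus.branchPoint.im := by rw [branchPoint_im]; exact h.Ap_pos
  filter_upwards [eventually_im_neg him] with k hk
  simp only [Function.comp]
  rw [schwarz_mul, ← M_of_im_neg h x t hk]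
  congr 1
  have e : conj (k - conj b.plus.branchPoint) = conj k - b.plus.branchPoint := by
    rw [map_sub, Complex.conj_conj]
  rw [root4Up, e]
  ext i j
  fin_cases i <;> fin_cases j <;> simp [schwarz, powSigma3]

theorem growth_minus_conj (h : IsStepSolution q b) (hg : GenericAt q b b.minus.branchPoint)
    (x t : ℝ) :
    ∃ B : Mat2, Tendsto (M q b x t) (𝓝[b.contourᶜ] conj b.minus.branchPoint) (𝓝 B) := by
  obtain ⟨B, hB⟩ := h.growth_minus hg x t
  refine ⟨schwarz B, ((continuous_schwarz.tendsto B).comp (hB.comp (tendsto_conj_contour b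
      _))).congr' ?_⟩
  have him : 0 < b.minus.branchPoint.im := by rw [branchPoint_im]; exact h.Am_pos
  filter_upwards [eventually_im_neg him] with k hk
  exact (M_of_im_neg h x t hk).symm

end IsStepSolution

end BranchPoints

end StepNLS

end
theorem theoremt (b : StepNLS.Background) (hAp : 0 < b.Ap) (hAm : 0 < b.Am) (hV : b.V ≠ 0)
    (q : ℝ → ℝ → ℂ) (hq : StepNLS.IsNLSSolution q)
    (hplus : StepNLS.IsAsymptoticTo q b.plus (Set.Ioi 0))
    (hminus : StepNLS.IsAsymptoticTo q b.minus (Set.Iio 0))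
    (hgen_plus : StepNLS.GenericAt q b b.plus.branchPoint)
    (hgen_minus : StepNLS.GenericAt q b b.minus.branchPoint)
    (hfin : (StepNLS.eigenvalues q b).Finite)
    (hsimple : ∀ k ∈ StepNLS.eigenvalues q b, deriv (StepNLS.s22 q b) k ≠ 0) :
    ∃ c : ℂ → ℂ, ∀ x t : ℝ,
      StepNLS.IsRHPSolution b (StepNLS.rho q b) (StepNLS.refl q b)
        (StepNLS.spectralSingularities q b) (StepNLS.eigenvalues q b) c x t
        (StepNLS.M q b x t) := by
  have h : StepNLS.IsStepSolution q b := ⟨hAp, hAm, hV, hq, hplus, hminus⟩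
  -- The norming constant is `c = β / s₂₂'`, where `φ₋₂ = β φ₊₁` at the eigenvalue; both are
  -- independent of `(x, t)`.
  choose! β hβ using fun k hk => h.exists_proportional (k := k) hk
  refine ⟨fun k => β k / deriv (StepNLS.s22 q b) k, fun x t => ⟨hfin, fun k hk => ⟨hk.1, hk.2.1⟩,
    fun i j k hk => h.analyticAt_M x t hk.1 hk.2.1 hk.2.2 i j, fun k hk hs => h.jump_cond x t hk hs,
    h.isBigO_M x t, fun k hk => ⟨_, h.tendsto_M_column x t ⟨hk.1, hk.2.1⟩,
      h.hasSimplePole_M x t hk (hsimple k hk) (hβ k hk x t)⟩, fun k hk => ⟨_,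
      h.tendsto_M_column_conj hk.1 (h.tendsto_M_column x t ⟨hk.1, hk.2.1⟩), ?_⟩,
    h.growth_plus hgen_plus x t, h.growth_plus_conj hgen_plus x t, h.growth_minus hgen_minus x t,
    h.growth_minus_conj hgen_minus x t⟩⟩
  -- The residue at the conjugate point is the Schwarz image of the one in the upper half-plane.
  rw [← StepNLS.schwarz_residue]
  exact h.hasSimplePole_conj hk.1 (h.hasSimplePole_M x t hk (hsimple k hk) (hβ k hk x t))
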